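/- Let $X$ be a smooth projective variety over $\mathbb{C}$ (irreducible, non-empty) of dimension $n$, and let $L$ be a very ample line bundle on $X$. Write $X=\operatorname{Proj} S$ and $L=\mathcal{O}_X(1)$, where $S$ is a graded integral domain generated over $\mathbb{C}$ by finitely many elements of degree $1$. Let $U$ be the complement of the zero section of $L$, that is, the punctured cone $\operatorname{Spec} S\setminus\{0\}$, graded so that the functions of degree $k$ on $U$ are the sections of $L^{k}$ on $X$ ($k\in\mathbb{Z}$). Let $\mathfrak{g}$ be a finite-dimensional semisimple complex Lie algebra acting on $X$ by a homomorphism of Lie algebras $\rho:\mathfrak{g}\to\Gamma(X,T_X)$ (for example the Lie algebra of a semisimple group acting on $(L,X)$), and put $\hat{\mathfrak g}=\mathfrak{g}\oplus\mathbb{C}$. Assume (i) $\omega_X\cong L^{-N}$ for some integer $N\ge 1$; (ii) the map of sheaves $\mathfrak{g}\otimes\mathcal{O}_X\to T_X$ is surjective; (iii) the maps $\mathfrak{g}\otimes\Gamma(X,\omega_X^{-r})\to\Gamma(X,T_X\otimes\omega_X^{-r})$ are surjective for all $r\ge 0$. Let $V=\Gamma(X,\omega_X^{-1})^*$, let $\hat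 X\subset V$ be the cone over $X$ (the cone over the image of $X\to\mathbb{P}V$), with vanishing ideal $I(\hat X,V)\subset\mathbb{C}[V]=\operatorname{Sym}\Gamma(X,\omega_X^{-1})$, and let $0\ne f\in V^*=\Gamma(X,\omega_X^{-1})$. Let $Z^*$ be the action of $\hat{\mathfrak g}$ by derivations on $\mathbb{C}[V]$ for which $\mathfrak{g}$ acts on $V^*=\Gamma(X,\omega_X^{-1})$ by Lie derivative along $\rho$ and $1\in\mathbb{C}$ acts on $V^*$ as $-1$; it preserves $I(\hat X,V)$. Let $\beta:\hat{\mathfrak g}\to\mathbb{C}$ be $\beta(x,c)=c$. Let $R_f$ be the ring $\mathbb{C}[\hat X]=\mathbb{C}[V]/I(\hat X,V)$ with the action of $\hat{\mathfrak g}$ in which $\xi$ acts by the operator $Z^*(\xi)+(Z^*(\xi)f)-\beta(\xi)$, where $(Z^*(\xi)f)$ denotes multiplication by that element. For any choice of the isomorphism in (i), regard $f\in\Gamma(X,\omega_X^{-1})\cong\Gamma(X,L^N)$ as a function of degree $N$ on $U$. Then the Lie algebra homology $$H_0^{Lie}(\hat{\mathfrak g},R_f)=R_f/\hat{\mathfrak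 g}R_f$$ is isomorphic, as a complex vector space, to $$\operatorname{Coker}\Bigl(\Gamma(U,\Omega^n_U)_{0 \bmod N}\xrightarrow{\ d+df\ }\Gamma(U,\omega_U)_{0 \bmod N}\Bigr),$$ where $\omega_U=\Omega^{n+1}_U$, the map is $\eta\mapsto d\eta+df\wedge\eta$, and the subscript $0\bmod N$ denotes the forms all of whose homogeneous components have degree divisible by $N$. -/

import Mathlib

set_option linter.unusedSectionVars false

namespace CYCone

noncomputable section

/-! ### Differential forms of a `ℂ`-algebra -/

section Forms

variable (A : Type*) [CommRing A] [Algebra ℂ A]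

/-- The algebra of Kähler differential forms of `A` over `ℂ`. -/
abbrev Forms : Type _ := ExteriorAlgebra A Ω[A⁄ℂ]

/-- The exterior algebra of `A ε ⊕ Ω`; it is used to build `d` through `ω ↦ ω + ε dω`. -/
def Tw : Type _ := ExteriorAlgebra A (A × Ω[A⁄ℂ])

instance : Ring (Tw A) := inferInstanceAs (Ring (ExteriorAlgebra A (A × Ω[A⁄ℂ])))

variable {A}

/-- The generators of `Tw A`. -/
def Tw.gen (v : A × Ω[A⁄ℂ]) : Tw A := ExteriorAlgebra.ι A v

/-- The untwisted scalars of `Tw A`. -/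
def Tw.scal : A →+* Tw A := algebraMap A (ExteriorAlgebra A (A × Ω[A⁄ℂ]))

theorem Tw.scal_comm (a : A) (x : Tw A) : Tw.scal a * x = x * Tw.scal a :=
  Algebra.commutes (A := ExteriorAlgebra A (A × Ω[A⁄ℂ])) a x

theorem Tw.gen_sq (v : A × Ω[A⁄ℂ]) : Tw.gen v * Tw.gen v = 0 :=
  ExteriorAlgebra.ι_sq_zero v

theorem Tw.gen_swap (v w : A × Ω[A⁄ℂ]) : Tw.gen v * Tw.gen w = - (Tw.gen w * Tw.gen v) :=
  eq_neg_of_add_eq_zero_left (ExteriorAlgebra.ι_add_mul_swap v w)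

theorem Tw.gen_smul (a : A) (v : A × Ω[A⁄ℂ]) : Tw.gen (a • v) = Tw.scal a * Tw.gen v := by
  have := (ExteriorAlgebra.ι A).map_smul a v
  rw [Algebra.smul_def] at this
  exact this

theorem Tw.gen_add (v w : A × Ω[A⁄ℂ]) : Tw.gen (v + w) = Tw.gen v + Tw.gen w :=
  (ExteriorAlgebra.ι A).map_add v w

theorem Tw.gen_zero : Tw.gen (0 : A × Ω[A⁄ℂ]) = 0 := (ExteriorAlgebra.ι A).map_zero

theorem Tw.gen_mul_gen_comm (v w : A × Ω[A⁄ℂ]) (x : Tw A) :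
    Tw.gen v * Tw.gen w * x = x * (Tw.gen v * Tw.gen w) := by
  refine ExteriorAlgebra.induction (R := A) (M := A × Ω[A⁄ℂ])
    (C := fun x => Tw.gen v * Tw.gen w * (show Tw A from x) = (show Tw A from x) * (Tw.gen v * Tw.gen w))
    ?_ ?_ ?_ ?_ x
  · intro r
    exact (Tw.scal_comm r _).symm
  · intro u
    change Tw.gen v * Tw.gen w * Tw.gen u = Tw.gen u * (Tw.gen v * Tw.gen w)
    rw [mul_assoc, Tw.gen_swap w u, mul_neg, ← mul_assoc, Tw.gen_swap v u, neg_mul, neg_neg,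
      mul_assoc]
  · intro a b ha hb
    change Tw.gen v * Tw.gen w * ((show Tw A from a) * (show Tw A from b)) = _
    rw [← mul_assoc, ha, mul_assoc, hb, ← mul_assoc]
    rfl
  · intro a b ha hb
    change Tw.gen v * Tw.gen w * ((show Tw A from a) + (show Tw A from b)) = _
    rw [mul_add, ha, hb, ← add_mul]
    rfl

/-- The odd variable `ε`. -/
def Tw.eps : Tw A := Tw.gen (1, 0)

/-- The differential `db` in `Tw A`. -/
def Tw.dd (b : A) : Tw A := Tw.gen (0, KaehlerDifferential.D ℂ A b)

theorem Tw.dd_add (a b : A) : Tw.dd (a + b) = Tw.dd a + Tw.dd b := by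
  simp only [Tw.dd, map_add, ← Tw.gen_add, Prod.mk_add_mk, add_zero]

theorem Tw.dd_mul (a b : A) : Tw.dd (a * b) = Tw.scal a * Tw.dd b + Tw.scal b * Tw.dd a := by
  simp only [Tw.dd, Derivation.leibniz, ← Tw.gen_add, ← Tw.gen_smul, Prod.mk_add_mk,
    Prod.smul_mk, smul_zero, add_zero]

theorem Tw.eps_dd_eps (a : A) (x : Tw A) : Tw.eps * Tw.dd a * (Tw.eps * x) = 0 := by
  rw [← mul_assoc, Tw.eps, Tw.dd, Tw.gen_mul_gen_comm, ← mul_assoc, Tw.gen_sq, zero_mul, zero_mul]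

/-- The twisted scalars `a ↦ a + ε da`. -/
def Tw.twist : A →+* Tw A where
  toFun a := Tw.scal a + Tw.eps * Tw.dd a
  map_one' := by
    have : Tw.dd (1 : A) = 0 := by
      simp only [Tw.dd, Derivation.map_one_eq_zero]
      exact Tw.gen_zero
    rw [this, mul_zero, add_zero, map_one]
  map_zero' := by
    have : Tw.dd (0 : A) = 0 := by
      simp only [Tw.dd, map_zero]
      exact Tw.gen_zero
    rw [this, mul_zero, add_zero, map_zero]
  map_add' a b := by
    rw [Tw.dd_add, map_add, mul_add]; abel
  map_mul' a b := by
    rw [Tw.dd_mul, map_mul, mul_add, add_mul, mul_add, mul_add, Tw.eps_dd_eps, add_zero,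
      ← mul_assoc Tw.eps, ← Tw.scal_comm a Tw.eps, ← mul_assoc Tw.eps, ← Tw.scal_comm b Tw.eps,
      mul_assoc, mul_assoc, ← Tw.scal_comm b (Tw.eps * Tw.dd a), add_assoc]

theorem Tw.twist_comm (a : A) (x : Tw A) : Tw.twist a * x = x * Tw.twist a := by
  change (Tw.scal a + Tw.eps * Tw.dd a) * x = x * (Tw.scal a + Tw.eps * Tw.dd a)
  rw [add_mul, mul_add, Tw.scal_comm, Tw.eps, Tw.dd, Tw.gen_mul_gen_comm]

instance : Algebra A (Tw A) := Tw.twist.toAlgebra' Tw.twist_comm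

theorem Tw.smul_eq (a : A) (x : Tw A) :
    a • x = Tw.scal a * x + Tw.eps * Tw.dd a * x := by
  rw [Algebra.smul_def]
  exact add_mul _ _ _

instance : Algebra ℂ (Tw A) :=
  ((Tw.twist (A := A)).comp (algebraMap ℂ A)).toAlgebra' fun _ _ => Tw.twist_comm _ _

instance : IsScalarTower ℂ A (Tw A) := IsScalarTower.of_algebraMap_eq fun _ => rfl

/-- `b ↦ db` is a derivation for the twisted scalars. -/
def Tw.der : Derivation ℂ A (Tw A) where
  toFun := Tw.dd
  map_add' := Tw.dd_add
  map_smul' c b := by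
    have h : Tw.dd (algebraMap ℂ A c) = 0 := by
      simp only [Tw.dd, Derivation.map_algebraMap]
      exact Tw.gen_zero
    rw [RingHom.id_apply, ← algebraMap_smul A c (Tw.dd b), Tw.smul_eq, h, mul_zero, zero_mul,
      add_zero, Algebra.smul_def, Tw.dd_mul, h, mul_zero, add_zero]
  map_one_eq_zero' := by
    change Tw.dd (1 : A) = 0
    simp only [Tw.dd, Derivation.map_one_eq_zero]
    exact Tw.gen_zero
  leibniz' a b := by
    change Tw.dd (a * b) = a • Tw.dd b + b • Tw.dd a
    rw [Tw.smul_eq, Tw.smul_eq, Tw.dd_mul]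
    have h : Tw.eps * Tw.dd b * Tw.dd a = - (Tw.eps * Tw.dd a * Tw.dd b) := by
      rw [mul_assoc, mul_assoc, Tw.dd, Tw.dd, Tw.gen_swap, mul_neg]
    rw [h]; abel

theorem Tw.lift_sq (m : Ω[A⁄ℂ]) :
    Tw.der.liftKaehlerDifferential m * Tw.der.liftKaehlerDifferential m = 0 := by
  have anti : ∀ m m' : Ω[A⁄ℂ], Tw.der.liftKaehlerDifferential m * Tw.der.liftKaehlerDifferential m'
      + Tw.der.liftKaehlerDifferential m' * Tw.der.liftKaehlerDifferential m = 0 := by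
    intro m m'
    have hm : m ∈ Submodule.span A (Set.range (KaehlerDifferential.D ℂ A)) := by
      rw [KaehlerDifferential.span_range_derivation]; trivial
    have hm' : m' ∈ Submodule.span A (Set.range (KaehlerDifferential.D ℂ A)) := by
      rw [KaehlerDifferential.span_range_derivation]; trivial
    induction hm using Submodule.span_induction with
    | mem x hx =>
      obtain ⟨a, rfl⟩ := hx
      induction hm' using Submodule.span_induction with
      | mem y hy =>
        obtain ⟨b, rfl⟩ := hy
        rw [Derivation.liftKaehlerDifferential_comp_D, Derivation.liftKaehlerDifferential_comp_D]
        change Tw.gen _ * Tw.gen _ + Tw.gen _ * Tw.gen _ = 0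
        rw [Tw.gen_swap, neg_add_cancel]
      | zero => simp
      | add y z _ _ hy hz =>
        rw [map_add, mul_add, add_mul, add_add_add_comm, hy, hz, add_zero]
      | smul c y _ hy =>
        rw [map_smul, mul_smul_comm, smul_mul_assoc, ← smul_add, hy, smul_zero]
    | zero => simp
    | add y z _ _ hy hz =>
      rw [map_add, mul_add, add_mul, add_add_add_comm, hy, hz, add_zero]
    | smul c y _ hy =>
      rw [map_smul, mul_smul_comm, smul_mul_assoc, ← smul_add, hy, smul_zero]
  have hm : m ∈ Submodule.span A (Set.range (KaehlerDifferential.D ℂ A)) := by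
    rw [KaehlerDifferential.span_range_derivation]; trivial
  induction hm using Submodule.span_induction with
  | mem x hx =>
    obtain ⟨a, rfl⟩ := hx
    rw [Derivation.liftKaehlerDifferential_comp_D]
    exact Tw.gen_sq _
  | zero => simp
  | add y z _ _ hy hz =>
    rw [map_add, mul_add, add_mul, add_mul, hy, hz, zero_add, add_zero, add_comm, anti]
  | smul c y _ hy =>
    rw [map_smul, mul_smul_comm, smul_mul_assoc, hy, smul_zero, smul_zero]

/-- The algebra homomorphism `ω ↦ ω + ε dω`. -/
def Tw.theta : Forms A →ₐ[A] Tw A :=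
  ExteriorAlgebra.lift A ⟨Tw.der.liftKaehlerDifferential, Tw.lift_sq⟩

theorem Tw.theta_smul (a : A) (ω : Forms A) :
    Tw.theta (a • ω) = Tw.scal a * Tw.theta ω + Tw.eps * (Tw.dd a * Tw.theta ω) := by
  rw [map_smul, Tw.smul_eq, mul_assoc]

theorem Tw.theta_D_mul (b : A) (ω : Forms A) :
    Tw.theta (ExteriorAlgebra.ι A (KaehlerDifferential.D ℂ A b) * ω) = Tw.dd b * Tw.theta ω := by
  rw [map_mul, Tw.theta, ExteriorAlgebra.lift_ι_apply, Derivation.liftKaehlerDifferential_comp_D]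
  rfl

/-- Setting `ε = 0`. -/
def Tw.const : Tw A →+* Forms A :=
  (ExteriorAlgebra.map (LinearMap.snd A A Ω[A⁄ℂ])).toRingHom

/-- The coefficient of `ε`. -/
def Tw.coeff : Tw A →+ Forms A :=
  ((ExteriorAlgebra.map (LinearMap.snd A A Ω[A⁄ℂ])).toLinearMap ∘ₗ
    CliffordAlgebra.contractLeft (LinearMap.fst A A Ω[A⁄ℂ])).toAddMonoidHom

theorem Tw.const_scal (a : A) : Tw.const (Tw.scal a) = algebraMap A (Forms A) a :=
  (ExteriorAlgebra.map (LinearMap.snd A A Ω[A⁄ℂ])).commutes a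

theorem Tw.const_gen (v : A × Ω[A⁄ℂ]) : Tw.const (Tw.gen v) = ExteriorAlgebra.ι A v.2 :=
  ExteriorAlgebra.map_apply_ι _ _

theorem Tw.coeff_scal_mul (a : A) (x : Tw A) : Tw.coeff (Tw.scal a * x) = a • Tw.coeff x := by
  have : Tw.scal a * x = (show Tw A from
      (a • (show ExteriorAlgebra A (A × Ω[A⁄ℂ]) from x))) := by
    rw [Algebra.smul_def]; rfl
  rw [this]
  exact map_smul ((ExteriorAlgebra.map (LinearMap.snd A A Ω[A⁄ℂ])).toLinearMap ∘ₗ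
    CliffordAlgebra.contractLeft (LinearMap.fst A A Ω[A⁄ℂ])) a _

theorem Tw.coeff_gen_mul (v : A × Ω[A⁄ℂ]) (x : Tw A) :
    Tw.coeff (Tw.gen v * x) = v.1 • Tw.const x - ExteriorAlgebra.ι A v.2 * Tw.coeff x := by
  change ExteriorAlgebra.map (LinearMap.snd A A Ω[A⁄ℂ]) (CliffordAlgebra.contractLeft
    (LinearMap.fst A A Ω[A⁄ℂ]) (CliffordAlgebra.ι (0 : QuadraticForm A (A × Ω[A⁄ℂ])) v *
      (show ExteriorAlgebra A (A × Ω[A⁄ℂ]) from x))) = _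
  rw [CliffordAlgebra.contractLeft_ι_mul, map_sub, map_smul, map_mul]
  congr 1
  congr 1
  exact ExteriorAlgebra.map_apply_ι _ _

theorem Tw.const_theta (ω : Forms A) : Tw.const (Tw.theta ω) = ω := by
  induction ω using ExteriorAlgebra.induction with
  | algebraMap r =>
    rw [Algebra.algebraMap_eq_smul_one, Tw.theta_smul, map_add, map_mul, map_mul, Tw.eps,
      Tw.const_gen, map_zero, zero_mul, add_zero, Tw.const_scal, map_one, map_one, mul_one,
      Algebra.smul_def, mul_one]
  | ι m =>
    have hm : m ∈ Submodule.span A (Set.range (KaehlerDifferential.D ℂ A)) := by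
      rw [KaehlerDifferential.span_range_derivation]; trivial
    induction hm using Submodule.span_induction with
    | mem x hx =>
      obtain ⟨a, rfl⟩ := hx
      rw [← mul_one (ExteriorAlgebra.ι A _), Tw.theta_D_mul, map_mul, Tw.dd, Tw.const_gen, map_one,
        map_one]
    | zero => simp
    | add y z _ _ hy hz => rw [map_add, map_add, map_add, hy, hz]
    | smul c y _ hy =>
      rw [map_smul, Tw.theta_smul, map_add, map_mul, map_mul, Tw.eps, Tw.const_gen, map_zero,
        zero_mul, add_zero, Tw.const_scal, hy, Algebra.smul_def]
  | mul x y hx hy => rw [map_mul, map_mul, hx, hy]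
  | add x y hx hy => rw [map_add, map_add, hx, hy]

theorem Tw.coeff_theta_smul (a : A) (ω : Forms A) :
    Tw.coeff (Tw.theta (a • ω)) =
      ExteriorAlgebra.ι A (KaehlerDifferential.D ℂ A a) * ω + a • Tw.coeff (Tw.theta ω) := by
  rw [Tw.theta_smul, map_add, Tw.coeff_scal_mul, Tw.eps, Tw.coeff_gen_mul, one_smul, map_mul,
    Tw.const_theta, Tw.dd, Tw.const_gen, map_zero, zero_mul, sub_zero, add_comm]

/-- The exterior derivative `d` on differential forms; it is the `ℂ`-linear map with
`d (a • ω) = da ∧ ω + a • dω` and `d (db ∧ ω) = - db ∧ dω`. -/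
def extDeriv : Forms A →ₗ[ℂ] Forms A where
  toFun ω := Tw.coeff (Tw.theta ω)
  map_add' x y := by rw [map_add, map_add]
  map_smul' c ω := by
    rw [← algebraMap_smul A c ω, Tw.coeff_theta_smul, Derivation.map_algebraMap, map_zero,
      zero_mul, zero_add, algebraMap_smul, RingHom.id_apply]

theorem extDeriv_smul (a : A) (ω : Forms A) :
    extDeriv (a • ω) = ExteriorAlgebra.ι A (KaehlerDifferential.D ℂ A a) * ω + a • extDeriv ω :=
  Tw.coeff_theta_smul a ω

theorem extDeriv_D_mul (b : A) (ω : Forms A) :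
    extDeriv (ExteriorAlgebra.ι A (KaehlerDifferential.D ℂ A b) * ω) =
      - (ExteriorAlgebra.ι A (KaehlerDifferential.D ℂ A b) * extDeriv ω) := by
  change Tw.coeff (Tw.theta _) = - (_ * Tw.coeff (Tw.theta ω))
  rw [Tw.theta_D_mul, Tw.dd, Tw.coeff_gen_mul, zero_smul, zero_sub]

theorem extDeriv_one : extDeriv (1 : Forms A) = 0 := by
  change Tw.coeff (Tw.theta 1) = 0
  rw [map_one]
  change ExteriorAlgebra.map (LinearMap.snd A A Ω[A⁄ℂ]) (CliffordAlgebra.contractLeft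
    (LinearMap.fst A A Ω[A⁄ℂ]) 1) = 0
  rw [CliffordAlgebra.contractLeft_one, map_zero]

/-- Contraction of differential forms with a vector field. -/
def contr (δ : Derivation ℂ A A) : Forms A →ₗ[A] Forms A :=
  CliffordAlgebra.contractLeft δ.liftKaehlerDifferential

theorem contr_D_mul (δ : Derivation ℂ A A) (b : A) (ω : Forms A) :
    contr δ (ExteriorAlgebra.ι A (KaehlerDifferential.D ℂ A b) * ω) =
      δ b • ω - ExteriorAlgebra.ι A (KaehlerDifferential.D ℂ A b) * contr δ ω := by
  have := CliffordAlgebra.contractLeft_ι_mul (Q := (0 : QuadraticForm A Ω[A⁄ℂ]))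
    δ.liftKaehlerDifferential (KaehlerDifferential.D ℂ A b) ω
  rw [Derivation.liftKaehlerDifferential_comp_D] at this
  exact this

/-- The Lie derivative of differential forms along a vector field (Cartan's formula). -/
def lieD (δ : Derivation ℂ A A) : Forms A →ₗ[ℂ] Forms A :=
  extDeriv ∘ₗ (contr δ).restrictScalars ℂ + (contr δ).restrictScalars ℂ ∘ₗ extDeriv

theorem lieD_apply (δ : Derivation ℂ A A) (ω : Forms A) :
    lieD δ ω = extDeriv (contr δ ω) + contr δ (extDeriv ω) := rfl

theorem lieD_smul (δ : Derivation ℂ A A) (a : A) (ω : Forms A) :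
    lieD δ (a • ω) = δ a • ω + a • lieD δ ω := by
  rw [lieD_apply, lieD_apply, map_smul, extDeriv_smul, extDeriv_smul, map_add, contr_D_mul,
    map_smul, smul_add]
  abel

theorem lieD_D_mul (δ : Derivation ℂ A A) (b : A) (ω : Forms A) :
    lieD δ (ExteriorAlgebra.ι A (KaehlerDifferential.D ℂ A b) * ω) =
      ExteriorAlgebra.ι A (KaehlerDifferential.D ℂ A (δ b)) * ω +
      ExteriorAlgebra.ι A (KaehlerDifferential.D ℂ A b) * lieD δ ω := by
  rw [lieD_apply, lieD_apply, contr_D_mul, extDeriv_D_mul, map_sub, extDeriv_smul, extDeriv_D_mul,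
    map_neg, contr_D_mul, mul_add]
  abel

theorem lieD_one (δ : Derivation ℂ A A) : lieD δ (1 : Forms A) = 0 := by
  rw [lieD_apply, extDeriv_one, map_zero, add_zero]
  have : contr δ (1 : Forms A) = 0 := CliffordAlgebra.contractLeft_one _ _
  rw [this, map_zero]

/-- Induction over forms: every form is a sum of terms `a • db₁ ∧ ⋯ ∧ dbₚ`. -/
theorem forms_induction {C : Forms A → Prop} (one : C 1) (add : ∀ x y, C x → C y → C (x + y))
    (smul : ∀ (a : A) (x : Forms A), C x → C (a • x))
    (D_mul : ∀ (b : A) (x : Forms A), C x →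
      C (ExteriorAlgebra.ι A (KaehlerDifferential.D ℂ A b) * x)) (ω : Forms A) : C ω := by
  have zero : C 0 := by simpa using smul 0 1 one
  induction ω using CliffordAlgebra.left_induction with
  | algebraMap r => rw [Algebra.algebraMap_eq_smul_one]; exact smul r 1 one
  | add x y hx hy => exact add x y hx hy
  | ι_mul x m hx =>
    have hm : m ∈ Submodule.span A (Set.range (KaehlerDifferential.D ℂ A)) := by
      rw [KaehlerDifferential.span_range_derivation]; trivial
    induction hm using Submodule.span_induction with
    | mem y hy => obtain ⟨a, rfl⟩ := hy; exact D_mul a x hx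
    | zero => rw [map_zero, zero_mul]; exact zero
    | add y z _ _ hy hz => rw [map_add, add_mul]; exact add _ _ hy hz
    | smul c y _ hy => rw [map_smul, smul_mul_assoc]; exact smul c _ hy

theorem lieD_add_left (δ δ' : Derivation ℂ A A) (ω : Forms A) :
    lieD (δ + δ') ω = lieD δ ω + lieD δ' ω := by
  induction ω using forms_induction with
  | one => simp only [lieD_one, add_zero]
  | add x y hx hy => simp only [map_add, hx, hy]; abel
  | smul a x hx => simp only [lieD_smul, hx, Derivation.add_apply, add_smul, smul_add]; abel
  | D_mul b x hx =>
    simp only [lieD_D_mul, hx, Derivation.add_apply, map_add, add_mul, mul_add]; abel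

theorem lieD_smul_left (c : ℂ) (δ : Derivation ℂ A A) (ω : Forms A) :
    lieD (c • δ) ω = c • lieD δ ω := by
  induction ω using forms_induction with
  | one => simp only [lieD_one, smul_zero]
  | add x y hx hy => simp only [map_add, hx, hy, smul_add]
  | smul a x hx =>
    simp only [lieD_smul, hx, Derivation.smul_apply, smul_add, smul_assoc, smul_comm a c]
  | D_mul b x hx =>
    have : ExteriorAlgebra.ι A (KaehlerDifferential.D ℂ A (c • δ b)) =
        c • ExteriorAlgebra.ι A (KaehlerDifferential.D ℂ A (δ b)) := by
      rw [Derivation.map_smul, ← algebraMap_smul A c, map_smul, algebraMap_smul]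
    simp only [lieD_D_mul, hx, Derivation.smul_apply, smul_add, this, smul_mul_assoc,
      mul_smul_comm]

theorem lieD_lie (δ δ' : Derivation ℂ A A) (ω : Forms A) :
    lieD ⁅δ, δ'⁆ ω = lieD δ (lieD δ' ω) - lieD δ' (lieD δ ω) := by
  induction ω using forms_induction with
  | one => simp only [lieD_one, map_zero, sub_zero]
  | add x y hx hy => simp only [map_add, hx, hy]; abel
  | smul a x hx =>
    simp only [lieD_smul, hx, Derivation.commutator_apply, map_add, sub_smul, smul_sub]; abel
  | D_mul b x hx =>
    simp only [lieD_D_mul, hx, Derivation.commutator_apply, map_add, map_sub, sub_mul, mul_sub]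
    abel

/-- The wedge product `db₁ ∧ ⋯ ∧ dbₚ`. -/
def wedgeD {p : ℕ} (b : Fin p → A) : Forms A :=
  ExteriorAlgebra.ιMulti A p fun i => KaehlerDifferential.D ℂ A (b i)

theorem wedgeD_cons {p : ℕ} (b : A) (c : Fin p → A) :
    wedgeD (Fin.cons b c : Fin (p + 1) → A) =
      ExteriorAlgebra.ι A (KaehlerDifferential.D ℂ A b) * wedgeD c := by
  rw [wedgeD, ExteriorAlgebra.ιMulti_succ_apply]
  rfl

theorem wedgeD_succ {p : ℕ} (b : Fin (p + 1) → A) :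
    wedgeD b = ExteriorAlgebra.ι A (KaehlerDifferential.D ℂ A (b 0)) *
      wedgeD (fun i => b i.succ) := by
  rw [wedgeD, ExteriorAlgebra.ιMulti_succ_apply]
  rfl

theorem extDeriv_wedgeD {p : ℕ} (b : Fin p → A) : extDeriv (wedgeD b) = 0 := by
  induction p with
  | zero =>
    rw [wedgeD, ExteriorAlgebra.ιMulti_zero_apply, extDeriv_one]
  | succ p ih => rw [wedgeD_succ, extDeriv_D_mul, ih, mul_zero, neg_zero]

/-- The differential `p`-forms coming from a subring `O`: the sums of the forms
`a db₁ ∧ ⋯ ∧ dbₚ` with `a, b₁, …, bₚ ∈ O`. -/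
def formsOver (O : Subalgebra ℂ A) (p : ℕ) : Submodule ℂ (Forms A) :=
  Submodule.span ℂ {ω | ∃ a ∈ O, ∃ b : Fin p → A, (∀ i, b i ∈ O) ∧ ω = a • wedgeD b}

theorem smul_mem_formsOver {O : Subalgebra ℂ A} {p : ℕ} {a : A} (ha : a ∈ O) {ω : Forms A}
    (hω : ω ∈ formsOver O p) : a • ω ∈ formsOver O p := by
  induction hω using Submodule.span_induction with
  | mem x hx =>
    obtain ⟨c, hc, b, hb, rfl⟩ := hx
    exact Submodule.subset_span ⟨a * c, O.mul_mem ha hc, b, hb, smul_smul _ _ _⟩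
  | zero => rw [smul_zero]; exact zero_mem _
  | add x y _ _ hx hy => rw [smul_add]; exact add_mem hx hy
  | smul c x _ hx => rw [smul_comm]; exact Submodule.smul_mem _ c hx

theorem D_mul_mem_formsOver {O : Subalgebra ℂ A} {p : ℕ} {b : A} (hb : b ∈ O) {ω : Forms A}
    (hω : ω ∈ formsOver O p) :
    ExteriorAlgebra.ι A (KaehlerDifferential.D ℂ A b) * ω ∈ formsOver O (p + 1) := by
  induction hω using Submodule.span_induction with
  | mem x hx =>
    obtain ⟨a, ha, c, hc, rfl⟩ := hx
    refine Submodule.subset_span ⟨a, ha, Fin.cons b c, ?_, ?_⟩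
    · exact fun i => Fin.cases (by simpa using hb) (by simpa using hc) i
    · rw [wedgeD_cons, mul_smul_comm]
  | zero => rw [mul_zero]; exact zero_mem _
  | add x y _ _ hx hy => rw [mul_add]; exact add_mem hx hy
  | smul c x _ hx => rw [mul_smul_comm]; exact Submodule.smul_mem _ c hx

theorem extDeriv_mem_formsOver {O : Subalgebra ℂ A} {p : ℕ} {ω : Forms A}
    (hω : ω ∈ formsOver O p) : extDeriv ω ∈ formsOver O (p + 1) := by
  induction hω using Submodule.span_induction with
  | mem x hx =>
    obtain ⟨a, ha, c, hc, rfl⟩ := hx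
    rw [extDeriv_smul, extDeriv_wedgeD, smul_zero, add_zero]
    refine D_mul_mem_formsOver ha (Submodule.subset_span ⟨1, O.one_mem, c, hc, ?_⟩)
    rw [one_smul]
  | zero => rw [map_zero]; exact zero_mem _
  | add x y _ _ hx hy => rw [map_add]; exact add_mem hx hy
  | smul c x _ hx => rw [map_smul]; exact Submodule.smul_mem _ c hx

theorem lieD_wedgeD_mem {O : Subalgebra ℂ A} {δ : Derivation ℂ A A} (hδ : ∀ g ∈ O, δ g ∈ O)
    {p : ℕ} (b : Fin p → A) (hb : ∀ i, b i ∈ O) : lieD δ (wedgeD b) ∈ formsOver O p := by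
  induction p with
  | zero => rw [wedgeD, ExteriorAlgebra.ιMulti_zero_apply, lieD_one]; exact zero_mem _
  | succ p ih =>
    rw [wedgeD_succ, lieD_D_mul]
    refine add_mem (D_mul_mem_formsOver (hδ _ (hb 0)) (Submodule.subset_span
      ⟨1, O.one_mem, _, fun i => hb i.succ, (one_smul _ _).symm⟩)) ?_
    exact D_mul_mem_formsOver (hb 0) (ih _ fun i => hb i.succ)

theorem lieD_mem_formsOver {O : Subalgebra ℂ A} {δ : Derivation ℂ A A} (hδ : ∀ g ∈ O, δ g ∈ O)
    {p : ℕ} {ω : Forms A} (hω : ω ∈ formsOver O p) : lieD δ ω ∈ formsOver O p := by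
  induction hω using Submodule.span_induction with
  | mem x hx =>
    obtain ⟨a, ha, c, hc, rfl⟩ := hx
    rw [lieD_smul]
    exact add_mem (Submodule.subset_span ⟨_, hδ a ha, c, hc, rfl⟩)
      (smul_mem_formsOver ha (lieD_wedgeD_mem hδ c hc))
  | zero => rw [map_zero]; exact zero_mem _
  | add x y _ _ hx hy => rw [map_add]; exact add_mem hx hy
  | smul c x _ hx => rw [map_smul]; exact Submodule.smul_mem _ c hx

theorem formsOver_top (p : ℕ) (ω : Forms A) :
    ω ∈ formsOver (⊤ : Subalgebra ℂ A) p ↔ ω ∈ ⋀[A]^p Ω[A⁄ℂ] := by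
  constructor
  · intro hω
    induction hω using Submodule.span_induction with
    | mem x hx =>
      obtain ⟨a, -, c, -, rfl⟩ := hx
      exact Submodule.smul_mem _ a (ExteriorAlgebra.ιMulti_range A p ⟨_, rfl⟩)
    | zero => exact zero_mem _
    | add x y _ _ hx hy => exact add_mem hx hy
    | smul c x _ hx => rw [← algebraMap_smul A c x]; exact Submodule.smul_mem _ _ hx
  · intro hω
    rw [← exteriorPower.ιMulti_span_fixedDegree_of_span_eq_top A p Ω[A⁄ℂ]
      (KaehlerDifferential.span_range_derivation ℂ A)] at hω
    induction hω using Submodule.span_induction with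
    | mem x hx =>
      obtain ⟨v, hv, rfl⟩ := hx
      choose b hb using fun i => hv (Set.mem_range_self i)
      refine Submodule.subset_span ⟨1, Algebra.mem_top, b, fun _ => Algebra.mem_top, ?_⟩
      rw [one_smul, wedgeD]
      congr 1
      exact (funext hb).symm
    | zero => exact zero_mem _
    | add x y _ _ hx hy => exact add_mem hx hy
    | smul c x _ hx => exact smul_mem_formsOver (O := ⊤) Algebra.mem_top hx

/-- The Lie derivative on `p`-forms. -/
def lieForm (p : ℕ) (δ : Derivation ℂ A A) : ⋀[A]^p Ω[A⁄ℂ] →ₗ[ℂ] ⋀[A]^p Ω[A⁄ℂ] where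
  toFun η := ⟨lieD δ η, (formsOver_top p _).1
    (lieD_mem_formsOver (O := ⊤) (fun _ _ => Algebra.mem_top) ((formsOver_top p _).2 η.2))⟩
  map_add' x y := Subtype.ext (map_add (lieD δ) (x : Forms A) y)
  map_smul' c x := Subtype.ext (map_smul (lieD δ) c (x : Forms A))

theorem lieForm_smul (p : ℕ) (δ : Derivation ℂ A A) (a : A) (η : ⋀[A]^p Ω[A⁄ℂ]) :
    lieForm p δ (a • η) = δ a • η + a • lieForm p δ η :=
  Subtype.ext (lieD_smul δ a (η : Forms A))

end Forms
/-! ### Sheaves on a smooth integral variety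

A smooth integral variety is described by its function field `F` and the local rings
`O p ⊆ F` of its points `p`. The sheaves below are locally free, hence subsheaves of the constant
sheaf of their rational sections, and global sections are the rational sections that lie in the
stalk at every point. -/

section Variety

variable {F : Type*} [Field F] [Algebra ℂ F] {P : Type*} (O : P → Subalgebra ℂ F)

/-- Rational vector fields that are regular at a point with local ring `R`. -/
def derStalk (R : Subalgebra ℂ F) : Submodule ℂ (Derivation ℂ F F) where
  carrier := {δ | ∀ g ∈ R, δ g ∈ R}
  add_mem' h h' g hg := add_mem (h g hg) (h' g hg)
  zero_mem' _ _ := zero_mem _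
  smul_mem' c _ h g hg := R.smul_mem (h g hg) c

/-- The Lie algebra `Γ(X, T_X)` of global vector fields. -/
def vectorFields : LieSubalgebra ℂ (Derivation ℂ F F) where
  toSubmodule := ⨅ p, derStalk (O p)
  lie_mem' := by
    intro δ δ' h h'
    have h1 : δ ∈ ⨅ p, derStalk (O p) := h
    have h2 : δ' ∈ ⨅ p, derStalk (O p) := h'
    change ⁅δ, δ'⁆ ∈ ⨅ p, derStalk (O p)
    rw [Submodule.mem_iInf] at h1 h2 ⊢
    intro p g hg
    rw [Derivation.commutator_apply]
    exact sub_mem (h1 p _ (h2 p g hg)) (h2 p _ (h1 p g hg))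

theorem vectorFields_mem (δ : vectorFields O) (p : P) {g : F} (hg : g ∈ O p) :
    (δ : Derivation ℂ F F) g ∈ O p := by
  have h : (δ : Derivation ℂ F F) ∈ ⨅ p, derStalk (O p) := δ.2
  rw [Submodule.mem_iInf] at h
  exact h p g hg

variable (F) in
/-- Rational sections of `ω_X`, where `n = dim X`. -/
abbrev Can (n : ℕ) : Type _ := ⋀[F]^n Ω[F⁄ℂ]

/-- The stalk of `ω_X` at a point with local ring `R`. -/
def canStalk (n : ℕ) (R : Subalgebra ℂ F) : Set (Can F n) := {η | (η : Forms F) ∈ formsOver R n}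

variable (F) in
/-- Rational sections of `ω_X^{-r}`: the `r`-linear forms on `ω_X`. -/
abbrev AntiCanPow (n r : ℕ) : Type _ := MultilinearMap F (fun _ : Fin r => Can F n) F

/-- The stalk of `ω_X^{-r}` at a point with local ring `R`. -/
def antiCanPowStalk (n r : ℕ) (R : Subalgebra ℂ F) : Submodule ℂ (AntiCanPow F n r) where
  carrier := {s | ∀ η : Fin r → Can F n, (∀ i, η i ∈ canStalk n R) → s η ∈ R}
  add_mem' h h' η hη := add_mem (h η hη) (h' η hη)
  zero_mem' _ _ := zero_mem _
  smul_mem' c _ h η hη := R.smul_mem (h η hη) c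

/-- `Γ(X, ω_X^{-r})`. -/
def antiCanPowSections (n r : ℕ) : Submodule ℂ (AntiCanPow F n r) :=
  ⨅ p, antiCanPowStalk n r (O p)

/-- The stalk `T_{X,p} ⊗ ω_{X,p}^{-r}` of `T_X ⊗ ω_X^{-r}` at a point with local ring `R`. -/
def twistedDerStalk (n r : ℕ) (R : Subalgebra ℂ F) :
    Submodule ℂ (TensorProduct F (Derivation ℂ F F) (AntiCanPow F n r)) :=
  Submodule.span ℂ {t | ∃ δ ∈ derStalk R, ∃ s ∈ antiCanPowStalk n r R, t = δ ⊗ₜ[F] s}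

/-- `Γ(X, T_X ⊗ ω_X^{-r})`. -/
def twistedDerSections (n r : ℕ) :
    Submodule ℂ (TensorProduct F (Derivation ℂ F F) (AntiCanPow F n r)) :=
  ⨅ p, twistedDerStalk n r (O p)

/-- The stalk of `ω_X^{-1}` at a point with local ring `R`. -/
def antiCanStalk (n : ℕ) (R : Subalgebra ℂ F) : Submodule ℂ (Can F n →ₗ[F] F) where
  carrier := {s | ∀ η ∈ canStalk n R, s η ∈ R}
  add_mem' h h' η hη := add_mem (h η hη) (h' η hη)
  zero_mem' _ _ := zero_mem _
  smul_mem' c _ h η hη := R.smul_mem (h η hη) c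

/-- `Γ(X, ω_X^{-1})`. -/
def antiCanSections (n : ℕ) : Submodule ℂ (Can F n →ₗ[F] F) := ⨅ p, antiCanStalk n (O p)

/-- The Lie derivative of a rational section of `ω_X^{-1}` along a vector field. -/
def lieAntiCan (n : ℕ) (δ : Derivation ℂ F F) (s : Can F n →ₗ[F] F) : Can F n →ₗ[F] F where
  toFun η := δ (s η) - s (lieForm n δ η)
  map_add' x y := by simp only [map_add]; abel
  map_smul' a x := by
    simp only [map_smul, lieForm_smul, map_add, smul_eq_mul, Derivation.leibniz, RingHom.id_apply]
    ring

/-- The space `V^* = Γ(X, ω_X^{-1})`. -/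
def AntiCanSec (n : ℕ) : Type _ := antiCanSections O n

instance (n : ℕ) : AddCommGroup (AntiCanSec O n) :=
  inferInstanceAs (AddCommGroup (antiCanSections O n))

instance (n : ℕ) : Module ℂ (AntiCanSec O n) :=
  inferInstanceAs (Module ℂ (antiCanSections O n))

variable {O} in
/-- The value of a section of `ω_X^{-1}` on a rational `n`-form. -/
def AntiCanSec.eval {n : ℕ} (s : AntiCanSec O n) (η : Can F n) : F := s.1 η

theorem AntiCanSec.ext {n : ℕ} {s t : AntiCanSec O n} (h : ∀ η, s.eval η = t.eval η) : s = t :=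
  Subtype.ext (LinearMap.ext h)

theorem AntiCanSec.eval_add {n : ℕ} (s t : AntiCanSec O n) (η : Can F n) :
    (s + t).eval η = s.eval η + t.eval η := rfl

theorem AntiCanSec.eval_smul {n : ℕ} (c : ℂ) (s : AntiCanSec O n) (η : Can F n) :
    (c • s).eval η = c • s.eval η := rfl

theorem AntiCanSec.eval_neg {n : ℕ} (s : AntiCanSec O n) (η : Can F n) :
    (-s).eval η = - s.eval η := rfl

theorem AntiCanSec.eval_sub {n : ℕ} (s t : AntiCanSec O n) (η : Can F n) :
    (s - t).eval η = s.eval η - t.eval η := rfl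

theorem AntiCanSec.eval_map_add {n : ℕ} (s : AntiCanSec O n) (η ζ : Can F n) :
    s.eval (η + ζ) = s.eval η + s.eval ζ := map_add s.1 η ζ

theorem AntiCanSec.eval_map_sub {n : ℕ} (s : AntiCanSec O n) (η ζ : Can F n) :
    s.eval (η - ζ) = s.eval η - s.eval ζ := map_sub s.1 η ζ

theorem AntiCanSec.eval_map_smul {n : ℕ} (s : AntiCanSec O n) (a : F) (η : Can F n) :
    s.eval (a • η) = a * s.eval η := map_smul s.1 a η

theorem AntiCanSec.eval_map_csmul {n : ℕ} (s : AntiCanSec O n) (c : ℂ) (η : Can F n) :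
    s.eval (c • η) = c • s.eval η := by
  rw [← algebraMap_smul F c η, eval_map_smul, Algebra.smul_def]

variable {O} in
/-- The Lie derivative of a section of `ω_X^{-1}` along a global vector field. -/
def lieAct {n : ℕ} (δ : vectorFields O) (s : AntiCanSec O n) : AntiCanSec O n :=
  ⟨lieAntiCan n δ s.1, by
    have hs : s.1 ∈ ⨅ p, antiCanStalk n (O p) := s.2
    rw [Submodule.mem_iInf] at hs
    change lieAntiCan n δ s.1 ∈ ⨅ p, antiCanStalk n (O p)
    rw [Submodule.mem_iInf]
    intro p η hη
    exact sub_mem (vectorFields_mem O δ p (hs p η hη))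
      (hs p _ (lieD_mem_formsOver (fun _ hg => vectorFields_mem O δ p hg) hη))⟩

theorem lieAct_eval {n : ℕ} (δ : vectorFields O) (s : AntiCanSec O n) (η : Can F n) :
    (lieAct δ s).eval η = (δ : Derivation ℂ F F) (s.eval η) - s.eval (lieForm n δ η) := rfl

theorem lieAct_add_left {n : ℕ} (δ δ' : vectorFields O) (s : AntiCanSec O n) :
    lieAct (δ + δ') s = lieAct δ s + lieAct δ' s := by
  refine AntiCanSec.ext O fun η => ?_
  have h : lieForm n ((δ + δ' : vectorFields O) : Derivation ℂ F F) η =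
      lieForm n (δ : Derivation ℂ F F) η + lieForm n (δ' : Derivation ℂ F F) η :=
    Subtype.ext (lieD_add_left _ _ _)
  have hc : ((δ + δ' : vectorFields O) : Derivation ℂ F F) = δ + δ' := rfl
  rw [AntiCanSec.eval_add, lieAct_eval, lieAct_eval, lieAct_eval, h, AntiCanSec.eval_map_add,
    hc, Derivation.add_apply]
  ring

theorem lieAct_smul_left {n : ℕ} (c : ℂ) (δ : vectorFields O) (s : AntiCanSec O n) :
    lieAct (c • δ) s = c • lieAct δ s := by
  refine AntiCanSec.ext O fun η => ?_
  have h : lieForm n ((c • δ : vectorFields O) : Derivation ℂ F F) η =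
      c • lieForm n (δ : Derivation ℂ F F) η :=
    Subtype.ext (lieD_smul_left _ _ _)
  have hc : ((c • δ : vectorFields O) : Derivation ℂ F F) = c • (δ : Derivation ℂ F F) := rfl
  rw [AntiCanSec.eval_smul, lieAct_eval, lieAct_eval, h, AntiCanSec.eval_map_csmul, hc, Derivation.smul_apply, smul_sub]

theorem lieAct_lie {n : ℕ} (δ δ' : vectorFields O) (s : AntiCanSec O n) :
    lieAct ⁅δ, δ'⁆ s = lieAct δ (lieAct δ' s) - lieAct δ' (lieAct δ s) := by
  refine AntiCanSec.ext O fun η => ?_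
  have h : lieForm n ((⁅δ, δ'⁆ : vectorFields O) : Derivation ℂ F F) η =
      lieForm n (δ : Derivation ℂ F F) (lieForm n (δ' : Derivation ℂ F F) η) -
      lieForm n (δ' : Derivation ℂ F F) (lieForm n (δ : Derivation ℂ F F) η) :=
    Subtype.ext (lieD_lie _ _ _)
  rw [AntiCanSec.eval_sub, lieAct_eval, lieAct_eval _ δ, lieAct_eval _ δ', lieAct_eval, lieAct_eval,
    lieAct_eval, lieAct_eval, h, AntiCanSec.eval_map_sub, LieSubalgebra.coe_bracket,
    Derivation.commutator_apply, map_sub, map_sub]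
  ring

attribute [local instance 100] LieRing.ofAssociativeRing

/-- The natural action of the Lie algebra of vector fields on `Γ(X, ω_X^{-1})`. -/
def lieSec (n : ℕ) : vectorFields O →ₗ⁅ℂ⁆ Module.End ℂ (AntiCanSec O n) where
  toFun δ :=
    { toFun := lieAct δ
      map_add' := fun s t => AntiCanSec.ext O fun η => by
        simp only [lieAct_eval, AntiCanSec.eval_add, map_add]; ring
      map_smul' := fun c s => AntiCanSec.ext O fun η => by
        simp only [lieAct_eval, AntiCanSec.eval_smul, Derivation.map_smul, smul_sub,
          RingHom.id_apply] }
  map_add' δ δ' := LinearMap.ext fun s => lieAct_add_left O δ δ' s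
  map_smul' c δ := LinearMap.ext fun s => lieAct_smul_left O c δ s
  map_lie' {δ δ'} := LinearMap.ext fun s => lieAct_lie O δ δ' s

end Variety

/-! ### Coordinate ring of the cone over the anticanonical image, and Lie algebra homology -/

section Symmetric

variable {M : Type*} [AddCommGroup M] [Module ℂ M]

/-- The algebra homomorphism `φ ↦ φ + ε ∂φ`, where `∂` extends `T`. -/
def symDerAux (T : Module.End ℂ M) :
    SymmetricAlgebra ℂ M →ₐ[ℂ] TrivSqZeroExt (SymmetricAlgebra ℂ M) (SymmetricAlgebra ℂ M) :=
  SymmetricAlgebra.lift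
    ((TrivSqZeroExt.inlAlgHom ℂ (SymmetricAlgebra ℂ M) (SymmetricAlgebra ℂ M)).toLinearMap ∘ₗ
        SymmetricAlgebra.ι ℂ M +
      (TrivSqZeroExt.inrHom (SymmetricAlgebra ℂ M) (SymmetricAlgebra ℂ M)).restrictScalars ℂ ∘ₗ
        SymmetricAlgebra.ι ℂ M ∘ₗ T)

theorem symDerAux_ι (T : Module.End ℂ M) (m : M) :
    symDerAux T (SymmetricAlgebra.ι ℂ M m) =
      TrivSqZeroExt.inl (SymmetricAlgebra.ι ℂ M m) +
        TrivSqZeroExt.inr (SymmetricAlgebra.ι ℂ M (T m)) :=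
  SymmetricAlgebra.lift_ι_apply _ _

theorem symDerAux_fst (T : Module.End ℂ M) (φ : SymmetricAlgebra ℂ M) :
    (symDerAux T φ).fst = φ := by
  have : (TrivSqZeroExt.fstHom ℂ (SymmetricAlgebra ℂ M) (SymmetricAlgebra ℂ M)).comp
      (symDerAux T) = AlgHom.id ℂ _ := by
    apply SymmetricAlgebra.algHom_ext
    ext m
    change (symDerAux T (SymmetricAlgebra.ι ℂ M m)).fst = SymmetricAlgebra.ι ℂ M m
    rw [symDerAux_ι, TrivSqZeroExt.fst_add, TrivSqZeroExt.fst_inl, TrivSqZeroExt.fst_inr, add_zero]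
  exact DFunLike.congr_fun this φ

/-- The derivation of `Sym M` extending the linear map `T : M → M`. -/
def symDer (T : Module.End ℂ M) : Derivation ℂ (SymmetricAlgebra ℂ M) (SymmetricAlgebra ℂ M) :=
  Derivation.mk'
    { toFun := fun φ => (symDerAux T φ).snd
      map_add' := fun x y => by rw [map_add, TrivSqZeroExt.snd_add]
      map_smul' := fun c x => by rw [map_smul, TrivSqZeroExt.snd_smul, RingHom.id_apply] }
    fun a b => by
      change (symDerAux T (a * b)).snd = a • (symDerAux T b).snd + b • (symDerAux T a).snd
      rw [map_mul, TrivSqZeroExt.snd_mul, symDerAux_fst, symDerAux_fst, op_smul_eq_smul]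

theorem symDer_ι (T : Module.End ℂ M) (m : M) :
    symDer T (SymmetricAlgebra.ι ℂ M m) = SymmetricAlgebra.ι ℂ M (T m) := by
  change (symDerAux T (SymmetricAlgebra.ι ℂ M m)).snd = _
  rw [symDerAux_ι, TrivSqZeroExt.snd_add, TrivSqZeroExt.snd_inl, TrivSqZeroExt.snd_inr, zero_add]

theorem symDer_ext {D D' : Derivation ℂ (SymmetricAlgebra ℂ M) (SymmetricAlgebra ℂ M)}
    (h : ∀ m, D (SymmetricAlgebra.ι ℂ M m) = D' (SymmetricAlgebra.ι ℂ M m)) : D = D' := by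
  ext φ
  induction φ using SymmetricAlgebra.induction with
  | algebraMap r => rw [Derivation.map_algebraMap, Derivation.map_algebraMap]
  | ι x => exact h x
  | mul a b ha hb => rw [Derivation.leibniz, Derivation.leibniz, ha, hb]
  | add a b ha hb => rw [map_add, map_add, ha, hb]

attribute [local instance 100] LieRing.ofAssociativeRing

/-- `End M ⊆ Der (Sym M)`. -/
def symDerHom : Module.End ℂ M →ₗ⁅ℂ⁆
    Derivation ℂ (SymmetricAlgebra ℂ M) (SymmetricAlgebra ℂ M) where
  toFun := symDer
  map_add' T T' := symDer_ext fun m => by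
    simp only [Derivation.add_apply, symDer_ι, LinearMap.add_apply, map_add]
  map_smul' c T := symDer_ext fun m => by
    simp only [Derivation.smul_apply, symDer_ι, LinearMap.smul_apply, map_smul, RingHom.id_apply]
  map_lie' {T T'} := symDer_ext fun m => by
    simp only [Derivation.commutator_apply, symDer_ι, LieRing.of_associative_ring_bracket,
      LinearMap.sub_apply, Module.End.mul_apply, map_sub]

/-- The operators `Z^*_{f,β}(ξ) = Z^*(ξ) + (Z^*(ξ) f) - β(ξ)` on a commutative algebra, attached
to an action `Z^*` by derivations and a character `β`. -/
def twistedAction {L B : Type*} [LieRing L] [LieAlgebra ℂ L] [CommRing B] [Algebra ℂ B]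
    (Z : L →ₗ⁅ℂ⁆ Derivation ℂ B B) (β : L →ₗ⁅ℂ⁆ ℂ) (f : B) : L →ₗ⁅ℂ⁆ Module.End ℂ B where
  toFun ξ := (Z ξ : B →ₗ[ℂ] B) + LinearMap.mulLeft ℂ (Z ξ f) - β ξ • 1
  map_add' ξ ξ' := by
    ext b
    simp only [map_add, LinearMap.sub_apply, LinearMap.add_apply, Derivation.coe_add_linearMap,
      Derivation.add_apply, LinearMap.mulLeft_apply, LinearMap.smul_apply, add_smul, add_mul]
    abel
  map_smul' c ξ := by
    ext b
    simp [smul_sub, smul_smul]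
  map_lie' {ξ ξ'} := by
    have hβ : β ⁅ξ, ξ'⁆ = 0 := by
      rw [LieHom.map_lie, LieRing.of_associative_ring_bracket, mul_comm, sub_self]
    ext b
    rw [hβ]
    simp only [LieHom.map_lie, LieRing.of_associative_ring_bracket, LinearMap.sub_apply,
      LinearMap.add_apply, Module.End.mul_apply, LinearMap.mulLeft_apply, LinearMap.smul_apply,
      Module.End.one_apply, Derivation.coeFn_coe, map_add, map_sub,
      Derivation.commutator_apply, Derivation.leibniz, Derivation.map_smul, smul_eq_mul, zero_smul,
      LinearMap.zero_apply]
    simp only [Algebra.smul_def]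
    ring

/-- The zeroth Lie algebra homology `H_0(L, M) = M / L M` of an `L`-module. -/
abbrev LieH0 {L : Type*} [LieRing L] [LieAlgebra ℂ L] (a : L →ₗ⁅ℂ⁆ Module.End ℂ M) : Type _ :=
  M ⧸ ⨆ ξ : L, LinearMap.range (a ξ)

end Symmetric

section Cone

variable {F : Type*} [Field F] [Algebra ℂ F] {P : Type*} (O : P → Subalgebra ℂ F) (n : ℕ)

/-- The ring `ℂ[V] = Sym V^*` of polynomial functions on `V = Γ(X, ω_X^{-1})^*`. -/
abbrev PolyRing : Type _ := SymmetricAlgebra ℂ (AntiCanSec O n)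

variable {n} in
/-- The value of sections of `ω_X^{-1}` on a fixed rational `n`-form, as a linear map. -/
def evalLin (η : Can F n) : AntiCanSec O n →ₗ[ℂ] F where
  toFun s := s.eval η
  map_add' s t := AntiCanSec.eval_add O s t η
  map_smul' c s := AntiCanSec.eval_smul O c s η

variable {n} in
/-- The value of a polynomial in sections of `ω_X^{-1}` on a rational `n`-form. -/
def evalPoly (η : Can F n) : PolyRing O n →ₐ[ℂ] F := SymmetricAlgebra.lift (evalLin O η)

/-- The vanishing ideal `I(X̂, V) ⊆ ℂ[V]` of the cone `X̂ ⊆ V` over `X`: the polynomials `φ` in the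
sections of `ω_X^{-1}` that vanish identically on `X`. For a rational `n`-form `η` the functional
`s ↦ s(η)` is a point of `X̂` with values in the function field; for `η ≠ 0` it lies over the
generic point of `X`, and `η` runs over the whole line of `X̂` above it, so that `φ` vanishes on the
irreducible variety `X̂` if and only if it vanishes at all of these points. -/
def coneIdeal : Ideal (PolyRing O n) := ⨅ η : Can F n, RingHom.ker (evalPoly O η)

theorem mem_coneIdeal {φ : PolyRing O n} : φ ∈ coneIdeal O n ↔ ∀ η, evalPoly O η φ = 0 := by
  simp [coneIdeal, RingHom.mem_ker]

/-- The homogeneous coordinate ring `R = ℂ[X̂] = ℂ[V] / I(X̂, V)`. -/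
abbrev ConeRing : Type _ := PolyRing O n ⧸ coneIdeal O n

variable {n} in
/-- The restriction of polynomials to the line `η + t ζ`. -/
def lineEval (η ζ : Can F n) : PolyRing O n →ₐ[ℂ] Polynomial F :=
  SymmetricAlgebra.lift
    { toFun := fun s => Polynomial.C (s.eval η) + Polynomial.X * Polynomial.C (s.eval ζ)
      map_add' := fun s t => by simp only [AntiCanSec.eval_add, map_add]; ring
      map_smul' := fun c s => by
        simp only [AntiCanSec.eval_smul, RingHom.id_apply, Algebra.smul_def, map_mul,
          Polynomial.algebraMap_apply]
        ring }

variable {n} in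
theorem lineEval_eval (η ζ : Can F n) (t : ℂ) (φ : PolyRing O n) :
    (lineEval O η ζ φ).eval (algebraMap ℂ F t) = evalPoly O (η + t • ζ) φ := by
  have : ((Polynomial.aeval (R := F) (algebraMap ℂ F t)).restrictScalars ℂ).comp (lineEval O η ζ) =
      evalPoly O (η + t • ζ) := by
    apply SymmetricAlgebra.algHom_ext
    ext s
    change Polynomial.aeval _ (lineEval O η ζ (SymmetricAlgebra.ι ℂ _ s)) =
      evalPoly O (η + t • ζ) (SymmetricAlgebra.ι ℂ _ s)
    rw [lineEval, evalPoly, SymmetricAlgebra.lift_ι_apply, SymmetricAlgebra.lift_ι_apply]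
    change Polynomial.aeval _ (Polynomial.C (s.eval η) + Polynomial.X * Polynomial.C (s.eval ζ)) =
      s.eval (η + t • ζ)
    rw [AntiCanSec.eval_map_add, AntiCanSec.eval_map_csmul]
    simp only [map_add, map_mul, Polynomial.aeval_C, Polynomial.aeval_X, Algebra.algebraMap_self,
      RingHom.id_apply, Algebra.smul_def]
  have h := DFunLike.congr_fun this φ
  rw [← h]
  simp

variable {n} in
theorem lineEval_eq_zero (η ζ : Can F n) {φ : PolyRing O n} (hφ : φ ∈ coneIdeal O n) :
    lineEval O η ζ φ = 0 := by
  rw [mem_coneIdeal] at hφ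
  apply Polynomial.eq_zero_of_infinite_isRoot
  refine Set.Infinite.mono (s := Set.range (algebraMap ℂ F)) ?_
    (Set.infinite_range_of_injective (algebraMap ℂ F).injective)
  rintro _ ⟨t, rfl⟩
  change (lineEval O η ζ φ).eval _ = 0
  rw [lineEval_eval, hφ]

variable {n} in
theorem lineEval_coeff_zero (η ζ : Can F n) (φ : PolyRing O n) :
    (lineEval O η ζ φ).coeff 0 = evalPoly O η φ := by
  have := lineEval_eval O η ζ 0 φ
  rwa [map_zero, zero_smul, add_zero, ← Polynomial.coeff_zero_eq_eval_zero] at this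

attribute [local instance 100] LieRing.ofAssociativeRing

variable {𝔤 : Type*} [LieRing 𝔤] [LieAlgebra ℂ 𝔤] (ρ : 𝔤 →ₗ⁅ℂ⁆ vectorFields O)

/-- The action of `ĝ = 𝔤 ⊕ ℂ` on `V^* = Γ(X, ω_X^{-1})`: `𝔤` acts naturally, and `1 ∈ ℂ` acts on
`V` as the identity, hence on `V^*` as `-1`. -/
def ghatLin : 𝔤 × ℂ →ₗ⁅ℂ⁆ Module.End ℂ (AntiCanSec O n) where
  toFun ξ := lieSec O n (ρ ξ.1) - ξ.2 • 1
  map_add' ξ ξ' := by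
    simp only [Prod.fst_add, Prod.snd_add, map_add, add_smul]; abel
  map_smul' c ξ := by
    simp only [Prod.smul_fst, Prod.smul_snd, map_smul, smul_sub, RingHom.id_apply, smul_assoc]
  map_lie' {ξ ξ'} := by
    rw [LieAlgebra.Prod.bracket_apply]
    simp only [LieHom.map_lie, LieRing.of_associative_ring_bracket, mul_comm ξ.2, sub_self,
      zero_smul, sub_zero, sub_mul, mul_sub, smul_mul_assoc, mul_smul_comm, one_mul, mul_one]
    module

/-- The action `Z^*` of `ĝ = 𝔤 ⊕ ℂ` on `ℂ[V]` by derivations. -/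
def zStar : 𝔤 × ℂ →ₗ⁅ℂ⁆ Derivation ℂ (PolyRing O n) (PolyRing O n) :=
  symDerHom.comp (ghatLin O n ρ)

theorem evalPoly_zStar (ξ : 𝔤 × ℂ) (η : Can F n) (φ : PolyRing O n) :
    evalPoly O η (zStar O n ρ ξ φ) = (ρ ξ.1 : Derivation ℂ F F) (evalPoly O η φ) -
      (lineEval O η (lieForm n (ρ ξ.1 : Derivation ℂ F F) η + ξ.2 • η) φ).coeff 1 := by
  induction φ using SymmetricAlgebra.induction with
  | algebraMap r =>
    rw [Derivation.map_algebraMap, map_zero, AlgHom.commutes, AlgHom.commutes,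
      Derivation.map_algebraMap, Polynomial.algebraMap_apply, Polynomial.coeff_C_succ, sub_zero]
  | ι s =>
    change evalPoly O η (symDer (ghatLin O n ρ ξ) (SymmetricAlgebra.ι ℂ _ s)) = _
    rw [symDer_ι, evalPoly, SymmetricAlgebra.lift_ι_apply, SymmetricAlgebra.lift_ι_apply, lineEval,
      SymmetricAlgebra.lift_ι_apply]
    change (lieAct (ρ ξ.1) s - ξ.2 • s).eval η = (ρ ξ.1 : Derivation ℂ F F) (s.eval η) -
      (Polynomial.C (s.eval η) + Polynomial.X * Polynomial.C (s.eval
        (lieForm n (ρ ξ.1 : Derivation ℂ F F) η + ξ.2 • η))).coeff 1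
    rw [AntiCanSec.eval_sub, lieAct_eval, AntiCanSec.eval_smul, Polynomial.coeff_add,
      Polynomial.coeff_C_succ, Polynomial.coeff_X_mul, Polynomial.coeff_C_zero,
      AntiCanSec.eval_map_add, AntiCanSec.eval_map_csmul]
    ring
  | mul a b ha hb =>
    rw [Derivation.leibniz, smul_eq_mul, smul_eq_mul, map_add, map_mul, map_mul, ha, hb,
      map_mul (evalPoly O η) a b, map_mul (lineEval O _ _) a b, Derivation.leibniz, smul_eq_mul, smul_eq_mul, Polynomial.mul_coeff_one,
      lineEval_coeff_zero, lineEval_coeff_zero]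
    ring
  | add a b ha hb =>
    rw [map_add, map_add, ha, hb, map_add, map_add, map_add, Polynomial.coeff_add]
    ring

theorem zStar_mem (ξ : 𝔤 × ℂ) {φ : PolyRing O n} (hφ : φ ∈ coneIdeal O n) :
    zStar O n ρ ξ φ ∈ coneIdeal O n := by
  rw [mem_coneIdeal]
  intro η
  rw [evalPoly_zStar, lineEval_eq_zero O _ _ hφ, (mem_coneIdeal O n).1 hφ, map_zero,
    Polynomial.coeff_zero, sub_zero]

/-- The action `Z^*` of `ĝ = 𝔤 ⊕ ℂ` on `R = ℂ[X̂]` by derivations. -/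
def zStarCone : 𝔤 × ℂ →ₗ⁅ℂ⁆ Derivation ℂ (ConeRing O n) (ConeRing O n) where
  toFun ξ := Derivation.mk'
    (Submodule.mapQ ((coneIdeal O n).restrictScalars ℂ) ((coneIdeal O n).restrictScalars ℂ)
      (zStar O n ρ ξ : PolyRing O n →ₗ[ℂ] PolyRing O n) fun _ h => zStar_mem O n ρ ξ h)
    (by
      intro a b
      obtain ⟨a, rfl⟩ := Ideal.Quotient.mk_surjective a
      obtain ⟨b, rfl⟩ := Ideal.Quotient.mk_surjective b
      change Ideal.Quotient.mk (coneIdeal O n) (zStar O n ρ ξ (a * b)) =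
        Ideal.Quotient.mk _ a * Ideal.Quotient.mk _ (zStar O n ρ ξ b) +
        Ideal.Quotient.mk _ b * Ideal.Quotient.mk _ (zStar O n ρ ξ a)
      rw [Derivation.leibniz, smul_eq_mul, smul_eq_mul, map_add, map_mul, map_mul])
  map_add' ξ ξ' := by
    ext a
    obtain ⟨a, rfl⟩ := Ideal.Quotient.mk_surjective a
    change Ideal.Quotient.mk (coneIdeal O n) (zStar O n ρ (ξ + ξ') a) =
      Ideal.Quotient.mk _ (zStar O n ρ ξ a) + Ideal.Quotient.mk _ (zStar O n ρ ξ' a)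
    rw [map_add, Derivation.add_apply, map_add]
  map_smul' c ξ := by
    ext a
    obtain ⟨a, rfl⟩ := Ideal.Quotient.mk_surjective a
    change Ideal.Quotient.mk (coneIdeal O n) (zStar O n ρ (c • ξ) a) =
      c • Ideal.Quotient.mk (coneIdeal O n) (zStar O n ρ ξ a)
    rw [map_smul, Derivation.smul_apply]
    rfl
  map_lie' {ξ ξ'} := by
    ext a
    obtain ⟨a, rfl⟩ := Ideal.Quotient.mk_surjective a
    rw [Derivation.commutator_apply]
    change Ideal.Quotient.mk (coneIdeal O n) (zStar O n ρ ⁅ξ, ξ'⁆ a) =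
      Ideal.Quotient.mk _ (zStar O n ρ ξ (zStar O n ρ ξ' a)) -
      Ideal.Quotient.mk _ (zStar O n ρ ξ' (zStar O n ρ ξ a))
    rw [LieHom.map_lie, Derivation.commutator_apply, map_sub]

/-- The `ĝ`-module `R_f`: the ring `R = ℂ[X̂]` with `ĝ = 𝔤 ⊕ ℂ` acting by
`Z^*(ξ) + (Z^*(ξ) f) - β(ξ)`, where `β = (0; 1)`. -/
def rfAction (f : AntiCanSec O n) : 𝔤 × ℂ →ₗ⁅ℂ⁆ Module.End ℂ (ConeRing O n) :=
  twistedAction (zStarCone O n ρ) (LieHom.snd ℂ 𝔤 ℂ)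
    (Ideal.Quotient.mk (coneIdeal O n) (SymmetricAlgebra.ι ℂ _ f))

/-- The Lie algebra homology `H_0(ĝ, R_f)`. -/
abbrev RfH0 (f : AntiCanSec O n) : Type _ := LieH0 (rfAction O n ρ f)

end Cone

/-! ### The projective variety `X = Proj S` and the punctured cone `U = Spec S ∖ {0}`

A projective variety with a very ample line bundle `L` is `X = Proj S` with `L = O_X(1)`, where `S`
is a domain that is generated over `ℂ` by finitely many elements of degree `1`. Above the open set
`D₊(x)` of `X`, where `x ∈ S₁` trivializes `L`, the complement `U` of the zero section of `L` is
`Spec S_(x)[x, x⁻¹] = Spec S[1/x]`, with the sections of `L^k` as the functions of degree `k`; so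
`U` is the complement of the vertex in `Spec S`. -/

section Proj

variable {S : Type*} [CommRing S] [IsDomain S] [Algebra ℂ S] (𝒜 : ℕ → Submodule ℂ S)
  [GradedAlgebra 𝒜]

/-- Rational sections of `L^k = O_X(k)`: the homogeneous fractions of degree `k` (and `0`). -/
def IsHomFrac (k : ℤ) (z : FractionRing S) : Prop :=
  z = 0 ∨ ∃ i j : ℕ, (i : ℤ) = j + k ∧ ∃ a ∈ 𝒜 i, ∃ b ∈ 𝒜 j, b ≠ 0 ∧
    z = algebraMap S (FractionRing S) a / algebraMap S (FractionRing S) b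

/-- The sections of `L^k = O_X(k)` at a point `p` of `X`: the homogeneous fractions of degree `k`
whose denominator does not vanish at `p`. -/
def twistStalk (k : ℤ) (p : ProjectiveSpectrum 𝒜) : Set (FractionRing S) :=
  {z | ∃ i j : ℕ, (i : ℤ) = j + k ∧ ∃ a ∈ 𝒜 i, ∃ b ∈ 𝒜 j, b ∉ p.asHomogeneousIdeal ∧
    z = algebraMap S (FractionRing S) a / algebraMap S (FractionRing S) b}

theorem algebraMap_frac_ne_zero {b : S} (hb : b ≠ 0) : algebraMap S (FractionRing S) b ≠ 0 :=
  fun h => hb ((IsFractionRing.injective S (FractionRing S)) (by rw [h, map_zero]))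

variable {𝒜}

theorem IsHomFrac.zero (k : ℤ) : IsHomFrac 𝒜 k (0 : FractionRing S) := Or.inl rfl

theorem IsHomFrac.add {k : ℤ} {z w : FractionRing S} (hz : IsHomFrac 𝒜 k z)
    (hw : IsHomFrac 𝒜 k w) : IsHomFrac 𝒜 k (z + w) := by
  rcases hz with rfl | ⟨i, j, h, a, ha, b, hb, hb0, rfl⟩
  · rwa [zero_add]
  rcases hw with rfl | ⟨i', j', h', a', ha', b', hb', hb0', rfl⟩
  · rw [add_zero]; exact Or.inr ⟨i, j, h, a, ha, b, hb, hb0, rfl⟩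
  refine Or.inr ⟨i + j', j + j', by push_cast; omega, a * b' + b * a',
    add_mem (SetLike.mul_mem_graded ha hb') ?_,
    b * b', SetLike.mul_mem_graded hb hb', mul_ne_zero hb0 hb0', ?_⟩
  · have : i + j' = j + i' := by omega
    rw [this]; exact SetLike.mul_mem_graded hb ha'
  · rw [div_add_div _ _ (algebraMap_frac_ne_zero hb0) (algebraMap_frac_ne_zero hb0')]
    simp only [map_add, map_mul]

theorem IsHomFrac.mul {k l : ℤ} {z w : FractionRing S} (hz : IsHomFrac 𝒜 k z)
    (hw : IsHomFrac 𝒜 l w) : IsHomFrac 𝒜 (k + l) (z * w) := by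
  rcases hz with rfl | ⟨i, j, h, a, ha, b, hb, hb0, rfl⟩
  · rw [zero_mul]; exact IsHomFrac.zero _
  rcases hw with rfl | ⟨i', j', h', a', ha', b', hb', hb0', rfl⟩
  · rw [mul_zero]; exact IsHomFrac.zero _
  refine Or.inr ⟨i + i', j + j', by push_cast; omega, a * a', SetLike.mul_mem_graded ha ha',
    b * b', SetLike.mul_mem_graded hb hb', mul_ne_zero hb0 hb0', ?_⟩
  rw [div_mul_div_comm, map_mul, map_mul]

theorem IsHomFrac.const (c : ℂ) : IsHomFrac 𝒜 0 (algebraMap ℂ (FractionRing S) c) := by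
  refine Or.inr ⟨0, 0, rfl, algebraMap ℂ S c, SetLike.algebraMap_mem_graded 𝒜 c, 1,
    SetLike.one_mem_graded 𝒜, one_ne_zero, ?_⟩
  rw [map_one, div_one, ← IsScalarTower.algebraMap_apply]

theorem IsHomFrac.inv {z : FractionRing S} (hz : IsHomFrac 𝒜 0 z) : IsHomFrac 𝒜 0 z⁻¹ := by
  rcases hz with rfl | ⟨i, j, h, a, ha, b, hb, hb0, rfl⟩
  · rw [inv_zero]; exact IsHomFrac.zero 0
  by_cases ha0 : a = 0
  · rw [ha0, map_zero, zero_div, inv_zero]; exact IsHomFrac.zero 0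
  · exact Or.inr ⟨j, i, by omega, b, hb, a, ha, ha0, inv_div _ _⟩

variable (𝒜)

/-- The function field of `X`: the homogeneous fractions of degree `0`. -/
def functionField : IntermediateField ℂ (FractionRing S) where
  carrier := {z | IsHomFrac 𝒜 0 z}
  mul_mem' h h' := by simpa using IsHomFrac.mul h h'
  add_mem' h h' := IsHomFrac.add h h'
  algebraMap_mem' c := IsHomFrac.const c
  inv_mem' _ h := IsHomFrac.inv h

/-- The local ring of `X` at a point `p`. -/
def localX (p : ProjectiveSpectrum 𝒜) : Subalgebra ℂ (functionField 𝒜) where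
  carrier := {z | (z : FractionRing S) ∈ twistStalk 𝒜 0 p}
  mul_mem' := by
    rintro z w ⟨i, j, h, a, ha, b, hb, hb0, e⟩ ⟨i', j', h', a', ha', b', hb', hb0', e'⟩
    refine ⟨i + i', j + j', by push_cast; omega, a * a', SetLike.mul_mem_graded ha ha',
      b * b', SetLike.mul_mem_graded hb hb',
      fun hm => (p.isPrime.mem_or_mem hm).elim hb0 hb0', ?_⟩
    rw [MulMemClass.coe_mul, e, e', div_mul_div_comm, map_mul, map_mul]
  add_mem' := by
    rintro z w ⟨i, j, h, a, ha, b, hb, hb0, e⟩ ⟨i', j', h', a', ha', b', hb', hb0', e'⟩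
    have hb1 : b ≠ 0 := fun h => hb0 (h ▸ zero_mem _)
    have hb1' : b' ≠ 0 := fun h => hb0' (h ▸ zero_mem _)
    refine ⟨i + j', j + j', by push_cast; omega, a * b' + b * a',
      add_mem (SetLike.mul_mem_graded ha hb') ?_, b * b', SetLike.mul_mem_graded hb hb',
      fun hm => (p.isPrime.mem_or_mem hm).elim hb0 hb0', ?_⟩
    · have : i + j' = j + i' := by omega
      rw [this]; exact SetLike.mul_mem_graded hb ha'
    · rw [AddMemClass.coe_add, e, e',
        div_add_div _ _ (algebraMap_frac_ne_zero hb1) (algebraMap_frac_ne_zero hb1')]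
      simp only [map_add, map_mul]
  algebraMap_mem' c := by
    refine ⟨0, 0, rfl, algebraMap ℂ S c, SetLike.algebraMap_mem_graded 𝒜 c, 1,
      SetLike.one_mem_graded 𝒜, fun h => p.isPrime.ne_top ((Ideal.eq_top_iff_one _).2 h), ?_⟩
    rw [map_one, div_one, ← IsScalarTower.algebraMap_apply]
    rfl

/-- Rational sections of `L^k = O_X(k)`, as a vector space over the function field of `X`. -/
def twist (k : ℤ) : Submodule (functionField 𝒜) (FractionRing S) where
  carrier := {z | IsHomFrac 𝒜 k z}
  add_mem' h h' := IsHomFrac.add h h'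
  zero_mem' := IsHomFrac.zero k
  smul_mem' c z h := by
    have := IsHomFrac.mul c.2 h
    rwa [zero_add] at this

/-- The structure morphism `X = Proj S ⟶ Spec ℂ`. -/
def projToSpec {S : Type} [CommRing S] [Algebra ℂ S] (𝒜 : ℕ → Submodule ℂ S) [GradedAlgebra 𝒜] :
    AlgebraicGeometry.Proj 𝒜 ⟶ AlgebraicGeometry.Spec (CommRingCat.of ℂ) :=
  CategoryTheory.CategoryStruct.comp (AlgebraicGeometry.Proj.toSpecZero 𝒜)
    (AlgebraicGeometry.Spec.map (CommRingCat.ofHom (algebraMap ℂ (𝒜 0))))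

/-- The points of `U = Spec S ∖ {0}`, the complement of the zero section: the primes of `S` that do
not contain the irrelevant ideal. -/
abbrev ConePoint : Type _ :=
  {q : PrimeSpectrum S // ¬ (HomogeneousIdeal.irrelevant 𝒜).toIdeal ≤ q.asIdeal}

variable {𝒜} in
/-- The local ring of `U` at a point `q`. -/
def localU (q : ConePoint 𝒜) : Subalgebra ℂ (FractionRing S) where
  carrier := {z | ∃ a b : S, b ∉ q.1.asIdeal ∧
    z = algebraMap S (FractionRing S) a / algebraMap S (FractionRing S) b}
  mul_mem' := by
    rintro _ _ ⟨a, b, hb, rfl⟩ ⟨a', b', hb', rfl⟩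
    refine ⟨a * a', b * b', fun hm => (q.1.isPrime.mem_or_mem hm).elim hb hb', ?_⟩
    rw [div_mul_div_comm, map_mul, map_mul]
  add_mem' := by
    rintro _ _ ⟨a, b, hb, rfl⟩ ⟨a', b', hb', rfl⟩
    have hb1 : b ≠ 0 := fun h => hb (h ▸ zero_mem _)
    have hb1' : b' ≠ 0 := fun h => hb' (h ▸ zero_mem _)
    refine ⟨a * b' + b * a', b * b', fun hm => (q.1.isPrime.mem_or_mem hm).elim hb hb', ?_⟩
    rw [div_add_div _ _ (algebraMap_frac_ne_zero hb1) (algebraMap_frac_ne_zero hb1')]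
    simp only [map_add, map_mul]
  algebraMap_mem' c := by
    refine ⟨algebraMap ℂ S c, 1, fun h => q.1.isPrime.ne_top ((Ideal.eq_top_iff_one _).2 h), ?_⟩
    rw [map_one, div_one, ← IsScalarTower.algebraMap_apply]

/-- `Γ(U, O_U)_k`, the regular functions on `U` that are homogeneous of degree `k`. -/
def functionsU (k : ℤ) : Set (FractionRing S) :=
  {z | IsHomFrac 𝒜 k z ∧ ∀ q : ConePoint 𝒜, z ∈ localU q}

/-- The rational `p`-forms on `U` that are homogeneous of degree `k`: the sums of the forms
`a db₁ ∧ ⋯ ∧ dbₚ` with `a, b₁, …, bₚ` homogeneous of total degree `k`. -/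
def homForms (p : ℕ) (k : ℤ) : Submodule ℂ (Forms (FractionRing S)) :=
  Submodule.span ℂ {ω | ∃ (l : ℤ) (e : Fin p → ℤ), l + ∑ i, e i = k ∧
    ∃ a, IsHomFrac 𝒜 l a ∧ ∃ b : Fin p → FractionRing S, (∀ i, IsHomFrac 𝒜 (e i) (b i)) ∧
      ω = a • wedgeD b}

/-- `Γ(U, Ω^p_U)_{0 mod N}`: the `p`-forms that are regular at all points of `U` and whose
homogeneous components have degrees divisible by `N`. -/
def formsU (N p : ℕ) : Submodule ℂ (Forms (FractionRing S)) :=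
  (⨅ q : ConePoint 𝒜, formsOver (localU q) p) ⊓ ⨆ m : ℤ, homForms 𝒜 p (N * m)

variable {𝒜}

theorem extDeriv_mem_homForms {p : ℕ} {k : ℤ} {ω : Forms (FractionRing S)}
    (hω : ω ∈ homForms 𝒜 p k) : extDeriv ω ∈ homForms 𝒜 (p + 1) k := by
  induction hω using Submodule.span_induction with
  | mem x hx =>
    obtain ⟨l, e, h, a, ha, c, hc, rfl⟩ := hx
    rw [extDeriv_smul, extDeriv_wedgeD, smul_zero, add_zero, ← wedgeD_cons]
    refine Submodule.subset_span ⟨0, Fin.cons l e, ?_, 1, ?_, Fin.cons a c, ?_, (one_smul _ _).symm⟩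
    · rw [Fin.sum_univ_succ]; simpa using h
    · simpa using IsHomFrac.const (𝒜 := 𝒜) 1
    · exact fun i => Fin.cases (by simpa using ha) (by simpa using hc) i
  | zero => rw [map_zero]; exact zero_mem _
  | add x y _ _ hx hy => rw [map_add]; exact add_mem hx hy
  | smul c x _ hx => rw [map_smul]; exact Submodule.smul_mem _ c hx

theorem D_mul_mem_homForms {p : ℕ} {k l : ℤ} {f : FractionRing S} (hf : IsHomFrac 𝒜 l f)
    {ω : Forms (FractionRing S)} (hω : ω ∈ homForms 𝒜 p k) :
    ExteriorAlgebra.ι _ (KaehlerDifferential.D ℂ _ f) * ω ∈ homForms 𝒜 (p + 1) (k + l) := by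
  induction hω using Submodule.span_induction with
  | mem x hx =>
    obtain ⟨m, e, h, a, ha, c, hc, rfl⟩ := hx
    rw [mul_smul_comm, ← wedgeD_cons]
    refine Submodule.subset_span ⟨m, Fin.cons l e, ?_, a, ha, Fin.cons f c, ?_, rfl⟩
    · rw [Fin.sum_univ_succ]
      simp only [Fin.cons_zero, Fin.cons_succ]
      omega
    · exact fun i => Fin.cases (by simpa using hf) (by simpa using hc) i
  | zero => rw [mul_zero]; exact zero_mem _
  | add x y _ _ hx hy => rw [mul_add]; exact add_mem hx hy
  | smul c x _ hx => rw [mul_smul_comm]; exact Submodule.smul_mem _ c hx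

theorem extDeriv_mem_formsU {N p : ℕ} {ω : Forms (FractionRing S)} (hω : ω ∈ formsU 𝒜 N p) :
    extDeriv ω ∈ formsU 𝒜 N (p + 1) := by
  refine ⟨(Submodule.mem_iInf _).2 fun q =>
    extDeriv_mem_formsOver ((Submodule.mem_iInf _).1 hω.1 q), ?_⟩
  refine Submodule.iSup_induction _ (motive := fun ω => extDeriv ω ∈
    ⨆ m : ℤ, homForms 𝒜 (p + 1) (N * m)) hω.2 ?_ ?_ ?_
  · exact fun m x hx => Submodule.mem_iSup_of_mem m (extDeriv_mem_homForms hx)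
  · rw [map_zero]; exact zero_mem _
  · intro x y hx hy; rw [map_add]; exact add_mem hx hy

theorem D_mul_mem_formsU {N p : ℕ} {f : FractionRing S} (hf : f ∈ functionsU 𝒜 N)
    {ω : Forms (FractionRing S)} (hω : ω ∈ formsU 𝒜 N p) :
    ExteriorAlgebra.ι _ (KaehlerDifferential.D ℂ _ f) * ω ∈ formsU 𝒜 N (p + 1) := by
  refine ⟨(Submodule.mem_iInf _).2 fun q =>
    D_mul_mem_formsOver (hf.2 q) ((Submodule.mem_iInf _).1 hω.1 q), ?_⟩
  refine Submodule.iSup_induction _ (motive := fun ω =>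
    ExteriorAlgebra.ι _ (KaehlerDifferential.D ℂ _ f) * ω ∈
    ⨆ m : ℤ, homForms 𝒜 (p + 1) (N * m)) hω.2 ?_ ?_ ?_
  · intro m x hx
    refine Submodule.mem_iSup_of_mem (m + 1) ?_
    rw [mul_add, mul_one]
    exact D_mul_mem_homForms hf.1 hx
  · rw [mul_zero]; exact zero_mem _
  · intro x y hx hy; rw [mul_add]; exact add_mem hx hy

variable (𝒜)

/-- The map `d + df : Γ(U, Ω^p_U)_{0 mod N} → Γ(U, Ω^{p+1}_U)_{0 mod N}`, `ω ↦ dω + df ∧ ω`, for a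
function `f` of degree `N` on `U`. -/
def dPlusDf (N p : ℕ) (f : functionsU 𝒜 N) : formsU 𝒜 N p →ₗ[ℂ] formsU 𝒜 N (p + 1) where
  toFun ω := ⟨extDeriv ω.1 + ExteriorAlgebra.ι _ (KaehlerDifferential.D ℂ _ f.1) * ω.1,
    add_mem (extDeriv_mem_formsU ω.2) (D_mul_mem_formsU f.2 ω.2)⟩
  map_add' x y := by
    apply Subtype.ext
    simp only [Submodule.coe_add, map_add, mul_add]
    abel
  map_smul' c x := by
    apply Subtype.ext
    simp only [Submodule.coe_smul, map_smul, mul_smul_comm, RingHom.id_apply, smul_add]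

/-- The cokernel of `d + df : Γ(U, Ω^n_U)_{0 mod N} → Γ(U, ω_U)_{0 mod N}`. -/
abbrev CokerDPlusDf (N n : ℕ) (f : functionsU 𝒜 N) : Type _ :=
  formsU 𝒜 N (n + 1) ⧸ LinearMap.range (dPlusDf 𝒜 N n f)

end Proj

end

end CYCone

/-! The isomorphism `α : ω_X ≅ L^{-N}` produces a nowhere vanishing top form `vol = (α(η) x)⁻¹ dx ∧
η` of degree `N` on `U`. Dividing by `vol` turns top forms into functions: `Γ(U, ω_U)_{0 mod N} = R
· vol`, where `R` is `regMod`, the ring of regular functions with degrees divisible by `N`.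
Contracting `vol` turns `n`-forms into vector fields (`formsU_eq_span`). Every `y ∈ 𝔤` lifts to a
field `θ_y` on `U` with `L_{θ_y} vol = 0`, and the Euler field satisfies `L_E vol = N vol`. Hence
for `θ = θ_y` (with `β = 0`) and for `θ = -E/N` (with `β = 1`), Cartan's formula gives `(d +
df)(ι_{Gθ} vol) = (θ(G) + θ(f) G - β G) vol`. This is `twisted_contr`, and the right-hand side is
the operator by which `ĝ` acts on `R_f`.

So the cokernel is `R / ĝR` as soon as the `θ_y` and `E` generate over `R` all fields on `U` of
degree divisible by `N` (`Generated`). In degree `Nr ≥ 0`, a field induces a section of `T_X ⊗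
ω_X^{-r}`; by (iii) a combination of the `θ_y` induces the same section, and the difference is
vertical, hence a multiple of `E`. If `X` is not a point, functions of negative degree vanish. This
kills the fields of negative degree, except possibly those of degree `-1` when `N = 1`. These are
excluded by a trace computation on `V^*`, in which semisimplicity enters through the vanishing of
traces (`apply_eq_zero_of_degree_neg_one`).

It remains to compare `R` with the subring `A = ℂ[X̂]` (`coneFun`). The operator `T` of `-E/N`
commutes with `ĝ` and equals `-((k + 1) + f)` on functions of degree `Nk`. A power of `f` moves any
given element of `R` into `A` (`exists_pow_mul_mem`, a Nakayama argument), and `k + 1 ≠ 0` for `k ≥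
0`, so `T` is invertible on `R / A`. An invertible operator commuting with `ĝ` that itself comes
from `ĝ` leaves no contribution of `R / A` to the coinvariants (`mem_opSum_of_invertible`), whence
`A / ĝA = R / ĝR`.

If `X` is a point, then `A = ℂ[f]` and `R = ℂ[f, f⁻¹]`. The inclusion no longer induces an
isomorphism, since `1 = -T(f⁻¹)` dies in `R / ĝR`. Both quotients are one-dimensional, however, as
explicit functionals show. -/

set_option linter.unusedSectionVars false
-- Local coordinates on X
namespace CYCone
noncomputable section

/-- A standard smooth algebra with fraction field `K` has coordinates. -/
theorem exists_coords_of_standardSmooth {n : ℕ} {C K : Type*} [CommRing C] [Algebra ℂ C]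
    [Field K] [Algebra ℂ K] [Algebra C K] [IsScalarTower ℂ C K] [IsFractionRing C K]
    [Algebra.IsStandardSmoothOfRelativeDimension n ℂ C] :
    ∃ (g : Fin n → C) (e : Module.Basis (Fin n) K Ω[K⁄ℂ]),
      (∀ i, e i = KaehlerDifferential.D ℂ K (algebraMap C K (g i))) ∧
      ∀ c i, e.repr (KaehlerDifferential.D ℂ K (algebraMap C K c)) i ∈ Set.range (algebraMap C K) := by
  classical
  obtain ⟨ι, σ, _, _, P, hP⟩ := Algebra.IsStandardSmoothOfRelativeDimension.out (n := n) (R := ℂ) (S := C)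
  have : Nontrivial C := (algebraMap C K).domain_nontrivial
  have : Fintype ((Set.range P.map)ᶜ : Set ι) := Fintype.ofFinite _
  have hcard : Fintype.card ((Set.range P.map)ᶜ : Set ι) = n := by
    have h1 := P.rank_kaehlerDifferential
    rw [rank_eq_card_basis P.basisKaehler, hP] at h1
    exact_mod_cast h1
  let b : Module.Basis (Fin n) C Ω[C⁄ℂ] := P.basisKaehler.reindex (Fintype.equivFinOfCardEq hcard)
  have hb : ∀ i, ∃ g : C, b i = KaehlerDifferential.D ℂ C g := fun i =>
    ⟨_, by simp only [b, Module.Basis.reindex_apply]; exact P.basisKaehler_apply _⟩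
  choose g hg using hb
  -- A localization is formally étale, so `Ω_K = K ⊗ Ω_C` and the basis `dgᵢ` of `Ω_C` becomes a
  -- basis over `K`; differentials of elements of `C` keep their coefficients in `C`.
  have : Algebra.FormallyEtale C K := Algebra.FormallyEtale.of_isLocalization (nonZeroDivisors C)
  let T := KaehlerDifferential.tensorKaehlerEquivOfFormallyEtale ℂ C K
  let e : Module.Basis (Fin n) K Ω[K⁄ℂ] := (b.baseChange K).map T
  refine ⟨g, e, fun i => ?_, fun c i => ?_⟩
  · simp only [e, Module.Basis.map_apply, Module.Basis.baseChange_apply, hg]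
    rw [← LinearEquiv.eq_symm_apply]
    exact (KaehlerDifferential.tensorKaehlerEquivOfFormallyEtale_symm_D_algebraMap ℂ C K _).symm
  · refine ⟨b.repr (KaehlerDifferential.D ℂ C c) i, ?_⟩
    simp only [e, Module.Basis.map_repr, LinearEquiv.trans_apply]
    rw [KaehlerDifferential.tensorKaehlerEquivOfFormallyEtale_symm_D_algebraMap,
      Module.Basis.baseChange_repr_tmul, Algebra.smul_def, mul_one]

/-- This is the quotient rule. It passes from a chart `R` to the local ring `O` of a point of that
chart, whose elements are fractions over `R` with denominators invertible in `O`. -/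
theorem repr_D_mem_of_fractions {ι K : Type*} [Field K] [Algebra ℂ K] (e : Module.Basis ι K Ω[K⁄ℂ])
    {R : Set K} {O : Subalgebra ℂ K} (hR : R ⊆ O)
    (hO : ∀ h ∈ O, ∃ a ∈ R, ∃ b ∈ R, b ≠ 0 ∧ b⁻¹ ∈ O ∧ h = a / b)
    (he : ∀ c ∈ R, ∀ i, e.repr (KaehlerDifferential.D ℂ K c) i ∈ O) {h : K} (hh : h ∈ O) (i : ι) :
    e.repr (KaehlerDifferential.D ℂ K h) i ∈ O := by
  obtain ⟨a, ha, b, hb, hb0, hbO, rfl⟩ := hO h hh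
  rw [div_eq_mul_inv, Derivation.leibniz, Derivation.leibniz_inv, map_add, map_smul, map_smul,
    map_smul, Finsupp.add_apply, Finsupp.smul_apply, Finsupp.smul_apply, Finsupp.smul_apply]
  simp only [smul_eq_mul]
  refine O.add_mem (O.mul_mem (hR ha) (O.mul_mem (O.neg_mem (O.pow_mem hbO 2)) (he b hb i)))
    (O.mul_mem hbO (he a ha i))


section Proj

open HomogeneousLocalization AlgebraicGeometry CategoryTheory

section AnyUniverse

variable {S : Type*} [CommRing S] [IsDomain S] [Algebra ℂ S] (𝒜 : ℕ → Submodule ℂ S)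
  [GradedAlgebra 𝒜]

/-- The degree zero part of `S[1/x]` inside the function field. -/
def awayFrac (x : S) (hx : x ≠ 0) : Away 𝒜 x →+* FractionRing S :=
  (IsLocalization.lift (M := Submonoid.powers x) (S := Localization.Away x)
    (g := algebraMap S (FractionRing S)) (by
      rintro ⟨_, k, rfl⟩
      exact (algebraMap_frac_ne_zero (pow_ne_zero k hx)).isUnit)).comp
    (algebraMap (Away 𝒜 x) (Localization.Away x))

theorem awayFrac_mk (x : S) (hx : x ≠ 0) (y : NumDenSameDeg 𝒜 (Submonoid.powers x)) :
    awayFrac 𝒜 x hx (HomogeneousLocalization.mk y) =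
      algebraMap S (FractionRing S) y.num / algebraMap S (FractionRing S) y.den := by
  have hy : (y.den : S) ≠ 0 := by
    obtain ⟨k, hk⟩ := y.den_mem
    rw [← hk]
    exact pow_ne_zero k hx
  rw [awayFrac, RingHom.comp_apply, HomogeneousLocalization.algebraMap_apply, val_mk,
    Localization.mk_eq_mk', IsLocalization.lift_mk'_spec, mul_comm,
    div_mul_cancel₀ _ (algebraMap_frac_ne_zero hy)]

theorem awayFrac_mem (x : S) (hx : x ≠ 0) (z : Away 𝒜 x) :
    awayFrac 𝒜 x hx z ∈ functionField 𝒜 := by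
  obtain ⟨y, rfl⟩ := HomogeneousLocalization.mk_surjective z
  have hy : (y.den : S) ≠ 0 := by
    obtain ⟨k, hk⟩ := y.den_mem
    rw [← hk]
    exact pow_ne_zero k hx
  rw [awayFrac_mk]
  exact Or.inr ⟨y.deg, y.deg, by simp, y.num, y.num.2, y.den, y.den.2, hy, rfl⟩

theorem awayFrac_injective (x : S) (hx : x ≠ 0) : Function.Injective (awayFrac 𝒜 x hx) := by
  rw [injective_iff_map_eq_zero]
  intro z hz
  obtain ⟨y, rfl⟩ := HomogeneousLocalization.mk_surjective z
  have hy : (y.den : S) ≠ 0 := by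
    obtain ⟨k, hk⟩ := y.den_mem
    rw [← hk]
    exact pow_ne_zero k hx
  rw [awayFrac_mk, div_eq_zero_iff, or_iff_left (algebraMap_frac_ne_zero hy)] at hz
  have : (y.num : S) = 0 := IsFractionRing.injective S (FractionRing S) (by rw [hz, map_zero])
  exact mk_eq_zero_of_num y (Subtype.ext this)

/-- The degree zero part of `S[1/x]` inside the function field of `X`. -/
def awayField (x : S) (hx : x ≠ 0) : Away 𝒜 x →+* functionField 𝒜 :=
  (awayFrac 𝒜 x hx).codRestrict (functionField 𝒜) (awayFrac_mem 𝒜 x hx)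

theorem awayField_injective (x : S) (hx : x ≠ 0) : Function.Injective (awayField 𝒜 x hx) :=
  fun _ _ h => awayFrac_injective 𝒜 x hx (congrArg Subtype.val h)

variable {𝒜}

/-- Modulo the ideal generated by `𝒜 1` every element is a constant, and the only constant in the
irrelevant ideal is `0`. -/
theorem irrelevant_le_span (hgen : Algebra.adjoin ℂ (𝒜 1 : Set S) = ⊤) :
    (HomogeneousIdeal.irrelevant 𝒜).toIdeal ≤ Ideal.span (𝒜 1 : Set S) := by
  have h2 : ∀ s : S, ∃ c : ℂ, s - algebraMap ℂ S c ∈ Ideal.span (𝒜 1 : Set S) := by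
    intro s
    have hs : s ∈ Algebra.adjoin ℂ (𝒜 1 : Set S) := by rw [hgen]; trivial
    induction hs using Algebra.adjoin_induction with
    | mem x hx => exact ⟨0, by rw [map_zero, sub_zero]; exact Ideal.subset_span hx⟩
    | algebraMap r => exact ⟨r, by rw [sub_self]; exact Ideal.zero_mem _⟩
    | add x y _ _ hx hy =>
      obtain ⟨a, ha⟩ := hx
      obtain ⟨b, hb⟩ := hy
      exact ⟨a + b, by rw [map_add, add_sub_add_comm]; exact Ideal.add_mem _ ha hb⟩
    | mul x y _ _ hx hy =>
      obtain ⟨a, ha⟩ := hx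
      obtain ⟨b, hb⟩ := hy
      refine ⟨a * b, ?_⟩
      have : x * y - algebraMap ℂ S (a * b) =
          x * (y - algebraMap ℂ S b) + algebraMap ℂ S b * (x - algebraMap ℂ S a) := by
        rw [map_mul]; ring
      rw [this]
      exact Ideal.add_mem _ (Ideal.mul_mem_left _ _ hb) (Ideal.mul_mem_left _ _ ha)
  have h3 : Ideal.span (𝒜 1 : Set S) ≤ (HomogeneousIdeal.irrelevant 𝒜).toIdeal := by
    rw [Ideal.span_le]
    intro x hx
    change x ∈ HomogeneousIdeal.irrelevant 𝒜
    rw [HomogeneousIdeal.mem_irrelevant_iff, GradedRing.proj_apply]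
    exact DirectSum.decompose_of_mem_ne 𝒜 hx one_ne_zero
  intro s hs
  obtain ⟨c, hc⟩ := h2 s
  have h4 : algebraMap ℂ S c ∈ (HomogeneousIdeal.irrelevant 𝒜).toIdeal := by
    have := Ideal.sub_mem _ hs (h3 hc)
    rwa [sub_sub_cancel] at this
  have h5 : algebraMap ℂ S c = 0 := by
    have h6 : algebraMap ℂ S c ∈ HomogeneousIdeal.irrelevant 𝒜 := h4
    rw [HomogeneousIdeal.mem_irrelevant_iff, GradedRing.proj_apply,
      DirectSum.decompose_of_mem_same 𝒜 (SetLike.algebraMap_mem_graded 𝒜 c)] at h6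
    exact h6
  rwa [h5, sub_zero] at hc

/-- A point outside the vertex lies in `D₊(x)` for some `x` of degree one. -/
theorem exists_degree_one_notMem (hgen : Algebra.adjoin ℂ (𝒜 1 : Set S) = ⊤) {I : Ideal S}
    (hI : ¬ (HomogeneousIdeal.irrelevant 𝒜).toIdeal ≤ I) : ∃ x ∈ 𝒜 1, x ∉ I := by
  by_contra! h
  exact hI ((irrelevant_le_span hgen).trans (Ideal.span_le.2 h))

/-- Elements of the local ring of `X` at a point of `D₊(x)`, as fractions over `D₊(x)`. -/
theorem localX_eq_div {p : ProjectiveSpectrum 𝒜} {x : S} (hx1 : x ∈ 𝒜 1)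
    (hx : x ≠ 0) {h : functionField 𝒜} (hh : h ∈ localX 𝒜 p) :
    ∃ a b, h = awayField 𝒜 x hx a / awayField 𝒜 x hx b ∧ b ≠ 0 ∧
      (awayField 𝒜 x hx b)⁻¹ ∈ localX 𝒜 p := by
  obtain ⟨i, j, hij, a, ha, b, hb, hbp, e⟩ := hh
  have hij' : i = j := by omega
  subst hij'
  have hb0 : b ≠ 0 := fun h => hbp (h ▸ zero_mem _)
  have hxi : x ^ i ∈ 𝒜 i := by simpa using SetLike.pow_mem_graded i hx1
  have hQx : algebraMap S (FractionRing S) (x ^ i) ≠ 0 := algebraMap_frac_ne_zero (pow_ne_zero _ hx)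
  have hQb := algebraMap_frac_ne_zero hb0
  let A : Away 𝒜 x := HomogeneousLocalization.mk ⟨i, ⟨a, ha⟩, ⟨x ^ i, hxi⟩, ⟨i, rfl⟩⟩
  let B : Away 𝒜 x := HomogeneousLocalization.mk ⟨i, ⟨b, hb⟩, ⟨x ^ i, hxi⟩, ⟨i, rfl⟩⟩
  have hA : ((awayField 𝒜 x hx A : functionField 𝒜) : FractionRing S) =
    algebraMap S (FractionRing S) a / algebraMap S (FractionRing S) (x ^ i) := awayFrac_mk 𝒜 x hx _
  have hB : ((awayField 𝒜 x hx B : functionField 𝒜) : FractionRing S) =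
    algebraMap S (FractionRing S) b / algebraMap S (FractionRing S) (x ^ i) := awayFrac_mk 𝒜 x hx _
  refine ⟨A, B, ?_, ?_, ?_⟩
  · apply Subtype.ext
    rw [IntermediateField.coe_div, hA, hB, e]
    field_simp
  · intro hB0
    rw [hB0, map_zero] at hB
    exact div_ne_zero hQb hQx hB.symm
  · refine ⟨i, i, by simp, x ^ i, hxi, b, hb, hbp, ?_⟩
    rw [IntermediateField.coe_inv, hB, inv_div]

theorem awayField_mem_localX {p : ProjectiveSpectrum 𝒜} {x : S}
    (hxp : x ∉ p.asHomogeneousIdeal) (hx : x ≠ 0) (a : Away 𝒜 x) :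
    awayField 𝒜 x hx a ∈ localX 𝒜 p := by
  obtain ⟨y, rfl⟩ := HomogeneousLocalization.mk_surjective a
  refine ⟨y.deg, y.deg, by simp, y.num, y.num.2, y.den, y.den.2, ?_, awayFrac_mk 𝒜 x hx y⟩
  obtain ⟨k, hk⟩ := y.den_mem
  intro hm
  rw [← hk] at hm
  exact hxp (p.isPrime.mem_of_pow_mem _ hm)

theorem functionField_eq_div {x : S} (hx1 : x ∈ 𝒜 1) (hx : x ≠ 0) (h : functionField 𝒜) :
    ∃ a b, h = awayField 𝒜 x hx a / awayField 𝒜 x hx b ∧ b ≠ 0 := by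
  obtain ⟨h, hh⟩ := h
  rcases hh with rfl | ⟨i, j, hij, a, ha, b, hb, hb0, e⟩
  · exact ⟨0, 1, by rw [map_zero, zero_div]; rfl, fun h => one_ne_zero (α := functionField 𝒜)
      (by rw [← map_one (awayField 𝒜 x hx), h, map_zero])⟩
  have hij' : i = j := by omega
  subst hij'
  have hxi : x ^ i ∈ 𝒜 i := by simpa using SetLike.pow_mem_graded i hx1
  have hQx : algebraMap S (FractionRing S) (x ^ i) ≠ 0 := algebraMap_frac_ne_zero (pow_ne_zero _ hx)
  have hQb := algebraMap_frac_ne_zero hb0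
  let A : Away 𝒜 x := HomogeneousLocalization.mk ⟨i, ⟨a, ha⟩, ⟨x ^ i, hxi⟩, ⟨i, rfl⟩⟩
  let B : Away 𝒜 x := HomogeneousLocalization.mk ⟨i, ⟨b, hb⟩, ⟨x ^ i, hxi⟩, ⟨i, rfl⟩⟩
  have hA : ((awayField 𝒜 x hx A : functionField 𝒜) : FractionRing S) =
    algebraMap S (FractionRing S) a / algebraMap S (FractionRing S) (x ^ i) := awayFrac_mk 𝒜 x hx _
  have hB : ((awayField 𝒜 x hx B : functionField 𝒜) : FractionRing S) =
    algebraMap S (FractionRing S) b / algebraMap S (FractionRing S) (x ^ i) := awayFrac_mk 𝒜 x hx _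
  refine ⟨A, B, ?_, ?_⟩
  · apply Subtype.ext
    rw [IntermediateField.coe_div, hA, hB]
    change h = _
    rw [e]
    field_simp
  · intro hB0
    rw [hB0, map_zero] at hB
    exact div_ne_zero hQb hQx hB.symm

theorem awayFrac_mul_pow (x : S) (hx : x ≠ 0) (z : Away 𝒜 x) :
    ∃ (a : S) (k : ℕ) (d : ℕ), a ∈ 𝒜 d ∧ x ^ k ∈ 𝒜 d ∧
      awayFrac 𝒜 x hx z * algebraMap S (FractionRing S) (x ^ k) = algebraMap S (FractionRing S) a := by
  obtain ⟨y, rfl⟩ := HomogeneousLocalization.mk_surjective z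
  obtain ⟨k, hk⟩ := y.den_mem
  refine ⟨y.num, k, y.deg, y.num.2, by rw [show x ^ k = (y.den : S) from hk]; exact y.den.2, ?_⟩
  rw [awayFrac_mk, ← hk]
  exact div_mul_cancel₀ _ (algebraMap_frac_ne_zero (pow_ne_zero k hx))

/-- If every element of `T` vanished at `p`, so would every element of the ideal they generate, in
particular `1`. Concretely, every element of the span, times a power of `x`, would lie in `p`, which
forces a power of `x` into `p`. In the application `T` describes a cover of `D₊(x)`, and the lemma
finds a member of the cover that contains `p`. -/
theorem exists_inv_mem_localX {p : ProjectiveSpectrum 𝒜} {x : S}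
    (hxp : x ∉ p.asHomogeneousIdeal) (hx : x ≠ 0) {T : Set (Away 𝒜 x)} (hT : Ideal.span T = ⊤) :
    ∃ t ∈ T, t ≠ 0 ∧ (awayField 𝒜 x hx t)⁻¹ ∈ localX 𝒜 p := by
  by_contra! hcon
  have hQx : ∀ k, algebraMap S (FractionRing S) (x ^ k) ≠ 0 :=
    fun k => algebraMap_frac_ne_zero (pow_ne_zero _ hx)
  have key : ∀ z ∈ Ideal.span T, ∃ (k : ℕ) (a : S), a ∈ p.asHomogeneousIdeal ∧
      awayFrac 𝒜 x hx z * algebraMap S (FractionRing S) (x ^ k) =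
        algebraMap S (FractionRing S) a := by
    intro z hz
    induction hz using Submodule.span_induction with
    | mem t ht =>
      obtain ⟨a, k, d, had, hxd, e⟩ := awayFrac_mul_pow x hx t
      refine ⟨k, a, ?_, e⟩
      by_contra hap
      have ha0 : a ≠ 0 := fun h => hap (h ▸ zero_mem _)
      have ht0 : t ≠ 0 := by
        rintro rfl
        rw [map_zero, zero_mul] at e
        exact algebraMap_frac_ne_zero ha0 e.symm
      refine hcon t ht ht0 ⟨d, d, by simp, x ^ k, hxd, a, had, hap, ?_⟩
      rw [IntermediateField.coe_inv, ← e]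
      change (awayFrac 𝒜 x hx t)⁻¹ = _
      rw [div_mul_cancel_right₀ (hQx k)]
    | zero => exact ⟨0, 0, zero_mem _, by simp⟩
    | add y z _ _ hy hz =>
      obtain ⟨k, a, ha, e⟩ := hy
      obtain ⟨l, b, hb, e'⟩ := hz
      refine ⟨k + l, a * x ^ l + x ^ k * b, Ideal.add_mem _ (Ideal.mul_mem_right _ _ ha)
        (Ideal.mul_mem_left _ _ hb), ?_⟩
      rw [map_add, map_add, map_mul, map_mul, ← e, ← e', pow_add, map_mul]
      ring
    | smul c z _ hz =>
      obtain ⟨k, a, ha, e⟩ := hz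
      obtain ⟨b, l, -, -, -, e'⟩ := awayFrac_mul_pow x hx c
      refine ⟨l + k, b * a, Ideal.mul_mem_left _ _ ha, ?_⟩
      rw [smul_eq_mul, map_mul, map_mul, ← e, ← e', pow_add, map_mul]
      ring
  obtain ⟨k, a, ha, e⟩ := key 1 (hT ▸ trivial)
  rw [map_one, one_mul] at e
  have : x ^ k = a := IsFractionRing.injective S (FractionRing S) e
  exact hxp (p.isPrime.mem_of_pow_mem k (this ▸ ha))

end AnyUniverse


variable {S : Type} [CommRing S] [IsDomain S] [Algebra ℂ S] {𝒜 : ℕ → Submodule ℂ S}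
  [GradedAlgebra 𝒜]

/-- Smoothness provides a standard smooth basic open set around `p`. Its coordinates are coordinates
of the function field, and they stay adapted to the local ring at `p` by the quotient rule. -/
theorem exists_local_coords (hgen : Algebra.adjoin ℂ (𝒜 1 : Set S) = ⊤) {n : ℕ}
    (hX : SmoothOfRelativeDimension n (projToSpec 𝒜)) (p : ProjectiveSpectrum 𝒜) :
    ∃ (g : Fin n → functionField 𝒜)
      (e : Module.Basis (Fin n) (functionField 𝒜) Ω[functionField 𝒜⁄ℂ]),
      (∀ i, g i ∈ localX 𝒜 p) ∧
      (∀ i, e i = KaehlerDifferential.D ℂ (functionField 𝒜) (g i)) ∧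
      ∀ h ∈ localX 𝒜 p, ∀ i, e.repr (KaehlerDifferential.D ℂ (functionField 𝒜) h) i ∈ localX 𝒜 p := by
  obtain ⟨x, hx1, hxp⟩ := exists_degree_one_notMem hgen p.not_irrelevant_le
  have hx : x ≠ 0 := fun h => hxp (h ▸ zero_mem _)
  have hsm : SmoothOfRelativeDimension n
      (Spec.map (CommRingCat.ofHom ((fromZeroRingHom 𝒜 (Submonoid.powers x)).comp (algebraMap ℂ (𝒜 0))))) := by
    -- The chart `D₊(x) → X` is an open immersion, hence smooth of relative dimension `0`.
    have h1 : SmoothOfRelativeDimension (0 + n) (Proj.awayι 𝒜 x hx1 one_pos ≫ projToSpec 𝒜) :=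
      inferInstance
    rw [zero_add, projToSpec, ← Category.assoc, Proj.awayι_toSpecZero, ← Spec.map_comp] at h1
    exact h1
  rw [HasRingHomProperty.Spec_iff (P := @SmoothOfRelativeDimension n)] at hsm
  -- The chart is standard smooth only after inverting each member of a family `T` that generates
  -- the unit ideal.
  obtain ⟨T, hT, hsm⟩ := hsm
  obtain ⟨t, htT, ht0, htp⟩ := exists_inv_mem_localX hxp hx hT
  have ht := hsm t htT
  rw [CommRingCat.hom_ofHom] at ht
  have hft : awayField 𝒜 x hx t ≠ 0 := fun h =>
    ht0 (awayField_injective 𝒜 x hx (by rw [h, map_zero]))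
  let C := Localization.Away t
  let j : C →+* functionField 𝒜 := IsLocalization.Away.lift t (g := awayField 𝒜 x hx) hft.isUnit
  have hj : ∀ a, j (algebraMap (Away 𝒜 x) C a) = awayField 𝒜 x hx a :=
    fun a => IsLocalization.Away.lift_eq t _ a
  have hjinj : Function.Injective j := by
    rw [injective_iff_map_eq_zero]
    intro c hc
    obtain ⟨k, a, e⟩ := IsLocalization.Away.surj t c
    have h1 := congrArg j e
    rw [map_mul, hc, zero_mul, hj] at h1
    have h2 : a = 0 := awayField_injective 𝒜 x hx (by rw [← h1, map_zero])
    rw [h2, map_zero] at e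
    exact (IsUnit.mul_left_eq_zero
      ((IsLocalization.Away.algebraMap_isUnit t).pow k)).1 e
  have hjC : ∀ c, j c ∈ localX 𝒜 p := by
    intro c
    obtain ⟨k, a, e⟩ := IsLocalization.Away.surj t c
    have h1 := congrArg j e
    rw [map_mul, map_pow, hj, hj] at h1
    have h2 : j c = awayField 𝒜 x hx a * ((awayField 𝒜 x hx t)⁻¹) ^ k := by
      rw [inv_pow, eq_mul_inv_iff_mul_eq₀ (pow_ne_zero _ hft), h1]
    rw [h2]
    exact Subalgebra.mul_mem _ (awayField_mem_localX hxp hx a) (Subalgebra.pow_mem _ htp k)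
  let : Algebra C (functionField 𝒜) := j.toAlgebra
  let : Algebra ℂ C := ((algebraMap (Away 𝒜 x) C).comp
    ((fromZeroRingHom 𝒜 (Submonoid.powers x)).comp (algebraMap ℂ (𝒜 0)))).toAlgebra
  have : Algebra.IsStandardSmoothOfRelativeDimension n ℂ C := ht
  have : IsScalarTower ℂ C (functionField 𝒜) := by
    refine IsScalarTower.of_algebraMap_eq fun c => Subtype.ext ?_
    have h1 : algebraMap C (functionField 𝒜) (algebraMap ℂ C c) = awayField 𝒜 x hx
      (fromZeroRingHom 𝒜 (Submonoid.powers x) (algebraMap ℂ (𝒜 0) c)) := hj _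
    rw [h1]
    refine Eq.trans ?_ (awayFrac_mk 𝒜 x hx _).symm
    change algebraMap ℂ (FractionRing S) c = algebraMap S (FractionRing S) (algebraMap ℂ S c) /
      algebraMap S (FractionRing S) 1
    rw [map_one, div_one, ← IsScalarTower.algebraMap_apply]
  have : FaithfulSMul C (functionField 𝒜) := (faithfulSMul_iff_algebraMap_injective _ _).2 hjinj
  have : IsFractionRing C (functionField 𝒜) := by
    refine IsFractionRing.of_field _ _ fun z => ?_
    obtain ⟨a, b, e, -⟩ := functionField_eq_div hx1 hx z
    exact ⟨algebraMap _ C a, algebraMap _ C b, e.trans (by rw [← hj, ← hj]; rfl)⟩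
  obtain ⟨g, e, he, hr⟩ := exists_coords_of_standardSmooth (n := n) (C := C) (K := functionField 𝒜)
  refine ⟨fun i => j (g i), e, fun i => hjC _, he, fun h hh i => ?_⟩
  refine repr_D_mem_of_fractions e (R := Set.range j) (O := localX 𝒜 p) ?_ ?_ ?_ hh i
  · rintro _ ⟨c, rfl⟩
    exact hjC c
  · intro h hh
    obtain ⟨a, b, e, hb0, hb⟩ := localX_eq_div hx1 hx hh
    refine ⟨_, ⟨algebraMap _ C a, hj a⟩, _, ⟨algebraMap _ C b, hj b⟩, ?_, hb, e⟩
    exact fun h => hb0 (awayField_injective 𝒜 x hx (by rw [h, map_zero]))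
  · rintro _ ⟨c, rfl⟩ i
    obtain ⟨d, hd⟩ := hr c i
    have := hjC d
    rwa [show j d = _ from hd] at this

end Proj

end
end CYCone

/-! ### Calculus of top forms: determinants, contraction, pullback -/

set_option linter.unusedSectionVars false
namespace CYCone
noncomputable section

section FormsTools

variable {A : Type*} [CommRing A] [Algebra ℂ A]

/-- Two alternating maps in `m` arguments agree once they agree on permutations of a basis of `m`
elements, where both sides only change by the sign. -/
theorem ιMulti_eq_det_smul {M : Type*} [AddCommGroup M] [Module A M] {m : ℕ}
    (e : Module.Basis (Fin m) A M) (v : Fin m → M) :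
    ExteriorAlgebra.ιMulti A m v = e.det v • ExteriorAlgebra.ιMulti A m e := by
  have key : ExteriorAlgebra.ιMulti A m = (LinearMap.toSpanSingleton A (ExteriorAlgebra A M)
      (ExteriorAlgebra.ιMulti A m e)).compAlternatingMap e.det := by
    refine e.ext_alternating fun v hv => ?_
    obtain ⟨σ, hσ⟩ : ∃ σ : Equiv.Perm (Fin m), ⇑σ = v :=
      ⟨Equiv.ofBijective v (Finite.injective_iff_bijective.1 hv), rfl⟩
    subst hσ
    rw [LinearMap.compAlternatingMap_apply, LinearMap.toSpanSingleton_apply]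
    have h1 := (ExteriorAlgebra.ιMulti A m).map_perm (⇑e) σ
    have h2 := e.det.map_perm (⇑e) σ
    rw [e.det_self] at h2
    simp only [Function.comp_def] at h1 h2
    rw [h1, h2]
    simp
  exact congrArg (fun f => f v) key

/-- The determinant extends to a linear form on the exterior algebra, and it takes the value `1`
here. -/
theorem ιMulti_basis_ne_zero [Nontrivial A] {M : Type*} [AddCommGroup M] [Module A M] {m : ℕ}
    (e : Module.Basis (Fin m) A M) : ExteriorAlgebra.ιMulti A m e ≠ 0 := by
  intro h
  have h1 := ExteriorAlgebra.liftAlternating_apply_ιMulti (R := A) (M := M) (N := A)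
    (Function.update 0 m e.det) (⇑e)
  rw [h, map_zero, Function.update_self, e.det_self] at h1
  exact zero_ne_one h1

theorem wedgeD_eq_det_smul {m : ℕ} (e : Module.Basis (Fin m) A Ω[A⁄ℂ]) (b : Fin m → A) :
    wedgeD b = (Matrix.of fun i j => e.repr (KaehlerDifferential.D ℂ A (b j)) i).det •
      ExteriorAlgebra.ιMulti A m e := by
  rw [wedgeD, ιMulti_eq_det_smul e, Module.Basis.det_apply]
  rfl

theorem contr_one (δ : Derivation ℂ A A) : contr δ (1 : Forms A) = 0 :=
  CliffordAlgebra.contractLeft_one _ _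

theorem contr_add_left (δ δ' : Derivation ℂ A A) (ω : Forms A) :
    contr (δ + δ') ω = contr δ ω + contr δ' ω := by
  have : (δ + δ').liftKaehlerDifferential =
      δ.liftKaehlerDifferential + δ'.liftKaehlerDifferential :=
    map_add (KaehlerDifferential.linearMapEquivDerivation ℂ A (M := A)).symm δ δ'
  rw [contr, this, map_add]; rfl

theorem contr_smul_left (a : A) (δ : Derivation ℂ A A) (ω : Forms A) :
    contr (a • δ) ω = a • contr δ ω := by
  have : (a • δ).liftKaehlerDifferential = a • δ.liftKaehlerDifferential :=
    map_smul (KaehlerDifferential.linearMapEquivDerivation ℂ A (M := A)).symm a δ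
  rw [contr, this, map_smul]; rfl

theorem contr_wedgeD_mem {O : Subalgebra ℂ A} {δ : Derivation ℂ A A} (hδ : ∀ g ∈ O, δ g ∈ O)
    {p : ℕ} (b : Fin (p + 1) → A) (hb : ∀ i, b i ∈ O) : contr δ (wedgeD b) ∈ formsOver O p := by
  induction p with
  | zero =>
    rw [wedgeD_succ, contr_D_mul]
    have : (wedgeD fun i => b (Fin.succ i) : Forms A) = 1 := by
      rw [wedgeD, ExteriorAlgebra.ιMulti_zero_apply]
    rw [this, contr_one, mul_zero, sub_zero]
    exact Submodule.subset_span ⟨_, hδ _ (hb 0), ![], fun i => i.elim0, by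
      rw [wedgeD, ExteriorAlgebra.ιMulti_zero_apply]⟩
  | succ p ih =>
    rw [wedgeD_succ, contr_D_mul]
    exact sub_mem (Submodule.subset_span ⟨_, hδ _ (hb 0), _, fun i => hb i.succ, rfl⟩)
      (D_mul_mem_formsOver (hb 0) (ih _ fun i => hb i.succ))

theorem contr_mem_formsOver {O : Subalgebra ℂ A} {δ : Derivation ℂ A A} (hδ : ∀ g ∈ O, δ g ∈ O)
    {p : ℕ} {ω : Forms A} (hω : ω ∈ formsOver O (p + 1)) : contr δ ω ∈ formsOver O p := by
  induction hω using Submodule.span_induction with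
  | mem x hx =>
    obtain ⟨a, ha, c, hc, rfl⟩ := hx
    rw [map_smul]
    exact smul_mem_formsOver ha (contr_wedgeD_mem hδ c hc)
  | zero => rw [map_zero]; exact zero_mem _
  | add x y _ _ hx hy => rw [map_add]; exact add_mem hx hy
  | smul c x _ hx =>
    rw [← algebraMap_smul A c x, map_smul, algebraMap_smul]; exact Submodule.smul_mem _ c hx

theorem formsOver_mono {O O' : Subalgebra ℂ A} (h : O ≤ O') (p : ℕ) :
    formsOver O p ≤ formsOver O' p :=
  Submodule.span_mono fun _ ⟨a, ha, b, hb, e⟩ => ⟨a, h ha, b, fun i => h (hb i), e⟩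

/-- Contraction is an antiderivation; apply it to `db ∧ w = 0`. -/
theorem D_mul_contr {δ : Derivation ℂ A A} {w : Forms A}
    (hw : ∀ b, ExteriorAlgebra.ι A (KaehlerDifferential.D ℂ A b) * w = 0) (b : A) :
    ExteriorAlgebra.ι A (KaehlerDifferential.D ℂ A b) * contr δ w = δ b • w := by
  have := contr_D_mul δ b w
  rw [hw, map_zero] at this
  exact (sub_eq_zero.1 this.symm).symm

/-- Cartan's formula for a closed top form `w`. With `L_δ w` a multiple of `w`, this is the
divergence formula that turns `d` on `n`-forms into a first order operator on functions. -/
theorem extDeriv_contr_smul {δ : Derivation ℂ A A} {w : Forms A}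
    (hw : ∀ b, ExteriorAlgebra.ι A (KaehlerDifferential.D ℂ A b) * w = 0)
    (hdw : extDeriv w = 0) (g : A) :
    extDeriv (contr (g • δ) w) = δ g • w + g • lieD δ w := by
  rw [contr_smul_left, extDeriv_smul, D_mul_contr hw, lieD_apply, hdw, map_zero, add_zero]

end FormsTools

section FormsField

variable {F : Type*} [Field F] [Algebra ℂ F] {m : ℕ}

theorem D_mul_eq_zero_of_top (e : Module.Basis (Fin m) F Ω[F⁄ℂ]) {w : Forms F}
    (hw : w ∈ ⋀[F]^m Ω[F⁄ℂ]) (b : F) :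
    ExteriorAlgebra.ι F (KaehlerDifferential.D ℂ F b) * w = 0 := by
  rw [← formsOver_top] at hw
  have := D_mul_mem_formsOver (O := ⊤) (b := b) Algebra.mem_top hw
  generalize ExteriorAlgebra.ι F (KaehlerDifferential.D ℂ F b) * w = w' at this
  induction this using Submodule.span_induction with
  | mem x hx =>
    obtain ⟨a, -, c, -, rfl⟩ := hx
    rw [wedgeD, AlternatingMap.map_linearDependent, smul_zero]
    intro hli
    have := Module.Finite.of_basis e
    have h1 := hli.fintype_card_le_finrank
    rw [Module.finrank_eq_card_basis e, Fintype.card_fin, Fintype.card_fin] at h1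
    omega
  | zero => rfl
  | add x y _ _ hx hy => rw [hx, hy, add_zero]
  | smul c x _ hx => rw [hx, smul_zero]

theorem extDeriv_eq_zero_of_top (e : Module.Basis (Fin m) F Ω[F⁄ℂ]) {w : Forms F}
    (hw : w ∈ ⋀[F]^m Ω[F⁄ℂ]) : extDeriv w = 0 := by
  have hw' := (formsOver_top m w).2 hw
  induction hw' using Submodule.span_induction with
  | mem x hx =>
    obtain ⟨a, -, c, -, rfl⟩ := hx
    rw [extDeriv_smul, extDeriv_wedgeD, smul_zero, add_zero]
    exact D_mul_eq_zero_of_top e (ExteriorAlgebra.ιMulti_range F m ⟨_, rfl⟩) a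
  | zero => rw [map_zero]
  | add x y hx' hy' hx hy =>
    rw [map_add, hx ((formsOver_top m _).1 hx'), hy ((formsOver_top m _).1 hy'), add_zero]
  | smul c x hx' hx => rw [map_smul, hx ((formsOver_top m _).1 hx'), smul_zero]

theorem exists_smul_of_top (e : Module.Basis (Fin m) F Ω[F⁄ℂ]) {w w' : Forms F} (hw0 : w ≠ 0)
    (hw : w ∈ ⋀[F]^m Ω[F⁄ℂ]) (hw' : w' ∈ ⋀[F]^m Ω[F⁄ℂ]) : ∃ c : F, w' = c • w := by
  have h : ∀ v ∈ ⋀[F]^m Ω[F⁄ℂ], ∃ c : F, v = c • ExteriorAlgebra.ιMulti F m e := by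
    intro v hv
    rw [← formsOver_top] at hv
    induction hv using Submodule.span_induction with
    | mem x hx =>
      obtain ⟨a, -, c, -, rfl⟩ := hx
      exact ⟨_, by rw [wedgeD_eq_det_smul e, smul_smul]⟩
    | zero => exact ⟨0, by rw [zero_smul]⟩
    | add x y _ _ hx hy =>
      obtain ⟨a, rfl⟩ := hx
      obtain ⟨b, rfl⟩ := hy
      exact ⟨a + b, by rw [add_smul]⟩
    | smul c x _ hx =>
      obtain ⟨a, rfl⟩ := hx
      exact ⟨c • a, by rw [smul_assoc]⟩
  obtain ⟨a, ha⟩ := h w hw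
  obtain ⟨b, hb⟩ := h w' hw'
  have ha0 : a ≠ 0 := by
    rintro rfl
    rw [zero_smul] at ha
    exact hw0 ha
  exact ⟨b / a, by rw [ha, hb, smul_smul, div_mul_cancel₀ _ ha0]⟩

theorem contr_mem_exteriorPower (δ : Derivation ℂ F F) {n : ℕ} {w : Forms F}
    (hw : w ∈ ⋀[F]^(n + 1) Ω[F⁄ℂ]) : contr δ w ∈ ⋀[F]^n Ω[F⁄ℂ] := by
  rw [← formsOver_top] at hw ⊢
  exact contr_mem_formsOver (fun _ _ => Algebra.mem_top) hw

/-- On a field of transcendence degree `n + 1`, every `n`-form is the contraction of a given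
non-zero `(n + 1)`-form with a vector field. -/
theorem exists_contr_eq {n : ℕ} (e : Module.Basis (Fin (n + 1)) F Ω[F⁄ℂ]) {w : Forms F}
    (hw0 : w ≠ 0) (hw : w ∈ ⋀[F]^(n + 1) Ω[F⁄ℂ]) {ω : Forms F} (hω : ω ∈ ⋀[F]^n Ω[F⁄ℂ]) :
    ∃ δ : Derivation ℂ F F, ω = contr δ w := by
  have : Module.Finite F Ω[F⁄ℂ] := Module.Finite.of_basis e
  let Φ : (Ω[F⁄ℂ] →ₗ[F] F) →ₗ[F] ⋀[F]^n Ω[F⁄ℂ] :=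
    { toFun := fun l => ⟨contr ((KaehlerDifferential.linearMapEquivDerivation ℂ F) l) w,
        contr_mem_exteriorPower _ hw⟩
      map_add' := fun l l' => Subtype.ext (by
        change contr _ w = contr _ w + contr _ w
        rw [map_add, contr_add_left])
      map_smul' := fun c l => Subtype.ext (by
        change contr _ w = c • contr _ w
        rw [map_smul, contr_smul_left]) }
  have hinj : Function.Injective Φ := by
    rw [injective_iff_map_eq_zero]
    intro l hl
    have h1 : contr ((KaehlerDifferential.linearMapEquivDerivation ℂ F) l) w = 0 :=
      congrArg Subtype.val hl
    rw [← (KaehlerDifferential.linearMapEquivDerivation ℂ F (M := F)).map_eq_zero_iff]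
    ext b
    have h2 := D_mul_contr (δ := (KaehlerDifferential.linearMapEquivDerivation ℂ F) l)
      (D_mul_eq_zero_of_top e hw) b
    rw [h1, mul_zero] at h2
    exact (smul_eq_zero.1 h2.symm).resolve_right hw0
  -- Injectivity suffices because both sides have dimension `n + 1 = C(n + 1, n)`.
  have hdim : Module.finrank F (Ω[F⁄ℂ] →ₗ[F] F) = Module.finrank F (⋀[F]^n Ω[F⁄ℂ]) := by
    rw [exteriorPower.finrank_eq, Module.finrank_linearMap_self, Module.finrank_eq_card_basis e,
      Fintype.card_fin, Nat.choose_succ_self_right]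
  have hsurj := (LinearMap.injective_iff_surjective_of_finrank_eq_finrank hdim).1 hinj
  obtain ⟨l, hl⟩ := hsurj ⟨ω, hω⟩
  exact ⟨_, (congrArg Subtype.val hl).symm⟩

end FormsField

section Pullback

variable {K Q : Type*} [Field K] [Algebra ℂ K] [Field Q] [Algebra ℂ Q] [Algebra K Q]
  [IsScalarTower ℂ K Q]

variable (K Q) in
/-- The pullback of differential forms along a field extension. -/
def pullForms : Forms K →ₐ[K] Forms Q :=
  ExteriorAlgebra.lift K ⟨(ExteriorAlgebra.ι Q).restrictScalars K ∘ₗ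
    KaehlerDifferential.map ℂ ℂ K Q, fun _ => ExteriorAlgebra.ι_sq_zero _⟩

theorem pullForms_D_mul (b : K) (ω : Forms K) :
    pullForms K Q (ExteriorAlgebra.ι K (KaehlerDifferential.D ℂ K b) * ω) =
      ExteriorAlgebra.ι Q (KaehlerDifferential.D ℂ Q (algebraMap K Q b)) * pullForms K Q ω := by
  have h : pullForms K Q (ExteriorAlgebra.ι K (KaehlerDifferential.D ℂ K b)) =
      ExteriorAlgebra.ι Q (KaehlerDifferential.map ℂ ℂ K Q (KaehlerDifferential.D ℂ K b)) :=
    ExteriorAlgebra.lift_ι_apply K _ _ _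
  rw [map_mul, h, KaehlerDifferential.map_D]

theorem pullForms_smul (a : K) (ω : Forms K) :
    pullForms K Q (a • ω) = algebraMap K Q a • pullForms K Q ω := by
  rw [map_smul, algebraMap_smul]

theorem pullForms_wedgeD {p : ℕ} (b : Fin p → K) :
    pullForms K Q (wedgeD b) = wedgeD fun i => algebraMap K Q (b i) := by
  induction p with
  | zero => simp only [wedgeD, ExteriorAlgebra.ιMulti_zero_apply, map_one]
  | succ p ih => rw [wedgeD_succ, pullForms_D_mul, ih, wedgeD_succ]

/-- Both sides obey the same product rules, and they agree on functions and on exact differentials.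
-/
theorem lieD_pullForms {δ : Derivation ℂ K K} {θ : Derivation ℂ Q Q}
    (h : ∀ a, θ (algebraMap K Q a) = algebraMap K Q (δ a)) (ω : Forms K) :
    lieD θ (pullForms K Q ω) = pullForms K Q (lieD δ ω) := by
  induction ω using forms_induction with
  | one => rw [lieD_one, map_one, lieD_one, map_zero]
  | add x y hx hy => simp only [map_add, hx, hy]
  | smul a x hx => rw [lieD_smul, map_add, pullForms_smul, pullForms_smul, pullForms_smul,
      lieD_smul, h, hx]
  | D_mul b x hx => rw [lieD_D_mul, map_add, pullForms_D_mul, pullForms_D_mul, pullForms_D_mul,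
      lieD_D_mul, h, hx]

end Pullback

end
end CYCone

/-! ### The grading on homogeneous fractions -/

set_option linter.unusedSectionVars false
namespace CYCone
noncomputable section

section Graded

variable {S : Type*} [CommRing S] [IsDomain S] [Algebra ℂ S] (𝒜 : ℕ → Submodule ℂ S)
  [GradedAlgebra 𝒜]

/-- The homogeneous fractions of degree `k`. -/
def homPart (k : ℤ) : Submodule ℂ (FractionRing S) where
  carrier := {z | IsHomFrac 𝒜 k z}
  add_mem' h h' := IsHomFrac.add h h'
  zero_mem' := IsHomFrac.zero k
  smul_mem' c z h := by
    rw [Algebra.smul_def]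
    simpa using IsHomFrac.mul (IsHomFrac.const (𝒜 := 𝒜) c) h

variable {𝒜}

theorem IsHomFrac.algebraMap {k : ℕ} {s : S} (hs : s ∈ 𝒜 k) :
    IsHomFrac 𝒜 k (algebraMap S (FractionRing S) s) :=
  Or.inr ⟨k, 0, by simp, s, hs, 1, SetLike.one_mem_graded 𝒜, one_ne_zero, by simp⟩

theorem IsHomFrac.inv' {k : ℤ} {z : FractionRing S} (hz : IsHomFrac 𝒜 k z) :
    IsHomFrac 𝒜 (-k) z⁻¹ := by
  rcases hz with rfl | ⟨i, j, h, a, ha, b, hb, hb0, rfl⟩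
  · rw [inv_zero]; exact IsHomFrac.zero _
  by_cases ha0 : a = 0
  · rw [ha0, map_zero, zero_div, inv_zero]; exact IsHomFrac.zero _
  · exact Or.inr ⟨j, i, by omega, b, hb, a, ha, ha0, inv_div _ _⟩

theorem IsHomFrac.pow {k : ℤ} {z : FractionRing S} (hz : IsHomFrac 𝒜 k z) (m : ℕ) :
    IsHomFrac 𝒜 (m * k) (z ^ m) := by
  induction m with
  | zero => simpa using IsHomFrac.const (𝒜 := 𝒜) 1
  | succ m ih =>
    rw [pow_succ]
    convert ih.mul hz using 1
    push_cast; ring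

theorem IsHomFrac.zpow {k : ℤ} {z : FractionRing S} (hz : IsHomFrac 𝒜 k z) (m : ℤ) :
    IsHomFrac 𝒜 (m * k) (z ^ m) := by
  cases m with
  | ofNat m => simpa using hz.pow m
  | negSucc m =>
    rw [zpow_negSucc]
    convert (hz.pow (m + 1)).inv' using 1
    rw [Int.negSucc_eq]; push_cast; ring

theorem IsHomFrac.cast {k l : ℤ} {z : FractionRing S} (hz : IsHomFrac 𝒜 k z) (h : k = l) :
    IsHomFrac 𝒜 l z := h ▸ hz

theorem IsHomFrac.finset_sum {ι : Type*} {k : ℤ} {t : Finset ι} {z : ι → FractionRing S}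
    (h : ∀ i ∈ t, IsHomFrac 𝒜 k (z i)) : IsHomFrac 𝒜 k (∑ i ∈ t, z i) :=
  Submodule.sum_mem (homPart 𝒜 k) h

theorem isHomFrac_coe (z : functionField 𝒜) : IsHomFrac 𝒜 0 (z : FractionRing S) := z.2

/-- Finitely many homogeneous fractions have a common homogeneous denominator. -/
theorem exists_common_denominator (t : Finset ℤ) (z : ℤ → FractionRing S)
    (hz : ∀ k, IsHomFrac 𝒜 k (z k)) : ∃ (j : ℕ) (b : S), b ∈ 𝒜 j ∧ b ≠ 0 ∧ ∀ k ∈ t,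
      ∃ a : S, (∃ i : ℕ, (i : ℤ) = k + j ∧ a ∈ 𝒜 i) ∧
        algebraMap S (FractionRing S) b * z k = algebraMap S (FractionRing S) a ∨ z k = 0 := by
  induction t using Finset.induction_on with
  | empty => exact ⟨0, 1, SetLike.one_mem_graded 𝒜, one_ne_zero, by simp⟩
  | insert k t _ ih =>
    obtain ⟨j, b, hb, hb0, h⟩ := ih
    rcases hz k with h0 | ⟨i', j', hij, a', ha', b', hb', hb0', e⟩
    · refine ⟨j, b, hb, hb0, fun l hl => ?_⟩
      rcases Finset.mem_insert.1 hl with rfl | hl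
      · exact ⟨0, Or.inr h0⟩
      · exact h l hl
    · have hQ := algebraMap_frac_ne_zero hb0'
      refine ⟨j + j', b * b', SetLike.mul_mem_graded hb hb', mul_ne_zero hb0 hb0', fun l hl => ?_⟩
      rcases Finset.mem_insert.1 hl with rfl | hl
      · refine ⟨b * a', Or.inl ⟨⟨j + i', by push_cast; omega, SetLike.mul_mem_graded hb ha'⟩, ?_⟩⟩
        rw [e, map_mul, map_mul]
        field_simp
      · obtain ⟨a, ⟨⟨i, hi, ha⟩, e'⟩ | e'⟩ := h l hl
        · refine ⟨a * b', Or.inl ⟨⟨i + j', by push_cast; omega, SetLike.mul_mem_graded ha hb'⟩, ?_⟩⟩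
          rw [map_mul, map_mul, ← e']
          ring
        · exact ⟨0, Or.inr e'⟩

/-- A common homogeneous denominator reduces the independence of different degrees to the direct sum
decomposition of `S`. -/
theorem eq_zero_of_sum_hom_eq_zero {f : ℤ →₀ FractionRing S} (hf : ∀ k, IsHomFrac 𝒜 k (f k))
    (h0 : ∑ k ∈ f.support, f k = 0) : f = 0 := by
  obtain ⟨j, b, hb, hb0, h⟩ := exists_common_denominator f.support f hf
  choose a ha using h
  have hQ := algebraMap_frac_ne_zero hb0
  have ha' : ∀ k (hk : k ∈ f.support), (∃ i : ℕ, (i : ℤ) = k + j ∧ a k hk ∈ 𝒜 i) ∧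
      algebraMap S (FractionRing S) b * f k = algebraMap S (FractionRing S) (a k hk) :=
    fun k hk => (ha k hk).resolve_right (Finsupp.mem_support_iff.1 hk)
  have hsum : ∑ k ∈ f.support.attach, a k.1 k.2 = 0 := by
    apply IsFractionRing.injective S (FractionRing S)
    rw [map_sum, map_zero, ← mul_zero (algebraMap S (FractionRing S) b), ← h0, Finset.mul_sum,
      ← Finset.sum_attach f.support]
    exact Finset.sum_congr rfl fun k _ => ((ha' k.1 k.2).2).symm
  ext k
  by_contra hk
  have hk' : k ∈ f.support := Finsupp.mem_support_iff.2 hk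
  obtain ⟨⟨i, hi, hai⟩, e⟩ := ha' k hk'
  have h1 : GradedRing.proj 𝒜 i (∑ k ∈ f.support.attach, a k.1 k.2) = a k hk' := by
    rw [map_sum, Finset.sum_eq_single ⟨k, hk'⟩]
    · exact DirectSum.decompose_of_mem_same 𝒜 hai
    · rintro ⟨l, hl⟩ - hne
      obtain ⟨⟨i', hi', hai'⟩, -⟩ := ha' l hl
      refine DirectSum.decompose_of_mem_ne 𝒜 hai' ?_
      rintro rfl
      exact hne (Subtype.ext (by change l = k; omega))
    · exact fun h => absurd (Finset.mem_attach _ _) h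
  rw [hsum, map_zero] at h1
  rw [← h1, map_zero, mul_eq_zero, or_iff_right hQ] at e
  exact hk e

theorem eq_of_sum_hom_eq {f g : ℤ →₀ FractionRing S} (hf : ∀ k, IsHomFrac 𝒜 k (f k))
    (hg : ∀ k, IsHomFrac 𝒜 k (g k)) (h : ∑ k ∈ f.support, f k = ∑ k ∈ g.support, g k) :
    f = g := by
  rw [← sub_eq_zero]
  refine eq_zero_of_sum_hom_eq_zero (𝒜 := 𝒜) (fun k => ?_) ?_
  · rw [Finsupp.sub_apply]
    exact (homPart 𝒜 k).sub_mem (hf k) (hg k)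
  · change (f - g).sum (fun _ z => z) = 0
    rw [Finsupp.sum_sub_index (fun _ _ _ => rfl)]
    exact sub_eq_zero.2 h

/-- Homogeneous components of an element of a graded subspace lie in it. -/
theorem component_mem {W : Submodule ℂ (FractionRing S)}
    (hW : W ≤ ⨆ k, W ⊓ homPart 𝒜 k) {f : ℤ →₀ FractionRing S}
    (hf : ∀ k, IsHomFrac 𝒜 k (f k)) (h : ∑ k ∈ f.support, f k ∈ W) (k : ℤ) : f k ∈ W := by
  obtain ⟨g, hg, e⟩ := (Submodule.mem_iSup_iff_exists_finsupp _ _).1 (hW h)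
  rw [eq_of_sum_hom_eq hf (fun k => (hg k).2) e.symm]
  exact (hg k).1

end Graded

end
end CYCone

/-! ### Regular functions on U -/

set_option linter.unusedSectionVars false
namespace CYCone
noncomputable section

section Regular

variable {S : Type*} [CommRing S] [IsDomain S] [Algebra ℂ S] (𝒜 : ℕ → Submodule ℂ S)
  [GradedAlgebra 𝒜]

/-- The ring `Γ(U, O_U)` of regular functions on `U`. -/
def regU : Subalgebra ℂ (FractionRing S) := ⨅ q : ConePoint 𝒜, localU q

/-- The image of `S` in its fraction field. -/
def baseRing (S : Type*) [CommRing S] [IsDomain S] [Algebra ℂ S] :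
    Subalgebra ℂ (FractionRing S) := (Algebra.ofId S (FractionRing S)).range.restrictScalars ℂ

variable {𝒜}

theorem mem_regU {z : FractionRing S} : z ∈ regU 𝒜 ↔ ∀ q : ConePoint 𝒜, z ∈ localU q := by
  rw [regU, Algebra.mem_iInf]

theorem algebraMap_mem_localU (s : S) (q : ConePoint 𝒜) :
    algebraMap S (FractionRing S) s ∈ localU q :=
  ⟨s, 1, fun h => q.1.isPrime.ne_top ((Ideal.eq_top_iff_one _).2 h), by rw [map_one, div_one]⟩

theorem inv_mem_localU {s : S} {q : ConePoint 𝒜} (hs : s ∉ q.1.asIdeal) :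
    (algebraMap S (FractionRing S) s)⁻¹ ∈ localU q :=
  ⟨1, s, hs, by rw [map_one, one_div]⟩

theorem algebraMap_mem_regU (s : S) : algebraMap S (FractionRing S) s ∈ regU 𝒜 :=
  mem_regU.2 (algebraMap_mem_localU s)

/-- The ideal of denominators of a fraction. -/
def denIdeal (z : FractionRing S) : Ideal S where
  carrier := {b | z * algebraMap S (FractionRing S) b ∈ baseRing S}
  add_mem' {a b} ha hb := by
    change z * algebraMap S (FractionRing S) (a + b) ∈ baseRing S
    rw [map_add, mul_add]
    exact (baseRing S).add_mem ha hb
  zero_mem' := by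
    change z * algebraMap S (FractionRing S) 0 ∈ baseRing S
    rw [map_zero, mul_zero]
    exact (baseRing S).zero_mem
  smul_mem' c b hb := by
    change z * algebraMap S (FractionRing S) (c * b) ∈ baseRing S
    rw [map_mul, mul_left_comm]
    exact (baseRing S).mul_mem ⟨c, rfl⟩ hb

theorem mem_denIdeal {z : FractionRing S} {b : S} :
    b ∈ denIdeal z ↔ z * algebraMap S (FractionRing S) b ∈ baseRing S := Iff.rfl

theorem mem_irrelevant_of_mem_one {x : S} (hx : x ∈ 𝒜 1) :
    x ∈ (HomogeneousIdeal.irrelevant 𝒜).toIdeal := by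
  change x ∈ HomogeneousIdeal.irrelevant 𝒜
  rw [HomogeneousIdeal.mem_irrelevant_iff, GradedRing.proj_apply]
  exact DirectSum.decompose_of_mem_ne 𝒜 hx one_ne_zero

/-- Otherwise some prime contains all denominators of `z` but not `x`. It is a point of `U`, and
regularity of `z` there supplies a denominator outside the prime. -/
theorem exists_pow_mem_denIdeal {z : FractionRing S} (hz : z ∈ regU 𝒜) {x : S} (hx : x ∈ 𝒜 1) :
    ∃ M : ℕ, x ^ M ∈ denIdeal z := by
  by_contra! h
  obtain ⟨q, hq, hle, hdisj⟩ := Ideal.exists_le_prime_disjoint (denIdeal z) (Submonoid.powers x)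
    (Set.disjoint_left.2 (by rintro y hy ⟨M, rfl⟩; exact h M hy))
  have hxq : x ∉ q := fun hxq => Set.disjoint_left.1 hdisj hxq ⟨1, pow_one x⟩
  obtain ⟨a, b, hb, e⟩ := mem_regU.1 hz
    ⟨⟨q, hq⟩, fun hle' => hxq (hle' (mem_irrelevant_of_mem_one hx))⟩
  refine hb (hle ?_)
  have hb0 : b ≠ 0 := fun h => hb (h ▸ zero_mem _)
  rw [mem_denIdeal, e, div_mul_cancel₀ _ (algebraMap_frac_ne_zero hb0)]
  exact ⟨a, rfl⟩

theorem mem_regU_of_pow (hgen : Algebra.adjoin ℂ (𝒜 1 : Set S) = ⊤) {z : FractionRing S}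
    (h : ∀ x ∈ 𝒜 1, ∃ M : ℕ, x ^ M ∈ denIdeal z) : z ∈ regU 𝒜 := by
  rw [mem_regU]
  intro q
  obtain ⟨x, hx, hxq⟩ := exists_degree_one_notMem hgen q.2
  obtain ⟨M, s, hs⟩ := h x hx
  have hxM : x ^ M ∉ q.1.asIdeal := fun h => hxq (q.1.isPrime.mem_of_pow_mem M h)
  have hx0 : x ^ M ≠ 0 := fun h => hxM (h ▸ zero_mem _)
  refine ⟨s, x ^ M, hxM, ?_⟩
  rw [eq_div_iff (algebraMap_frac_ne_zero hx0)]
  exact hs.symm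

/-- Homogeneous components of regular functions are regular. -/
theorem component_mem_regU (hgen : Algebra.adjoin ℂ (𝒜 1 : Set S) = ⊤) {f : ℤ →₀ FractionRing S}
    (hf : ∀ k, IsHomFrac 𝒜 k (f k)) (h : ∑ k ∈ f.support, f k ∈ regU 𝒜) (k : ℤ) :
    f k ∈ regU 𝒜 := by
  classical
  refine mem_regU_of_pow hgen fun x hx => ?_
  by_cases hx0 : x = 0
  · exact ⟨1, by rw [hx0, pow_one]; exact zero_mem _⟩
  obtain ⟨M, hM⟩ := exists_pow_mem_denIdeal h hx
  refine ⟨M, ?_⟩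
  have hxM : x ^ M ∈ 𝒜 M := by simpa using SetLike.pow_mem_graded M hx
  have hQ := algebraMap_frac_ne_zero (pow_ne_zero M hx0)
  -- The fractions `z` with `z x ^ M ∈ S` form a graded subspace, because `S` is graded and `x ^ M`
  -- is homogeneous; so components can be taken inside it.
  let W : Submodule ℂ (FractionRing S) := (Subalgebra.toSubmodule (baseRing S)).comap
    (LinearMap.mulRight ℂ (algebraMap S (FractionRing S) (x ^ M)))
  refine component_mem (𝒜 := 𝒜) (W := W) ?_ hf hM k
  rintro z ⟨s, hs⟩
  have hs' : algebraMap S (FractionRing S) s = z * algebraMap S (FractionRing S) (x ^ M) := hs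
  have hz : z = ∑ i ∈ (DirectSum.decompose 𝒜 s).support,
      algebraMap S (FractionRing S) (DirectSum.decompose 𝒜 s i) *
        (algebraMap S (FractionRing S) (x ^ M))⁻¹ := by
    rw [← Finset.sum_mul, ← map_sum, DirectSum.sum_support_decompose, hs', mul_inv_cancel_right₀ hQ]
  rw [hz]
  refine Submodule.sum_mem _ fun i _ => Submodule.mem_iSup_of_mem ((i : ℤ) + -(M : ℤ)) ⟨?_, ?_⟩
  · change _ * _ * _ ∈ baseRing S
    rw [inv_mul_cancel_right₀ hQ]
    exact ⟨_, rfl⟩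
  · exact (IsHomFrac.algebraMap (SetLike.coe_mem _)).mul (IsHomFrac.algebraMap hxM).inv'

/-! Generation in degree one. -/

theorem mem_iSup_pow (hgen : Algebra.adjoin ℂ (𝒜 1 : Set S) = ⊤) (s : S) :
    s ∈ ⨆ k : ℕ, (𝒜 1) ^ k := by
  have hs : s ∈ Algebra.adjoin ℂ (𝒜 1 : Set S) := by rw [hgen]; trivial
  induction hs using Algebra.adjoin_induction with
  | mem x hx => exact Submodule.mem_iSup_of_mem 1 (by rwa [pow_one])
  | algebraMap r =>
    exact Submodule.mem_iSup_of_mem 0 (by rw [pow_zero]; exact Submodule.mem_one.2 ⟨r, rfl⟩)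
  | add x y _ _ hx hy => exact add_mem hx hy
  | mul x y _ _ hx hy =>
    clear * - hx hy
    induction hx using Submodule.iSup_induction' with
    | zero => rw [zero_mul]; exact zero_mem _
    | add a b _ _ ha hb => rw [add_mul]; exact add_mem ha hb
    | mem i a ha =>
      induction hy using Submodule.iSup_induction' with
      | zero => rw [mul_zero]; exact zero_mem _
      | add c d _ _ hc hd => rw [mul_add]; exact add_mem hc hd
      | mem j c hc =>
        exact Submodule.mem_iSup_of_mem (i + j) (by rw [pow_add]; exact Submodule.mul_mem_mul ha hc)

theorem pow_one_le (k : ℕ) : (𝒜 1) ^ k ≤ 𝒜 k := by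
  induction k with
  | zero =>
    rw [pow_zero]
    rintro _ h
    obtain ⟨c, rfl⟩ := Submodule.mem_one.1 h
    exact SetLike.algebraMap_mem_graded 𝒜 c
  | succ k ih =>
    rw [pow_succ]
    exact Submodule.mul_le.2 fun a ha b hb => SetLike.mul_mem_graded (ih ha) hb

theorem pow_one_eq (hgen : Algebra.adjoin ℂ (𝒜 1 : Set S) = ⊤) (k : ℕ) : (𝒜 1) ^ k = 𝒜 k := by
  refine le_antisymm (pow_one_le k) fun s hs => ?_
  have key : ∀ t ∈ ⨆ k : ℕ, (𝒜 1) ^ k, GradedRing.proj 𝒜 k t ∈ (𝒜 1) ^ k := by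
    intro t ht
    induction ht using Submodule.iSup_induction' with
    | zero => rw [map_zero]; exact zero_mem _
    | add a b _ _ ha hb => rw [map_add]; exact add_mem ha hb
    | mem i a ha =>
      rw [GradedRing.proj_apply]
      by_cases hik : i = k
      · subst hik
        rwa [DirectSum.decompose_of_mem_same 𝒜 (pow_one_le i ha)]
      · rw [DirectSum.decompose_of_mem_ne 𝒜 (pow_one_le i ha) hik]
        exact zero_mem _
  have h1 := key s (mem_iSup_pow hgen s)
  rwa [GradedRing.proj_apply, DirectSum.decompose_of_mem_same 𝒜 hs] at h1

theorem exists_algebraMap_of_mem_zero (hgen : Algebra.adjoin ℂ (𝒜 1 : Set S) = ⊤) {s : S}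
    (hs : s ∈ 𝒜 0) : ∃ c : ℂ, algebraMap ℂ S c = s := by
  rw [← pow_one_eq hgen, pow_zero] at hs
  exact Submodule.mem_one.1 hs

/-- By noetherianity the ideal generated by `𝒜 1` is generated by finitely many elements of `𝒜 1`.
Comparing degree one parts, these span `𝒜 1` over `𝒜 0 = ℂ`. -/
theorem fg_one (hgen : Algebra.adjoin ℂ (𝒜 1 : Set S) = ⊤) [Algebra.FiniteType ℂ S] :
    (𝒜 1).FG := by
  have : IsNoetherianRing S := Algebra.FiniteType.isNoetherianRing ℂ S
  obtain ⟨T, hT, e⟩ := (Submodule.fg_span_iff_fg_span_finset_subset (R := S) (𝒜 1 : Set S)).1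
    (IsNoetherian.noetherian (Ideal.span (𝒜 1 : Set S)))
  refine ⟨T, le_antisymm (Submodule.span_le.2 hT) fun s hs => ?_⟩
  have key : ∀ z ∈ Submodule.span S (T : Set S), ∀ c : S,
      GradedRing.proj 𝒜 1 (c * z) ∈ Submodule.span ℂ (T : Set S) := by
    intro z hz
    induction hz using Submodule.span_induction with
    | mem t ht =>
      intro c
      have h1 := DirectSum.coe_decompose_mul_of_right_mem_of_le 𝒜 (n := 1) (i := 1) (a := c)
        (hT ht) le_rfl
      rw [Nat.sub_self] at h1
      rw [GradedRing.proj_apply, h1]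
      obtain ⟨r, hr⟩ := exists_algebraMap_of_mem_zero hgen (SetLike.coe_mem (DirectSum.decompose 𝒜 c 0))
      rw [← hr, ← Algebra.smul_def]
      exact Submodule.smul_mem _ _ (Submodule.subset_span ht)
    | zero => intro c; rw [mul_zero, map_zero]; exact zero_mem _
    | add a b _ _ ha hb => intro c; rw [mul_add, map_add]; exact add_mem (ha c) (hb c)
    | smul d a _ ha => intro c; rw [smul_eq_mul, ← mul_assoc]; exact ha _
  have h1 := key s (e ▸ Ideal.subset_span hs) 1
  rwa [one_mul, GradedRing.proj_apply, DirectSum.decompose_of_mem_same 𝒜 hs] at h1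

theorem fg_graded (hgen : Algebra.adjoin ℂ (𝒜 1 : Set S) = ⊤) [Algebra.FiniteType ℂ S] (k : ℕ) :
    (𝒜 k).FG := by
  rw [← pow_one_eq hgen]
  exact (fg_one hgen).pow k

/-- The radical of the denominator ideal contains `𝒜 1`, so by noetherianity the ideal itself
contains a power of the ideal generated by `𝒜 1`. In general `Γ(X, L^k)` is larger than `𝒜 k`; this
bounds the difference. -/
theorem exists_graded_le_denIdeal (hgen : Algebra.adjoin ℂ (𝒜 1 : Set S) = ⊤)
    [Algebra.FiniteType ℂ S] {z : FractionRing S} (hz : z ∈ regU 𝒜) :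
    ∃ M : ℕ, ∀ k, M ≤ k → ∀ s ∈ 𝒜 k, s ∈ denIdeal z := by
  have : IsNoetherianRing S := Algebra.FiniteType.isNoetherianRing ℂ S
  obtain ⟨M, hM⟩ := Ideal.exists_pow_le_of_le_radical_of_fg
    (I := Ideal.span (𝒜 1 : Set S)) (J := denIdeal z) (by
      rw [Ideal.span_le]
      exact fun x hx => exists_pow_mem_denIdeal hz hx) (IsNoetherian.noetherian _)
  have hpow : ∀ k, ∀ s ∈ 𝒜 k, s ∈ Ideal.span (𝒜 1 : Set S) ^ k := by
    intro k
    rw [← pow_one_eq hgen]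
    induction k with
    | zero => intro s _; rw [pow_zero, Ideal.one_eq_top]; trivial
    | succ k ih =>
      intro s hs
      rw [pow_succ] at hs ⊢
      induction hs using Submodule.mul_induction_on' with
      | mem_mul_mem a ha b hb => exact Ideal.mul_mem_mul (ih a ha) (Ideal.subset_span hb)
      | add a _ b _ ha hb => exact Ideal.add_mem _ ha hb
  exact ⟨M, fun k hk s hs => hM (Ideal.pow_le_pow_right hk (hpow k s hs))⟩

/-- If `z` is regular and homogeneous, it multiplies the homogeneous elements of large degree into
homogeneous elements. -/
theorem exists_mul_graded (hgen : Algebra.adjoin ℂ (𝒜 1 : Set S) = ⊤) [Algebra.FiniteType ℂ S]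
    {z : FractionRing S} (hz : z ∈ regU 𝒜) {d : ℤ} (hd : IsHomFrac 𝒜 d z) :
    ∃ M : ℕ, ∀ k, M ≤ k → ∀ l : ℕ, (l : ℤ) = k + d → ∀ s ∈ 𝒜 k, ∃ t ∈ 𝒜 l,
      algebraMap S (FractionRing S) t = z * algebraMap S (FractionRing S) s := by
  classical
  obtain ⟨M, hM⟩ := exists_graded_le_denIdeal hgen hz
  refine ⟨M, fun k hk l hl s hs => ?_⟩
  obtain ⟨t, ht⟩ := hM k hk s hs
  have ht' : algebraMap S (FractionRing S) t = z * algebraMap S (FractionRing S) s := ht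
  have hhom : IsHomFrac 𝒜 l (algebraMap S (FractionRing S) t) := by
    rw [ht']
    exact (hd.mul (IsHomFrac.algebraMap hs)).cast (by omega)
  refine ⟨t, ?_, ht'⟩
  rcases hhom with h0 | ⟨i, j, hij, a, ha, b, hb, hb0, e⟩
  · have : t = 0 := IsFractionRing.injective S (FractionRing S) (by rw [h0, map_zero])
    rw [this]; exact zero_mem _
  -- The element `t ∈ S` is a quotient of homogeneous elements. In `t b = a` only the degree `l`
  -- part of `t` can contribute, and `S` is a domain.
  · rw [eq_div_iff (algebraMap_frac_ne_zero hb0), ← map_mul] at e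
    have e' : t * b = a := IsFractionRing.injective S (FractionRing S) e
    have hil : i = l + j := by omega
    rw [← DirectSum.sum_support_decompose 𝒜 t]
    refine Submodule.sum_mem _ fun m _ => ?_
    by_cases hml : m = l
    · subst hml; exact SetLike.coe_mem _
    · have h1 := DirectSum.coe_decompose_mul_add_of_right_mem 𝒜 (i := m) (a := t) hb
      rw [e', DirectSum.decompose_of_mem_ne 𝒜 ha (by omega)] at h1
      rw [(mul_eq_zero.1 h1.symm).resolve_right hb0]
      exact zero_mem _

theorem const_of_isIntegral {Q : Type*} [Field Q] [Algebra ℂ Q] {z : Q} (hz : IsIntegral ℂ z) :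
    ∃ c : ℂ, algebraMap ℂ Q c = z :=
  minpoly.mem_range_of_degree_eq_one ℂ z
    (IsAlgClosed.degree_eq_one_of_irreducible ℂ (minpoly.irreducible hz))

/-- Multiplication by `z` preserves the finite-dimensional space `𝒜 M` for large `M`, so `z` is
integral over `ℂ`, and `ℂ` is algebraically closed. -/
theorem exists_const_of_regU_of_degree_zero (hgen : Algebra.adjoin ℂ (𝒜 1 : Set S) = ⊤)
    (hne : 𝒜 1 ≠ ⊥) [Algebra.FiniteType ℂ S] {z : FractionRing S} (hz : z ∈ regU 𝒜)
    (h0 : IsHomFrac 𝒜 0 z) : ∃ c : ℂ, algebraMap ℂ (FractionRing S) c = z := by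
  obtain ⟨M, hM⟩ := exists_mul_graded hgen hz h0
  let ι : S →ₗ[ℂ] FractionRing S := (Algebra.linearMap S (FractionRing S)).restrictScalars ℂ
  have hint : IsIntegral ℂ z := by
    refine isIntegral_of_smul_mem_submodule ((𝒜 M).map ι) ?_ ((fg_graded hgen M).map ι) z ?_
    · obtain ⟨x, hx, hx0⟩ := Submodule.exists_mem_ne_zero_of_ne_bot hne
      intro hbot
      have h1 : ι (x ^ M) ∈ (𝒜 M).map ι :=
        Submodule.mem_map_of_mem (by simpa using SetLike.pow_mem_graded M hx)
      rw [hbot, Submodule.mem_bot] at h1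
      exact algebraMap_frac_ne_zero (pow_ne_zero M hx0) h1
    · rintro _ ⟨s, hs, rfl⟩
      obtain ⟨t, ht, e⟩ := hM M le_rfl M (by simp) s hs
      exact ⟨t, ht, e⟩
  exact const_of_isIntegral hint

/-- If `S₁` is a line, then the function field of `X` is `ℂ`. -/
theorem functionField_eq_const (hgen : Algebra.adjoin ℂ (𝒜 1 : Set S) = ⊤) {x : S}
    (h : ∀ y ∈ 𝒜 1, ∃ c : ℂ, y = c • x) (z : functionField 𝒜) :
    ∃ c : ℂ, algebraMap ℂ (functionField 𝒜) c = z := by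
  have hk : ∀ k, ∀ y ∈ 𝒜 k, ∃ c : ℂ, y = c • x ^ k := by
    intro k
    rw [← pow_one_eq hgen]
    have hle : 𝒜 1 ≤ Submodule.span ℂ {x} := fun y hy => by
      obtain ⟨c, rfl⟩ := h y hy
      exact Submodule.smul_mem _ _ (Submodule.mem_span_singleton_self x)
    intro y hy
    have h1 := pow_le_pow_left' hle k hy
    rw [Submodule.span_pow, Set.singleton_pow, Submodule.mem_span_singleton] at h1
    obtain ⟨c, hc⟩ := h1
    exact ⟨c, hc.symm⟩
  obtain ⟨z, rfl | ⟨i, j, hij, a, ha, b, hb, hb0, rfl⟩⟩ := z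
  · exact ⟨0, by rw [map_zero]; rfl⟩
  have hij' : i = j := by omega
  subst hij'
  obtain ⟨c, rfl⟩ := hk i a ha
  obtain ⟨d, rfl⟩ := hk i b hb
  have hd : d ≠ 0 := by rintro rfl; exact hb0 (zero_smul _ _)
  have hx : x ^ i ≠ 0 := by intro h0; rw [h0, smul_zero] at hb0; exact hb0 rfl
  refine ⟨c / d, Subtype.ext ?_⟩
  change algebraMap ℂ (FractionRing S) (c / d) = algebraMap S _ (c • x ^ i) / algebraMap S _ (d • x ^ i)
  have hQ := algebraMap_frac_ne_zero hx
  have hdQ : algebraMap ℂ (FractionRing S) d ≠ 0 := by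
    rw [Ne, map_eq_zero]; exact hd
  rw [Algebra.smul_def, Algebra.smul_def, map_mul, map_mul, ← IsScalarTower.algebraMap_apply,
    ← IsScalarTower.algebraMap_apply, map_div₀]
  field_simp

theorem exists_nonconst_ratio (hgen : Algebra.adjoin ℂ (𝒜 1 : Set S) = ⊤)
    (hK : ¬ ∀ z : functionField 𝒜, ∃ c : ℂ, algebraMap ℂ (functionField 𝒜) c = z) (x : S) :
    ∃ y ∈ 𝒜 1, ∀ c : ℂ, y ≠ c • x := by
  by_contra! h
  exact hK (functionField_eq_const hgen h)

/-- A regular function of negative degree vanishes. -/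
theorem eq_zero_of_regU_of_neg (hgen : Algebra.adjoin ℂ (𝒜 1 : Set S) = ⊤)
    (hne : 𝒜 1 ≠ ⊥) [Algebra.FiniteType ℂ S]
    (hK : ¬ ∀ z : functionField 𝒜, ∃ c : ℂ, algebraMap ℂ (functionField 𝒜) c = z)
    {z : FractionRing S} (hz : z ∈ regU 𝒜) {k : ℤ} (hk : IsHomFrac 𝒜 k z) (hneg : k < 0) :
    z = 0 := by
  by_contra hz0
  obtain ⟨m, hm⟩ := Int.eq_ofNat_of_zero_le (show 0 ≤ -k by omega)
  have hm0 : m ≠ 0 := by omega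
  -- With `m = -k`, the product `z x ^ m` has degree zero and is therefore constant.
  have key : ∀ x ∈ 𝒜 1, ∃ c : ℂ,
      algebraMap ℂ (FractionRing S) c = z * algebraMap S (FractionRing S) x ^ m := by
    intro x hx
    refine exists_const_of_regU_of_degree_zero hgen hne
      ((regU 𝒜).mul_mem hz ((regU 𝒜).pow_mem (algebraMap_mem_regU x) m)) ?_
    exact (hk.mul ((IsHomFrac.algebraMap hx).pow m)).cast (by push_cast; omega)
  obtain ⟨x, hx, hx0⟩ := Submodule.exists_mem_ne_zero_of_ne_bot hne
  obtain ⟨y, hy, hxy⟩ := exists_nonconst_ratio hgen hK x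
  have hQx := algebraMap_frac_ne_zero hx0
  obtain ⟨c, hc⟩ := key x hx
  obtain ⟨d, hd⟩ := key y hy
  have hc0 : algebraMap ℂ (FractionRing S) c ≠ 0 := by
    rw [hc]; exact mul_ne_zero hz0 (pow_ne_zero _ hQx)
  -- Dividing the two constants shows that `(y / x) ^ m` is constant; then `y / x` is algebraic over
  -- `ℂ`, hence constant, contrary to the choice of `y`.
  have hpow : (algebraMap S (FractionRing S) y / algebraMap S (FractionRing S) x) ^ m =
      algebraMap ℂ (FractionRing S) (d / c) := by
    rw [map_div₀, hd, hc, div_pow, mul_div_mul_left _ _ hz0]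
  have hint : IsIntegral ℂ (algebraMap S (FractionRing S) y / algebraMap S (FractionRing S) x) :=
    IsIntegral.of_pow (Nat.pos_of_ne_zero hm0) (hpow ▸ isIntegral_algebraMap)
  obtain ⟨e, he⟩ := const_of_isIntegral hint
  refine hxy e (IsFractionRing.injective S (FractionRing S) ?_)
  rw [Algebra.smul_def, map_mul, ← IsScalarTower.algebraMap_apply, he, div_mul_cancel₀ _ hQx]

end Regular

end
end CYCone

/-! ### Derivations of the function field of U -/

set_option linter.unusedSectionVars false
namespace CYCone
noncomputable section

section Extend

open Polynomial

/-- A derivation on `K` extends to `K(x)`, with an arbitrary value at the transcendental `x`. -/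
theorem exists_derivation_extend {K Q : Type*} [Field K] [Algebra ℂ K] [Field Q] [Algebra ℂ Q]
    [Algebra K Q] [IsScalarTower ℂ K Q] (x v : Q)
    (hinj : Function.Injective (aeval (R := K) x))
    (hfrac : ∀ z : Q, ∃ a b : K[X], z = aeval x a / aeval x b) (δ : Derivation ℂ K Q) :
    ∃ θ : Derivation ℂ Q Q, (∀ c, θ (algebraMap K Q c) = δ c) ∧ θ x = v := by
  let _ : Algebra K[X] Q := (aeval (R := K) x).toRingHom.toAlgebra
  have : FaithfulSMul K[X] Q := (faithfulSMul_iff_algebraMap_injective _ _).2 hinj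
  have : IsFractionRing K[X] Q := IsFractionRing.of_field _ _ fun z => by
    obtain ⟨a, b, h⟩ := hfrac z
    exact ⟨a, b, h⟩
  -- A derivation is the `ε`-part of a ring homomorphism to the dual numbers. The homomorphism is
  -- prescribed by `c ↦ c + ε δ(c)` and `X ↦ x + ε v` on `K[X]`, then extended to fractions.
  let φ : K →+* TrivSqZeroExt Q Q :=
    { toFun := fun c => TrivSqZeroExt.inl (algebraMap K Q c) + TrivSqZeroExt.inr (δ c)
      map_one' := by simp
      map_zero' := by simp
      map_add' := fun a b => by ext <;> simp
      map_mul' := fun a b => by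
        ext
        · simp
        · simp only [map_mul, Derivation.leibniz, TrivSqZeroExt.snd_add, TrivSqZeroExt.snd_inl,
            TrivSqZeroExt.snd_inr, TrivSqZeroExt.snd_mul, TrivSqZeroExt.fst_add,
            TrivSqZeroExt.fst_inl, TrivSqZeroExt.fst_inr, add_zero, zero_add, op_smul_eq_smul,
            algebraMap_smul] }
  let ψ : K[X] →+* TrivSqZeroExt Q Q :=
    eval₂RingHom φ (TrivSqZeroExt.inl x + TrivSqZeroExt.inr v)
  have hψ : ∀ P, (ψ P).fst = aeval x P := by
    have h : (TrivSqZeroExt.fstHom Q Q Q).toRingHom.comp ψ = (aeval (R := K) x).toRingHom := by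
      ext c
      · simp [ψ, φ]
      · simp [ψ]
    exact fun P => DFunLike.congr_fun h P
  -- A dual number is a unit when its `ε`-free part is, and `x` is transcendental.
  have hunit : ∀ y : nonZeroDivisors K[X], IsUnit (ψ y) := by
    intro y
    rw [TrivSqZeroExt.isUnit_iff_isUnit_fst, hψ, isUnit_iff_ne_zero]
    exact fun h => nonZeroDivisors.ne_zero y.2 (hinj (by rw [h, map_zero]))
  let L : Q →+* TrivSqZeroExt Q Q := IsLocalization.lift (M := nonZeroDivisors K[X]) hunit
  have hL : ∀ P : K[X], L (aeval x P) = ψ P := fun P => IsLocalization.lift_eq hunit P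
  have hLfst : ∀ z, (L z).fst = z := by
    have h : (TrivSqZeroExt.fstHom Q Q Q).toRingHom.comp L = RingHom.id Q := by
      refine IsLocalization.ringHom_ext (nonZeroDivisors K[X]) (RingHom.ext fun P => ?_)
      change (L (aeval x P)).fst = aeval x P
      rw [hL, hψ]
    exact fun z => DFunLike.congr_fun h z
  have hLK : ∀ c, L (algebraMap K Q c) = φ c := by
    intro c
    have := hL (C c)
    rw [aeval_C] at this
    rw [this]
    exact eval₂_C _ _
  refine ⟨Derivation.mk'
    { toFun := fun z => (L z).snd
      map_add' := fun a b => by rw [map_add, TrivSqZeroExt.snd_add]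
      map_smul' := fun c z => by
        rw [Algebra.smul_def, map_mul, IsScalarTower.algebraMap_apply ℂ K Q, hLK,
          TrivSqZeroExt.snd_mul, hLfst]
        simp only [φ, RingHom.coe_mk, MonoidHom.coe_mk, OneHom.coe_mk, TrivSqZeroExt.fst_add,
          TrivSqZeroExt.fst_inl, TrivSqZeroExt.fst_inr, TrivSqZeroExt.snd_add,
          TrivSqZeroExt.snd_inl, TrivSqZeroExt.snd_inr, Derivation.map_algebraMap, add_zero,
          smul_zero, RingHom.id_apply]
        rw [← IsScalarTower.algebraMap_apply, algebraMap_smul] }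
    (fun a b => by
      change (L (a * b)).snd = a • (L b).snd + b • (L a).snd
      rw [map_mul, TrivSqZeroExt.snd_mul, hLfst, hLfst, op_smul_eq_smul]), fun c => ?_, ?_⟩
  · change (L _).snd = _
    rw [hLK]
    simp [φ]
  · change (L x).snd = v
    have := hL X
    rw [aeval_X] at this
    rw [this]
    simp [ψ]

theorem exists_derivation_extend_zero {K Q : Type*} [Field K] [Algebra ℂ K] [Field Q] [Algebra ℂ Q]
    [Algebra K Q] [IsScalarTower ℂ K Q] (x v : Q)
    (hinj : Function.Injective (aeval (R := K) x))
    (hfrac : ∀ z : Q, ∃ a b : K[X], z = aeval x a / aeval x b) :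
    ∃ θ : Derivation ℂ Q Q, (∀ c, θ (algebraMap K Q c) = 0) ∧ θ x = v :=
  exists_derivation_extend x v hinj hfrac 0

end Extend

section Coordinates

open Polynomial

variable {S : Type*} [CommRing S] [IsDomain S] [Algebra ℂ S] {𝒜 : ℕ → Submodule ℂ S}
  [GradedAlgebra 𝒜]

theorem algebraMap_functionField (z : functionField 𝒜) :
    algebraMap (functionField 𝒜) (FractionRing S) z = z := rfl

/-- An element `x` of degree one is transcendental over the field of degree zero fractions: the
terms `cᵢ xⁱ` have distinct degrees, so a vanishing sum has vanishing terms. -/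
theorem aeval_injective {x : S} (hx1 : x ∈ 𝒜 1) (hx : x ≠ 0) :
    Function.Injective (aeval (R := functionField 𝒜) (algebraMap S (FractionRing S) x)) := by
  rw [injective_iff_map_eq_zero]
  intro P hP
  have hQ := algebraMap_frac_ne_zero hx
  let f : ℤ →₀ FractionRing S := Finsupp.onFinset (P.support.map ⟨Int.ofNat, Int.ofNat_injective⟩)
    (fun k => if 0 ≤ k then (P.coeff k.toNat : FractionRing S) *
      algebraMap S (FractionRing S) x ^ k.toNat else 0) (by
        intro k hk
        by_cases h0 : 0 ≤ k
        · rw [if_pos h0] at hk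
          refine Finset.mem_map.2 ⟨k.toNat, ?_, Int.toNat_of_nonneg h0⟩
          rw [mem_support_iff]
          rintro h
          rw [h] at hk
          exact hk (by rw [ZeroMemClass.coe_zero, zero_mul])
        · rw [if_neg h0] at hk
          exact absurd rfl hk)
  have hf : f = 0 := by
    refine eq_zero_of_sum_hom_eq_zero (𝒜 := 𝒜) (fun k => ?_) ?_
    · change IsHomFrac 𝒜 k (if 0 ≤ k then _ else _)
      split_ifs with h0
      · exact ((isHomFrac_coe _).mul ((IsHomFrac.algebraMap hx1).pow _)).cast (by
          push_cast; omega)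
      · exact IsHomFrac.zero _
    · change f.sum (fun _ z => z) = 0
      rw [Finsupp.onFinset_sum _ (fun _ => rfl), Finset.sum_map, ← hP, aeval_eq_sum_range,
        Finset.sum_subset (supp_subset_range_natDegree_succ)]
      · refine Finset.sum_congr rfl fun i _ => ?_
        simp [Algebra.smul_def]
      · intro i _ hi
        rw [notMem_support_iff] at hi
        simp [hi]
  ext k
  have h1 := DFunLike.congr_fun hf (k : ℤ)
  have h2 : (P.coeff k : FractionRing S) * algebraMap S (FractionRing S) x ^ k = 0 := by
    simpa [f] using h1
  have h3 := (mul_eq_zero.1 h2).resolve_right (pow_ne_zero _ hQ)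
  simpa using h3

/-- Rationally, `x` trivializes `L` and `x ^ k` trivializes `L^k`. -/
theorem exists_mul_pow {x : S} (hx1 : x ∈ 𝒜 1) (hx : x ≠ 0) {k : ℤ} {z : FractionRing S}
    (hz : IsHomFrac 𝒜 k z) : ∃ c : functionField 𝒜,
      z = c * algebraMap S (FractionRing S) x ^ k := by
  have hQ := algebraMap_frac_ne_zero hx
  refine ⟨⟨z * algebraMap S (FractionRing S) x ^ (-k), (hz.mul
    ((IsHomFrac.algebraMap hx1).zpow (-k))).cast (by push_cast; ring)⟩, ?_⟩
  rw [mul_assoc, ← zpow_add₀ hQ, neg_add_cancel, zpow_zero, mul_one]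

theorem algebraMap_mem_range_aeval {x : S} (hx1 : x ∈ 𝒜 1) (hx : x ≠ 0) (s : S) :
    ∃ P : (functionField 𝒜)[X], algebraMap S (FractionRing S) s =
      aeval (algebraMap S (FractionRing S) x) P := by
  classical
  have h : ∀ i (a : 𝒜 i), ∃ P : (functionField 𝒜)[X], algebraMap S (FractionRing S) a =
      aeval (algebraMap S (FractionRing S) x) P := by
    intro i a
    obtain ⟨c, hc⟩ := exists_mul_pow hx1 hx (IsHomFrac.algebraMap a.2)
    exact ⟨C c * X ^ i, by rw [hc]; simp⟩
  choose P hP using h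
  refine ⟨∑ i ∈ (DirectSum.decompose 𝒜 s).support, P i (DirectSum.decompose 𝒜 s i), ?_⟩
  conv_lhs => rw [← DirectSum.sum_support_decompose 𝒜 s, map_sum]
  rw [map_sum]
  exact Finset.sum_congr rfl fun i _ => hP i _

theorem exists_eq_aeval_div {x : S} (hx1 : x ∈ 𝒜 1) (hx : x ≠ 0) (z : FractionRing S) :
    ∃ P R : (functionField 𝒜)[X], z = aeval (algebraMap S (FractionRing S) x) P /
      aeval (algebraMap S (FractionRing S) x) R := by
  obtain ⟨a, b, -, rfl⟩ := IsFractionRing.div_surjective (A := S) z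
  obtain ⟨P, hP⟩ := algebraMap_mem_range_aeval hx1 hx a
  obtain ⟨R, hR⟩ := algebraMap_mem_range_aeval hx1 hx b
  exact ⟨P, R, by rw [hP, hR]⟩

theorem exists_derivation_zero {x : S} (hx1 : x ∈ 𝒜 1) (hx : x ≠ 0) (v : FractionRing S) :
    ∃ θ : Derivation ℂ (FractionRing S) (FractionRing S),
      (∀ c : functionField 𝒜, θ c = 0) ∧ θ (algebraMap S (FractionRing S) x) = v :=
  exists_derivation_extend_zero _ v (aeval_injective hx1 hx) (exists_eq_aeval_div hx1 hx)

theorem exists_derivation {x : S} (hx1 : x ∈ 𝒜 1) (hx : x ≠ 0)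
    (δ : Derivation ℂ (functionField 𝒜) (functionField 𝒜)) (v : FractionRing S) :
    ∃ θ : Derivation ℂ (FractionRing S) (FractionRing S),
      (∀ c : functionField 𝒜, θ c = (δ c : functionField 𝒜)) ∧ θ (algebraMap S (FractionRing S) x) = v := by
  exact exists_derivation_extend _ v (aeval_injective hx1 hx) (exists_eq_aeval_div hx1 hx)
    ((Algebra.linearMap (functionField 𝒜) (FractionRing S)).compDer δ)

section ZeroLocus

variable {Q M : Type*} [Field Q] [Algebra ℂ Q] [AddCommGroup M] [Module Q M] [Module ℂ M]
  {θ : Derivation ℂ Q M}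

theorem derivation_div_eq_zero {a b : Q} (ha : θ a = 0) (hb : θ b = 0) : θ (a / b) = 0 := by
  rw [div_eq_mul_inv, Derivation.leibniz, Derivation.leibniz_inv, ha, hb, smul_zero, smul_zero,
    smul_zero, add_zero]

theorem derivation_mul_pow_eq_zero {a b : Q} (ha : θ a = 0) (hb : θ b = 0) (n : ℕ) :
    θ (a * b ^ n) = 0 := by
  rw [Derivation.leibniz, Derivation.leibniz_pow, ha, hb, smul_zero, smul_zero, smul_zero,
    smul_zero, add_zero]

end ZeroLocus

/-- The function field of `U` is generated as a field by that of `X` together with `x`. -/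
theorem derivation_ext {M : Type*} [AddCommGroup M] [Module (FractionRing S) M] [Module ℂ M]
    {x : S} (hx1 : x ∈ 𝒜 1) (hx : x ≠ 0)
    {θ θ' : Derivation ℂ (FractionRing S) M}
    (h : ∀ c : functionField 𝒜, θ c = θ' c)
    (h' : θ (algebraMap S (FractionRing S) x) = θ' (algebraMap S (FractionRing S) x)) :
    θ = θ' := by
  rw [← sub_eq_zero]
  set ξ := θ - θ' with hξ
  have hc : ∀ c : functionField 𝒜, ξ c = 0 := fun c => by
    rw [hξ, Derivation.sub_apply, h, sub_self]
  have hx' : ξ (algebraMap S (FractionRing S) x) = 0 := by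
    rw [hξ, Derivation.sub_apply, h', sub_self]
  have hP : ∀ P : (functionField 𝒜)[X], ξ (aeval (algebraMap S (FractionRing S) x) P) = 0 := by
    intro P
    induction P using Polynomial.induction_on' with
    | add p q hp hq => rw [map_add, map_add, hp, hq, add_zero]
    | monomial n a =>
      rw [aeval_monomial]
      exact derivation_mul_pow_eq_zero (hc a) hx' n
  ext z
  obtain ⟨P, R, rfl⟩ := exists_eq_aeval_div hx1 hx z
  exact derivation_div_eq_zero (hP P) (hP R)

end Coordinates

end
end CYCone

/-! ### The Euler field and frames on U -/

set_option linter.unusedSectionVars false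
namespace CYCone
noncomputable section

section Frames

variable {S : Type*} [CommRing S] [IsDomain S] [Algebra ℂ S] (𝒜 : ℕ → Submodule ℂ S)
  [GradedAlgebra 𝒜]

/-- The Euler derivation, multiplying the homogeneous fractions by their degree. -/
def IsEuler (E : Derivation ℂ (FractionRing S) (FractionRing S)) : Prop :=
  ∀ k z, IsHomFrac 𝒜 k z → E z = (k : FractionRing S) * z

/-- Derivations that are homogeneous of degree `d`. -/
def IsHomDer (d : ℤ) (ξ : Derivation ℂ (FractionRing S) (FractionRing S)) : Prop :=
  ∀ k z, IsHomFrac 𝒜 k z → IsHomFrac 𝒜 (k + d) (ξ z)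

/-- Vector fields that are regular on `U`. -/
def IsRegDer (ξ : Derivation ℂ (FractionRing S) (FractionRing S)) : Prop :=
  ∀ (q : ConePoint 𝒜), ∀ g ∈ localU q, ξ g ∈ localU q

variable {𝒜}

theorem derivation_mul_zpow {Q : Type*} [Field Q] [Algebra ℂ Q] (θ : Derivation ℂ Q Q) (c : Q)
    {x : Q} (hx : x ≠ 0) (k : ℤ) :
    θ (c * x ^ k) = θ c * x ^ k + (k : Q) * (c * x ^ k) * (x⁻¹ * θ x) := by
  rw [Derivation.leibniz, Derivation.leibniz_zpow, zpow_sub_one₀ hx]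
  simp only [smul_eq_mul, zsmul_eq_mul]
  ring

/-- The derivation that kills the function field of `X` and fixes `x` multiplies `c x ^ k` by `k`.
-/
theorem exists_euler {x : S} (hx1 : x ∈ 𝒜 1) (hx : x ≠ 0) :
    ∃ E : Derivation ℂ (FractionRing S) (FractionRing S), IsEuler 𝒜 E := by
  obtain ⟨E, h0, h1⟩ := exists_derivation_zero hx1 hx (algebraMap S (FractionRing S) x)
  have hQ := algebraMap_frac_ne_zero hx
  refine ⟨E, fun k z hz => ?_⟩
  obtain ⟨c, rfl⟩ := exists_mul_pow hx1 hx hz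
  rw [derivation_mul_zpow E _ hQ, h0, h1, zero_mul, zero_add,
    inv_mul_cancel₀ hQ, mul_one]

/-- Homogeneous fractions have the form `c x ^ k`, so homogeneity need only be tested on functions
of `X` and on `x`. -/
theorem isHomDer_of {x : S} (hx1 : x ∈ 𝒜 1) (hx : x ≠ 0) {d : ℤ}
    {ξ : Derivation ℂ (FractionRing S) (FractionRing S)}
    (h0 : ∀ c : functionField 𝒜, IsHomFrac 𝒜 d (ξ c))
    (h1 : IsHomFrac 𝒜 (1 + d) (ξ (algebraMap S (FractionRing S) x))) : IsHomDer 𝒜 d ξ := by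
  intro k z hz
  have hQ := algebraMap_frac_ne_zero hx
  obtain ⟨c, rfl⟩ := exists_mul_pow hx1 hx hz
  have hX := IsHomFrac.algebraMap hx1
  rw [derivation_mul_zpow ξ _ hQ]
  refine IsHomFrac.add (((h0 c).mul (hX.zpow k)).cast (by push_cast; ring)) ?_
  have h2 := (IsHomFrac.const (𝒜 := 𝒜) (k : ℂ)).mul hz
  rw [map_intCast] at h2
  exact (h2.mul (hX.inv'.mul h1)).cast (by push_cast; ring)

theorem IsEuler.isHomDer {E : Derivation ℂ (FractionRing S) (FractionRing S)}
    (hE : IsEuler 𝒜 E) : IsHomDer 𝒜 0 E := by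
  intro k z hz
  rw [hE k z hz]
  have h2 := (IsHomFrac.const (𝒜 := 𝒜) (k : ℂ)).mul hz
  rw [map_intCast] at h2
  exact h2.cast (by ring)

theorem derivation_mem_localU {q : ConePoint 𝒜}
    {ξ : Derivation ℂ (FractionRing S) (FractionRing S)}
    (h : ∀ s : S, ξ (algebraMap S (FractionRing S) s) ∈ localU q) {g : FractionRing S}
    (hg : g ∈ localU q) : ξ g ∈ localU q := by
  obtain ⟨a, b, hb, rfl⟩ := hg
  have hi := inv_mem_localU hb
  rw [div_eq_mul_inv, Derivation.leibniz, Derivation.leibniz_inv]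
  simp only [smul_eq_mul]
  exact (localU q).add_mem ((localU q).mul_mem (algebraMap_mem_localU a q)
    ((localU q).mul_mem ((localU q).neg_mem ((localU q).pow_mem hi 2)) (h b)))
    ((localU q).mul_mem hi (h a))

theorem isRegDer_of (hgen : Algebra.adjoin ℂ (𝒜 1 : Set S) = ⊤)
    {ξ : Derivation ℂ (FractionRing S) (FractionRing S)}
    (h : ∀ x ∈ 𝒜 1, ξ (algebraMap S (FractionRing S) x) ∈ regU 𝒜) : IsRegDer 𝒜 ξ := by
  intro q g hg
  refine derivation_mem_localU (fun s => ?_) hg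
  have hs : s ∈ Algebra.adjoin ℂ (𝒜 1 : Set S) := by rw [hgen]; trivial
  induction hs using Algebra.adjoin_induction with
  | mem x hx => exact mem_regU.1 (h x hx) q
  | algebraMap r =>
    rw [← IsScalarTower.algebraMap_apply, Derivation.map_algebraMap]
    exact (localU q).zero_mem
  | add x y _ _ hx hy => rw [map_add, map_add]; exact (localU q).add_mem hx hy
  | mul x y _ _ hx hy =>
    rw [map_mul, Derivation.leibniz, smul_eq_mul, smul_eq_mul]
    exact (localU q).add_mem ((localU q).mul_mem (algebraMap_mem_localU _ q) hy)
      ((localU q).mul_mem (algebraMap_mem_localU _ q) hx)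

theorem IsRegDer.apply_mem {ξ : Derivation ℂ (FractionRing S) (FractionRing S)}
    (h : IsRegDer 𝒜 ξ) {g : FractionRing S} (hg : g ∈ regU 𝒜) : ξ g ∈ regU 𝒜 :=
  mem_regU.2 fun q => h q g (mem_regU.1 hg q)

/-- The point of `X` below a point of `U`. -/
def corePoint (q : ConePoint 𝒜) : ProjectiveSpectrum 𝒜 where
  asHomogeneousIdeal := q.1.asIdeal.homogeneousCore 𝒜
  isPrime := q.1.isPrime.homogeneousCore
  not_irrelevant_le := fun h => q.2 (le_trans h (Ideal.toIdeal_homogeneousCore_le 𝒜 q.1.asIdeal))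

theorem notMem_corePoint {q : ConePoint 𝒜} {x : S} (hx : x ∉ q.1.asIdeal) :
    x ∉ (corePoint q).asHomogeneousIdeal :=
  fun h => hx (Ideal.toIdeal_homogeneousCore_le 𝒜 q.1.asIdeal h)

theorem notMem_of_notMem_corePoint {q : ConePoint 𝒜} {x : S} {i : ℕ} (hxi : x ∈ 𝒜 i)
    (hx : x ∉ (corePoint q).asHomogeneousIdeal) : x ∉ q.1.asIdeal :=
  fun h => hx (Ideal.mem_homogeneousCore_of_homogeneous_of_mem ⟨i, hxi⟩ h)

theorem twistStalk_subset_localU {q : ConePoint 𝒜} {k : ℤ} {z : FractionRing S}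
    (hz : z ∈ twistStalk 𝒜 k (corePoint q)) : z ∈ localU q := by
  obtain ⟨i, j, -, a, -, b, hb, hbp, e⟩ := hz
  exact ⟨a, b, notMem_of_notMem_corePoint hb hbp, e⟩

/-- Near `q` the cone is a product: a homogeneous `s` of degree `i` is `c x ^ i` with `c = s / x ^
i` regular at the point of `X` below `q`. Regularity is thus tested on local functions of `X` and on
`x`. -/
theorem derivation_algebraMap_mem_localU {q : ConePoint 𝒜} {x : S} (hx1 : x ∈ 𝒜 1)
    (hxq : x ∉ q.1.asIdeal) {ξ : Derivation ℂ (FractionRing S) (FractionRing S)}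
    (h0 : ∀ c ∈ localX 𝒜 (corePoint q), ξ (c : functionField 𝒜) ∈ localU q)
    (h1 : ξ (algebraMap S (FractionRing S) x) ∈ localU q) {g : FractionRing S}
    (hg : g ∈ localU q) : ξ g ∈ localU q := by
  classical
  refine derivation_mem_localU (fun s => ?_) hg
  have hx : x ≠ 0 := fun h => hxq (h ▸ zero_mem _)
  have hQ := algebraMap_frac_ne_zero hx
  rw [← DirectSum.sum_support_decompose 𝒜 s, map_sum, map_sum]
  refine (localU q).sum_mem fun i _ => ?_
  set a := DirectSum.decompose 𝒜 s i with ha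
  have hxi : x ^ i ∈ 𝒜 i := by simpa using SetLike.pow_mem_graded i hx1
  have hxiq : x ^ i ∉ (corePoint q).asHomogeneousIdeal :=
    fun h => notMem_corePoint hxq ((corePoint q).isPrime.mem_of_pow_mem i h)
  let c : functionField 𝒜 := ⟨algebraMap S (FractionRing S) a / algebraMap S (FractionRing S) (x ^ i),
    Or.inr ⟨i, i, by simp, a, a.2, x ^ i, hxi, pow_ne_zero _ hx, rfl⟩⟩
  have hc : c ∈ localX 𝒜 (corePoint q) := ⟨i, i, by simp, a, a.2, x ^ i, hxi, hxiq, rfl⟩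
  have e : algebraMap S (FractionRing S) a = c * algebraMap S (FractionRing S) x ^ i := by
    change _ = _ / _ * _
    rw [map_pow, div_mul_cancel₀ _ (pow_ne_zero _ hQ)]
  rw [e, Derivation.leibniz, Derivation.leibniz_pow]
  simp only [smul_eq_mul, nsmul_eq_mul]
  have hX := algebraMap_mem_localU x q
  exact (localU q).add_mem ((localU q).mul_mem (twistStalk_subset_localU hc)
    ((localU q).mul_mem (natCast_mem _ _) ((localU q).mul_mem ((localU q).pow_mem hX _) h1)))
    ((localU q).mul_mem ((localU q).pow_mem hX _) (h0 c hc))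

/-- A basis of the differentials of the function field of `X` and a function `x` of degree one give
a basis of the differentials of the function field of `U`. -/
theorem exists_frame {x : S} (hx1 : x ∈ 𝒜 1) (hx : x ≠ 0) {n : ℕ}
    (e : Module.Basis (Fin n) (functionField 𝒜) Ω[functionField 𝒜⁄ℂ]) (g : Fin n → functionField 𝒜)
    (he : ∀ i, e i = KaehlerDifferential.D ℂ (functionField 𝒜) (g i)) :
    ∃ (ε : Module.Basis (Fin (n + 1)) (FractionRing S) Ω[FractionRing S⁄ℂ])
      (dd : Fin (n + 1) → Derivation ℂ (FractionRing S) (FractionRing S)),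
      ε 0 = (algebraMap S (FractionRing S) x)⁻¹ •
        KaehlerDifferential.D ℂ (FractionRing S) (algebraMap S (FractionRing S) x) ∧
      (∀ i, ε (Fin.succ i) = KaehlerDifferential.D ℂ (FractionRing S) (g i : FractionRing S)) ∧
      (∀ z j, ε.repr (KaehlerDifferential.D ℂ (FractionRing S) z) j = dd j z) ∧
      (∀ c : functionField 𝒜, dd 0 c = 0) ∧
      (∀ (c : functionField 𝒜) i, dd (Fin.succ i) c =
        (e.repr (KaehlerDifferential.D ℂ (functionField 𝒜) c) i : functionField 𝒜)) ∧
      dd 0 (algebraMap S (FractionRing S) x) = algebraMap S (FractionRing S) x ∧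
      ∀ i, dd (Fin.succ i) (algebraMap S (FractionRing S) x) = 0 := by
  classical
  have hQ := algebraMap_frac_ne_zero hx
  set X := algebraMap S (FractionRing S) x with hX
  obtain ⟨E, hE0', hE1⟩ := exists_derivation_zero hx1 hx X
  have hd : ∀ i : Fin n, ∃ θ : Derivation ℂ (FractionRing S) (FractionRing S),
      (∀ c : functionField 𝒜, θ c =
        (e.repr (KaehlerDifferential.D ℂ (functionField 𝒜) c) i : functionField 𝒜)) ∧ θ X = 0 :=
    fun i => exists_derivation hx1 hx
      ((e.coord i).compDer (KaehlerDifferential.D ℂ (functionField 𝒜))) 0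
  choose d hd0 hd1 using hd
  let dd : Fin (n + 1) → Derivation ℂ (FractionRing S) (FractionRing S) := Fin.cons E d
  let w : Fin (n + 1) → Ω[FractionRing S⁄ℂ] :=
    Fin.cons (X⁻¹ • KaehlerDifferential.D ℂ (FractionRing S) X)
      (fun i => KaehlerDifferential.D ℂ (FractionRing S) (g i : FractionRing S))
  -- The derivations `dd j` are dual to the forms `w j`, so `Φ` and `Ψ` will be mutually inverse.
  let Φ : Ω[FractionRing S⁄ℂ] →ₗ[FractionRing S] (Fin (n + 1) → FractionRing S) :=
    LinearMap.pi fun j => (dd j).liftKaehlerDifferential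
  let Ψ : (Fin (n + 1) → FractionRing S) →ₗ[FractionRing S] Ω[FractionRing S⁄ℂ] :=
    Fintype.linearCombination (FractionRing S) w
  have hΦD : ∀ z j, Φ (KaehlerDifferential.D ℂ (FractionRing S) z) j = dd j z := fun z j =>
    Derivation.liftKaehlerDifferential_comp_D (dd j) z
  have hΦw : ∀ j, Φ (w j) = Pi.single j 1 := by
    intro j
    refine Fin.cases ?_ (fun i => ?_) j
    · change Φ (X⁻¹ • KaehlerDifferential.D ℂ (FractionRing S) X) = _
      rw [map_smul]
      ext k
      rw [Pi.smul_apply, hΦD]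
      refine Fin.cases ?_ (fun l => ?_) k
      · change X⁻¹ • E X = _
        rw [hE1, Pi.single_eq_same, smul_eq_mul, inv_mul_cancel₀ hQ]
      · change X⁻¹ • d l X = _
        rw [hd1, smul_zero, Pi.single_eq_of_ne (Fin.succ_ne_zero l)]
    · change Φ (KaehlerDifferential.D ℂ (FractionRing S) (g i : FractionRing S)) = _
      ext k
      rw [hΦD]
      refine Fin.cases ?_ (fun l => ?_) k
      · change E _ = _
        rw [hE0', Pi.single_eq_of_ne (Fin.succ_ne_zero i).symm]
      · change d l _ = _
        rw [hd0, ← he, Module.Basis.repr_self]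
        by_cases hil : i = l
        · subst hil; simp
        · rw [Finsupp.single_eq_of_ne (Ne.symm hil), Pi.single_eq_of_ne
            (fun h => hil (Fin.succ_injective _ h).symm)]
          rfl
  have h1 : Φ ∘ₗ Ψ = LinearMap.id := by
    refine LinearMap.pi_ext' fun j => LinearMap.ext_ring ?_
    change Φ (Ψ (Pi.single j 1)) = Pi.single j 1
    rw [Fintype.linearCombination_apply_single, one_smul, hΦw]
  have h2 : Ψ ∘ₗ Φ = LinearMap.id := by
    -- The universal derivation and its image under `Ψ ∘ Φ` agree on the function field of `X` and
    -- on `x`, hence everywhere.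
    have h3 : (Ψ ∘ₗ Φ).compDer (KaehlerDifferential.D ℂ (FractionRing S)) =
        KaehlerDifferential.D ℂ (FractionRing S) := by
      refine derivation_ext hx1 hx (fun c => ?_) ?_
      · change Ψ (Φ (KaehlerDifferential.D ℂ (FractionRing S) (c : FractionRing S))) = _
        have h4 : Φ (KaehlerDifferential.D ℂ (FractionRing S) (c : FractionRing S)) =
            Fin.cons 0 fun i =>
              ((e.repr (KaehlerDifferential.D ℂ (functionField 𝒜) c) i : functionField 𝒜) :
                FractionRing S) := by
          ext k
          rw [hΦD]
          refine Fin.cases ?_ (fun l => ?_) k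
          · exact hE0' c
          · exact hd0 l c
        rw [h4, Fintype.linearCombination_apply, Fin.sum_univ_succ, Fin.cons_zero, zero_smul,
          zero_add]
        have h5 := congrArg (KaehlerDifferential.map ℂ ℂ (functionField 𝒜) (FractionRing S))
          (e.sum_repr (KaehlerDifferential.D ℂ (functionField 𝒜) c))
        rw [KaehlerDifferential.map_D, map_sum] at h5
        rw [← algebraMap_functionField c, ← h5]
        refine Finset.sum_congr rfl fun i _ => ?_
        rw [Fin.cons_succ, map_smul, he, KaehlerDifferential.map_D]
        change algebraMap (functionField 𝒜) (FractionRing S) (e.repr _ i) •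
          KaehlerDifferential.D ℂ (FractionRing S)
            (algebraMap (functionField 𝒜) (FractionRing S) (g i)) = _
        rw [algebraMap_smul]
      · change Ψ (Φ (KaehlerDifferential.D ℂ (FractionRing S) X)) = _
        have h4 : Φ (KaehlerDifferential.D ℂ (FractionRing S) X) = Pi.single 0 X := by
          ext k
          rw [hΦD]
          refine Fin.cases ?_ (fun l => ?_) k
          · rw [Pi.single_eq_same]; exact hE1
          · rw [Pi.single_eq_of_ne (Fin.succ_ne_zero l)]; exact hd1 l
        rw [h4, Fintype.linearCombination_apply_single]
        change X • X⁻¹ • _ = _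
        rw [smul_smul, mul_inv_cancel₀ hQ, one_smul]
    refine LinearMap.ext_on_range (v := KaehlerDifferential.D ℂ (FractionRing S))
      (KaehlerDifferential.span_range_derivation ℂ (FractionRing S)) fun z => ?_
    exact DFunLike.congr_fun h3 z
  let ε : Module.Basis (Fin (n + 1)) (FractionRing S) Ω[FractionRing S⁄ℂ] :=
    Module.Basis.ofEquivFun (LinearEquiv.ofLinearMap Φ Ψ h1 h2)
  have hε : ∀ j, ε j = w j := by
    intro j
    rw [Module.Basis.coe_ofEquivFun]
    change Ψ (Pi.single j 1) = _
    rw [Fintype.linearCombination_apply_single, one_smul]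
  refine ⟨ε, dd, hε 0, fun i => hε i.succ, hΦD, hE0', fun c i => hd0 i c, hE1, hd1⟩

end Frames

end
end CYCone

/-! ### Top forms, and the volume form on U -/

set_option linter.unusedSectionVars false
namespace CYCone
noncomputable section

section TopForms

/-- Relative to the basis, `db₁ ∧ ⋯ ∧ dbₘ` has as coefficient a Jacobian determinant with entries in
`O`. -/
theorem exists_smul_of_mem_formsOver_top {F : Type*} [Field F] [Algebra ℂ F] {m : ℕ}
    (e : Module.Basis (Fin m) F Ω[F⁄ℂ]) {O : Subalgebra ℂ F}
    (he : ∀ h ∈ O, ∀ i, e.repr (KaehlerDifferential.D ℂ F h) i ∈ O) {ω : Forms F}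
    (hω : ω ∈ formsOver O m) : ∃ a ∈ O, ω = a • ExteriorAlgebra.ιMulti F m e := by
  induction hω using Submodule.span_induction with
  | mem x hx =>
    obtain ⟨a, ha, b, hb, rfl⟩ := hx
    refine ⟨_, O.mul_mem ha ?_, by rw [wedgeD_eq_det_smul e, smul_smul]⟩
    rw [Matrix.det_apply]
    refine O.sum_mem fun σ _ => ?_
    rw [Units.smul_def, zsmul_eq_mul]
    exact O.mul_mem (intCast_mem _ _) (O.prod_mem fun i _ => he _ (hb _) _)
  | zero => exact ⟨0, O.zero_mem, by rw [zero_smul]⟩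
  | add x y _ _ hx hy =>
    obtain ⟨a, ha, rfl⟩ := hx
    obtain ⟨b, hb, rfl⟩ := hy
    exact ⟨a + b, O.add_mem ha hb, by rw [add_smul]⟩
  | smul c x _ hx =>
    obtain ⟨a, ha, rfl⟩ := hx
    exact ⟨c • a, O.smul_mem ha c, by rw [smul_assoc]⟩

variable {S : Type*} [CommRing S] [IsDomain S] [Algebra ℂ S] {𝒜 : ℕ → Submodule ℂ S}
  [GradedAlgebra 𝒜]

theorem IsHomFrac.prod {ι : Type*} (t : Finset ι) {e : ι → ℤ} {z : ι → FractionRing S}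
    (h : ∀ i ∈ t, IsHomFrac 𝒜 (e i) (z i)) : IsHomFrac 𝒜 (∑ i ∈ t, e i) (∏ i ∈ t, z i) := by
  classical
  induction t using Finset.induction_on with
  | empty => simpa using IsHomFrac.const (𝒜 := 𝒜) 1
  | insert a t ha ih =>
    rw [Finset.sum_insert ha, Finset.prod_insert ha]
    exact (h a (Finset.mem_insert_self a t)).mul
      (ih fun i hi => h i (Finset.mem_insert_of_mem hi))

/-- The graded counterpart: the frame has degree zero, so each term of the Jacobian determinant has
the total degree of the `bᵢ`. -/
theorem exists_smul_of_mem_homForms_top {m : ℕ}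
    (e : Module.Basis (Fin m) (FractionRing S) Ω[FractionRing S⁄ℂ])
    (he : ∀ k z i, IsHomFrac 𝒜 k z →
      IsHomFrac 𝒜 k (e.repr (KaehlerDifferential.D ℂ (FractionRing S) z) i)) {k : ℤ}
    {ω : Forms (FractionRing S)} (hω : ω ∈ homForms 𝒜 m k) :
    ∃ a, IsHomFrac 𝒜 k a ∧ ω = a • ExteriorAlgebra.ιMulti (FractionRing S) m e := by
  induction hω using Submodule.span_induction with
  | mem x hx =>
    obtain ⟨l, d, hk, a, ha, b, hb, rfl⟩ := hx
    refine ⟨a * _, ?_, by rw [wedgeD_eq_det_smul e, smul_smul]⟩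
    rw [← hk]
    refine ha.mul ?_
    rw [Matrix.det_apply]
    refine IsHomFrac.finset_sum fun σ _ => ?_
    have h1 : IsHomFrac 𝒜 (∑ i, d i) (∏ i, e.repr
        (KaehlerDifferential.D ℂ (FractionRing S) (b i)) (σ i)) :=
      IsHomFrac.prod Finset.univ fun i _ => he _ _ _ (hb i)
    rw [Units.smul_def, zsmul_eq_mul]
    have h2 := (IsHomFrac.const (𝒜 := 𝒜) ((Equiv.Perm.sign σ : ℤ) : ℂ)).mul h1
    rw [map_intCast, zero_add] at h2
    exact h2
  | zero => exact ⟨0, IsHomFrac.zero k, by rw [zero_smul]⟩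
  | add x y _ _ hx hy =>
    obtain ⟨a, ha, rfl⟩ := hx
    obtain ⟨b, hb, rfl⟩ := hy
    exact ⟨a + b, ha.add hb, by rw [add_smul]⟩
  | smul c x _ hx =>
    obtain ⟨a, ha, rfl⟩ := hx
    exact ⟨c • a, (homPart 𝒜 k).smul_mem c ha, by rw [smul_assoc]⟩

theorem contr_wedgeD_mem_homForms {d : ℤ} {ξ : Derivation ℂ (FractionRing S) (FractionRing S)}
    (hξ : IsHomDer 𝒜 d ξ) {p : ℕ} (e : Fin (p + 1) → ℤ) (b : Fin (p + 1) → FractionRing S)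
    (hb : ∀ i, IsHomFrac 𝒜 (e i) (b i)) :
    contr ξ (wedgeD b) ∈ homForms 𝒜 p (∑ i, e i + d) := by
  induction p with
  | zero =>
    rw [wedgeD_succ, contr_D_mul]
    have : (wedgeD fun i => b (Fin.succ i) : Forms (FractionRing S)) = 1 := by
      rw [wedgeD, ExteriorAlgebra.ιMulti_zero_apply]
    rw [this, contr_one, mul_zero, sub_zero]
    refine Submodule.subset_span ⟨e 0 + d, ![], by simp, _, hξ _ _ (hb 0), ![],
      fun i => i.elim0, by rw [wedgeD, ExteriorAlgebra.ιMulti_zero_apply]⟩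
  | succ p ih =>
    rw [wedgeD_succ, contr_D_mul]
    refine sub_mem (Submodule.subset_span ⟨e 0 + d, fun i => e i.succ, ?_, _, hξ _ _ (hb 0), _,
      fun i => hb i.succ, rfl⟩) ?_
    · rw [Fin.sum_univ_succ e]; ring
    · have h1 := D_mul_mem_homForms (hb 0) (ih (fun i => e i.succ) _ fun i => hb i.succ)
      have h2 : ∑ i : Fin (p + 1), e i.succ + d + e 0 = ∑ i, e i + d := by
        rw [Fin.sum_univ_succ e]; ring
      rwa [h2] at h1

theorem smul_mem_homForms {p : ℕ} {k l : ℤ} {a : FractionRing S} (ha : IsHomFrac 𝒜 l a)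
    {ω : Forms (FractionRing S)} (hω : ω ∈ homForms 𝒜 p k) : a • ω ∈ homForms 𝒜 p (k + l) := by
  induction hω using Submodule.span_induction with
  | mem x hx =>
    obtain ⟨m, e, h, c, hc, b, hb, rfl⟩ := hx
    exact Submodule.subset_span ⟨l + m, e, by omega, a * c, ha.mul hc, b, hb, smul_smul _ _ _⟩
  | zero => rw [smul_zero]; exact zero_mem _
  | add x y _ _ hx hy => rw [smul_add]; exact add_mem hx hy
  | smul c x _ hx => rw [smul_comm]; exact Submodule.smul_mem _ c hx

theorem contr_mem_homForms {d : ℤ} {ξ : Derivation ℂ (FractionRing S) (FractionRing S)}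
    (hξ : IsHomDer 𝒜 d ξ) {p : ℕ} {k : ℤ} {ω : Forms (FractionRing S)}
    (hω : ω ∈ homForms 𝒜 (p + 1) k) : contr ξ ω ∈ homForms 𝒜 p (k + d) := by
  induction hω using Submodule.span_induction with
  | mem x hx =>
    obtain ⟨m, e, h, c, hc, b, hb, rfl⟩ := hx
    rw [map_smul]
    have := smul_mem_homForms hc (contr_wedgeD_mem_homForms hξ e b hb)
    rwa [show ∑ i, e i + d + m = k + d by omega] at this
  | zero => rw [map_zero]; exact zero_mem _
  | add x y _ _ hx hy => rw [map_add]; exact add_mem hx hy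
  | smul c x _ hx =>
    rw [← algebraMap_smul (FractionRing S) c x, map_smul, algebraMap_smul]
    exact Submodule.smul_mem _ c hx

end TopForms

section Instances

/-- The vector space structure on the rational sections of `ω_X`. -/
abbrev canModule (F : Type*) [Field F] [Algebra ℂ F] (n : ℕ) : Module F (Can F n) := inferInstance

variable {S : Type*} [CommRing S] [IsDomain S] [Algebra ℂ S] (𝒜 : ℕ → Submodule ℂ S)
  [GradedAlgebra 𝒜]

scoped instance (n : ℕ) : Module (functionField 𝒜) (Can (functionField 𝒜) n) :=
  canModule (functionField 𝒜) n

scoped instance (n : ℕ) : SMul (functionField 𝒜) (Can (functionField 𝒜) n) :=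
  (canModule (functionField 𝒜) n).toSMul

scoped instance (k : ℤ) : Module (functionField 𝒜) (twist 𝒜 k) := Submodule.module (twist 𝒜 k)

scoped instance (k : ℤ) : SMul (functionField 𝒜) (twist 𝒜 k) :=
  (Submodule.module (twist 𝒜 k)).toSMul

end Instances

section Volume

variable {S : Type*} [CommRing S] [IsDomain S] [Algebra ℂ S] (𝒜 : ℕ → Submodule ℂ S)
  [GradedAlgebra 𝒜]

/-- A smooth projective variety `X = Proj S`, with `S` generated in degree one, together with an
isomorphism `ω_X ≅ O_X(-N)`. -/
structure ConeData (n N : ℕ) where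
  gen : Algebra.adjoin ℂ (𝒜 1 : Set S) = ⊤
  ne_bot : 𝒜 1 ≠ ⊥
  coords : ∀ p : ProjectiveSpectrum 𝒜, ∃ (g : Fin n → functionField 𝒜)
      (e : Module.Basis (Fin n) (functionField 𝒜) Ω[functionField 𝒜⁄ℂ]),
      (∀ i, g i ∈ localX 𝒜 p) ∧
      (∀ i, e i = KaehlerDifferential.D ℂ (functionField 𝒜) (g i)) ∧
      ∀ h ∈ localX 𝒜 p, ∀ i, e.repr (KaehlerDifferential.D ℂ (functionField 𝒜) h) i ∈ localX 𝒜 p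
  one_le : 1 ≤ N
  iso : Can (functionField 𝒜) n ≃ₗ[functionField 𝒜] twist 𝒜 (-N)
  mem_iff : ∀ (p : ProjectiveSpectrum 𝒜) (η : Can (functionField 𝒜) n),
      η ∈ canStalk n (localX 𝒜 p) ↔ (iso η : FractionRing S) ∈ twistStalk 𝒜 (-N) p

variable {𝒜} {n N : ℕ}

namespace ConeData

variable (D : ConeData 𝒜 n N)

/-- The fraction of degree `-N` corresponding to a rational `n`-form on `X`. -/
def val (η : Can (functionField 𝒜) n) : FractionRing S := D.iso η

theorem val_smul (c : functionField 𝒜) (η : Can (functionField 𝒜) n) :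
    D.val (c • η) = c * D.val η := by
  rw [val, map_smul]; rfl

theorem val_add (η ζ : Can (functionField 𝒜) n) : D.val (η + ζ) = D.val η + D.val ζ := by
  rw [val, map_add]; rfl

theorem val_ne_zero {η : Can (functionField 𝒜) n} (h : η ≠ 0) : D.val η ≠ 0 := by
  intro h0
  exact h ((LinearEquiv.map_eq_zero_iff D.iso).1 (Subtype.ext h0))

theorem val_hom (η : Can (functionField 𝒜) n) : IsHomFrac 𝒜 (-N) (D.val η) := (D.iso η).2

theorem exists_val_eq {z : FractionRing S} (hz : IsHomFrac 𝒜 (-N) z) : ∃ η, D.val η = z :=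
  ⟨D.iso.symm ⟨z, hz⟩, by rw [val, LinearEquiv.apply_symm_apply]⟩

theorem exists_degree_one (D : ConeData 𝒜 n N) : ∃ x ∈ 𝒜 1, x ≠ 0 := Submodule.exists_mem_ne_zero_of_ne_bot D.ne_bot

/-- The generic point of `X`. -/
def genericPoint (D : ConeData 𝒜 n N) : ProjectiveSpectrum 𝒜 where
  asHomogeneousIdeal := ⊥
  isPrime := Ideal.isPrime_bot
  not_irrelevant_le := fun h => by
    obtain ⟨x, hx, hx0⟩ := D.exists_degree_one
    exact hx0 (h (mem_irrelevant_of_mem_one hx))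

theorem exists_basis (D : ConeData 𝒜 n N) : ∃ (_ : Module.Basis (Fin n) (functionField 𝒜) Ω[functionField 𝒜⁄ℂ]), True := by
  obtain ⟨-, e, -⟩ := D.coords D.genericPoint
  exact ⟨e, trivial⟩

theorem exists_form_ne_zero (D : ConeData 𝒜 n N) : ∃ η : Can (functionField 𝒜) n, η ≠ 0 := by
  obtain ⟨x, hx, hx0⟩ := D.exists_degree_one
  have hQ := algebraMap_frac_ne_zero hx0
  obtain ⟨η, hη⟩ := D.exists_val_eq (z := algebraMap S (FractionRing S) x ^ (-N : ℤ))
    (((IsHomFrac.algebraMap hx).zpow _).cast (by push_cast; ring))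
  refine ⟨η, ?_⟩
  rintro rfl
  have : D.val 0 = 0 := by rw [val, map_zero]; rfl
  exact zpow_ne_zero _ hQ (hη.symm.trans this)

theorem exists_smul (D : ConeData 𝒜 n N) {η ζ : Can (functionField 𝒜) n} (hη : η ≠ 0) :
    ∃ c : functionField 𝒜, ζ = c • η := by
  obtain ⟨e, -⟩ := D.exists_basis
  obtain ⟨c, hc⟩ := exists_smul_of_top e (fun h => hη (Subtype.ext h)) η.2 ζ.2
  exact ⟨c, Subtype.ext hc⟩

/-- The form `(α(η) x)⁻¹ dx ∧ η` on `U`. -/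
def preVol (x : S) (η : Can (functionField 𝒜) n) : Forms (FractionRing S) :=
  ((D.val η)⁻¹ * (algebraMap S (FractionRing S) x)⁻¹) •
    (ExteriorAlgebra.ι (FractionRing S)
      (KaehlerDifferential.D ℂ (FractionRing S) (algebraMap S (FractionRing S) x)) *
      pullForms (functionField 𝒜) (FractionRing S) η)

theorem D_mul_pullForms_eq_zero (D : ConeData 𝒜 n N) (c : functionField 𝒜) (η : Can (functionField 𝒜) n) :
    ExteriorAlgebra.ι (FractionRing S) (KaehlerDifferential.D ℂ (FractionRing S)
      (c : FractionRing S)) * pullForms (functionField 𝒜) (FractionRing S) η = 0 := by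
  obtain ⟨e, -⟩ := D.exists_basis
  rw [← algebraMap_functionField, ← pullForms_D_mul, D_mul_eq_zero_of_top e η.2, map_zero]

/-- Replacing `η` by `cη` multiplies `α(η)` by `c` as well. If `y = d x` with `d` a function on `X`,
then `dy ∧ η = d dx ∧ η`, because the `(n + 1)`-form `dd ∧ η` comes from `X` and vanishes. -/
theorem preVol_eq {x y : S} (hx : x ∈ 𝒜 1) (hx0 : x ≠ 0) (hy : y ∈ 𝒜 1) (hy0 : y ≠ 0)
    {η ζ : Can (functionField 𝒜) n} (hη : η ≠ 0) (hζ : ζ ≠ 0) :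
    D.preVol x η = D.preVol y ζ := by
  have hQx := algebraMap_frac_ne_zero hx0
  have hQy := algebraMap_frac_ne_zero hy0
  obtain ⟨c, rfl⟩ := D.exists_smul (ζ := ζ) hη
  obtain ⟨d, hd⟩ := exists_mul_pow hx hx0 (IsHomFrac.algebraMap hy)
  rw [Nat.cast_one, zpow_one] at hd
  have hc0 : (c : FractionRing S) ≠ 0 := by
    intro h
    exact hζ (by rw [show c = 0 from Subtype.ext h, zero_smul])
  have hd0 : (d : FractionRing S) ≠ 0 := by
    intro h
    rw [h, zero_mul] at hd
    exact hQy hd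
  have hv := D.val_ne_zero hη
  have h1 : pullForms (functionField 𝒜) (FractionRing S) ((c • η : Can (functionField 𝒜) n) :
      Forms (functionField 𝒜)) = (c : FractionRing S) •
      pullForms (functionField 𝒜) (FractionRing S) η := pullForms_smul c _
  rw [preVol, preVol, h1, hd, Derivation.leibniz, map_add, map_smul, map_smul, add_mul,
    mul_smul_comm, smul_mul_assoc, smul_mul_assoc, mul_smul_comm, D.D_mul_pullForms_eq_zero,
    smul_zero, smul_zero, add_zero, smul_smul, smul_smul, D.val_smul]
  congr 1
  field_simp

/-- The volume form of degree `N` on `U`. -/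
def vol : Forms (FractionRing S) :=
  D.preVol D.exists_degree_one.choose D.exists_form_ne_zero.choose

theorem vol_eq {x : S} (hx : x ∈ 𝒜 1) (hx0 : x ≠ 0) {η : Can (functionField 𝒜) n} (hη : η ≠ 0) :
    D.vol = D.preVol x η :=
  D.preVol_eq D.exists_degree_one.choose_spec.1 D.exists_degree_one.choose_spec.2 hx hx0
    D.exists_form_ne_zero.choose_spec hη

/-- A local frame of the differentials on `U` near a point `q`. -/
theorem exists_local_frame (q : ConePoint 𝒜) :
    ∃ x ∈ 𝒜 1, x ∉ q.1.asIdeal ∧ ∃ η : Can (functionField 𝒜) n, η ≠ 0 ∧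
      D.val η * algebraMap S (FractionRing S) x ^ N ∈ localU q ∧
      (D.val η * algebraMap S (FractionRing S) x ^ N)⁻¹ ∈ localU q ∧
      η ∈ canStalk n (localX 𝒜 (corePoint q)) ∧
      (D.val η * algebraMap S (FractionRing S) x ^ N)⁻¹ ∈ twistStalk 𝒜 0 (corePoint q) ∧
      ∃ (g : Fin n → functionField 𝒜)
        (ε : Module.Basis (Fin (n + 1)) (FractionRing S) Ω[FractionRing S⁄ℂ]),
        (∀ i, (g i : FractionRing S) ∈ localU q) ∧ (η : Forms (functionField 𝒜)) = wedgeD g ∧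
        D.vol = (D.val η)⁻¹ • ExteriorAlgebra.ιMulti (FractionRing S) (n + 1) ε ∧
        (∀ z ∈ localU q, ∀ j,
          ε.repr (KaehlerDifferential.D ℂ (FractionRing S) z) j ∈ localU q) ∧
        ∀ k z j, IsHomFrac 𝒜 k z →
          IsHomFrac 𝒜 k (ε.repr (KaehlerDifferential.D ℂ (FractionRing S) z) j) := by
  obtain ⟨x, hx, hxq⟩ := exists_degree_one_notMem D.gen q.2
  have hx0 : x ≠ 0 := fun h => hxq (h ▸ zero_mem _)
  have hQ := algebraMap_frac_ne_zero hx0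
  set p := corePoint q with hp
  have hxp : x ∉ p.asHomogeneousIdeal := notMem_corePoint hxq
  obtain ⟨g, e, hg, he, her⟩ := D.coords p
  obtain ⟨ε, dd, hε0, hεs, hεr, hd0, hds, hdx, hdsx⟩ := exists_frame hx hx0 e g he
  have hwg : ExteriorAlgebra.ιMulti (functionField 𝒜) n e = wedgeD g := by
    rw [wedgeD]; congr 1; exact funext he
  let η : Can (functionField 𝒜) n := ⟨wedgeD g, ExteriorAlgebra.ιMulti_range _ n ⟨_, rfl⟩⟩
  have hη : η ≠ 0 := by
    intro h
    exact ιMulti_basis_ne_zero e (hwg.trans (congrArg Subtype.val h))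
  have hηp : η ∈ canStalk n (localX 𝒜 p) :=
    Submodule.subset_span ⟨1, (localX 𝒜 p).one_mem, g, hg, (one_smul _ _).symm⟩
  have hpow : x ^ N ∈ 𝒜 N := by simpa using SetLike.pow_mem_graded N hx
  have hpowp : x ^ N ∉ p.asHomogeneousIdeal := fun h => hxp (p.isPrime.mem_of_pow_mem N h)
  -- Let `η'` correspond to `x ^ (-N)`, a section of `L^{-N}` near the point, so `η'` is regular. As
  -- `η` generates the regular `n`-forms, `η' = u η` with `u` regular, and comparing values shows
  -- that `u` is the inverse of `α(η) x ^ N`.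
  obtain ⟨η', hη'⟩ := D.exists_val_eq (z := (algebraMap S (FractionRing S) x ^ N)⁻¹)
    (((IsHomFrac.algebraMap hx).pow N).inv'.cast (by push_cast; ring))
  have hη'p : η' ∈ canStalk n (localX 𝒜 p) := by
    rw [D.mem_iff]
    change D.val η' ∈ _
    rw [hη']
    exact ⟨0, N, by simp, 1, SetLike.one_mem_graded 𝒜, x ^ N, hpow, hpowp, by
      rw [map_one, one_div, map_pow]⟩
  obtain ⟨u, hu, hηu⟩ := exists_smul_of_mem_formsOver_top e her hη'p
  have hηu' : η' = u • η := Subtype.ext (hηu.trans (by rw [hwg]; rfl))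
  have hinv : (D.val η * algebraMap S (FractionRing S) x ^ N)⁻¹ = u := by
    rw [hηu', D.val_smul] at hη'
    have hv := D.val_ne_zero hη
    have h1 : (u : FractionRing S) * (D.val η * algebraMap S (FractionRing S) x ^ N) = 1 := by
      rw [← mul_assoc, hη', inv_mul_cancel₀ (pow_ne_zero _ hQ)]
    exact (eq_inv_of_mul_eq_one_left h1).symm
  refine ⟨x, hx, hxq, η, hη, ?_, ?_, hηp, ?_, g, ε, ?_, rfl, ?_, ?_, ?_⟩
  · have h1 : D.val η ∈ twistStalk 𝒜 (-N) p := (D.mem_iff p η).1 hηp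
    exact (localU q).mul_mem (twistStalk_subset_localU h1)
      ((localU q).pow_mem (algebraMap_mem_localU x q) N)
  · rw [hinv]; exact twistStalk_subset_localU hu
  · rw [hinv]; exact hu
  · exact fun i => twistStalk_subset_localU (hg i)
  · rw [D.vol_eq hx hx0 hη, preVol, mul_smul]
    congr 1
    rw [ExteriorAlgebra.ιMulti_succ_apply, hε0, map_smul, smul_mul_assoc]
    congr 2
    change pullForms _ _ (wedgeD g) = _
    rw [pullForms_wedgeD, wedgeD]
    congr 1
    exact funext fun i => (hεs i).symm
  · intro z hz j
    rw [hεr]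
    refine derivation_algebraMap_mem_localU hx hxq (fun c hc => ?_) ?_ hz
    · refine Fin.cases ?_ (fun i => ?_) j
      · rw [hd0]; exact (localU q).zero_mem
      · rw [hds]; exact twistStalk_subset_localU (her c hc i)
    · refine Fin.cases ?_ (fun i => ?_) j
      · rw [hdx]; exact algebraMap_mem_localU x q
      · rw [hdsx]; exact (localU q).zero_mem
  · intro k z j hz
    rw [hεr]
    have : IsHomDer 𝒜 0 (dd j) := by
      refine isHomDer_of hx hx0 (fun c => ?_) ?_
      · refine Fin.cases ?_ (fun i => ?_) j
        · rw [hd0]; exact IsHomFrac.zero _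
        · rw [hds]; exact isHomFrac_coe _
      · refine Fin.cases ?_ (fun i => ?_) j
        · rw [hdx]; exact (IsHomFrac.algebraMap hx).cast (by simp)
        · rw [hdsx]; exact IsHomFrac.zero _
    exact (this k z hz).cast (add_zero k)

end ConeData

end Volume

end
end CYCone

/-! ### Forms on U as functions and vector fields -/

set_option linter.unusedSectionVars false
namespace CYCone
noncomputable section

variable {S : Type*} [CommRing S] [IsDomain S] [Algebra ℂ S] {𝒜 : ℕ → Submodule ℂ S}
  [GradedAlgebra 𝒜]

/-- Stability under homogeneous components, restated for families whose degrees are only required to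
be distinct, such as `m ↦ N m`. -/
theorem family_component_mem {W : Submodule ℂ (FractionRing S)}
    (hW : ∀ f : ℤ →₀ FractionRing S, (∀ k, IsHomFrac 𝒜 k (f k)) → ∑ k ∈ f.support, f k ∈ W →
      ∀ k, f k ∈ W) {ι : Type*}
    {deg : ι → ℤ} (hdeg : Function.Injective deg) (t : Finset ι) {f : ι → FractionRing S}
    (hf : ∀ i, IsHomFrac 𝒜 (deg i) (f i)) (h : ∑ i ∈ t, f i ∈ W) {i : ι} (hi : i ∈ t) :
    f i ∈ W := by
  classical
  set g : ℤ →₀ FractionRing S := ∑ i ∈ t, Finsupp.single (deg i) (f i) with hg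
  have hgk : ∀ k, g k = ∑ i ∈ t, if deg i = k then f i else 0 := fun k => by
    rw [hg, Finsupp.finsetSum_apply]
    exact Finset.sum_congr rfl fun i _ => Finsupp.single_apply
  have h1 : ∀ k, IsHomFrac 𝒜 k (g k) := fun k => by
    rw [hgk]
    refine IsHomFrac.finset_sum fun i _ => ?_
    split_ifs with hk
    · exact hk ▸ hf i
    · exact IsHomFrac.zero k
  have h2 : ∑ k ∈ g.support, g k = ∑ i ∈ t, f i := by
    change g.sum (fun _ a => a) = _
    rw [hg, ← Finsupp.sum_finsetSum_index (fun _ => rfl) (fun _ _ _ => rfl)]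
    exact Finset.sum_congr rfl fun i _ => Finsupp.sum_single_index rfl
  have h3 := hW g h1 (h2 ▸ h) (deg i)
  rwa [hgk, Finset.sum_congr rfl fun j _ => if_congr hdeg.eq_iff rfl rfl, Finset.sum_ite_eq',
    if_pos hi] at h3

theorem family_component_mem_regU (hgen : Algebra.adjoin ℂ (𝒜 1 : Set S) = ⊤) {ι : Type*}
    {deg : ι → ℤ} (hdeg : Function.Injective deg) (t : Finset ι) {f : ι → FractionRing S}
    (hf : ∀ i, IsHomFrac 𝒜 (deg i) (f i)) (h : ∑ i ∈ t, f i ∈ regU 𝒜) {i : ι} (hi : i ∈ t) :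
    f i ∈ regU 𝒜 :=
  family_component_mem (W := Subalgebra.toSubmodule (regU 𝒜))
    (fun _ hf h => component_mem_regU hgen hf h) hdeg t hf h hi

variable (𝒜) in
/-- The regular functions on `U` whose homogeneous components have degrees divisible by `N`. -/
def regMod (N : ℕ) : Submodule ℂ (FractionRing S) :=
  Subalgebra.toSubmodule (regU 𝒜) ⊓ ⨆ m : ℤ, homPart 𝒜 (N * m)

theorem mem_regMod_of_hom {N : ℕ} {g : FractionRing S} (hg : g ∈ regU 𝒜) {m : ℤ}
    (hm : IsHomFrac 𝒜 (N * m) g) : g ∈ regMod 𝒜 N :=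
  ⟨hg, Submodule.mem_iSup_of_mem m hm⟩

/-- The homogeneous components of a regular function are regular, so it suffices to treat
homogeneous regular functions. -/
theorem regMod_induction (hgen : Algebra.adjoin ℂ (𝒜 1 : Set S) = ⊤) {N : ℕ} (hN : 1 ≤ N)
    {C : FractionRing S → Prop} (hom : ∀ (m : ℤ) g, g ∈ regU 𝒜 → IsHomFrac 𝒜 (N * m) g → C g)
    (zero : C 0) (add : ∀ a b, C a → C b → C (a + b)) {g : FractionRing S}
    (hg : g ∈ regMod 𝒜 N) : C g := by
  obtain ⟨h1, h2⟩ := hg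
  obtain ⟨f, hf, rfl⟩ := (Submodule.mem_iSup_iff_exists_finsupp _ _).1 h2
  have hdeg : Function.Injective fun m : ℤ => (N : ℤ) * m := fun a b h =>
    mul_left_cancel₀ (by positivity : (N : ℤ) ≠ 0) h
  have h3 : ∀ m ∈ f.support, f m ∈ regU 𝒜 := fun m hm =>
    family_component_mem_regU hgen hdeg f.support hf h1 hm
  exact Finset.sum_induction _ C add zero fun m hm => hom m _ (h3 m hm) (hf m)

theorem IsHomDer.mem_iSup {d N : ℤ} {ξ : Derivation ℂ (FractionRing S) (FractionRing S)}
    (h : IsHomDer 𝒜 (N * d) ξ) {g : FractionRing S} (hg : g ∈ ⨆ m : ℤ, homPart 𝒜 (N * m)) :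
    ξ g ∈ ⨆ m : ℤ, homPart 𝒜 (N * m) := by
  refine Submodule.iSup_induction _ (motive := fun g => ξ g ∈ ⨆ m : ℤ, homPart 𝒜 (N * m)) hg
    (fun m x hx => ?_) ?_ ?_
  · exact Submodule.mem_iSup_of_mem (m + d) ((h _ x hx).cast (by ring))
  · rw [map_zero]; exact zero_mem _
  · intro x y hx hy; rw [map_add]; exact add_mem hx hy

theorem IsHomDer.mem_regMod {d : ℤ} {N : ℕ} {ξ : Derivation ℂ (FractionRing S) (FractionRing S)}
    (h : IsHomDer 𝒜 (N * d) ξ) (hr : IsRegDer 𝒜 ξ) {g : FractionRing S} (hg : g ∈ regMod 𝒜 N) :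
    ξ g ∈ regMod 𝒜 N := ⟨hr.apply_mem hg.1, h.mem_iSup hg.2⟩

theorem mul_mem_regMod {N : ℕ} {d : ℤ} {a g : FractionRing S} (ha : a ∈ regU 𝒜)
    (had : IsHomFrac 𝒜 (N * d) a) (hg : g ∈ regMod 𝒜 N) : a * g ∈ regMod 𝒜 N := by
  refine ⟨(regU 𝒜).mul_mem ha hg.1, ?_⟩
  refine Submodule.iSup_induction _
    (motive := fun g => a * g ∈ ⨆ m : ℤ, homPart 𝒜 (N * m)) hg.2 (fun m x hx => ?_) ?_ ?_
  · exact Submodule.mem_iSup_of_mem (d + m) ((had.mul hx).cast (by ring))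
  · rw [mul_zero]; exact zero_mem _
  · intro x y hx hy; rw [mul_add]; exact add_mem hx hy

namespace ConeData

variable {n N : ℕ} (D : ConeData 𝒜 n N)

/-- With `η = dg₁ ∧ ⋯ ∧ dgₙ`, the form is `(α(η) x)⁻¹ dx ∧ dg₁ ∧ ⋯ ∧ dgₙ`; the coefficient is
regular at `q` since `α(η) x ^ N` is a unit there. -/
theorem vol_eq_smul_wedgeD (q : ConePoint 𝒜) :
    ∃ (a : FractionRing S) (b : Fin (n + 1) → FractionRing S) (e : Fin (n + 1) → ℤ),
      a ∈ localU q ∧ (∀ i, b i ∈ localU q) ∧ D.vol = a • wedgeD b ∧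
      (∀ i, IsHomFrac 𝒜 (e i) (b i)) ∧ IsHomFrac 𝒜 (N - ∑ i, e i) a := by
  obtain ⟨x, hx, hxq, η, hη, h1, h2, -, -, g, ε, hg, hηg, -, -, -⟩ := D.exists_local_frame q
  have hx0 : x ≠ 0 := fun h => hxq (h ▸ zero_mem _)
  have hQ := algebraMap_frac_ne_zero hx0
  have hv := D.val_ne_zero hη
  refine ⟨(D.val η)⁻¹ * (algebraMap S (FractionRing S) x)⁻¹,
    Fin.cons (algebraMap S (FractionRing S) x) fun i => (g i : FractionRing S), Fin.cons 1 0,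
    ?_, ?_, ?_, ?_, ?_⟩
  · have h3 : (D.val η)⁻¹ = (D.val η * algebraMap S (FractionRing S) x ^ N)⁻¹ *
        algebraMap S (FractionRing S) x ^ N := by
      field_simp
    rw [h3]
    exact (localU q).mul_mem ((localU q).mul_mem h2 ((localU q).pow_mem
      (algebraMap_mem_localU x q) N)) (inv_mem_localU hxq)
  · exact Fin.cases (algebraMap_mem_localU x q) hg
  · rw [D.vol_eq hx hx0 hη, preVol, wedgeD_cons, hηg, pullForms_wedgeD]
    rfl
  · exact Fin.cases (IsHomFrac.algebraMap hx) fun i => isHomFrac_coe (g i)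
  · refine ((D.val_hom η).inv'.mul (IsHomFrac.algebraMap hx).inv').cast ?_
    rw [Fin.sum_univ_succ]
    simp
    ring

/-- The generic point of `U`. -/
def genericConePoint (D : ConeData 𝒜 n N) : ConePoint 𝒜 :=
  ⟨⟨⊥, Ideal.isPrime_bot⟩, fun h => by
    obtain ⟨x, hx, hx0⟩ := D.exists_degree_one
    exact hx0 (h (mem_irrelevant_of_mem_one hx))⟩

theorem exists_coneBasis (D : ConeData 𝒜 n N) :
    ∃ (ε : Module.Basis (Fin (n + 1)) (FractionRing S) Ω[FractionRing S⁄ℂ]) (c : FractionRing S),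
      c ≠ 0 ∧ D.vol = c • ExteriorAlgebra.ιMulti (FractionRing S) (n + 1) ε := by
  obtain ⟨-, -, -, η, hη, -, -, -, -, -, ε, -, -, h, -, -⟩ :=
    D.exists_local_frame D.genericConePoint
  exact ⟨ε, _, inv_ne_zero (D.val_ne_zero hη), h⟩

theorem vol_ne_zero : D.vol ≠ 0 := by
  obtain ⟨ε, c, hc, h⟩ := D.exists_coneBasis
  rw [h]
  exact smul_ne_zero hc (ιMulti_basis_ne_zero ε)

theorem vol_mem : D.vol ∈ ⋀[FractionRing S]^(n + 1) Ω[FractionRing S⁄ℂ] := by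
  obtain ⟨ε, c, hc, h⟩ := D.exists_coneBasis
  rw [h]
  exact Submodule.smul_mem _ c (ExteriorAlgebra.ιMulti_range _ (n + 1) ⟨_, rfl⟩)

theorem D_mul_vol (b : FractionRing S) :
    ExteriorAlgebra.ι (FractionRing S) (KaehlerDifferential.D ℂ (FractionRing S) b) * D.vol = 0 := by
  obtain ⟨ε, -⟩ := D.exists_coneBasis
  exact D_mul_eq_zero_of_top ε D.vol_mem b

theorem extDeriv_vol : extDeriv D.vol = 0 := by
  obtain ⟨ε, -⟩ := D.exists_coneBasis
  exact extDeriv_eq_zero_of_top ε D.vol_mem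

theorem D_mul_contr_vol (ξ : Derivation ℂ (FractionRing S) (FractionRing S))
    (b : FractionRing S) : ExteriorAlgebra.ι (FractionRing S)
      (KaehlerDifferential.D ℂ (FractionRing S) b) * contr ξ D.vol = ξ b • D.vol :=
  D_mul_contr D.D_mul_vol b

theorem smul_vol_injective : Function.Injective fun a : FractionRing S => a • D.vol :=
  smul_left_injective _ D.vol_ne_zero

/-- This expresses that `vol` generates `ω_U` at every point of `U`. -/
theorem smul_vol_mem_formsOver_iff {q : ConePoint 𝒜} {a : FractionRing S} :
    a • D.vol ∈ formsOver (localU q) (n + 1) ↔ a ∈ localU q := by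
  constructor
  · intro h
    obtain ⟨x, hx, hxq, η, hη, h1, -, -, -, -, ε, -, -, hvol, hε, -⟩ := D.exists_local_frame q
    have hx0 : x ≠ 0 := fun h => hxq (h ▸ zero_mem _)
    have hQ := algebraMap_frac_ne_zero hx0
    have hv := D.val_ne_zero hη
    obtain ⟨c, hc, he⟩ := exists_smul_of_mem_formsOver_top ε hε h
    rw [hvol, smul_smul] at he
    have h2 := smul_left_injective (FractionRing S) (ιMulti_basis_ne_zero ε) he
    have h3 : a = c * (D.val η * algebraMap S (FractionRing S) x ^ N *
        (algebraMap S (FractionRing S) x)⁻¹ ^ N) := by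
      rw [← h2, mul_assoc (D.val η), ← mul_pow, mul_inv_cancel₀ hQ, one_pow, mul_one, mul_assoc,
        inv_mul_cancel₀ hv, mul_one]
    rw [h3]
    exact (localU q).mul_mem hc ((localU q).mul_mem h1
      ((localU q).pow_mem (inv_mem_localU hxq) N))
  · intro h
    obtain ⟨c, b, -, hc, hb, hvol, -⟩ := D.vol_eq_smul_wedgeD q
    rw [hvol, smul_smul]
    exact Submodule.subset_span ⟨_, (localU q).mul_mem h hc, b, hb, rfl⟩

theorem exists_smul_vol {ω : Forms (FractionRing S)}
    (hω : ω ∈ ⋀[FractionRing S]^(n + 1) Ω[FractionRing S⁄ℂ]) : ∃ a : FractionRing S, ω = a • D.vol := by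
  obtain ⟨ε, -⟩ := D.exists_coneBasis
  exact exists_smul_of_top ε D.vol_ne_zero D.vol_mem hω

/-- The shift by `N` is the degree of `vol`. -/
theorem smul_vol_mem_homForms_iff {k : ℤ} {a : FractionRing S} :
    a • D.vol ∈ homForms 𝒜 (n + 1) k ↔ IsHomFrac 𝒜 (k - N) a := by
  constructor
  · intro h
    obtain ⟨x, hx, hxq, η, hη, h1, -, -, -, -, ε, -, -, hvol, -, hε⟩ :=
      D.exists_local_frame D.genericConePoint
    have hv := D.val_ne_zero hη
    obtain ⟨c, hc, he⟩ := exists_smul_of_mem_homForms_top ε hε h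
    rw [hvol, smul_smul] at he
    have h2 := smul_left_injective (FractionRing S) (ιMulti_basis_ne_zero ε) he
    have h3 : a = c * D.val η := by
      rw [← h2, mul_assoc, inv_mul_cancel₀ hv, mul_one]
    rw [h3]
    exact hc.mul (D.val_hom η)
  · intro h
    obtain ⟨c, b, e, -, -, hvol, hb, hc⟩ := D.vol_eq_smul_wedgeD D.genericConePoint
    rw [hvol, smul_smul]
    exact Submodule.subset_span ⟨_, e, by ring, _, h.mul hc, b, hb, rfl⟩

theorem mem_exteriorPower_of_mem_formsU {p : ℕ} {ω : Forms (FractionRing S)}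
    (D : ConeData 𝒜 n N) (h : ω ∈ formsU 𝒜 N p) :
    ω ∈ ⋀[FractionRing S]^p Ω[FractionRing S⁄ℂ] :=
  (formsOver_top p ω).1 (formsOver_mono le_top p ((Submodule.mem_iInf _).1 h.1 D.genericConePoint))

theorem homForms_le_exteriorPower {p : ℕ} {k : ℤ} {ω : Forms (FractionRing S)}
    (h : ω ∈ homForms 𝒜 p k) : ω ∈ ⋀[FractionRing S]^p Ω[FractionRing S⁄ℂ] := by
  rw [← formsOver_top]
  refine Submodule.span_mono ?_ h
  rintro _ ⟨l, e, -, a, -, b, -, rfl⟩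
  exact ⟨a, Algebra.mem_top, b, fun _ => Algebra.mem_top, rfl⟩

theorem smul_vol_mem_formsU {g : FractionRing S} (hg : g ∈ regMod 𝒜 N) :
    g • D.vol ∈ formsU 𝒜 N (n + 1) := by
  refine ⟨(Submodule.mem_iInf _).2 fun q =>
    D.smul_vol_mem_formsOver_iff.2 (mem_regU.1 hg.1 q), ?_⟩
  refine Submodule.iSup_induction _ (motive := fun g => g • D.vol ∈
    ⨆ m : ℤ, homForms 𝒜 (n + 1) (N * m)) hg.2 (fun m x hx => ?_) ?_ ?_
  · exact Submodule.mem_iSup_of_mem (m + 1) (D.smul_vol_mem_homForms_iff.2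
      (IsHomFrac.cast hx (by ring)))
  · rw [zero_smul]; exact zero_mem _
  · intro x y hx hy; rw [add_smul]; exact add_mem hx hy

theorem exists_of_mem_formsU_top {ω : Forms (FractionRing S)} (hω : ω ∈ formsU 𝒜 N (n + 1)) :
    ∃ g ∈ regMod 𝒜 N, ω = g • D.vol := by
  obtain ⟨g, rfl⟩ := D.exists_smul_vol (D.mem_exteriorPower_of_mem_formsU hω)
  refine ⟨g, ⟨mem_regU.2 fun q =>
    D.smul_vol_mem_formsOver_iff.1 ((Submodule.mem_iInf _).1 hω.1 q), ?_⟩, rfl⟩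
  have h : ∃ a ∈ ⨆ m : ℤ, homPart 𝒜 (N * m), g • D.vol = a • D.vol := by
    refine Submodule.iSup_induction _ (motive := fun ω => ∃ a ∈ ⨆ m : ℤ, homPart 𝒜 (N * m),
      ω = a • D.vol) hω.2 (fun m x hx => ?_) ?_ ?_
    · obtain ⟨a, rfl⟩ := D.exists_smul_vol (homForms_le_exteriorPower hx)
      exact ⟨a, Submodule.mem_iSup_of_mem (m - 1) (IsHomFrac.cast
        (D.smul_vol_mem_homForms_iff.1 hx) (by ring)), rfl⟩
    · exact ⟨0, zero_mem _, by rw [zero_smul]⟩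
    · rintro _ _ ⟨a, ha, rfl⟩ ⟨b, hb, rfl⟩
      exact ⟨a + b, add_mem ha hb, by rw [add_smul]⟩
  obtain ⟨a, ha, hga⟩ := h
  rwa [D.smul_vol_injective hga]

theorem exists_contr_vol {ω : Forms (FractionRing S)}
    (hω : ω ∈ ⋀[FractionRing S]^n Ω[FractionRing S⁄ℂ]) : ∃ ξ, ω = contr ξ D.vol := by
  obtain ⟨ε, -⟩ := D.exists_coneBasis
  exact exists_contr_eq ε D.vol_ne_zero D.vol_mem hω

/-- A field is recovered from its contraction with `vol` through `dg ∧ ι_ξ vol = ξ(g) vol`. -/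
theorem isRegDer_of_contr {ξ : Derivation ℂ (FractionRing S) (FractionRing S)}
    (h : ∀ q : ConePoint 𝒜, contr ξ D.vol ∈ formsOver (localU q) n) : IsRegDer 𝒜 ξ := by
  intro q g hg
  rw [← D.smul_vol_mem_formsOver_iff, ← D.D_mul_contr_vol]
  exact D_mul_mem_formsOver hg (h q)

theorem isHomDer_of_contr {ξ : Derivation ℂ (FractionRing S) (FractionRing S)} {k : ℤ}
    (h : contr ξ D.vol ∈ homForms 𝒜 n k) : IsHomDer 𝒜 (k - N) ξ := by
  intro l g hg
  have h1 := D_mul_mem_homForms hg h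
  rw [D.D_mul_contr_vol, D.smul_vol_mem_homForms_iff] at h1
  exact h1.cast (by ring)

theorem contr_vol_mem_formsU {ξ : Derivation ℂ (FractionRing S) (FractionRing S)}
    (hξ : IsRegDer 𝒜 ξ) {d : ℤ} (hd : IsHomDer 𝒜 (N * d) ξ) :
    contr ξ D.vol ∈ formsU 𝒜 N n := by
  refine ⟨(Submodule.mem_iInf _).2 fun q => contr_mem_formsOver (hξ q) ?_,
    Submodule.mem_iSup_of_mem (d + 1) ?_⟩
  · have := (D.smul_vol_mem_formsOver_iff (q := q) (a := 1)).2 (localU q).one_mem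
    rwa [one_smul] at this
  · have h1 : D.vol ∈ homForms 𝒜 (n + 1) N := by
      have := (D.smul_vol_mem_homForms_iff (k := N) (a := 1)).2 (by
        simpa using IsHomFrac.const (𝒜 := 𝒜) 1)
      rwa [one_smul] at this
    have h2 := contr_mem_homForms hd h1
    rwa [show (N : ℤ) + N * d = N * (d + 1) by ring] at h2

/-- The `n`-forms on `U` are contractions of the volume form with vector fields. -/
theorem formsU_eq_span : formsU 𝒜 N n = Submodule.span ℂ {ω | ∃ ξ, ∃ d : ℤ, IsRegDer 𝒜 ξ ∧
    IsHomDer 𝒜 (N * d) ξ ∧ ω = contr ξ D.vol} := by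
  apply le_antisymm
  · intro ω hω
    obtain ⟨ξ, rfl⟩ := D.exists_contr_vol (D.mem_exteriorPower_of_mem_formsU hω)
    have hξ := D.isRegDer_of_contr ((Submodule.mem_iInf _).1 hω.1)
    obtain ⟨f, hf, hsum⟩ := (Submodule.mem_iSup_iff_exists_finsupp _ _).1 hω.2
    choose ζ hζ using fun m => D.exists_contr_vol (homForms_le_exteriorPower (hf m))
    have hdeg : ∀ m, IsHomDer 𝒜 (N * m - N) (ζ m) := fun m =>
      D.isHomDer_of_contr (hζ m ▸ hf m)
    -- Wedging with `db` shows that `ξ` is the sum of the homogeneous fields `ζ m`. The values `ζ m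
    -- (x)` are then components of the regular function `ξ(x)`, which makes each `ζ m` regular.
    have hs : ∀ b, ξ b = ∑ m ∈ f.support, ζ m b := by
      intro b
      apply D.smul_vol_injective
      change ξ b • D.vol = (∑ m ∈ f.support, ζ m b) • D.vol
      rw [← D.D_mul_contr_vol, ← hsum, Finsupp.sum, Finset.mul_sum, Finset.sum_smul]
      exact Finset.sum_congr rfl fun m _ => by rw [hζ m, D.D_mul_contr_vol]
    rw [← hsum]
    refine Submodule.sum_mem _ fun m hm => Submodule.subset_span ⟨ζ m, m - 1, ?_, ?_, hζ m⟩
    · refine isRegDer_of D.gen fun x hx => ?_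
      refine family_component_mem_regU D.gen (deg := fun m : ℤ => 1 + (N * m - N)) ?_ f.support
        (f := fun m => ζ m (algebraMap S (FractionRing S) x)) ?_ ?_ hm
      · intro a b hab
        have h0 := D.one_le
        have : (N : ℤ) * a = N * b := by simpa using hab
        exact mul_left_cancel₀ (by positivity : (N : ℤ) ≠ 0) this
      · exact fun m => by simpa using hdeg m _ _ (IsHomFrac.algebraMap hx)
      · rw [← hs]
        exact hξ.apply_mem (algebraMap_mem_regU x)
    · have := hdeg m
      rwa [show (N : ℤ) * m - N = N * (m - 1) by ring] at this
  · rw [Submodule.span_le]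
    rintro _ ⟨ξ, d, h1, h2, rfl⟩
    exact D.contr_vol_mem_formsU h1 h2

end ConeData

end
end CYCone

/-! ### Lifting vector fields from X to U; divergences -/

set_option linter.unusedSectionVars false
set_option maxHeartbeats 1000000
namespace CYCone
noncomputable section

theorem lieD_pullForms_eq_zero {K Q : Type*} [Field K] [Algebra ℂ K] [Field Q] [Algebra ℂ Q]
    [Algebra K Q] [IsScalarTower ℂ K Q] {θ : Derivation ℂ Q Q}
    (h : ∀ a, θ (algebraMap K Q a) = 0) (ω : Forms K) : lieD θ (pullForms K Q ω) = 0 := by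
  rw [lieD_pullForms (δ := 0) (fun a => by rw [h, Derivation.coe_zero, Pi.zero_apply, map_zero])]
  have : lieD (0 : Derivation ℂ K K) ω = 0 := by
    have := lieD_smul_left (0 : ℂ) (0 : Derivation ℂ K K) ω
    rwa [zero_smul, zero_smul] at this
  rw [this, map_zero]

variable {S : Type*} [CommRing S] [IsDomain S] [Algebra ℂ S] {𝒜 : ℕ → Submodule ℂ S}
  [GradedAlgebra 𝒜]

/-- A homogeneous fraction that is regular at a homogeneous prime has a homogeneous denominator
outside that prime, namely a suitable component of any denominator. -/
theorem mem_twistStalk_of_mem_localU {k : ℤ} (p : ProjectiveSpectrum 𝒜) {q : ConePoint 𝒜}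
    (hpq : q.1.asIdeal = p.asHomogeneousIdeal.toIdeal) {x : S} (hx : x ∈ 𝒜 1)
    (hxq : x ∉ q.1.asIdeal) {z : FractionRing S} (hz : IsHomFrac 𝒜 k z) (hzq : z ∈ localU q) :
    z ∈ twistStalk 𝒜 k p := by
  classical
  rcases hz with rfl | ⟨i, j, hij, a', ha', b', hb', hb0', rfl⟩
  -- Zero is written as `0 / x ^ |k|`, so that the degree `|k| + k` of the numerator is not
  -- negative.
  · refine ⟨(k.natAbs + k).toNat, k.natAbs, by omega, 0, zero_mem _, x ^ k.natAbs,
      by simpa using SetLike.pow_mem_graded k.natAbs hx, fun h => hxq ?_, by simp⟩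
    rw [hpq]
    exact p.isPrime.mem_of_pow_mem _ h
  obtain ⟨a, b, hb, e⟩ := hzq
  have hb0 : b ≠ 0 := fun h => hb (h ▸ zero_mem _)
  rw [div_eq_div_iff (algebraMap_frac_ne_zero hb0') (algebraMap_frac_ne_zero hb0), ← map_mul,
    ← map_mul] at e
  have e' : a' * b = b' * a := (IsFractionRing.injective S (FractionRing S) e).trans (mul_comm _ _)
  obtain ⟨m, hm⟩ : ∃ m, (DirectSum.decompose 𝒜 b m : S) ∉ p.asHomogeneousIdeal := by
    by_contra! h
    apply hb
    rw [hpq, ← DirectSum.sum_support_decompose 𝒜 b]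
    exact Ideal.sum_mem _ fun i _ => h i
  have h1 : a' * (DirectSum.decompose 𝒜 b m : S) = DirectSum.decompose 𝒜 (b' * a) (i + m) := by
    rw [← e', DirectSum.coe_decompose_mul_add_of_left_mem 𝒜 ha']
  have hm0 : (DirectSum.decompose 𝒜 b m : S) ≠ 0 := fun h => hm (h ▸ zero_mem _)
  -- Compare the parts of degree `i + m` in `a' b = b' a`. If `j ≤ i + m` this replaces `a / b` by
  -- homogeneous components; otherwise the right-hand side has no such part and `a' = 0`.
  by_cases hle : j ≤ i + m
  · obtain ⟨l, hl⟩ := Nat.exists_eq_add_of_le hle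
    rw [hl, DirectSum.coe_decompose_mul_add_of_left_mem 𝒜 hb'] at h1
    refine ⟨l, m, by omega, _, SetLike.coe_mem (DirectSum.decompose 𝒜 a l), _,
      SetLike.coe_mem _, hm, ?_⟩
    rw [div_eq_div_iff (algebraMap_frac_ne_zero hb0') (algebraMap_frac_ne_zero hm0), ← map_mul,
      ← map_mul, h1, mul_comm]
  · rw [DirectSum.coe_decompose_mul_of_left_mem_of_not_le 𝒜 hb' hle, mul_eq_zero,
      or_iff_left hm0] at h1
    refine ⟨(k.natAbs + k).toNat, k.natAbs, by omega, 0, zero_mem _, x ^ k.natAbs,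
      by simpa using SetLike.pow_mem_graded k.natAbs hx, fun h => hxq ?_, by simp [h1]⟩
    rw [hpq]
    exact p.isPrime.mem_of_pow_mem _ h

variable (S) in
theorem natCast_fractionRing_ne_zero {N : ℕ} (hN : 1 ≤ N) : (N : FractionRing S) ≠ 0 := by
  have : CharZero (FractionRing S) :=
    charZero_of_injective_algebraMap (algebraMap ℂ (FractionRing S)).injective
  exact Nat.cast_ne_zero.2 (by omega)

theorem derivation_inv_pow {Q : Type*} [Field Q] [Algebra ℂ Q] (θ : Derivation ℂ Q Q) {X : Q}
    (hX : X ≠ 0) {N : ℕ} (hN : 1 ≤ N) : X ^ (N + 1) * θ (X ^ N)⁻¹ = -(N : Q) * θ X := by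
  obtain ⟨m, rfl⟩ : ∃ m, N = m + 1 := ⟨N - 1, by omega⟩
  rw [Derivation.leibniz_inv, Derivation.leibniz_pow, Nat.add_sub_cancel]
  simp only [smul_eq_mul, nsmul_eq_mul]
  field_simp
  ring

theorem neg_mul_neg_inv_mul {Q : Type*} [Field Q] {c : Q} (hc : c ≠ 0) (a b : Q) :
    -c * (-c⁻¹ * a * b) = a * b := by
  field_simp

theorem lieForm_smul_coe (n : ℕ) (δ : Derivation ℂ (functionField 𝒜) (functionField 𝒜))
    (c : functionField 𝒜) (η : Can (functionField 𝒜) n) :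
    lieForm n δ (c • η) = δ c • η + c • lieForm n δ η :=
  Subtype.ext (lieD_smul δ c (η : Forms (functionField 𝒜)))

namespace ConeData

variable {n N : ℕ} (D : ConeData 𝒜 n N)

/-- Apply the product rule to `(α(η) x)⁻¹ dx ∧ η`. The contributions of `θ(x) = u x` cancel: `u`
comes from `X`, so `du ∧ η = 0`. -/
theorem lieD_vol {x : S} (hx : x ∈ 𝒜 1) (hx0 : x ≠ 0) {η : Can (functionField 𝒜) n} (hη : η ≠ 0)
    {θ : Derivation ℂ (FractionRing S) (FractionRing S)} {u c : FractionRing S} {u' : functionField 𝒜}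
    (hu : θ (algebraMap S (FractionRing S) x) = u * algebraMap S (FractionRing S) x)
    (hu' : u = u')
    (hc : lieD θ (pullForms (functionField 𝒜) (FractionRing S) η) =
      c • pullForms (functionField 𝒜) (FractionRing S) η) :
    lieD θ D.vol = (c - (D.val η)⁻¹ * θ (D.val η)) • D.vol := by
  have hQ := algebraMap_frac_ne_zero hx0
  have hv := D.val_ne_zero hη
  have h1 : ExteriorAlgebra.ι (FractionRing S) (KaehlerDifferential.D ℂ (FractionRing S)
      (u * algebraMap S (FractionRing S) x)) * pullForms (functionField 𝒜) (FractionRing S) η =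
      u • (ExteriorAlgebra.ι (FractionRing S) (KaehlerDifferential.D ℂ (FractionRing S)
      (algebraMap S (FractionRing S) x)) * pullForms (functionField 𝒜) (FractionRing S) η) := by
    rw [Derivation.leibniz, hu', map_add, map_smul, map_smul, add_mul, smul_mul_assoc,
      smul_mul_assoc, D.D_mul_pullForms_eq_zero, smul_zero, add_zero]
  rw [D.vol_eq hx hx0 hη, preVol, lieD_smul, lieD_D_mul, hc, hu, h1, mul_smul_comm, ← add_smul,
    smul_smul, smul_smul, ← add_smul]
  congr 1
  rw [Derivation.leibniz, Derivation.leibniz_inv, Derivation.leibniz_inv, hu, hu']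
  simp only [smul_eq_mul]
  field_simp
  ring

/-- The Euler field kills forms pulled back from `X`, and `α(η)` has degree `-N`. -/
theorem lieD_euler {E : Derivation ℂ (FractionRing S) (FractionRing S)} (hE : IsEuler 𝒜 E) :
    lieD E D.vol = (N : FractionRing S) • D.vol := by
  obtain ⟨x, hx, hx0⟩ := D.exists_degree_one
  obtain ⟨η, hη⟩ := D.exists_form_ne_zero
  have hv := D.val_ne_zero hη
  rw [D.lieD_vol hx hx0 hη (u := 1) (u' := 1) (c := 0) ?_ rfl ?_, hE _ _ (D.val_hom η)]
  · congr 1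
    push_cast
    field_simp
    ring
  · rw [hE _ _ (IsHomFrac.algebraMap hx)]; simp
  · rw [zero_smul]
    refine lieD_pullForms_eq_zero (fun a => ?_) _
    rw [algebraMap_functionField, hE _ _ (isHomFrac_coe a), Int.cast_zero, zero_mul]

/-- The derivation `θ` of the function field of `U` lifts the vector field `δ` on `X`, compatibly
with the isomorphism `ω_X ≅ O_X(-N)`. -/
structure IsLift (δ : Derivation ℂ (functionField 𝒜) (functionField 𝒜))
    (θ : Derivation ℂ (FractionRing S) (FractionRing S)) : Prop where
  coe : ∀ c : functionField 𝒜, θ c = (δ c : functionField 𝒜)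
  val : ∀ η, θ (D.val η) = D.val (lieForm n δ η)

theorem exists_val_eq_inv_pow {x : S} (hx : x ∈ 𝒜 1) :
    ∃ η, D.val η = (algebraMap S (FractionRing S) x ^ N)⁻¹ :=
  D.exists_val_eq (((IsHomFrac.algebraMap hx).pow N).inv'.cast (by push_cast; ring))

/-- The lift is determined by its value on `x`, and the compatibility with `α` prescribes `θ(x ^
(-N))`. Dividing by `N ≠ 0` recovers `θ(x)`: infinitesimally, an action on `L^N` induces one on `L`.
-/
theorem exists_isLift (δ : Derivation ℂ (functionField 𝒜) (functionField 𝒜)) :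
    ∃ θ, D.IsLift δ θ := by
  obtain ⟨x, hx, hx0⟩ := D.exists_degree_one
  have hQ := algebraMap_frac_ne_zero hx0
  set X := algebraMap S (FractionRing S) x with hX
  have hN := natCast_fractionRing_ne_zero S D.one_le
  obtain ⟨η₀, h₀⟩ := D.exists_val_eq_inv_pow hx
  have hη₀ : η₀ ≠ 0 := by
    rintro rfl
    rw [val, map_zero] at h₀
    exact inv_ne_zero (pow_ne_zero N hQ) h₀.symm
  -- The value solves `-N x ^ (-N - 1) θ(x) = α(L_δ η₀)`, where `α(η₀) = x ^ (-N)`.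
  obtain ⟨θ, h1, h2⟩ := exists_derivation hx hx0 δ
    (-(N : FractionRing S)⁻¹ * X ^ (N + 1) * D.val (lieForm n δ η₀))
  have h3 : θ (D.val η₀) = D.val (lieForm n δ η₀) := by
    have h5 := derivation_inv_pow θ hQ D.one_le
    rw [h2, ← h₀, neg_mul_neg_inv_mul hN] at h5
    exact mul_left_cancel₀ (pow_ne_zero (N + 1) hQ) h5
  refine ⟨θ, h1, fun η => ?_⟩
  obtain ⟨c, rfl⟩ := D.exists_smul (ζ := η) hη₀
  have h4 : D.val (lieForm n δ (c • η₀)) =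
      (δ c : functionField 𝒜) * D.val η₀ + c * D.val (lieForm n δ η₀) := by
    rw [lieForm_smul_coe, D.val_add, D.val_smul, D.val_smul]
  rw [h4, D.val_smul, θ.leibniz c (D.val η₀), h3, h1 c]
  exact (add_comm _ _).trans (congrArg₂ _ (mul_comm _ _) rfl)

namespace IsLift

variable {D} {δ : Derivation ℂ (functionField 𝒜) (functionField 𝒜)}
  {θ : Derivation ℂ (FractionRing S) (FractionRing S)} (h : D.IsLift δ θ)
include h

theorem isHomDer : IsHomDer 𝒜 0 θ := by
  obtain ⟨η, hη⟩ := D.exists_form_ne_zero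
  have hv := D.val_ne_zero hη
  obtain ⟨x, hx, hx0⟩ := D.exists_degree_one
  have hQ := algebraMap_frac_ne_zero hx0
  obtain ⟨c, hc⟩ := exists_mul_pow hx hx0 (D.val_hom η)
  have hc0 : (c : FractionRing S) ≠ 0 := by
    intro h0; rw [h0, zero_mul] at hc; exact hv hc
  have hN := natCast_fractionRing_ne_zero S D.one_le
  refine isHomDer_of hx hx0 (fun a => by rw [h.coe]; exact isHomFrac_coe _) ?_
  have h1 := h.val η
  rw [hc, derivation_mul_zpow _ _ hQ, ← hc, h.coe] at h1
  have h2 : θ (algebraMap S (FractionRing S) x) = algebraMap ℂ (FractionRing S) (-(N : ℂ))⁻¹ *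
      (algebraMap S (FractionRing S) x * (D.val η)⁻¹ * (D.val (lieForm n δ η) -
        (δ c : functionField 𝒜) * algebraMap S (FractionRing S) x ^ (-N : ℤ))) := by
    rw [← h1, map_inv₀, map_neg, map_natCast]
    push_cast
    field_simp
    ring
  rw [h2]
  refine ((IsHomFrac.const _).mul (((IsHomFrac.algebraMap hx).mul (D.val_hom η).inv').mul
    ((homPart 𝒜 (-N)).sub_mem (D.val_hom _) ?_))).cast (by push_cast; ring)
  exact ((isHomFrac_coe (δ c)).mul ((IsHomFrac.algebraMap hx).zpow (-N))).cast (by push_cast; ring)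

/-- If `L_δ η = c η`, then also `θ(α(η)) = c α(η)`, and the two terms in the divergence cancel. -/
theorem lieD_vol : lieD θ D.vol = 0 := by
  obtain ⟨x, hx, hx0⟩ := D.exists_degree_one
  obtain ⟨η, hη⟩ := D.exists_form_ne_zero
  have hQ := algebraMap_frac_ne_zero hx0
  have hv := D.val_ne_zero hη
  obtain ⟨u, hu⟩ := exists_mul_pow hx hx0 (h.isHomDer _ _ (IsHomFrac.algebraMap hx))
  obtain ⟨c, hc⟩ := D.exists_smul (ζ := lieForm n δ η) hη
  rw [D.lieD_vol hx hx0 hη (u := u) (u' := u) (c := c) (by simpa using hu) rfl ?_, h.val, hc,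
    D.val_smul]
  · rw [mul_comm _ (D.val η), inv_mul_cancel_left₀ hv, sub_self, zero_smul]
  · rw [lieD_pullForms h.coe]
    have : lieD δ (η : Forms (functionField 𝒜)) = (lieForm n δ η : Can (functionField 𝒜) n) := rfl
    rw [this, hc]
    exact pullForms_smul c _

/-- Choose `x` nonvanishing at `q` and solve for `θ(x)` as in the construction of the lift: `θ(x) =
-N⁻¹ x ^ (N + 1) α(L_δ η)`, where `L_δ η` is regular because `η` and `δ` are. -/
theorem isRegDer (hδ : ∀ p, ∀ g ∈ localX 𝒜 p, δ g ∈ localX 𝒜 p) : IsRegDer 𝒜 θ := by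
  intro q g hg
  obtain ⟨x, hx, hxq⟩ := exists_degree_one_notMem D.gen q.2
  have hx0 : x ≠ 0 := fun h => hxq (h ▸ zero_mem _)
  have hQ := algebraMap_frac_ne_zero hx0
  have hN := natCast_fractionRing_ne_zero S D.one_le
  set X := algebraMap S (FractionRing S) x with hX
  set p := corePoint q with hp
  have hxp : x ∉ p.asHomogeneousIdeal := notMem_corePoint hxq
  have hpowp : x ^ N ∉ p.asHomogeneousIdeal := fun h => hxp (p.isPrime.mem_of_pow_mem N h)
  obtain ⟨η, hη⟩ := D.exists_val_eq_inv_pow hx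
  have hηp : η ∈ canStalk n (localX 𝒜 p) := by
    rw [D.mem_iff]
    change D.val η ∈ _
    rw [hη]
    exact ⟨0, N, by simp, 1, SetLike.one_mem_graded 𝒜, x ^ N,
      by simpa using SetLike.pow_mem_graded N hx, hpowp, by rw [map_one, one_div, map_pow]⟩
  have hLη : D.val (lieForm n δ η) ∈ localU q := by
    refine twistStalk_subset_localU (k := -N) ?_
    exact (D.mem_iff p _).1 (lieD_mem_formsOver (hδ p) hηp)
  refine derivation_algebraMap_mem_localU hx hxq (fun c hc => ?_) ?_ hg
  · rw [h.coe]; exact twistStalk_subset_localU (hδ _ c hc)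
  · have h1 := derivation_inv_pow θ hQ D.one_le
    rw [← hη, h.val η] at h1
    have h2 : θ X = algebraMap ℂ (FractionRing S) (-(N : ℂ))⁻¹ *
        (X ^ (N + 1) * D.val (lieForm n δ η)) := by
      rw [h1, map_inv₀, map_neg, map_natCast, inv_mul_cancel_left₀ (neg_ne_zero.2 hN)]
    rw [h2]
    exact (localU q).mul_mem ((localU q).algebraMap_mem _) ((localU q).mul_mem
      ((localU q).pow_mem (algebraMap_mem_localU x q) _) hLη)

end IsLift

end ConeData

end
end CYCone

/-! ### Sections of the anticanonical bundle as functions on U -/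

set_option linter.unusedSectionVars false
set_option maxHeartbeats 1000000
namespace CYCone
noncomputable section

variable {S : Type*} [CommRing S] [IsDomain S] [Algebra ℂ S] {𝒜 : ℕ → Submodule ℂ S}
  [GradedAlgebra 𝒜]

/-- A point of `X` as a point of `U`. -/
def projPoint (p : ProjectiveSpectrum 𝒜) : ConePoint 𝒜 :=
  ⟨⟨p.asHomogeneousIdeal.toIdeal, p.isPrime⟩, p.not_irrelevant_le⟩

theorem twistStalk_subset_localU_projPoint {p : ProjectiveSpectrum 𝒜} {k : ℤ} {z : FractionRing S}
    (hz : z ∈ twistStalk 𝒜 k p) : z ∈ localU (projPoint p) := by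
  obtain ⟨i, j, -, a, -, b, -, hbp, e⟩ := hz
  exact ⟨a, b, hbp, e⟩

theorem mem_twistStalk_of_mem_projPoint (hgen : Algebra.adjoin ℂ (𝒜 1 : Set S) = ⊤) {k : ℤ}
    {p : ProjectiveSpectrum 𝒜} {z : FractionRing S} (hz : IsHomFrac 𝒜 k z)
    (hzq : z ∈ localU (projPoint p)) : z ∈ twistStalk 𝒜 k p := by
  obtain ⟨x, hx, hxq⟩ := exists_degree_one_notMem hgen (projPoint p).2
  exact mem_twistStalk_of_mem_localU p rfl hx hxq hz hzq

namespace ConeData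

variable {n N : ℕ} (D : ConeData 𝒜 n N)

/-- A local generator of `ω_X`. -/
theorem exists_local_form (q : ConePoint 𝒜) :
    ∃ x ∈ 𝒜 1, x ∉ q.1.asIdeal ∧ ∃ η : Can (functionField 𝒜) n, η ≠ 0 ∧
      D.val η = (algebraMap S (FractionRing S) x ^ N)⁻¹ ∧
      η ∈ canStalk n (localX 𝒜 (corePoint q)) := by
  obtain ⟨x, hx, hxq⟩ := exists_degree_one_notMem D.gen q.2
  have hx0 : x ≠ 0 := fun h => hxq (h ▸ zero_mem _)
  have hQ := algebraMap_frac_ne_zero hx0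
  obtain ⟨η, hη⟩ := D.exists_val_eq_inv_pow hx
  refine ⟨x, hx, hxq, η, ?_, hη, ?_⟩
  · rintro rfl
    rw [val, map_zero] at hη
    exact inv_ne_zero (pow_ne_zero N hQ) hη.symm
  · rw [D.mem_iff]
    change D.val η ∈ _
    rw [hη]
    exact ⟨0, N, by simp, 1, SetLike.one_mem_graded 𝒜, x ^ N,
      by simpa using SetLike.pow_mem_graded N hx,
      fun h => notMem_corePoint hxq ((corePoint q).isPrime.mem_of_pow_mem N h),
      by rw [map_one, one_div, map_pow]⟩

/-- A rational `n`-form that is not zero. -/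
def form : Can (functionField 𝒜) n := D.exists_form_ne_zero.choose

theorem form_ne_zero : D.form ≠ 0 := D.exists_form_ne_zero.choose_spec

/-- The function of degree `N` on `U` corresponding to a section of `ω_X^{-1}`. -/
def secVal : AntiCanSec (localX 𝒜) n →ₗ[ℂ] FractionRing S where
  toFun s := (s.eval D.form : FractionRing S) * (D.val D.form)⁻¹
  map_add' s t := by rw [AntiCanSec.eval_add, AddMemClass.coe_add, add_mul]
  map_smul' c s := by
    rw [AntiCanSec.eval_smul, RingHom.id_apply]
    exact smul_mul_assoc c (s.eval D.form : FractionRing S) _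

theorem secVal_mul_val (s : AntiCanSec (localX 𝒜) n) (η : Can (functionField 𝒜) n) :
    D.secVal s * D.val η = (s.eval η : functionField 𝒜) := by
  obtain ⟨c, rfl⟩ := D.exists_smul (ζ := η) D.form_ne_zero
  have h1 : s.eval (c • D.form) = c * s.eval D.form := s.eval_map_smul _ c D.form
  rw [h1, D.val_smul, MulMemClass.coe_mul]
  change _ * (D.val D.form)⁻¹ * _ = _
  have := D.val_ne_zero D.form_ne_zero
  field_simp

theorem secVal_hom (s : AntiCanSec (localX 𝒜) n) : IsHomFrac 𝒜 N (D.secVal s) :=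
  ((isHomFrac_coe _).mul (D.val_hom _).inv').cast (by ring)

theorem secVal_mem_regU (s : AntiCanSec (localX 𝒜) n) : D.secVal s ∈ regU 𝒜 := by
  refine mem_regU.2 fun q => ?_
  obtain ⟨x, hx, hxq, η, hη, hv, hηp⟩ := D.exists_local_form q
  have hs : s.1 ∈ ⨅ p, antiCanStalk n (localX 𝒜 p) := s.2
  have h1 : s.eval η ∈ localX 𝒜 (corePoint q) := (Submodule.mem_iInf _).1 hs (corePoint q) η hηp
  have h2 := D.secVal_mul_val s η
  have hx0 : x ≠ 0 := fun h => hxq (h ▸ zero_mem _)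
  rw [hv, ← div_eq_mul_inv, div_eq_iff (pow_ne_zero N (algebraMap_frac_ne_zero hx0))] at h2
  rw [h2]
  exact (localU q).mul_mem (twistStalk_subset_localU h1)
    ((localU q).pow_mem (algebraMap_mem_localU x q) N)

theorem secVal_injective : Function.Injective D.secVal := by
  intro s t h
  refine AntiCanSec.ext _ fun η => Subtype.ext ?_
  rw [← D.secVal_mul_val, ← D.secVal_mul_val, h]

/-- The section is `η ↦ g α(η)`; it maps regular forms to regular functions of degree zero. -/
theorem exists_secVal_eq {g : FractionRing S} (hg : g ∈ regU 𝒜) (hN : IsHomFrac 𝒜 N g) :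
    ∃ s, D.secVal s = g := by
  let s : Can (functionField 𝒜) n →ₗ[functionField 𝒜] functionField 𝒜 :=
    { toFun := fun η => ⟨g * D.val η, (hN.mul (D.val_hom η)).cast (by ring)⟩
      map_add' := fun η ζ => Subtype.ext
        ((congrArg (g * ·) (D.val_add η ζ)).trans (mul_add _ _ _))
      map_smul' := fun c η => Subtype.ext
        ((congrArg (g * ·) (D.val_smul c η)).trans (mul_left_comm _ _ _)) }
  have hs : s ∈ ⨅ p, antiCanStalk n (localX 𝒜 p) := by
    refine (Submodule.mem_iInf _).2 fun p η hη => ?_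
    refine mem_twistStalk_of_mem_projPoint D.gen ((hN.mul (D.val_hom η)).cast (by ring)) ?_
    exact (localU _).mul_mem (mem_regU.1 hg _)
      (twistStalk_subset_localU_projPoint ((D.mem_iff p η).1 hη))
  refine ⟨⟨s, hs⟩, ?_⟩
  exact mul_inv_cancel_right₀ (D.val_ne_zero D.form_ne_zero) g

/-- Apply `θ` to `f α(η) = s(η)`, where `f` is the function of `s`, and use `θ(α(η)) = α(L_δ η)`. -/
theorem IsLift.secVal_lieAct {D : ConeData 𝒜 n N} {δ : vectorFields (localX 𝒜)}
    {θ : Derivation ℂ (FractionRing S) (FractionRing S)}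
    (h : D.IsLift (δ : Derivation ℂ (functionField 𝒜) (functionField 𝒜)) θ)
    (s : AntiCanSec (localX 𝒜) n) : D.secVal (lieAct δ s) = θ (D.secVal s) := by
  have hv := D.val_ne_zero D.form_ne_zero
  apply mul_right_cancel₀ hv
  have h1 := congrArg θ (D.secVal_mul_val s D.form)
  rw [h.coe, Derivation.leibniz, h.val, smul_eq_mul, smul_eq_mul, D.secVal_mul_val] at h1
  rw [D.secVal_mul_val, lieAct_eval, AddSubgroupClass.coe_sub, ← h1]
  ring

/-- The evaluation of polynomials in the sections of `ω_X^{-1}` on `U`. -/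
def polyVal : PolyRing (localX 𝒜) n →ₐ[ℂ] FractionRing S := SymmetricAlgebra.lift D.secVal

theorem polyVal_ι (s : AntiCanSec (localX 𝒜) n) :
    D.polyVal (SymmetricAlgebra.ι ℂ _ s) = D.secVal s := SymmetricAlgebra.lift_ι_apply _ _

theorem polyVal_mem (φ : PolyRing (localX 𝒜) n) : D.polyVal φ ∈ regMod 𝒜 N := by
  induction φ using SymmetricAlgebra.induction with
  | algebraMap r =>
    rw [AlgHom.commutes]
    exact mem_regMod_of_hom (m := 0) ((regU 𝒜).algebraMap_mem r)
      ((IsHomFrac.const r).cast (by ring))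
  | ι s =>
    rw [polyVal_ι]
    exact mem_regMod_of_hom (m := 1) (D.secVal_mem_regU s) ((D.secVal_hom s).cast (by ring))
  | mul a b ha hb =>
    rw [map_mul]
    refine ⟨(regU 𝒜).mul_mem ha.1 hb.1, ?_⟩
    refine Submodule.iSup_induction _ (motive := fun g => g * D.polyVal b ∈
      ⨆ m : ℤ, homPart 𝒜 (N * m)) ha.2 (fun m x hx => ?_) ?_ ?_
    · refine Submodule.iSup_induction _ (motive := fun g => x * g ∈
        ⨆ m : ℤ, homPart 𝒜 (N * m)) hb.2 (fun m' y hy => ?_) ?_ ?_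
      · exact Submodule.mem_iSup_of_mem (m + m') ((IsHomFrac.mul hx hy).cast (by ring))
      · rw [mul_zero]; exact zero_mem _
      · intro x y hx hy; rw [mul_add]; exact add_mem hx hy
    · rw [zero_mul]; exact zero_mem _
    · intro x y hx hy; rw [add_mul]; exact add_mem hx hy
  | add a b ha hb => rw [map_add]; exact add_mem ha hb

/-- The element `α(η)⁻¹` equals `c x ^ N` with `c ≠ 0` and `N ≥ 1`, and is transcendental because
`x` is. -/
theorem aeval_inv_val_injective {η : Can (functionField 𝒜) n} (hη : η ≠ 0) :
    Function.Injective (Polynomial.aeval (R := functionField 𝒜) (D.val η)⁻¹) := by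
  obtain ⟨x, hx, hx0⟩ := D.exists_degree_one
  have hQ := algebraMap_frac_ne_zero hx0
  have hv := D.val_ne_zero hη
  obtain ⟨c, hc⟩ := exists_mul_pow hx hx0 (D.val_hom η).inv'
  rw [neg_neg, zpow_natCast] at hc
  have hc0 : c ≠ 0 := by
    rintro rfl
    rw [ZeroMemClass.coe_zero, zero_mul] at hc
    exact inv_ne_zero hv hc
  rw [injective_iff_map_eq_zero]
  intro P hP
  have h1 : (D.val η)⁻¹ = Polynomial.aeval (algebraMap S (FractionRing S) x)
      (Polynomial.C c * Polynomial.X ^ N : Polynomial (functionField 𝒜)) := by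
    rw [hc, map_mul, map_pow, Polynomial.aeval_C, Polynomial.aeval_X]
    rfl
  rw [h1, ← Polynomial.aeval_comp] at hP
  have h2 := (injective_iff_map_eq_zero _).1 (aeval_injective hx hx0) _ hP
  rw [Polynomial.comp_eq_zero_iff] at h2
  refine h2.resolve_right fun h => ?_
  have h3 := congrArg (fun R => Polynomial.coeff R N) h.2
  have h4 : N ≠ 0 := Nat.one_le_iff_ne_zero.1 D.one_le
  simp only [Polynomial.coeff_C_mul, Polynomial.coeff_X_pow_self, mul_one,
    Polynomial.coeff_C_of_ne_zero h4] at h3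
  exact hc0 h3

theorem polyVal_eq_aeval (φ : PolyRing (localX 𝒜) n) : D.polyVal φ =
    Polynomial.aeval (D.val D.form)⁻¹ (lineEval (localX 𝒜) 0 D.form φ) := by
  induction φ using SymmetricAlgebra.induction with
  | algebraMap r =>
    rw [AlgHom.commutes, AlgHom.commutes, Polynomial.algebraMap_apply, Polynomial.aeval_C]
    rfl
  | ι s =>
    rw [polyVal_ι, lineEval, SymmetricAlgebra.lift_ι_apply]
    change _ = Polynomial.aeval _ (Polynomial.C (s.eval 0) +
      Polynomial.X * Polynomial.C (s.eval D.form))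
    have : s.eval 0 = 0 := map_zero s.1
    rw [this, map_add, map_mul, Polynomial.aeval_C, Polynomial.aeval_C, Polynomial.aeval_X,
      map_zero, zero_add, mul_comm]
    rfl
  | mul a b ha hb => rw [map_mul, map_mul, map_mul, ha, hb]
  | add a b ha hb => rw [map_add, map_add, map_add, ha, hb]

/-- Over the generic point, `X̂` is the line of all `c · η₀`, on which `φ` is a polynomial in `c`
with coefficients in the function field of `X`. Its value on `U` is obtained by substituting the
transcendental element `α(η₀)⁻¹`, so one vanishes exactly when the other does. Hence `ℂ[X̂]` embeds
in the functions on `U`. -/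
theorem polyVal_eq_zero_iff {φ : PolyRing (localX 𝒜) n} :
    D.polyVal φ = 0 ↔ φ ∈ coneIdeal (localX 𝒜) n := by
  constructor
  · intro h
    rw [polyVal_eq_aeval] at h
    have h1 := (injective_iff_map_eq_zero _).1 (D.aeval_inv_val_injective D.form_ne_zero) _ h
    rw [mem_coneIdeal]
    intro η
    obtain ⟨c, rfl⟩ := D.exists_smul (ζ := η) D.form_ne_zero
    have h2 : ∀ φ, evalPoly (localX 𝒜) (c • D.form) φ =
        (lineEval (localX 𝒜) 0 D.form φ).eval c := by
      intro φ
      induction φ using SymmetricAlgebra.induction with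
      | algebraMap r =>
        rw [AlgHom.commutes, AlgHom.commutes, Polynomial.algebraMap_apply, Polynomial.eval_C]
      | ι s =>
        rw [lineEval, evalPoly, SymmetricAlgebra.lift_ι_apply, SymmetricAlgebra.lift_ι_apply]
        change s.eval (c • D.form) = Polynomial.eval c (Polynomial.C (s.eval 0) +
          Polynomial.X * Polynomial.C (s.eval D.form))
        have : s.eval 0 = 0 := map_zero s.1
        rw [this, map_zero, zero_add, Polynomial.eval_mul, Polynomial.eval_X, Polynomial.eval_C]
        exact s.eval_map_smul _ c D.form
      | mul a b ha hb => rw [map_mul, map_mul, Polynomial.eval_mul, ha, hb]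
      | add a b ha hb => rw [map_add, map_add, Polynomial.eval_add, ha, hb]
    rw [h2, h1, Polynomial.eval_zero]
  · intro h
    rw [polyVal_eq_aeval, lineEval_eq_zero _ _ _ h, map_zero]

variable {𝔤 : Type*} [LieRing 𝔤] [LieAlgebra ℂ 𝔤]

/-- Sections of `ω_X^{-1}` have degree `N`, so `-(c / N) E` acts on them as `-c`; both sides are
derivations along `polyVal`, so generators suffice. -/
theorem polyVal_zStar (ρ : 𝔤 →ₗ⁅ℂ⁆ vectorFields (localX 𝒜)) (ξ : 𝔤 × ℂ)
    {θ E : Derivation ℂ (FractionRing S) (FractionRing S)}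
    (hθ : D.IsLift (ρ ξ.1 : Derivation ℂ (functionField 𝒜) (functionField 𝒜)) θ)
    (hE : IsEuler 𝒜 E) (φ : PolyRing (localX 𝒜) n) :
    D.polyVal (zStar (localX 𝒜) n ρ ξ φ) =
      (θ - (ξ.2 / N) • E) (D.polyVal φ) := by
  induction φ using SymmetricAlgebra.induction with
  | algebraMap r =>
    rw [Derivation.map_algebraMap, map_zero, AlgHom.commutes, Derivation.map_algebraMap]
  | ι s =>
    change D.polyVal (symDer (ghatLin (localX 𝒜) n ρ ξ) (SymmetricAlgebra.ι ℂ _ s)) = _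
    rw [symDer_ι, polyVal_ι, polyVal_ι]
    change D.secVal (lieAct (ρ ξ.1) s - ξ.2 • s) = _
    rw [map_sub, map_smul, hθ.secVal_lieAct, Derivation.sub_apply, Derivation.smul_apply,
      hE _ _ (D.secVal_hom s)]
    congr 1
    have hN := natCast_fractionRing_ne_zero S D.one_le
    rw [Algebra.smul_def, Algebra.smul_def, map_div₀, map_natCast]
    push_cast
    field_simp
  | mul a b ha hb =>
    rw [Derivation.leibniz, smul_eq_mul, smul_eq_mul, map_add, map_mul, map_mul, ha, hb,
      map_mul D.polyVal a b, Derivation.leibniz, smul_eq_mul, smul_eq_mul]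
  | add a b ha hb => rw [map_add, map_add, ha, hb, map_add, map_add]

end ConeData

end
end CYCone

/-! ### Homogeneous vector fields of degree Nr, r ≥ 0 -/

set_option linter.unusedSectionVars false
set_option maxHeartbeats 1000000
namespace CYCone
noncomputable section

section Tensor

variable {K Q : Type*} [Field K] [Algebra ℂ K] [Field Q] [Algebra ℂ Q] [Algebra K Q]
  [IsScalarTower ℂ K Q] {M : Type*} [AddCommGroup M] [Module K M]

/-- The values on functions of a vector field with coefficients in a line bundle. -/
def tensorEval (l : M →ₗ[K] Q) : TensorProduct K (Derivation ℂ K K) M →ₗ[K] (K → Q) :=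
  TensorProduct.lift (LinearMap.mk₂ K (fun δ s c => algebraMap K Q (δ c) * l s)
    (fun δ δ' s => funext fun c => by
      rw [Derivation.add_apply, map_add, add_mul]; rfl)
    (fun a δ s => funext fun c => by
      rw [Derivation.smul_apply, smul_eq_mul, map_mul, Pi.smul_apply, Algebra.smul_def, mul_assoc])
    (fun δ s s' => funext fun c => by
      rw [map_add, mul_add]; rfl)
    (fun a δ s => funext fun c => by
      rw [map_smul, Pi.smul_apply, mul_smul_comm]))

theorem tensorEval_tmul (l : M →ₗ[K] Q) (δ : Derivation ℂ K K) (s : M) (c : K) :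
    tensorEval l (δ ⊗ₜ[K] s) c = algebraMap K Q (δ c) * l s := rfl

/-- The value of a rational section of `ω_X^{-r}`, multiplied by a constant. -/
def powEval {n : ℕ} (η : Can K n) (v : Q) (r : ℕ) : AntiCanPow K n r →ₗ[K] Q where
  toFun s := algebraMap K Q (s fun _ => η) * v
  map_add' s t := by rw [add_apply, map_add, add_mul]
  map_smul' c s := by
    rw [smul_apply, smul_eq_mul, map_mul, RingHom.id_apply, Algebra.smul_def,
      mul_assoc]

theorem powEval_apply {n : ℕ} (η : Can K n) (v : Q) (r : ℕ) (s : AntiCanPow K n r) :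
    powEval η v r s = algebraMap K Q (s fun _ => η) * v := rfl

theorem antiCanPow_smul {n r : ℕ} (s : AntiCanPow K n r) (c : K) (η : Can K n) :
    (s fun _ => c • η) = c ^ r * s fun _ => η := by
  have := s.map_smul_univ (fun _ => c) (fun _ => η)
  rwa [Finset.prod_const, Finset.card_univ, Fintype.card_fin, smul_eq_mul] at this

/-- The power of a rational section of `ω_X^{-1}`. -/
def antiCanPow {n : ℕ} (l : Can K n →ₗ[K] K) (r : ℕ) : AntiCanPow K n r :=
  (MultilinearMap.mkPiAlgebra K (Fin r) K).compLinearMap fun _ => l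

theorem antiCanPow_apply {n r : ℕ} (l : Can K n →ₗ[K] K) (η : Fin r → Can K n) :
    antiCanPow l r η = ∏ i, l (η i) := by
  rw [antiCanPow, MultilinearMap.compLinearMap_apply, MultilinearMap.mkPiAlgebra_apply]

theorem antiCanPow_smul_left {n r : ℕ} (l l' : Can K n →ₗ[K] K) (u : K)
    (h : ∀ η, l' η = u * l η) : antiCanPow l' r = u ^ r • antiCanPow l r := by
  ext η
  rw [smul_apply, antiCanPow_apply, antiCanPow_apply,
    Finset.prod_congr rfl fun i _ => h (η i), Finset.prod_mul_distrib, Finset.prod_const,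
    Finset.card_univ, Fintype.card_fin, smul_eq_mul]

theorem tmul_antiCanPow_eq {n r : ℕ} {l l' : Can K n →ₗ[K] K} {u : K} {δ δ' : Derivation ℂ K K}
    (h : ∀ η, l' η = u * l η) (hδ : ∀ c, δ c = u ^ r * δ' c) :
    δ ⊗ₜ[K] antiCanPow l r = δ' ⊗ₜ[K] antiCanPow l' r := by
  have h1 : δ = u ^ r • δ' := Derivation.ext hδ
  rw [antiCanPow_smul_left l l' u h, h1, TensorProduct.smul_tmul]

/-- A derivation from a subfield with values in a line. -/
theorem exists_derivation_of_mul (ξ : Derivation ℂ Q Q) (v : Q)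
    (h : ∀ c : K, ∃ d : K, algebraMap K Q d = ξ (algebraMap K Q c) * v) :
    ∃ δ : Derivation ℂ K K, ∀ c, algebraMap K Q (δ c) = ξ (algebraMap K Q c) * v := by
  choose d hd using h
  have hinj := (algebraMap K Q).injective
  refine ⟨Derivation.mk'
    { toFun := d
      map_add' := fun a b => hinj ?_
      map_smul' := fun c a => hinj ?_ } fun a b => hinj ?_, hd⟩
  · rw [map_add, hd, hd, hd, map_add, map_add, add_mul]
  · have h1 : ∀ z : K, algebraMap K Q (c • z) = c • algebraMap K Q z := fun z => by
      rw [Algebra.smul_def, Algebra.smul_def, map_mul, ← IsScalarTower.algebraMap_apply]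
    rw [hd, RingHom.id_apply, h1, h1, hd, Derivation.map_smul, smul_mul_assoc]
  · change algebraMap K Q (d (a * b)) = algebraMap K Q (a • d b + b • d a)
    rw [hd, map_mul, Derivation.leibniz, map_add, smul_eq_mul, smul_eq_mul, smul_eq_mul,
      smul_eq_mul, map_mul, map_mul, hd, hd]
    ring

end Tensor

variable {S : Type*} [CommRing S] [IsDomain S] [Algebra ℂ S] {𝒜 : ℕ → Submodule ℂ S}
  [GradedAlgebra 𝒜]

theorem IsRegDer.add {ξ ζ : Derivation ℂ (FractionRing S) (FractionRing S)}
    (h : IsRegDer 𝒜 ξ) (h' : IsRegDer 𝒜 ζ) : IsRegDer 𝒜 (ξ + ζ) :=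
  fun q g hg => (localU q).add_mem (h q g hg) (h' q g hg)

theorem IsRegDer.sub {ξ ζ : Derivation ℂ (FractionRing S) (FractionRing S)}
    (h : IsRegDer 𝒜 ξ) (h' : IsRegDer 𝒜 ζ) : IsRegDer 𝒜 (ξ - ζ) :=
  fun q g hg => (localU q).sub_mem (h q g hg) (h' q g hg)

theorem IsRegDer.smul {ξ : Derivation ℂ (FractionRing S) (FractionRing S)}
    (h : IsRegDer 𝒜 ξ) {a : FractionRing S} (ha : a ∈ regU 𝒜) : IsRegDer 𝒜 (a • ξ) :=
  fun q g hg => (localU q).mul_mem (mem_regU.1 ha q) (h q g hg)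

theorem IsRegDer.const_smul {ξ : Derivation ℂ (FractionRing S) (FractionRing S)}
    (h : IsRegDer 𝒜 ξ) (c : ℂ) : IsRegDer 𝒜 (c • ξ) :=
  fun q g hg => (localU q).smul_mem (h q g hg) c

theorem IsHomDer.add {d : ℤ} {ξ ζ : Derivation ℂ (FractionRing S) (FractionRing S)}
    (h : IsHomDer 𝒜 d ξ) (h' : IsHomDer 𝒜 d ζ) : IsHomDer 𝒜 d (ξ + ζ) :=
  fun k z hz => (h k z hz).add (h' k z hz)

theorem IsHomDer.sub {d : ℤ} {ξ ζ : Derivation ℂ (FractionRing S) (FractionRing S)}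
    (h : IsHomDer 𝒜 d ξ) (h' : IsHomDer 𝒜 d ζ) : IsHomDer 𝒜 d (ξ - ζ) :=
  fun k z hz => (homPart 𝒜 _).sub_mem (h k z hz) (h' k z hz)

theorem IsHomDer.smul {d l : ℤ} {ξ : Derivation ℂ (FractionRing S) (FractionRing S)}
    (h : IsHomDer 𝒜 d ξ) {a : FractionRing S} (ha : IsHomFrac 𝒜 l a) :
    IsHomDer 𝒜 (l + d) (a • ξ) :=
  fun k z hz => (ha.mul (h k z hz)).cast (by ring)

theorem IsHomDer.const_smul {d : ℤ} {ξ : Derivation ℂ (FractionRing S) (FractionRing S)}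
    (h : IsHomDer 𝒜 d ξ) (c : ℂ) : IsHomDer 𝒜 d (c • ξ) :=
  fun k z hz => (homPart 𝒜 _).smul_mem c (h k z hz)

theorem IsEuler.isRegDer (hgen : Algebra.adjoin ℂ (𝒜 1 : Set S) = ⊤)
    {E : Derivation ℂ (FractionRing S) (FractionRing S)} (hE : IsEuler 𝒜 E) : IsRegDer 𝒜 E :=
  isRegDer_of hgen fun x hx => by
    rw [hE _ _ (IsHomFrac.algebraMap hx), Nat.cast_one, Int.cast_one, one_mul]
    exact algebraMap_mem_regU x

namespace ConeData

variable {n N : ℕ} (D : ConeData 𝒜 n N)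

/-- A regular vector field on `U` that is vertical over `X` is a multiple of the Euler field. -/
theorem exists_eq_smul_euler {E ζ : Derivation ℂ (FractionRing S) (FractionRing S)}
    (hE : IsEuler 𝒜 E) (D : ConeData 𝒜 n N) (hζ : IsRegDer 𝒜 ζ) {d : ℤ} (hd : IsHomDer 𝒜 d ζ)
    (h0 : ∀ c : functionField 𝒜, ζ c = 0) :
    ∃ G ∈ regU 𝒜, IsHomFrac 𝒜 d G ∧ ζ = G • E := by
  obtain ⟨x, hx, hx0⟩ := D.exists_degree_one
  have hQ := algebraMap_frac_ne_zero hx0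
  have hEx : ∀ y ∈ 𝒜 1, E (algebraMap S (FractionRing S) y) = algebraMap S (FractionRing S) y :=
    fun y hy => by rw [hE _ _ (IsHomFrac.algebraMap hy), Nat.cast_one, Int.cast_one, one_mul]
  set G := ζ (algebraMap S (FractionRing S) x) * (algebraMap S (FractionRing S) x)⁻¹ with hG
  have h1 : ζ = G • E := by
    refine derivation_ext hx hx0 (fun c => ?_) ?_
    · rw [h0, Derivation.smul_apply, hE _ _ (isHomFrac_coe c), Int.cast_zero, zero_mul, smul_zero]
    · rw [Derivation.smul_apply, hEx x hx, smul_eq_mul, hG, inv_mul_cancel_right₀ hQ]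
  refine ⟨G, mem_regU.2 fun q => ?_, ?_, h1⟩
  · obtain ⟨y, hy, hyq⟩ := exists_degree_one_notMem D.gen q.2
    have hy0 : y ≠ 0 := fun h => hyq (h ▸ zero_mem _)
    have h2 : G = ζ (algebraMap S (FractionRing S) y) * (algebraMap S (FractionRing S) y)⁻¹ := by
      rw [h1, Derivation.smul_apply, hEx y hy, smul_eq_mul,
        mul_inv_cancel_right₀ (algebraMap_frac_ne_zero hy0)]
    rw [h2]
    exact (localU q).mul_mem (hζ q _ (algebraMap_mem_localU y q)) (inv_mem_localU hyq)
  · exact ((hd _ _ (IsHomFrac.algebraMap hx)).mul (IsHomFrac.algebraMap hx).inv').cast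
      (by push_cast; ring)

/-- The section of `ω_X^{-1}` that is given by multiplication with `x ^ N`. -/
def powForm {x : S} (hx : x ∈ 𝒜 1) :
    Can (functionField 𝒜) n →ₗ[functionField 𝒜] functionField 𝒜 where
  toFun η := ⟨D.val η * algebraMap S (FractionRing S) x ^ N,
    ((D.val_hom η).mul ((IsHomFrac.algebraMap hx).pow N)).cast (by push_cast; ring)⟩
  map_add' η ζ := Subtype.ext
    ((congrArg (· * algebraMap S (FractionRing S) x ^ N) (D.val_add η ζ)).trans (add_mul _ _ _))
  map_smul' c η := Subtype.ext
    ((congrArg (· * algebraMap S (FractionRing S) x ^ N) (D.val_smul c η)).trans (mul_assoc _ _ _))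

theorem coe_powForm {x : S} (hx : x ∈ 𝒜 1) (η : Can (functionField 𝒜) n) :
    (D.powForm hx η : FractionRing S) = D.val η * algebraMap S (FractionRing S) x ^ N := rfl

theorem powForm_mem_localX {x : S} (hx : x ∈ 𝒜 1) {p : ProjectiveSpectrum 𝒜}
    {η : Can (functionField 𝒜) n} (hη : η ∈ canStalk n (localX 𝒜 p)) :
    D.powForm hx η ∈ localX 𝒜 p := by
  refine mem_twistStalk_of_mem_projPoint D.gen (isHomFrac_coe _) ?_
  rw [coe_powForm]
  exact (localU _).mul_mem (twistStalk_subset_localU_projPoint ((D.mem_iff p η).1 hη))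
    ((localU _).pow_mem (algebraMap_mem_localU x _) N)

/-- A homogeneous regular vector field on `U` gives a section of `T_X ⊗ ω_X^{-r}`. -/
theorem exists_twistedDerSection {ξ : Derivation ℂ (FractionRing S) (FractionRing S)}
    (hξ : IsRegDer 𝒜 ξ) {r : ℕ} (hr : IsHomDer 𝒜 (N * r) ξ) :
    ∃ t ∈ twistedDerSections (localX 𝒜) n r, ∀ x ∈ 𝒜 1, x ≠ 0 → ∀ η : Can (functionField 𝒜) n,
      D.val η = (algebraMap S (FractionRing S) x ^ N)⁻¹ → ∀ c : functionField 𝒜,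
        tensorEval (powEval η ((algebraMap S (FractionRing S) x ^ N) ^ r) r) t c = ξ c := by
  -- Dividing by `x ^ (N r)` makes the field preserve degree zero, so it becomes a rational vector
  -- field on `X`.
  have key : ∀ x ∈ 𝒜 1, x ≠ 0 → ∃ δ : Derivation ℂ (functionField 𝒜) (functionField 𝒜),
      ∀ c, (δ c : FractionRing S) = ξ c * ((algebraMap S (FractionRing S) x ^ N) ^ r)⁻¹ :=
    fun x hx hx0 => exists_derivation_of_mul ξ _ fun c => ⟨⟨_, ((hr _ _ (isHomFrac_coe c)).mul
      (((IsHomFrac.algebraMap hx).pow N).pow r).inv').cast (by push_cast; ring)⟩, rfl⟩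
  choose δ hδ using key
  -- The section `δ_x ⊗ (x ^ N)^{⊗ r}` does not depend on `x`: the factor `(y ^ N / x ^ N) ^ r`
  -- moves across the tensor product. It may thus be written near each point with an `x` that does
  -- not vanish there.
  have heq : ∀ x (hx : x ∈ 𝒜 1) (hx0 : x ≠ 0) y (hy : y ∈ 𝒜 1) (hy0 : y ≠ 0),
      δ x hx hx0 ⊗ₜ[functionField 𝒜] antiCanPow (D.powForm hx) r =
      δ y hy hy0 ⊗ₜ[functionField 𝒜] antiCanPow (D.powForm hy) r := by
    intro x hx hx0 y hy hy0
    have hX := pow_ne_zero N (algebraMap_frac_ne_zero hx0)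
    have hY := pow_ne_zero N (algebraMap_frac_ne_zero hy0)
    refine tmul_antiCanPow_eq (u := ⟨algebraMap S (FractionRing S) y ^ N *
      (algebraMap S (FractionRing S) x ^ N)⁻¹, (((IsHomFrac.algebraMap hy).pow N).mul
        ((IsHomFrac.algebraMap hx).pow N).inv').cast (by push_cast; ring)⟩)
      (fun η => Subtype.ext ?_) (fun c => Subtype.ext ?_)
    · rw [MulMemClass.coe_mul, coe_powForm, coe_powForm]
      field_simp
    · rw [MulMemClass.coe_mul, hδ, hδ, SubmonoidClass.coe_pow, mul_pow, inv_pow]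
      field_simp
  obtain ⟨x₀, hx₀, hx₀'⟩ := D.exists_degree_one
  refine ⟨δ x₀ hx₀ hx₀' ⊗ₜ[functionField 𝒜] antiCanPow (D.powForm hx₀) r, ?_, ?_⟩
  · refine (Submodule.mem_iInf _).2 fun p => ?_
    obtain ⟨x, hx, hxq⟩ := exists_degree_one_notMem D.gen (projPoint p).2
    have hx0 : x ≠ 0 := fun h => hxq (h ▸ zero_mem _)
    rw [heq x₀ hx₀ hx₀' x hx hx0]
    refine Submodule.subset_span ⟨_, ?_, _, ?_, rfl⟩
    · intro c hc
      refine mem_twistStalk_of_mem_projPoint D.gen (isHomFrac_coe _) ?_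
      rw [hδ, ← inv_pow, ← inv_pow]
      exact (localU _).mul_mem (hξ _ _ (twistStalk_subset_localU_projPoint hc))
        ((localU _).pow_mem ((localU _).pow_mem (inv_mem_localU hxq) _) _)
    · intro η hη
      rw [antiCanPow_apply]
      exact (localX 𝒜 p).prod_mem fun i _ => D.powForm_mem_localX hx (hη i)
  · intro x hx hx0 η hη c
    have hX := pow_ne_zero N (algebraMap_frac_ne_zero hx0)
    have h1 : D.powForm hx η = 1 := Subtype.ext (by
      rw [coe_powForm, hη, inv_mul_cancel₀ hX]; rfl)
    rw [heq x₀ hx₀ hx₀' x hx hx0, tensorEval_tmul, powEval_apply, antiCanPow_apply, h1,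
      Finset.prod_const_one, map_one, one_mul, algebraMap_functionField, hδ,
      inv_mul_cancel_right₀ (pow_ne_zero r hX)]

/-- The lift to `U` of a vector field on `X`. -/
def lift (δ : Derivation ℂ (functionField 𝒜) (functionField 𝒜)) :
    Derivation ℂ (FractionRing S) (FractionRing S) := (D.exists_isLift δ).choose

theorem isLift_lift (δ : Derivation ℂ (functionField 𝒜) (functionField 𝒜)) :
    D.IsLift δ (D.lift δ) := (D.exists_isLift δ).choose_spec

theorem isRegDer_lift (δ : vectorFields (localX 𝒜)) :
    IsRegDer 𝒜 (D.lift (δ : Derivation ℂ (functionField 𝒜) (functionField 𝒜))) :=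
  (D.isLift_lift _).isRegDer fun p _ hg => vectorFields_mem (localX 𝒜) δ p hg

/-- If `α(η) = x ^ (-N)`, the function `s(η, …, η) x ^ (N r)` is unchanged when `x` is replaced by
another element of degree one, so regularity at a point can be checked with a local generator of
`ω_X`. -/
theorem powEval_mem_regU {r : ℕ} {s : AntiCanPow (functionField 𝒜) n r}
    (hs : s ∈ antiCanPowSections (localX 𝒜) n r) {x : S} (hx0 : x ≠ 0)
    {η : Can (functionField 𝒜) n} (hη : D.val η = (algebraMap S (FractionRing S) x ^ N)⁻¹) :
    powEval η ((algebraMap S (FractionRing S) x ^ N) ^ r) r s ∈ regU 𝒜 := by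
  refine mem_regU.2 fun q => ?_
  obtain ⟨y, hy, hyq, ζ, hζ, hv, hζp⟩ := D.exists_local_form q
  have hy0 : y ≠ 0 := fun h => hyq (h ▸ zero_mem _)
  have hX := pow_ne_zero N (algebraMap_frac_ne_zero hx0)
  have hY := pow_ne_zero N (algebraMap_frac_ne_zero hy0)
  obtain ⟨u, rfl⟩ := D.exists_smul (ζ := η) hζ
  rw [D.val_smul, hv, ← div_eq_mul_inv, div_eq_iff hY] at hη
  have h1 : powEval (u • ζ) ((algebraMap S (FractionRing S) x ^ N) ^ r) r s =
      ((s fun _ => ζ : functionField 𝒜) : FractionRing S) *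
        (algebraMap S (FractionRing S) y ^ N) ^ r := by
    have h2 : (s fun _ => u • ζ) = u ^ r * s fun _ => ζ := antiCanPow_smul s u ζ
    rw [powEval_apply, h2, algebraMap_functionField, MulMemClass.coe_mul, SubmonoidClass.coe_pow,
      hη, mul_pow, inv_pow]
    field_simp
  rw [h1]
  exact (localU q).mul_mem (twistStalk_subset_localU ((Submodule.mem_iInf _).1 hs (corePoint q) _
    fun _ => hζp)) ((localU q).pow_mem ((localU q).pow_mem (algebraMap_mem_localU y q) N) r)

variable {𝔤 : Type*} [LieRing 𝔤] [LieAlgebra ℂ 𝔤] (ρ : 𝔤 →ₗ⁅ℂ⁆ vectorFields (localX 𝒜))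

/-- The multiples of degree `N r` of the lifts of the vector fields given by `𝔤`. -/
def liftSpan (r : ℕ) : Submodule ℂ (Derivation ℂ (FractionRing S) (FractionRing S)) :=
  Submodule.span ℂ {ζ | ∃ y : 𝔤, ∃ G ∈ regU 𝒜, IsHomFrac 𝒜 (N * r) G ∧
    ζ = G • D.lift (ρ y : Derivation ℂ (functionField 𝒜) (functionField 𝒜))}

theorem isRegDer_of_mem_liftSpan {r : ℕ} {ζ : Derivation ℂ (FractionRing S) (FractionRing S)}
    (h : ζ ∈ D.liftSpan ρ r) : IsRegDer 𝒜 ζ ∧ IsHomDer 𝒜 (N * r) ζ := by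
  induction h using Submodule.span_induction with
  | mem x hx =>
    obtain ⟨y, G, hG, hr, rfl⟩ := hx
    refine ⟨(D.isRegDer_lift _).smul hG, ?_⟩
    have := (D.isLift_lift (ρ y : Derivation ℂ (functionField 𝒜) (functionField 𝒜))).isHomDer.smul hr
    rwa [add_zero] at this
  | zero => exact ⟨fun q _ _ => (localU q).zero_mem, fun _ _ _ => IsHomFrac.zero _⟩
  | add x y _ _ hx hy => exact ⟨hx.1.add hy.1, hx.2.add hy.2⟩
  | smul c x _ hx => exact ⟨hx.1.const_smul c, hx.2.const_smul c⟩

/-- Homogeneous regular vector fields of degree `N r`, with `r ≥ 0`, are generated by `𝔤` and the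
Euler field. -/
theorem exists_eq_lift_add (hTr : ∀ r : ℕ, twistedDerSections (localX 𝒜) n r ≤
      Submodule.span ℂ {t | ∃ x : 𝔤, ∃ s ∈ antiCanPowSections (localX 𝒜) n r,
        t = (ρ x : Derivation ℂ (functionField 𝒜) (functionField 𝒜)) ⊗ₜ[functionField 𝒜] s})
    {E ξ : Derivation ℂ (FractionRing S) (FractionRing S)} (hE : IsEuler 𝒜 E)
    (hξ : IsRegDer 𝒜 ξ) {r : ℕ} (hr : IsHomDer 𝒜 (N * r) ξ) :
    ∃ ζ ∈ D.liftSpan ρ r, ∃ G ∈ regU 𝒜, IsHomFrac 𝒜 (N * r) G ∧ ξ = ζ + G • E := by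
  obtain ⟨t, ht, hξt⟩ := D.exists_twistedDerSection hξ hr
  obtain ⟨x, hx, hx0⟩ := D.exists_degree_one
  obtain ⟨η, hη⟩ := D.exists_val_eq_inv_pow hx
  set ev := tensorEval (powEval η ((algebraMap S (FractionRing S) x ^ N) ^ r) r) with hev
  -- By hypothesis (iii) the section is a combination of terms `ρ(y) ⊗ s`, and each of them is
  -- induced by the field `G θ_y`, with `G` the function of degree `N r` given by `s`.
  have h1 : ∃ ζ ∈ D.liftSpan ρ r, ∀ c : functionField 𝒜, ζ c = ev t c := by
    have h2 := hTr r ht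
    clear_value ev
    clear ht hξt
    induction h2 using Submodule.span_induction with
    | mem t ht =>
      obtain ⟨y, s, hs, rfl⟩ := ht
      refine ⟨_, Submodule.subset_span ⟨y, _, D.powEval_mem_regU hs hx0 hη, ?_, rfl⟩, fun c => ?_⟩
      · rw [powEval_apply, algebraMap_functionField]
        exact ((isHomFrac_coe _).mul (((IsHomFrac.algebraMap hx).pow N).pow r)).cast
          (by push_cast; ring)
      · rw [hev, tensorEval_tmul, Derivation.smul_apply, (D.isLift_lift _).coe, smul_eq_mul,
          mul_comm]
        rfl
    | zero => exact ⟨0, zero_mem _, fun c => by rw [map_zero]; rfl⟩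
    | add t t' _ _ h h' =>
      obtain ⟨ζ, hζ, e⟩ := h
      obtain ⟨ζ', hζ', e'⟩ := h'
      exact ⟨ζ + ζ', add_mem hζ hζ', fun c => by
        rw [Derivation.add_apply, e, e', map_add]; rfl⟩
    | smul a t _ h =>
      obtain ⟨ζ, hζ, e⟩ := h
      refine ⟨a • ζ, Submodule.smul_mem _ a hζ, fun c => ?_⟩
      rw [Derivation.smul_apply, e, ← algebraMap_smul (functionField 𝒜) a t, map_smul]
      exact (algebraMap_smul (functionField 𝒜) a (ev t c)).symm
  obtain ⟨ζ, hζ, e⟩ := h1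
  obtain ⟨hreg, hhom⟩ := D.isRegDer_of_mem_liftSpan ρ hζ
  -- The difference `ξ - ζ` kills the functions of `X`, so it is vertical.
  obtain ⟨G, hG, hGr, e'⟩ := exists_eq_smul_euler hE D (hξ.sub hreg) (hr.sub hhom) fun c => by
    rw [Derivation.sub_apply, e, hξt x hx hx0 η hη, sub_self]
  exact ⟨ζ, hζ, G, hG, hGr, by rw [← e', add_sub_cancel]⟩

end ConeData

end
end CYCone

/-! ### Coinvariants and the operators of ĝ on functions -/

set_option linter.unusedSectionVars false
set_option maxHeartbeats 1000000
namespace CYCone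
noncomputable section

section Abstract

/-- A map between modules that induces an isomorphism of quotients. -/
theorem nonempty_quotient_equiv {V W : Type*} [AddCommGroup V] [Module ℂ V] [AddCommGroup W]
    [Module ℂ W] (φ : V →ₗ[ℂ] W) (V₀ : Submodule ℂ V) (W₀ : Submodule ℂ W)
    (h : ∀ v, φ v ∈ W₀ ↔ v ∈ V₀) (hs : ∀ w, ∃ v, w - φ v ∈ W₀) :
    Nonempty ((V ⧸ V₀) ≃ₗ[ℂ] (W ⧸ W₀)) := by
  refine ⟨LinearEquiv.ofBijective (V₀.mapQ W₀ φ fun v hv => (h v).2 hv) ⟨?_, ?_⟩⟩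
  · rw [injective_iff_map_eq_zero]
    intro v hv
    obtain ⟨v, rfl⟩ := Submodule.Quotient.mk_surjective _ v
    rw [Submodule.mapQ_apply, Submodule.Quotient.mk_eq_zero, h] at hv
    rwa [Submodule.Quotient.mk_eq_zero]
  · intro w
    obtain ⟨w, rfl⟩ := Submodule.Quotient.mk_surjective _ w
    obtain ⟨v, hv⟩ := hs w
    exact ⟨Submodule.Quotient.mk v, ((Submodule.Quotient.eq W₀).2 hv).symm⟩

variable {Q : Type*} [AddCommGroup Q] [Module ℂ Q] {ι : Type*}

/-- The sum of the images of a subspace under a family of operators. -/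
def opSum (op : ι → Q →ₗ[ℂ] Q) (W : Submodule ℂ Q) : Submodule ℂ Q := ⨆ i, W.map (op i)

theorem apply_mem_opSum (op : ι → Q →ₗ[ℂ] Q) {W : Submodule ℂ Q} (i : ι) {w : Q} (hw : w ∈ W) :
    op i w ∈ opSum op W :=
  Submodule.mem_iSup_of_mem i ⟨w, hw, rfl⟩

theorem opSum_mono (op : ι → Q →ₗ[ℂ] Q) {W W' : Submodule ℂ Q} (h : W ≤ W') :
    opSum op W ≤ opSum op W' :=
  iSup_mono fun _ => Submodule.map_mono h

/-- If an operator `T` that commutes with a family of operators is invertible on `R / A`, then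
`A` and `R` have the same coinvariants. -/
theorem mem_opSum_of_invertible (op : ι → Q →ₗ[ℂ] Q) (i₀ : ι) {A R : Submodule ℂ Q}
    (hR : ∀ i, ∀ w ∈ R, op i w ∈ R) (hA : ∀ i, ∀ w ∈ A, op i w ∈ A)
    (hcomm : ∀ i w, op i (op i₀ w) = op i₀ (op i w))
    (hinj : ∀ w ∈ R, op i₀ w ∈ A → w ∈ A) (hsurj : ∀ w ∈ R, ∃ a ∈ A, ∃ r ∈ R, w = a + op i₀ r)
    {w : Q} (hw : w ∈ A) (hw' : w ∈ opSum op R) : w ∈ opSum op A := by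
  -- Writing `w = a + T r` with `T = op i₀` and using that `T` commutes with `op i`, every `op i w`
  -- lies in `op i A + T R`. So only the image of `T` needs to be brought back into `A`.
  have h1 : ∃ a ∈ opSum op A, ∃ r ∈ R, w = a + op i₀ r := by
    refine Submodule.iSup_induction _ (motive := fun w => ∃ a ∈ opSum op A, ∃ r ∈ R,
      w = a + op i₀ r) hw' ?_ ?_ ?_
    · rintro i _ ⟨w, hw, rfl⟩
      obtain ⟨a, ha, r, hr, rfl⟩ := hsurj w hw
      exact ⟨op i a, apply_mem_opSum op i ha, op i r, hR i r hr, by rw [map_add, hcomm]⟩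
    · exact ⟨0, zero_mem _, 0, zero_mem _, by rw [map_zero, add_zero]⟩
    · rintro _ _ ⟨a, ha, r, hr, rfl⟩ ⟨a', ha', r', hr', rfl⟩
      exact ⟨a + a', add_mem ha ha', r + r', add_mem hr hr', by rw [map_add]; abel⟩
  obtain ⟨a, ha, r, hr, rfl⟩ := h1
  have haA : a ∈ A := by
    refine (iSup_le fun i => ?_ : opSum op A ≤ A) ha
    rintro _ ⟨w, hw, rfl⟩
    exact hA i w hw
  have h2 : op i₀ r ∈ A := by simpa using sub_mem hw haA
  exact add_mem ha (apply_mem_opSum op i₀ (hinj r hr h2))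

end Abstract

/-- The operator `p ↦ θ(p) + θ(F) p - c p`. -/
def opQ {Q : Type*} [CommRing Q] [Algebra ℂ Q] (θ : Derivation ℂ Q Q) (F : Q) (c : ℂ) :
    Q →ₗ[ℂ] Q := (θ : Q →ₗ[ℂ] Q) + LinearMap.mulLeft ℂ (θ F) - c • LinearMap.id

theorem opQ_apply {Q : Type*} [CommRing Q] [Algebra ℂ Q] (θ : Derivation ℂ Q Q) (F : Q) (c : ℂ)
    (p : Q) : opQ θ F c p = θ p + θ F * p - c • p := rfl

variable {S : Type*} [CommRing S] [IsDomain S] [Algebra ℂ S] {𝒜 : ℕ → Submodule ℂ S}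
  [GradedAlgebra 𝒜]

/-- The commutator of the two derivations kills the function field of `X` and the element `x`. -/
theorem IsEuler.comm {E θ : Derivation ℂ (FractionRing S) (FractionRing S)} (hE : IsEuler 𝒜 E)
    (hθ : IsHomDer 𝒜 0 θ) {x : S} (hx : x ∈ 𝒜 1) (hx0 : x ≠ 0) (p : FractionRing S) :
    θ (E p) = E (θ p) := by
  have h1 : ⁅θ, E⁆ = 0 := by
    refine derivation_ext hx hx0 (fun c => ?_) ?_
    · rw [Derivation.commutator_apply, hE _ _ (isHomFrac_coe c),
        hE _ _ (hθ _ _ (isHomFrac_coe c))]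
      simp
    · rw [Derivation.commutator_apply, hE _ _ (IsHomFrac.algebraMap hx),
        hE _ _ (hθ _ _ (IsHomFrac.algebraMap hx))]
      simp
  have h2 := DFunLike.congr_fun h1 p
  rw [Derivation.commutator_apply] at h2
  exact sub_eq_zero.1 h2

namespace ConeData

variable {n N : ℕ} (D : ConeData 𝒜 n N)

/-- The Euler field of `U`. -/
def euler (D : ConeData 𝒜 n N) : Derivation ℂ (FractionRing S) (FractionRing S) :=
  (exists_euler D.exists_degree_one.choose_spec.1 D.exists_degree_one.choose_spec.2).choose

theorem isEuler : IsEuler 𝒜 D.euler :=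
  (exists_euler D.exists_degree_one.choose_spec.1 D.exists_degree_one.choose_spec.2).choose_spec

variable {𝔤 : Type*} [LieRing 𝔤] [LieAlgebra ℂ 𝔤] (ρ : 𝔤 →ₗ⁅ℂ⁆ vectorFields (localX 𝒜))

/-- The lift of the vector field given by an element of `𝔤`. -/
def act (y : 𝔤) : Derivation ℂ (FractionRing S) (FractionRing S) :=
  D.lift (ρ y : Derivation ℂ (functionField 𝒜) (functionField 𝒜))

theorem isHomDer_act (y : 𝔤) : IsHomDer 𝒜 0 (D.act ρ y) := (D.isLift_lift _).isHomDer

theorem isRegDer_act (y : 𝔤) : IsRegDer 𝒜 (D.act ρ y) := D.isRegDer_lift (ρ y)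

/-- The vector fields `θ_y` and `-E / N` on `U`; they come from a set of generators of `ĝ`. -/
def gens : Option 𝔤 → Derivation ℂ (FractionRing S) (FractionRing S)
  | some y => D.act ρ y
  | none => -((N : ℂ)⁻¹ • D.euler)

/-- The values of the character `β` on the generators of `ĝ`. -/
def genChar : Option 𝔤 → ℂ
  | some _ => 0
  | none => 1

/-- The operators on functions on `U` given by the generators of `ĝ`. -/
def op (F : FractionRing S) (i : Option 𝔤) : FractionRing S →ₗ[ℂ] FractionRing S :=
  opQ (D.gens ρ i) F (genChar i)

theorem isHomDer_gens (i : Option 𝔤) : IsHomDer 𝒜 0 (D.gens ρ i) := by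
  rcases i with _ | y
  · exact fun k z hz => (homPart 𝒜 _).neg_mem ((D.isEuler.isHomDer.const_smul _) k z hz)
  · exact D.isHomDer_act ρ y

theorem isRegDer_gens (i : Option 𝔤) : IsRegDer 𝒜 (D.gens ρ i) := by
  rcases i with _ | y
  · exact fun q g hg => (localU q).neg_mem (((D.isEuler.isRegDer D.gen).const_smul _) q g hg)
  · exact D.isRegDer_act ρ y

theorem gens_none_of_hom {k : ℤ} {z : FractionRing S} (hz : IsHomFrac 𝒜 (N * k) z) :
    D.gens ρ none z = -((k : FractionRing S) * z) := by
  have hN := natCast_fractionRing_ne_zero S D.one_le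
  change -((N : ℂ)⁻¹ • D.euler z) = _
  rw [D.isEuler _ _ hz, Algebra.smul_def, map_inv₀, map_natCast]
  push_cast
  field_simp

variable {F : FractionRing S} (hF : F ∈ regU 𝒜) (hFN : IsHomFrac 𝒜 N F)
include hF hFN

/-- The summand `1` in `k + 1` is the value of `β`; it makes the operator invertible modulo
multiplication by `F` exactly when `k ≠ -1`. -/
theorem op_none_of_hom {k : ℤ} {z : FractionRing S} (hz : IsHomFrac 𝒜 (N * k) z) :
    D.op ρ F none z = -(((k : ℂ) + 1) • z + F * z) := by
  have h1 := D.gens_none_of_hom ρ (k := 1) (hFN.cast (mul_one (N : ℤ)).symm)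
  rw [op, opQ_apply, D.gens_none_of_hom ρ hz, h1]
  change _ - (1 : ℂ) • z = _
  rw [add_smul, one_smul, Algebra.smul_def, map_intCast, Int.cast_one]
  ring

theorem op_mem_regMod (i : Option 𝔤) {p : FractionRing S} (hp : p ∈ regMod 𝒜 N) :
    D.op ρ F i p ∈ regMod 𝒜 N := by
  have h1 := D.isHomDer_gens ρ i
  have h2 := D.isRegDer_gens ρ i
  have h1' : IsHomDer 𝒜 (N * 0) (D.gens ρ i) := by rwa [mul_zero]
  refine (regMod 𝒜 N).sub_mem ((regMod 𝒜 N).add_mem (h1'.mem_regMod h2 hp) ?_)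
    ((regMod 𝒜 N).smul_mem _ hp)
  exact mul_mem_regMod (d := 1) (h2.apply_mem hF) ((h1 _ _ hFN).cast (by ring)) hp

/-- The lifts have degree zero and commute with `E`; both `F` and `θ_y(F)` have degree `N`, so
`-E/N` acts on each of them as `-1`. -/
theorem op_comm (i : Option 𝔤) (p : FractionRing S) :
    D.op ρ F i (D.op ρ F none p) = D.op ρ F none (D.op ρ F i p) := by
  rcases i with _ | y
  · rfl
  obtain ⟨x, hx, hx0⟩ := D.exists_degree_one
  have hN := natCast_fractionRing_ne_zero S D.one_le
  have hc := D.isEuler.comm (D.isHomDer_act ρ y) hx hx0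
  have h1 := D.isHomDer_act ρ y _ _ hFN
  have e1 : D.gens ρ none F = -F := by
    have := D.gens_none_of_hom ρ (k := 1) (hFN.cast (mul_one (N : ℤ)).symm)
    rwa [Int.cast_one, one_mul] at this
  have e2 : D.gens ρ none (D.act ρ y F) = -D.act ρ y F := by
    have := D.gens_none_of_hom ρ (k := 1) (h1.cast (by ring))
    rwa [Int.cast_one, one_mul] at this
  have e3 : ∀ p, D.act ρ y (D.gens ρ none p) = D.gens ρ none (D.act ρ y p) := fun p => by
    change D.act ρ y (-((N : ℂ)⁻¹ • D.euler p)) = -((N : ℂ)⁻¹ • D.euler (D.act ρ y p))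
    rw [map_neg, Derivation.map_smul, hc]
  have s1 : ∀ p, D.op ρ F (some y) p = D.act ρ y p + D.act ρ y F * p := fun p => by
    change D.act ρ y p + D.act ρ y F * p - (0 : ℂ) • p = _
    rw [zero_smul, sub_zero]
  have s2 : ∀ p, D.op ρ F none p = D.gens ρ none p - F * p - p := fun p => by
    change D.gens ρ none p + D.gens ρ none F * p - (1 : ℂ) • p = _
    rw [one_smul, e1]
    ring
  rw [s1, s2, s2, s1]
  simp only [map_add, map_sub, Derivation.leibniz, smul_eq_mul, e2, e3]
  ring

end ConeData

end
end CYCone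

/-! ### Powers of f move regular functions into the cone ring -/

set_option linter.unusedSectionVars false
set_option maxHeartbeats 1000000
namespace CYCone
noncomputable section

variable {S : Type*} [CommRing S] [IsDomain S] [Algebra ℂ S] {𝒜 : ℕ → Submodule ℂ S}
  [GradedAlgebra 𝒜]

section Conductor

variable (𝒜) in
/-- The algebra generated by the fractions `s / F ^ m` of degree zero. -/
def fracAlg (N : ℕ) (F : FractionRing S) : Subalgebra ℂ (FractionRing S) :=
  Algebra.adjoin ℂ {z | ∃ m, ∃ s ∈ 𝒜 (N * m), z = algebraMap S (FractionRing S) s / F ^ m}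

variable {N : ℕ} {F : FractionRing S}

theorem div_mem_fracAlg {m : ℕ} {s : S} (hs : s ∈ 𝒜 (N * m)) :
    algebraMap S (FractionRing S) s / F ^ m ∈ fracAlg 𝒜 N F :=
  Algebra.subset_adjoin ⟨m, s, hs, rfl⟩

variable (𝒜 N F) in
/-- The fraction `s / F ^ m`. -/
def fracMap (m : ℕ) : 𝒜 (N * m) →ₗ[ℂ] fracAlg 𝒜 N F where
  toFun s := ⟨_, div_mem_fracAlg s.2⟩
  map_add' s t := Subtype.ext (by
    change algebraMap S (FractionRing S) (s + t : S) / _ = _ / _ + _ / _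
    rw [map_add, add_div])
  map_smul' c s := Subtype.ext (by
    change algebraMap S (FractionRing S) (c • s : S) / _ = c • (_ / _)
    rw [Algebra.smul_def, map_mul, ← IsScalarTower.algebraMap_apply, mul_div_assoc,
      ← Algebra.smul_def])

variable (𝒜 N F) in
/-- The ideal generated by the fractions `s / F ^ m` for a fixed `m`. -/
def fracIdeal (m : ℕ) : Ideal (fracAlg 𝒜 N F) := Ideal.span (Set.range (fracMap 𝒜 N F m))

theorem fracIdeal_fg (hgen : Algebra.adjoin ℂ (𝒜 1 : Set S) = ⊤) [Algebra.FiniteType ℂ S] (m : ℕ) :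
    (fracIdeal 𝒜 N F m).FG := by
  have h1 : (LinearMap.range (fracMap 𝒜 N F m)).FG := by
    have : Module.Finite ℂ (𝒜 (N * m)) := Module.Finite.iff_fg.2 (fg_graded hgen _)
    rw [LinearMap.range_eq_map]
    exact Submodule.FG.map _ Module.Finite.fg_top
  obtain ⟨t, ht⟩ := h1
  refine ⟨t, ?_⟩
  apply le_antisymm
  · refine Ideal.span_mono ?_
    rw [← LinearMap.coe_range, ← ht]
    exact Submodule.subset_span
  · refine Ideal.span_le.2 ?_
    rw [← LinearMap.coe_range, ← ht]
    exact Submodule.span_le_restrictScalars ℂ _ _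

/-- Generation in degree one gives `𝒜 (N (m + 1)) = 𝒜 N · 𝒜 (N m)`. -/
theorem fracIdeal_succ (hgen : Algebra.adjoin ℂ (𝒜 1 : Set S) = ⊤) (m : ℕ) :
    fracIdeal 𝒜 N F (m + 1) = fracIdeal 𝒜 N F 1 * fracIdeal 𝒜 N F m := by
  apply le_antisymm
  · refine Ideal.span_le.2 ?_
    rintro _ ⟨⟨s, hs⟩, rfl⟩
    have h1 : ∀ s ∈ 𝒜 (N * 1) * 𝒜 (N * m), ∃ c ∈ fracIdeal 𝒜 N F 1 * fracIdeal 𝒜 N F m,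
        (c : FractionRing S) = algebraMap S (FractionRing S) s / F ^ (m + 1) := by
      intro s hs
      induction hs using Submodule.mul_induction_on' with
      | mem_mul_mem a ha b hb =>
        refine ⟨_, Ideal.mul_mem_mul (Ideal.subset_span ⟨⟨a, ha⟩, rfl⟩)
          (Ideal.subset_span ⟨⟨b, hb⟩, rfl⟩), ?_⟩
        change _ / F ^ 1 * (_ / _) = _
        rw [map_mul, div_mul_div_comm, pow_one, pow_succ']
      | add a _ b _ ha hb =>
        obtain ⟨c, hc, e⟩ := ha
        obtain ⟨d, hd, e'⟩ := hb
        exact ⟨c + d, add_mem hc hd, by rw [AddMemClass.coe_add, e, e', map_add, add_div]⟩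
    have h2 : s ∈ 𝒜 (N * 1) * 𝒜 (N * m) := by
      rw [← pow_one_eq hgen, ← pow_one_eq hgen (N * m), ← pow_add, pow_one_eq hgen]
      rwa [show N * 1 + N * m = N * (m + 1) by ring]
    obtain ⟨c, hc, e⟩ := h1 s h2
    have h3 : c = fracMap 𝒜 N F (m + 1) ⟨s, hs⟩ := Subtype.ext e
    exact h3 ▸ hc
  · rw [fracIdeal, fracIdeal, Ideal.span_mul_span', Ideal.span_le]
    rintro _ ⟨_, ⟨⟨a, ha⟩, rfl⟩, _, ⟨⟨b, hb⟩, rfl⟩, rfl⟩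
    refine Ideal.subset_span ⟨⟨a * b, ?_⟩, Subtype.ext ?_⟩
    · have := SetLike.mul_mem_graded ha hb
      rwa [show N * 1 + N * m = N * (m + 1) by ring] at this
    · change algebraMap S (FractionRing S) (a * b) / F ^ (m + 1) = _ / F ^ 1 * (_ / _)
      rw [map_mul, div_mul_div_comm, pow_one, pow_succ']

variable (hgen : Algebra.adjoin ℂ (𝒜 1 : Set S) = ⊤) (hne : 𝒜 1 ≠ ⊥) [Algebra.FiniteType ℂ S]
  (hN : 1 ≤ N) (hF : F ∈ regU 𝒜) (hFN : IsHomFrac 𝒜 N F) (hF0 : F ≠ 0)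
include hgen hne hN hF hFN hF0

/-- On the part of `X` where `F ≠ 0`, the fractions `s / F` with `s ∈ 𝒜 N` have no common zero. As
`F` need not come from `S`, this is not immediate; but `F · 𝒜 (N M) ⊆ 𝒜 (N (M + 1))` for large `M`.
Writing `I_m` for `fracIdeal 𝒜 N F m`, this gives `I_M ⊆ I_{M+1} = I_1 I_M`, and Nakayama's lemma in
a domain gives `1 ∈ I_1`. -/
theorem fracIdeal_eq_top (m : ℕ) : fracIdeal 𝒜 N F m = ⊤ := by
  obtain ⟨M, hM⟩ := exists_mul_graded hgen hF hFN
  have h1 : fracIdeal 𝒜 N F M ≤ fracIdeal 𝒜 N F 1 • fracIdeal 𝒜 N F M := by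
    rw [smul_eq_mul, ← fracIdeal_succ hgen]
    refine Ideal.span_le.2 ?_
    rintro _ ⟨⟨s, hs⟩, rfl⟩
    obtain ⟨t, ht, e⟩ := hM (N * M) (Nat.le_mul_of_pos_left M hN) (N * (M + 1))
      (by push_cast; ring) s hs
    refine Ideal.subset_span ⟨⟨t, ht⟩, Subtype.ext ?_⟩
    change algebraMap S (FractionRing S) t / F ^ (M + 1) = algebraMap S (FractionRing S) s / F ^ M
    rw [e, pow_succ', mul_div_mul_left _ _ hF0]
  obtain ⟨a, ha, ha0⟩ :=
    Submodule.exists_sub_one_mem_and_smul_eq_zero_of_fg_of_le_smul _ _ (fracIdeal_fg hgen M) h1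
  have h2 : fracIdeal 𝒜 N F 1 = ⊤ := by
    obtain ⟨x, hx, hx0⟩ := Submodule.exists_mem_ne_zero_of_ne_bot hne
    have h3 := ha0 (fracMap 𝒜 N F M ⟨x ^ (N * M), by
      simpa using SetLike.pow_mem_graded (N * M) hx⟩) (Ideal.subset_span ⟨_, rfl⟩)
    rw [smul_eq_mul, mul_eq_zero] at h3
    have h4 : a = 0 := h3.resolve_right fun h => by
      have h5 := congrArg Subtype.val h
      change algebraMap S (FractionRing S) (x ^ (N * M)) / F ^ M = 0 at h5
      exact div_ne_zero (algebraMap_frac_ne_zero (pow_ne_zero _ hx0)) (pow_ne_zero M hF0) h5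
    rw [h4, zero_sub] at ha
    rw [Ideal.eq_top_iff_one]
    simpa using neg_mem ha
  induction m with
  | zero =>
    rw [Ideal.eq_top_iff_one]
    refine Ideal.subset_span ⟨⟨1, ?_⟩, Subtype.ext ?_⟩
    · rw [mul_zero]; exact SetLike.one_mem_graded 𝒜
    · change algebraMap S (FractionRing S) 1 / F ^ 0 = 1
      rw [map_one, pow_zero, div_one]
  | succ m ih => rw [fracIdeal_succ hgen, h2, ih, Ideal.top_mul]

/-- Regular functions on the affine part `F ≠ 0` of `X`. -/
theorem div_pow_mem_fracAlg {p : FractionRing S} (hp : p ∈ regU 𝒜) {r : ℕ}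
    (hr : IsHomFrac 𝒜 (N * r) p) : p / F ^ r ∈ fracAlg 𝒜 N F := by
  obtain ⟨M, hM⟩ := exists_mul_graded hgen hp hr
  -- For large `M`, `p` multiplies `𝒜 (N M)` into `𝒜 (N (M + r))`. So `p / F ^ r` maps the ideal for
  -- `M` into the algebra, and this ideal contains `1`.
  have h1 : ∀ c ∈ fracIdeal 𝒜 N F M, p / F ^ r * (c : FractionRing S) ∈ fracAlg 𝒜 N F := by
    intro c hc
    induction hc using Submodule.span_induction with
    | mem c hc =>
      obtain ⟨⟨s, hs⟩, rfl⟩ := hc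
      obtain ⟨t, ht, e⟩ := hM (N * M) (Nat.le_mul_of_pos_left M hN) (N * (M + r))
        (by push_cast; ring) s hs
      change p / F ^ r * (algebraMap S (FractionRing S) s / F ^ M) ∈ _
      rw [div_mul_div_comm, ← e, ← pow_add, add_comm r]
      exact div_mem_fracAlg ht
    | zero => rw [ZeroMemClass.coe_zero, mul_zero]; exact zero_mem _
    | add a b _ _ ha hb => rw [AddMemClass.coe_add, mul_add]; exact add_mem ha hb
    | smul a b _ hb =>
      rw [smul_eq_mul, MulMemClass.coe_mul, mul_left_comm]
      exact (fracAlg 𝒜 N F).mul_mem a.2 hb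
  have h2 := h1 1 (by rw [fracIdeal_eq_top hgen hne hN hF hFN hF0]; trivial)
  rwa [OneMemClass.coe_one, mul_one] at h2

/-- The element `p / F ^ r` is a polynomial in fractions `s / F ^ m`; a power of `F` clears their
denominators, and their numerators are polynomials in elements of `𝒜 N`. -/
theorem exists_pow_mul_mem {B : Subalgebra ℂ (FractionRing S)} (hFB : F ∈ B)
    (hB : ∀ s ∈ 𝒜 N, algebraMap S (FractionRing S) s ∈ B) {p : FractionRing S} (hp : p ∈ regU 𝒜)
    {r : ℕ} (hr : IsHomFrac 𝒜 (N * r) p) : ∃ j : ℕ, F ^ j * p ∈ B := by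
  have hB' : ∀ m, ∀ s ∈ 𝒜 (N * m), algebraMap S (FractionRing S) s ∈ B := by
    intro m
    induction m with
    | zero =>
      intro s hs
      rw [mul_zero] at hs
      obtain ⟨c, rfl⟩ := exists_algebraMap_of_mem_zero hgen hs
      rw [← IsScalarTower.algebraMap_apply]
      exact B.algebraMap_mem c
    | succ m ih =>
      intro s hs
      rw [mul_add, mul_one, ← pow_one_eq hgen, pow_add, pow_one_eq hgen, pow_one_eq hgen] at hs
      induction hs using Submodule.mul_induction_on' with
      | mem_mul_mem a ha b hb => rw [map_mul]; exact B.mul_mem (ih a ha) (hB b hb)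
      | add a _ b _ ha hb => rw [map_add]; exact B.add_mem ha hb
  have h1 : ∀ z ∈ fracAlg 𝒜 N F, ∃ j : ℕ, F ^ j * z ∈ B := by
    intro z hz
    induction hz using Algebra.adjoin_induction with
    | mem z hz =>
      obtain ⟨m, s, hs, rfl⟩ := hz
      exact ⟨m, by rw [mul_div_cancel₀ _ (pow_ne_zero m hF0)]; exact hB' m s hs⟩
    | algebraMap c => exact ⟨0, by rw [pow_zero, one_mul]; exact B.algebraMap_mem c⟩
    | add a b _ _ ha hb =>
      obtain ⟨i, hi⟩ := ha
      obtain ⟨j, hj⟩ := hb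
      refine ⟨i + j, ?_⟩
      rw [show F ^ (i + j) * (a + b) = F ^ j * (F ^ i * a) + F ^ i * (F ^ j * b) by ring]
      exact B.add_mem (B.mul_mem (B.pow_mem hFB j) hi) (B.mul_mem (B.pow_mem hFB i) hj)
    | mul a b _ _ ha hb =>
      obtain ⟨i, hi⟩ := ha
      obtain ⟨j, hj⟩ := hb
      refine ⟨i + j, ?_⟩
      rw [show F ^ (i + j) * (a * b) = (F ^ i * a) * (F ^ j * b) by ring]
      exact B.mul_mem hi hj
  obtain ⟨j, hj⟩ := h1 _ (div_pow_mem_fracAlg hgen hne hN hF hFN hF0 hp hr)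
  refine ⟨j + r, ?_⟩
  rw [show F ^ (j + r) * p = F ^ r * F ^ r * (F ^ j * (p / F ^ r)) by
    rw [pow_add]; field_simp]
  exact B.mul_mem (B.mul_mem (B.pow_mem hFB r) (B.pow_mem hFB r)) hj

end Conductor

end
end CYCone

/-! ### Comparison of the cokernel with the homology -/

set_option linter.unusedSectionVars false
set_option maxHeartbeats 1000000
namespace CYCone
noncomputable section

variable {S : Type*} [CommRing S] [IsDomain S] [Algebra ℂ S] {𝒜 : ℕ → Submodule ℂ S}
  [GradedAlgebra 𝒜]

namespace ConeData

variable {n N : ℕ} (D : ConeData 𝒜 n N)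
  {𝔤 : Type*} [LieRing 𝔤] [LieAlgebra ℂ 𝔤] (ρ : 𝔤 →ₗ⁅ℂ⁆ vectorFields (localX 𝒜))

/-- The divergence of the field attached to a generator of `ĝ` is minus its character. This is why
`β = (0; 1)` is the right twist. -/
theorem lieD_gens (i : Option 𝔤) : lieD (D.gens ρ i) D.vol = -genChar i • D.vol := by
  rcases i with _ | y
  · have hN := natCast_fractionRing_ne_zero S D.one_le
    have h1 : D.gens ρ none = (-(N : ℂ)⁻¹) • D.euler := (neg_smul _ _).symm
    have h2 : genChar (none : Option 𝔤) = 1 := rfl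
    rw [h1, lieD_smul_left, D.lieD_euler D.isEuler, h2, ← smul_assoc,
      ← algebraMap_smul (FractionRing S) (-(1 : ℂ)) D.vol]
    congr 1
    rw [Algebra.smul_def, map_neg, map_neg, map_inv₀, map_natCast, map_one, neg_mul,
      inv_mul_cancel₀ hN]
  · have h2 : genChar (some y) = 0 := rfl
    rw [h2, neg_zero, zero_smul]
    exact (D.isLift_lift _).lieD_vol

/-- The key identity: under `vol`, the map `d + dF` on the `n`-forms `ι_{Gθ} vol` is the operator of
`ĝ` on the function `G`. -/
theorem twisted_contr (F G : FractionRing S) (i : Option 𝔤) :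
    extDeriv (contr (G • D.gens ρ i) D.vol) + ExteriorAlgebra.ι (FractionRing S)
      (KaehlerDifferential.D ℂ (FractionRing S) F) * contr (G • D.gens ρ i) D.vol =
    D.op ρ F i G • D.vol := by
  rw [extDeriv_contr_smul D.D_mul_vol D.extDeriv_vol, D.lieD_gens, D.D_mul_contr_vol,
    ← algebraMap_smul (FractionRing S) (-genChar i) D.vol, smul_smul, ← add_smul, ← add_smul]
  congr 1
  rw [op, opQ_apply, Derivation.smul_apply, smul_eq_mul, Algebra.smul_def, map_neg]
  ring

/-- All homogeneous regular vector fields on `U` with degree divisible by `N` are generated by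
`ĝ`. -/
def Generated : Prop := ∀ (r : ℤ) (ξ : Derivation ℂ (FractionRing S) (FractionRing S)),
  IsRegDer 𝒜 ξ → IsHomDer 𝒜 (N * r) ξ →
    ξ ∈ Submodule.span ℂ {ζ | ∃ i, ∃ G ∈ regMod 𝒜 N, ζ = G • D.gens ρ i}

theorem contr_smul_mem_formsU (i : Option 𝔤) {G : FractionRing S} (hG : G ∈ regMod 𝒜 N) :
    contr (G • D.gens ρ i) D.vol ∈ formsU 𝒜 N n := by
  refine regMod_induction D.gen D.one_le
    (C := fun G => contr (G • D.gens ρ i) D.vol ∈ formsU 𝒜 N n) (fun m g hg hm => ?_) ?_ ?_ hG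
  · refine D.contr_vol_mem_formsU (d := m) ((D.isRegDer_gens ρ i).smul hg) ?_
    have := (D.isHomDer_gens ρ i).smul hm
    rwa [add_zero] at this
  · rw [contr_smul_left, zero_smul]; exact zero_mem _
  · intro a b ha hb
    rw [add_smul, contr_add_left]
    exact add_mem ha hb

/-- Every `n`-form is a contraction of `vol`, the fields are combinations of the `G θ`, and `d + dF`
is then computed by `twisted_contr`. -/
theorem smul_vol_mem_range_iff (hgen : D.Generated ρ) (F : functionsU 𝒜 N) {g : FractionRing S}
    (hg : g ∈ regMod 𝒜 N) :
    (⟨g • D.vol, D.smul_vol_mem_formsU hg⟩ : formsU 𝒜 N (n + 1)) ∈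
      LinearMap.range (dPlusDf 𝒜 N n F) ↔ g ∈ opSum (D.op ρ F) (regMod 𝒜 N) := by
  constructor
  · rintro ⟨⟨ω, hω⟩, e⟩
    have e1 : extDeriv ω + ExteriorAlgebra.ι (FractionRing S)
      (KaehlerDifferential.D ℂ (FractionRing S) F) * ω = g • D.vol := congrArg Subtype.val e
    have h1 : ∃ g' ∈ opSum (D.op ρ F) (regMod 𝒜 N), extDeriv ω + ExteriorAlgebra.ι (FractionRing S)
      (KaehlerDifferential.D ℂ (FractionRing S) F) * ω = g' • D.vol := by
      clear e e1
      rw [D.formsU_eq_span] at hω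
      induction hω using Submodule.span_induction with
      | mem ω hω =>
        obtain ⟨ξ, d, hξ, hd, rfl⟩ := hω
        have h2 := hgen d ξ hξ hd
        clear hξ hd
        induction h2 using Submodule.span_induction with
        | mem ξ hξ =>
          obtain ⟨i, G, hG, rfl⟩ := hξ
          exact ⟨_, apply_mem_opSum _ i hG, D.twisted_contr ρ F G i⟩
        | zero =>
          refine ⟨0, zero_mem _, ?_⟩
          have : contr (0 : Derivation ℂ (FractionRing S) (FractionRing S)) D.vol = 0 := by
            have := contr_smul_left (0 : FractionRing S)
              (0 : Derivation ℂ (FractionRing S) (FractionRing S)) D.vol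
            rwa [zero_smul, zero_smul] at this
          rw [this, map_zero, mul_zero, add_zero, zero_smul]
        | add a b _ _ ha hb =>
          obtain ⟨a', ha', ea⟩ := ha
          obtain ⟨b', hb', eb⟩ := hb
          refine ⟨a' + b', add_mem ha' hb', ?_⟩
          rw [contr_add_left, map_add, mul_add, add_smul, ← ea, ← eb]
          abel
        | smul c a _ ha =>
          obtain ⟨a', ha', ea⟩ := ha
          refine ⟨c • a', Submodule.smul_mem _ c ha', ?_⟩
          have h3 : contr (c • a) D.vol = c • contr a D.vol := by
            rw [← algebraMap_smul (FractionRing S) c a, contr_smul_left, algebraMap_smul]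
          rw [h3, map_smul, mul_smul_comm, ← smul_add, ea, smul_assoc]
      | zero => exact ⟨0, zero_mem _, by rw [map_zero, mul_zero, add_zero, zero_smul]⟩
      | add a b _ _ ha hb =>
        obtain ⟨a', ha', ea⟩ := ha
        obtain ⟨b', hb', eb⟩ := hb
        refine ⟨a' + b', add_mem ha' hb', ?_⟩
        rw [map_add, mul_add, add_smul, ← ea, ← eb]
        abel
      | smul c a _ ha =>
        obtain ⟨a', ha', ea⟩ := ha
        refine ⟨c • a', Submodule.smul_mem _ c ha', ?_⟩
        rw [map_smul, mul_smul_comm, ← smul_add, ea, smul_assoc]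
    obtain ⟨g', hg', e'⟩ := h1
    rwa [D.smul_vol_injective (e1.symm.trans e')]
  · intro h
    have h1 : ∃ ω : formsU 𝒜 N n, (dPlusDf 𝒜 N n F ω : Forms (FractionRing S)) = g • D.vol := by
      refine Submodule.iSup_induction _ (motive := fun g => ∃ ω : formsU 𝒜 N n,
        (dPlusDf 𝒜 N n F ω : Forms (FractionRing S)) = g • D.vol) h ?_ ?_ ?_
      · rintro i _ ⟨G, hG, rfl⟩
        exact ⟨⟨_, D.contr_smul_mem_formsU ρ i hG⟩, D.twisted_contr ρ F G i⟩
      · exact ⟨0, by rw [map_zero, zero_smul]; rfl⟩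
      · rintro a b ⟨ω, e⟩ ⟨ω', e'⟩
        exact ⟨ω + ω', by rw [map_add, Submodule.coe_add, e, e', add_smul]⟩
    obtain ⟨ω, hω⟩ := h1
    exact ⟨ω, Subtype.ext hω⟩

/-- The homogeneous coordinate ring of the anticanonical cone as functions on `U`. -/
def ringVal : ConeRing (localX 𝒜) n →ₐ[ℂ] FractionRing S :=
  Ideal.Quotient.liftₐ (coneIdeal (localX 𝒜) n) D.polyVal fun _ h => D.polyVal_eq_zero_iff.2 h

theorem ringVal_mk (φ : PolyRing (localX 𝒜) n) :
    D.ringVal (Ideal.Quotient.mk _ φ) = D.polyVal φ := rfl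

theorem ringVal_injective : Function.Injective D.ringVal := by
  rw [injective_iff_map_eq_zero]
  intro b hb
  obtain ⟨φ, rfl⟩ := Ideal.Quotient.mk_surjective b
  rw [ringVal_mk, D.polyVal_eq_zero_iff] at hb
  exact Ideal.Quotient.eq_zero_iff_mem.2 hb

theorem ringVal_mem (b : ConeRing (localX 𝒜) n) : D.ringVal b ∈ regMod 𝒜 N := by
  obtain ⟨φ, rfl⟩ := Ideal.Quotient.mk_surjective b
  exact D.polyVal_mem φ

/-- `(y, c)` acts through `θ_y - (c / N) E`, that is, through the generator of `y` plus `c` times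
the generator of `1 ∈ ℂ`. -/
theorem ringVal_rfAction (f : AntiCanSec (localX 𝒜) n) (y : 𝔤) (c : ℂ)
    (b : ConeRing (localX 𝒜) n) :
    D.ringVal (rfAction (localX 𝒜) n ρ f (y, c) b) =
      D.op ρ (D.secVal f) (some y) (D.ringVal b) +
        c • D.op ρ (D.secVal f) none (D.ringVal b) := by
  obtain ⟨φ, rfl⟩ := Ideal.Quotient.mk_surjective b
  have h1 : rfAction (localX 𝒜) n ρ f (y, c) (Ideal.Quotient.mk _ φ) =
      Ideal.Quotient.mk _ (zStar (localX 𝒜) n ρ (y, c) φ +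
        zStar (localX 𝒜) n ρ (y, c) (SymmetricAlgebra.ι ℂ _ f) * φ) -
      c • Ideal.Quotient.mk _ φ := rfl
  have h2 : ∀ φ, D.polyVal (zStar (localX 𝒜) n ρ (y, c) φ) =
      D.act ρ y (D.polyVal φ) - (c / N) • D.euler (D.polyVal φ) :=
    D.polyVal_zStar ρ (y, c) (D.isLift_lift _) D.isEuler
  rw [h1, map_sub, map_smul, ringVal_mk, ringVal_mk, map_add, map_mul, h2, h2, polyVal_ι]
  change _ = D.act ρ y _ + D.act ρ y _ * _ - (0 : ℂ) • _ +
    c • (-((N : ℂ)⁻¹ • D.euler _) + -((N : ℂ)⁻¹ • D.euler _) * _ - (1 : ℂ) • _)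
  simp only [Algebra.smul_def, map_div₀, map_zero, map_one, map_inv₀, LinearMap.id_apply]
  ring

/-- The functions on `U` that are polynomials in the sections of `ω_X^{-1}`. -/
def coneFun : Subalgebra ℂ (FractionRing S) := D.ringVal.range

theorem mem_opSum_coneFun_iff (f : AntiCanSec (localX 𝒜) n) (b : ConeRing (localX 𝒜) n) :
    D.ringVal b ∈ opSum (D.op ρ (D.secVal f)) (Subalgebra.toSubmodule D.coneFun) ↔
      b ∈ ⨆ ξ : 𝔤 × ℂ, LinearMap.range (rfAction (localX 𝒜) n ρ f ξ) := by
  constructor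
  · intro h
    have h1 : opSum (D.op ρ (D.secVal f)) (Subalgebra.toSubmodule D.coneFun) ≤
        (⨆ ξ : 𝔤 × ℂ, LinearMap.range (rfAction (localX 𝒜) n ρ f ξ)).map
          D.ringVal.toLinearMap := by
      refine iSup_le ?_
      rintro i _ ⟨_, ⟨b, rfl⟩, rfl⟩
      have h2 : ∀ (y : 𝔤) (c : ℂ), rfAction (localX 𝒜) n ρ f (y, c) b ∈
          ⨆ ξ : 𝔤 × ℂ, LinearMap.range (rfAction (localX 𝒜) n ρ f ξ) :=
        fun y c => Submodule.mem_iSup_of_mem (y, c) ⟨b, rfl⟩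
      rcases i with _ | y
      -- Both `(0, 1)` and `(0, 0)` involve the operator of the chosen lift of `ρ 0`; it cancels in
      -- the difference, which leaves the Euler operator.
      · refine ⟨_, sub_mem (h2 0 1) (h2 0 0), ?_⟩
        change D.ringVal _ = _
        rw [map_sub, D.ringVal_rfAction, D.ringVal_rfAction, one_smul, zero_smul, add_zero,
          add_sub_cancel_left]
        rfl
      · refine ⟨_, h2 y 0, ?_⟩
        change D.ringVal _ = _
        rw [D.ringVal_rfAction, zero_smul, add_zero]
        rfl
    obtain ⟨b', hb', e⟩ := h1 h
    rwa [← D.ringVal_injective e]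
  · intro h
    refine Submodule.iSup_induction _ (motive := fun b => D.ringVal b ∈
      opSum (D.op ρ (D.secVal f)) (Subalgebra.toSubmodule D.coneFun)) h ?_ ?_ ?_
    · rintro ⟨y, c⟩ _ ⟨b, rfl⟩
      rw [D.ringVal_rfAction]
      exact add_mem (apply_mem_opSum _ _ ⟨b, rfl⟩)
        (Submodule.smul_mem _ c (apply_mem_opSum _ _ ⟨b, rfl⟩))
    · rw [map_zero]; exact zero_mem _
    · intro x y hx hy; rw [map_add]; exact add_mem hx hy

theorem coneFun_le_regMod : Subalgebra.toSubmodule D.coneFun ≤ regMod 𝒜 N := by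
  rintro _ ⟨b, rfl⟩
  exact D.ringVal_mem b

theorem op_mem_coneFun (f : AntiCanSec (localX 𝒜) n) (i : Option 𝔤) {w : FractionRing S}
    (hw : w ∈ D.coneFun) : D.op ρ (D.secVal f) i w ∈ D.coneFun := by
  obtain ⟨b, rfl⟩ := hw
  rcases i with _ | y
  · have h1 := D.ringVal_rfAction ρ f 0 1 b
    have h2 := D.ringVal_rfAction ρ f 0 0 b
    rw [zero_smul, add_zero] at h2
    rw [one_smul, ← h2, ← sub_eq_iff_eq_add', ← map_sub] at h1
    exact ⟨_, h1⟩
  · have h2 := D.ringVal_rfAction ρ f y 0 b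
    rw [zero_smul, add_zero] at h2
    exact ⟨_, h2⟩

theorem secVal_mem_coneFun (s : AntiCanSec (localX 𝒜) n) : D.secVal s ∈ D.coneFun :=
  ⟨Ideal.Quotient.mk _ (SymmetricAlgebra.ι ℂ _ s), D.polyVal_ι s⟩

theorem coneFun_le_iSup : Subalgebra.toSubmodule D.coneFun ≤
    ⨆ k, Subalgebra.toSubmodule D.coneFun ⊓ homPart 𝒜 k := by
  rintro _ ⟨b, rfl⟩
  obtain ⟨φ, rfl⟩ := Ideal.Quotient.mk_surjective b
  change D.polyVal φ ∈ _
  induction φ using SymmetricAlgebra.induction with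
  | algebraMap r =>
    rw [AlgHom.commutes]
    exact Submodule.mem_iSup_of_mem 0 ⟨D.coneFun.algebraMap_mem r, IsHomFrac.const r⟩
  | ι s =>
    rw [polyVal_ι]
    exact Submodule.mem_iSup_of_mem (N : ℤ) ⟨D.secVal_mem_coneFun s, D.secVal_hom s⟩
  | mul a b ha hb =>
    rw [map_mul]
    refine Submodule.iSup_induction _ (motive := fun g => g * D.polyVal b ∈
      ⨆ k, Subalgebra.toSubmodule D.coneFun ⊓ homPart 𝒜 k) ha (fun m x hx => ?_) ?_ ?_
    · refine Submodule.iSup_induction _ (motive := fun g => x * g ∈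
        ⨆ k, Subalgebra.toSubmodule D.coneFun ⊓ homPart 𝒜 k) hb (fun m' y hy => ?_) ?_ ?_
      · exact Submodule.mem_iSup_of_mem (m + m')
          ⟨D.coneFun.mul_mem hx.1 hy.1, IsHomFrac.mul hx.2 hy.2⟩
      · rw [mul_zero]; exact zero_mem _
      · intro x y hx hy; rw [mul_add]; exact add_mem hx hy
    · rw [zero_mul]; exact zero_mem _
    · intro x y hx hy; rw [add_mul]; exact add_mem hx hy
  | add a b ha hb => rw [map_add]; exact add_mem ha hb

section Compare

variable {f : AntiCanSec (localX 𝒜) n} (hf : f ≠ 0)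
  (hneg : ∀ z ∈ regU 𝒜, ∀ k : ℤ, IsHomFrac 𝒜 k z → k < 0 → z = 0)
include hneg

/-- Injectivity of `T` on `R / A`. With components `g_k` of degree `N k`, the components of `-T w`
are `(k + 1) g_k + F g_{k-1}`. All lie in `A`, and `g_k = 0` for `k < 0`, so ascending induction
gives `g_k ∈ A`, dividing by `k + 1 ≠ 0`. -/
theorem mem_coneFun_of_op_mem {w : FractionRing S} (hw : w ∈ regMod 𝒜 N)
    (h : D.op ρ (D.secVal f) none w ∈ D.coneFun) : w ∈ D.coneFun := by
  classical
  have hN : (0 : ℤ) < N := by have := D.one_le; omega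
  have hdeg : Function.Injective fun m : ℤ => (N : ℤ) * m := fun a b h =>
    mul_left_cancel₀ hN.ne' h
  set F := D.secVal f with hF
  obtain ⟨g, hg, e⟩ := (Submodule.mem_iSup_iff_exists_finsupp _ _).1 hw.2
  have hreg : ∀ m, g m ∈ regU 𝒜 := fun m => by
    by_cases hm : m ∈ g.support
    · refine family_component_mem_regU D.gen hdeg g.support hg ?_ hm
      exact (show ∑ i ∈ g.support, g i = w from e) ▸ hw.1
    · rw [Finsupp.notMem_support_iff.1 hm]; exact zero_mem _
  -- Multiplication by `F` shifts the index by one, so `T w` has its components in the support of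
  -- `g` and its shift.
  set t := g.support ∪ g.support.map (addRightEmbedding 1) with ht
  have ht1 : ∀ m, m ∉ t → g m = 0 := fun m hm =>
    Finsupp.notMem_support_iff.1 fun h' => hm (Finset.mem_union_left _ h')
  have ht2 : ∀ m, m ∉ t → g (m - 1) = 0 := fun m hm => Finsupp.notMem_support_iff.1 fun h' =>
    hm (Finset.mem_union_right _ (Finset.mem_map.2 ⟨m - 1, h', sub_add_cancel m 1⟩))
  have h1 : D.op ρ F none w = ∑ k ∈ t, -(((k : ℂ) + 1) • g k + F * g (k - 1)) := by
    have h2 : ∑ k ∈ t, ((k : ℂ) + 1) • g k = ∑ k ∈ g.support, ((k : ℂ) + 1) • g k :=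
      (Finset.sum_subset Finset.subset_union_left fun m _ hm => by
        rw [Finsupp.notMem_support_iff.1 hm, smul_zero]).symm
    have h3 : ∑ k ∈ t, F * g (k - 1) = ∑ k ∈ g.support, F * g k := by
      have h4 : ∑ k ∈ g.support.map (addRightEmbedding 1), F * g (k - 1) =
          ∑ k ∈ t, F * g (k - 1) := Finset.sum_subset Finset.subset_union_right fun m _ hm => by
        have : g (m - 1) = 0 := Finsupp.notMem_support_iff.1 fun h' =>
          hm (Finset.mem_map.2 ⟨m - 1, h', sub_add_cancel m 1⟩)
        rw [this, mul_zero]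
      rw [← h4, Finset.sum_map]
      exact Finset.sum_congr rfl fun k _ => by rw [addRightEmbedding_apply, add_sub_cancel_right]
    rw [Finset.sum_neg_distrib, Finset.sum_add_distrib, h2, h3, ← Finset.sum_add_distrib,
      ← Finset.sum_neg_distrib, ← e, Finsupp.sum, map_sum]
    exact Finset.sum_congr rfl fun k _ =>
      D.op_none_of_hom ρ (D.secVal_mem_regU f) (D.secVal_hom f) (hg k)
  have h5 : ∀ k : ℤ, ((k : ℂ) + 1) • g k + F * g (k - 1) ∈ D.coneFun := fun k => by
    by_cases hk : k ∈ t
    · rw [← neg_neg (_ + _)]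
      refine neg_mem (family_component_mem (W := Subalgebra.toSubmodule D.coneFun)
        (fun f hf h => component_mem D.coneFun_le_iSup hf h) hdeg t
        (f := fun k : ℤ => -(((k : ℂ) + 1) • g k + F * g (k - 1))) (fun m => ?_) ?_ hk)
      · exact (homPart 𝒜 _).neg_mem ((homPart 𝒜 _).add_mem ((homPart 𝒜 _).smul_mem _ (hg m))
          (((D.secVal_hom f).mul (hg (m - 1))).cast (by ring)))
      · rwa [← h1]
    · rw [ht1 k hk, ht2 k hk, smul_zero, mul_zero, add_zero]; exact zero_mem _
  have h6 : ∀ k : ℤ, k < 0 → g k = 0 := fun k hk =>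
    hneg _ (hreg k) _ (hg k) (mul_neg_of_pos_of_neg hN hk)
  have h7 : ∀ (k : ℤ), 0 ≤ k → g (k - 1) ∈ D.coneFun → g k ∈ D.coneFun := fun k hk h => by
    have h8 : ((k : ℂ) + 1) • g k ∈ D.coneFun := by
      have := sub_mem (h5 k) (D.coneFun.mul_mem (D.secVal_mem_coneFun f) h)
      rwa [add_sub_cancel_right] at this
    have h9 : (k : ℂ) + 1 ≠ 0 := by
      have : ((k + 1 : ℤ) : ℂ) ≠ 0 := Int.cast_ne_zero.2 (by omega)
      rwa [Int.cast_add, Int.cast_one] at this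
    have := D.coneFun.smul_mem h8 ((k : ℂ) + 1)⁻¹
    rwa [smul_smul, inv_mul_cancel₀ h9, one_smul] at this
  have h8 : ∀ k : ℕ, g k ∈ D.coneFun := fun k => by
    induction k with
    | zero =>
      refine h7 _ le_rfl ?_
      rw [h6 _ (by simp)]
      exact zero_mem _
    | succ k ih => exact h7 _ (by positivity) (by simpa using ih)
  rw [← e]
  refine D.coneFun.sum_mem fun k _ => ?_
  rcases lt_or_ge k 0 with hk | hk
  · rw [h6 k hk]; exact zero_mem _
  · obtain ⟨k, rfl⟩ := Int.eq_ofNat_of_zero_le hk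
    exact h8 k

include hf

/-- Surjectivity of `T` on `R / A`. For `p` of degree `N r` with `r ≥ 0`, `p = -(r + 1)⁻¹ (T p + F
p)`. Since some `F ^ j p` lies in `A`, induction on `j` applies to `F p`. -/
theorem exists_eq_add_op [Algebra.FiniteType ℂ S] {w : FractionRing S} (hw : w ∈ regMod 𝒜 N) :
    ∃ a ∈ D.coneFun, ∃ r ∈ regMod 𝒜 N, w = a + D.op ρ (D.secVal f) none r := by
  have hN : (0 : ℤ) < N := by have := D.one_le; omega
  have hFr := D.secVal_mem_regU f
  have hFN := D.secVal_hom f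
  have hF0 : D.secVal f ≠ 0 := fun h => hf (D.secVal_injective (by rw [h, map_zero]))
  have key : ∀ (j r : ℕ) p, p ∈ regU 𝒜 → IsHomFrac 𝒜 (N * r) p → D.secVal f ^ j * p ∈ D.coneFun →
      ∃ a ∈ D.coneFun, ∃ r ∈ regMod 𝒜 N, p = a + D.op ρ (D.secVal f) none r := by
    intro j
    induction j with
    | zero =>
      intro r p hp hr h
      rw [pow_zero, one_mul] at h
      exact ⟨p, h, 0, zero_mem _, by rw [map_zero, add_zero]⟩
    | succ j ih =>
      intro r p hp hr h
      obtain ⟨a, ha, s, hs, e⟩ := ih (r + 1) (D.secVal f * p) ((regU 𝒜).mul_mem hFr hp)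
        ((hFN.mul hr).cast (by push_cast; ring)) (by rwa [← mul_assoc, ← pow_succ])
      have h1 := D.op_none_of_hom ρ hFr hFN hr
      have h2 : (((r : ℤ) : ℂ) + 1) ≠ 0 := by
        rw [Int.cast_natCast]
        exact Nat.cast_add_one_ne_zero r
      have h3 : p = -((((r : ℤ) : ℂ) + 1)⁻¹ • (D.op ρ (D.secVal f) none p + D.secVal f * p)) := by
        rw [h1, neg_add, neg_add_cancel_right, smul_neg, neg_neg, smul_smul, inv_mul_cancel₀ h2,
          one_smul]
      refine ⟨-((((r : ℤ) : ℂ) + 1)⁻¹ • a), neg_mem (D.coneFun.smul_mem ha _),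
        -((((r : ℤ) : ℂ) + 1)⁻¹ • (p + s)), (regMod 𝒜 N).neg_mem ((regMod 𝒜 N).smul_mem _
          ((regMod 𝒜 N).add_mem (mem_regMod_of_hom hp hr) hs)), ?_⟩
      rw [map_neg, map_smul, map_add, ← neg_add, ← smul_add]
      conv_lhs => rw [h3, e]
      congr 2
      abel
  refine regMod_induction D.gen D.one_le (C := fun w => ∃ a ∈ D.coneFun, ∃ r ∈ regMod 𝒜 N,
    w = a + D.op ρ (D.secVal f) none r) (fun m g hg hm => ?_) ?_ ?_ hw
  · rcases lt_or_ge m 0 with h | h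
    · rw [hneg g hg _ hm (mul_neg_of_pos_of_neg hN h)]
      exact ⟨0, zero_mem _, 0, zero_mem _, by rw [map_zero, add_zero]⟩
    · obtain ⟨r, rfl⟩ := Int.eq_ofNat_of_zero_le h
      obtain ⟨j, hj⟩ := exists_pow_mul_mem D.gen D.ne_bot D.one_le hFr hFN hF0
        (D.secVal_mem_coneFun f) (fun s hs => by
          obtain ⟨σ, hσ⟩ := D.exists_secVal_eq (algebraMap_mem_regU s) (IsHomFrac.algebraMap hs)
          exact hσ ▸ D.secVal_mem_coneFun σ) hg hm
      exact key j r g hg hm hj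
  · exact ⟨0, zero_mem _, 0, zero_mem _, by rw [map_zero, add_zero]⟩
  · rintro _ _ ⟨a, ha, r, hr, rfl⟩ ⟨a', ha', r', hr', rfl⟩
    exact ⟨a + a', add_mem ha ha', r + r', add_mem hr hr', by rw [map_add]; abel⟩

/-- The comparison of the homology of `R_f` with the cokernel of `d + df`. -/
theorem nonempty_equiv_of_generated [Algebra.FiniteType ℂ S] (hgen : D.Generated ρ)
    (F : functionsU 𝒜 N) (hF : (F : FractionRing S) = D.secVal f) :
    Nonempty (RfH0 (localX 𝒜) n ρ f ≃ₗ[ℂ] CokerDPlusDf 𝒜 N n F) := by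
  let φ : ConeRing (localX 𝒜) n →ₗ[ℂ] formsU 𝒜 N (n + 1) :=
    { toFun := fun b => ⟨D.ringVal b • D.vol, D.smul_vol_mem_formsU (D.ringVal_mem b)⟩
      map_add' := fun a b => Subtype.ext (by
        change D.ringVal (a + b) • D.vol = D.ringVal a • D.vol + D.ringVal b • D.vol
        rw [map_add, add_smul])
      map_smul' := fun c a => Subtype.ext (by
        change D.ringVal (c • a) • D.vol = c • (D.ringVal a • D.vol)
        rw [map_smul, smul_assoc]) }
  refine nonempty_quotient_equiv φ _ _ (fun b => ?_) (fun ω => ?_)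
  · rw [← D.mem_opSum_coneFun_iff ρ f b]
    refine (D.smul_vol_mem_range_iff ρ hgen F (D.ringVal_mem b)).trans ?_
    rw [hF]
    constructor
    · intro h
      exact mem_opSum_of_invertible _ none
        (fun i w hw => D.op_mem_regMod ρ (D.secVal_mem_regU f) (D.secVal_hom f) i hw)
        (fun i w hw => D.op_mem_coneFun ρ f i hw)
        (fun i w => D.op_comm ρ (D.secVal_mem_regU f) (D.secVal_hom f) i w)
        (fun w hw h => D.mem_coneFun_of_op_mem ρ hneg hw h)
        (fun w hw => D.exists_eq_add_op ρ hf hneg hw) ⟨b, rfl⟩ h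
    · exact fun h => opSum_mono _ D.coneFun_le_regMod h
  · obtain ⟨g, hg, e⟩ := D.exists_of_mem_formsU_top ω.2
    obtain ⟨_, ⟨b, rfl⟩, r, hr, rfl⟩ := D.exists_eq_add_op ρ hf hneg hg
    refine ⟨b, ?_⟩
    have hr' := D.op_mem_regMod ρ (D.secVal_mem_regU f) (D.secVal_hom f) none hr
    have h1 := (D.smul_vol_mem_range_iff ρ hgen F hr').2 (hF ▸ apply_mem_opSum _ none hr)
    convert h1 using 1
    refine Subtype.ext ?_
    rw [AddSubgroupClass.coe_sub, e, add_smul]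
    exact add_sub_cancel_left _ _

end Compare

end ConeData

end
end CYCone

/-! ### Vector fields of negative degree, and generation by ĝ -/

set_option linter.unusedSectionVars false
set_option maxHeartbeats 1000000
namespace CYCone
noncomputable section

attribute [local instance 100] LieRing.ofAssociativeRing

section Perfect

variable {𝔤 : Type*} [LieRing 𝔤] [LieAlgebra ℂ 𝔤] [LieAlgebra.IsSemisimple ℂ 𝔤]

/-- A semisimple Lie algebra is spanned by the brackets. -/
theorem span_bracket_eq_top : Submodule.span ℂ {z : 𝔤 | ∃ x y : 𝔤, ⁅x, y⁆ = z} = ⊤ := by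
  have h1 : ⁅(⊤ : LieIdeal ℂ 𝔤), (⊤ : LieIdeal ℂ 𝔤)⁆ = ⊤ := by
    refine top_le_iff.1 ((LieAlgebra.IsSemisimple.sSup_atoms_eq_top (R := ℂ) (L := 𝔤)).ge.trans
      (sSup_le fun I hI => ?_))
    exact (lie_eq_self_of_isAtom_of_nonabelian I hI
      (LieAlgebra.IsSemisimple.non_abelian_of_isAtom I hI)).ge.trans
      (LieSubmodule.mono_lie le_top le_top)
  have h2 := LieSubmodule.lieIdeal_oper_eq_linear_span' (I := (⊤ : LieIdeal ℂ 𝔤))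
    (N := (⊤ : LieIdeal ℂ 𝔤))
  rw [h1] at h2
  rw [eq_top_iff]
  intro z _
  have h3 : z ∈ (⊤ : LieIdeal ℂ 𝔤) := LieSubmodule.mem_top z
  rw [← LieSubmodule.mem_toSubmodule, h2] at h3
  refine Submodule.span_mono ?_ h3
  rintro _ ⟨x, -, y, -, rfl⟩
  exact ⟨x, y, rfl⟩

/-- A semisimple Lie algebra is spanned by brackets, and traces of commutators vanish. -/
theorem trace_eq_zero_of_semisimple {M : Type*} [AddCommGroup M] [Module ℂ M]
    (σ : 𝔤 →ₗ⁅ℂ⁆ Module.End ℂ M) (y : 𝔤) : LinearMap.trace ℂ M (σ y) = 0 := by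
  have hy : y ∈ Submodule.span ℂ {z : 𝔤 | ∃ x y : 𝔤, ⁅x, y⁆ = z} := by
    rw [span_bracket_eq_top]; trivial
  induction hy using Submodule.span_induction with
  | mem z hz =>
    obtain ⟨x, y, rfl⟩ := hz
    rw [LieHom.map_lie, LieRing.of_associative_ring_bracket, map_sub, LinearMap.trace_mul_comm,
      sub_self]
  | zero => rw [map_zero, map_zero]
  | add a b _ _ ha hb => rw [map_add, map_add, ha, hb, add_zero]
  | smul c a _ ha => rw [map_smul, map_smul, ha, smul_zero]

end Perfect

variable {S : Type*} [CommRing S] [IsDomain S] [Algebra ℂ S] {𝒜 : ℕ → Submodule ℂ S}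
  [GradedAlgebra 𝒜]

theorem derivation_eq_zero_of_one (hgen : Algebra.adjoin ℂ (𝒜 1 : Set S) = ⊤)
    {ξ : Derivation ℂ (FractionRing S) (FractionRing S)}
    (h : ∀ x ∈ 𝒜 1, ξ (algebraMap S (FractionRing S) x) = 0) : ξ = 0 := by
  have h1 : ∀ s : S, ξ (algebraMap S (FractionRing S) s) = 0 := by
    intro s
    have hs : s ∈ Algebra.adjoin ℂ (𝒜 1 : Set S) := by rw [hgen]; trivial
    induction hs using Algebra.adjoin_induction with
    | mem x hx => exact h x hx
    | algebraMap r => rw [← IsScalarTower.algebraMap_apply, Derivation.map_algebraMap]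
    | add x y _ _ hx hy => rw [map_add, map_add, hx, hy, add_zero]
    | mul x y _ _ hx hy => rw [map_mul, Derivation.leibniz, hx, hy, smul_zero, smul_zero, add_zero]
  ext z
  obtain ⟨a, b, -, rfl⟩ := IsFractionRing.div_surjective (A := S) z
  exact derivation_div_eq_zero (h1 a) (h1 b)

namespace ConeData

variable {n N : ℕ} (D : ConeData 𝒜 n N)
  {𝔤 : Type*} [LieRing 𝔤] [LieAlgebra ℂ 𝔤] (ρ : 𝔤 →ₗ⁅ℂ⁆ vectorFields (localX 𝒜))

theorem smul_euler_eq (G : FractionRing S) :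
    G • D.euler = (-(N : FractionRing S) * G) • D.gens ρ none := by
  have hN := natCast_fractionRing_ne_zero S D.one_le
  ext z
  change G * D.euler z = -(N : FractionRing S) * G * -((N : ℂ)⁻¹ • D.euler z)
  rw [Algebra.smul_def, map_inv₀, map_natCast]
  field_simp

theorem smul_euler_mem_span {d : ℤ} {G : FractionRing S} (hG : G ∈ regU 𝒜)
    (hd : IsHomFrac 𝒜 (N * d) G) : G • D.euler ∈
      Submodule.span ℂ {ζ | ∃ i, ∃ G ∈ regMod 𝒜 N, ζ = G • D.gens ρ i} := by
  refine Submodule.subset_span ⟨none, _, ?_, D.smul_euler_eq ρ G⟩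
  rw [neg_mul, ← nsmul_eq_mul]
  exact (regMod 𝒜 N).neg_mem ((regMod 𝒜 N).nsmul_mem (mem_regMod_of_hom hG hd) N)

theorem lieD_smul_vol (ξ : Derivation ℂ (FractionRing S) (FractionRing S)) (g : FractionRing S) :
    lieD (g • ξ) D.vol = ξ g • D.vol + g • lieD ξ D.vol := by
  have h := extDeriv_contr_smul (δ := ξ) D.D_mul_vol D.extDeriv_vol g
  rw [lieD_apply, D.extDeriv_vol, map_zero, add_zero, h]

/-- The divergence of a field of degree `N d` is a regular function of that degree, which is
negative. -/
theorem lieD_vol_eq_zero (hneg : ∀ z ∈ regU 𝒜, ∀ k : ℤ, IsHomFrac 𝒜 k z → k < 0 → z = 0)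
    {ξ : Derivation ℂ (FractionRing S) (FractionRing S)} (hξ : IsRegDer 𝒜 ξ) {d : ℤ}
    (hd : IsHomDer 𝒜 (N * d) ξ) (h0 : N * d < 0) : lieD ξ D.vol = 0 := by
  have h1 : lieD ξ D.vol = extDeriv (contr ξ D.vol) := by
    rw [lieD_apply, D.extDeriv_vol, map_zero, add_zero]
  obtain ⟨g, hg, e⟩ := D.exists_of_mem_formsU_top
    (extDeriv_mem_formsU (D.contr_vol_mem_formsU hξ hd))
  have h2 : D.vol ∈ homForms 𝒜 (n + 1) N := by
    have h := (D.smul_vol_mem_homForms_iff (k := N) (a := 1)).2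
      (by simpa using IsHomFrac.const (𝒜 := 𝒜) 1)
    rwa [one_smul] at h
  have h3 := extDeriv_mem_homForms (contr_mem_homForms hd h2)
  rw [e, D.smul_vol_mem_homForms_iff] at h3
  rw [h1, e, hneg g hg.1 _ h3 (by omega), zero_smul]

variable (hTr : ∀ r : ℕ, twistedDerSections (localX 𝒜) n r ≤
      Submodule.span ℂ {t | ∃ x : 𝔤, ∃ s ∈ antiCanPowSections (localX 𝒜) n r,
        t = (ρ x : Derivation ℂ (functionField 𝒜) (functionField 𝒜)) ⊗ₜ[functionField 𝒜] s})
include hTr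

theorem mem_span_of_nonneg {r : ℕ} {ξ : Derivation ℂ (FractionRing S) (FractionRing S)}
    (hξ : IsRegDer 𝒜 ξ) (hr : IsHomDer 𝒜 (N * r) ξ) :
    ξ ∈ Submodule.span ℂ {ζ | ∃ i, ∃ G ∈ regMod 𝒜 N, ζ = G • D.gens ρ i} := by
  obtain ⟨ζ, hζ, G, hG, hGr, rfl⟩ := D.exists_eq_lift_add ρ hTr D.isEuler hξ hr
  refine add_mem (Submodule.span_mono ?_ hζ) (D.smul_euler_mem_span ρ hG hGr)
  rintro _ ⟨y, G, hG, hd, rfl⟩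
  exact ⟨some y, G, mem_regMod_of_hom hG hd, rfl⟩

/-- A regular vector field of degree zero acts on the sections of `ω_X^{-1}` through `ĝ`. -/
theorem exists_act_of_degree_zero [Algebra.FiniteType ℂ S]
    {ξ : Derivation ℂ (FractionRing S) (FractionRing S)}
    (hξ : IsRegDer 𝒜 ξ) (h0 : IsHomDer 𝒜 0 ξ) : ∃ (y : 𝔤) (c : ℂ),
      (∀ s, ξ (D.secVal s) = D.secVal (lieSec (localX 𝒜) n (ρ y) s) + c • D.secVal s) ∧
      lieD ξ D.vol = c • D.vol := by
  have h0' : IsHomDer 𝒜 (N * (0 : ℕ)) ξ := by simpa using h0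
  obtain ⟨ζ, hζ, G, hG, hGr, rfl⟩ := D.exists_eq_lift_add ρ hTr D.isEuler hξ h0'
  obtain ⟨c, rfl⟩ := exists_const_of_regU_of_degree_zero D.gen D.ne_bot hG (hGr.cast (by simp))
  have h1 : ∃ y : 𝔤, (∀ s, ζ (D.secVal s) = D.secVal (lieSec (localX 𝒜) n (ρ y) s)) ∧
      lieD ζ D.vol = 0 := by
    clear hξ h0 h0'
    induction hζ using Submodule.span_induction with
    | mem ζ hζ =>
      obtain ⟨y, G, hG, hd, rfl⟩ := hζ
      obtain ⟨a, rfl⟩ := exists_const_of_regU_of_degree_zero D.gen D.ne_bot hG (hd.cast (by simp))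
      refine ⟨a • y, fun s => ?_, ?_⟩
      · rw [map_smul, map_smul, LinearMap.smul_apply, map_smul, algebraMap_smul,
          Derivation.smul_apply]
        exact congrArg (a • ·) ((D.isLift_lift _).secVal_lieAct s).symm
      · rw [algebraMap_smul, lieD_smul_left, (D.isLift_lift _).lieD_vol, smul_zero]
    | zero =>
      refine ⟨0, fun s => by
        rw [map_zero, map_zero, LinearMap.zero_apply, map_zero]; rfl, ?_⟩
      have := lieD_smul_left (0 : ℂ) (0 : Derivation ℂ (FractionRing S) (FractionRing S)) D.vol
      rwa [zero_smul, zero_smul] at this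
    | add a b _ _ ha hb =>
      obtain ⟨y, h1, h2⟩ := ha
      obtain ⟨y', h1', h2'⟩ := hb
      refine ⟨y + y', fun s => ?_, by rw [lieD_add_left, h2, h2', add_zero]⟩
      rw [map_add, map_add, LinearMap.add_apply, map_add, Derivation.add_apply, h1, h1']
    | smul c a _ ha =>
      obtain ⟨y, h1, h2⟩ := ha
      refine ⟨c • y, fun s => ?_, by rw [lieD_smul_left, h2, smul_zero]⟩
      rw [map_smul, map_smul, LinearMap.smul_apply, map_smul, Derivation.smul_apply, h1]
  obtain ⟨y, h1, h2⟩ := h1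
  -- The remaining summand is `c E`. It acts on sections, which have degree `N`, and on `vol`, also
  -- of degree `N`, by the same scalar `c N`.
  refine ⟨y, c * N, fun s => ?_, ?_⟩
  · rw [Derivation.add_apply, h1, algebraMap_smul, Derivation.smul_apply,
      D.isEuler _ _ (D.secVal_hom s), mul_smul, Algebra.smul_def (N : ℂ), map_natCast,
      Int.cast_natCast]
  · rw [lieD_add_left, h2, zero_add, algebraMap_smul, lieD_smul_left, D.lieD_euler D.isEuler,
      mul_smul, ← algebraMap_smul (FractionRing S) (N : ℂ) D.vol, map_natCast]

variable [Algebra.FiniteType ℂ S] [FiniteDimensional ℂ 𝔤] [LieAlgebra.IsSemisimple ℂ 𝔤]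
  (hK : ¬ ∀ z : functionField 𝒜, ∃ c : ℂ, algebraMap ℂ (functionField 𝒜) c = z)
include hK

include D in
-- Such a `ξ` takes constant values `l(s)` on the sections of `ω_X^{-1} ≅ L`. The field `s ξ` has
-- degree zero, so the rank one operator `t ↦ l(t) s` on `V^*` is `ρ(y) + c`. Its divergence gives
-- `c = l(s)`, and taking traces gives `l(s) = c · dim V^*`. If `l(s) ≠ 0`, then `dim V^* = 1`,
-- although `𝒜 1` contains two independent elements.
theorem apply_eq_zero_of_degree_neg_one {ξ : Derivation ℂ (FractionRing S) (FractionRing S)}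
    (hN : N = 1) (hξ : IsRegDer 𝒜 ξ) (h1 : IsHomDer 𝒜 (-1) ξ) {x : S} (hx : x ∈ 𝒜 1) :
    ξ (algebraMap S (FractionRing S) x) = 0 := by
  subst hN
  by_contra hne
  have hneg := fun z (hz : z ∈ regU 𝒜) (k : ℤ) (hk : IsHomFrac 𝒜 k z) (h : k < 0) =>
    eq_zero_of_regU_of_neg D.gen D.ne_bot hK hz hk h
  obtain ⟨s₀, hs₀⟩ := D.exists_secVal_eq (algebraMap_mem_regU x) (IsHomFrac.algebraMap hx)
  have hs₀' : s₀ ≠ 0 := by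
    rintro rfl
    rw [← hs₀, map_zero, map_zero] at hne
    exact hne rfl
  have hc : ∀ s, ∃ c : ℂ, algebraMap ℂ (FractionRing S) c = ξ (D.secVal s) := fun s =>
    exists_const_of_regU_of_degree_zero D.gen D.ne_bot (hξ.apply_mem (D.secVal_mem_regU s))
      ((h1 _ _ (D.secVal_hom s)).cast (by simp))
  choose l hl using hc
  have hinj := (algebraMap ℂ (FractionRing S)).injective
  let L : AntiCanSec (localX 𝒜) n →ₗ[ℂ] ℂ :=
    { toFun := l
      map_add' := fun s t => hinj (by rw [map_add, hl, hl, hl, map_add, map_add])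
      map_smul' := fun c s => hinj (by
        rw [smul_eq_mul, map_mul, hl, hl, map_smul, Derivation.map_smul, Algebra.smul_def]; rfl) }
  have hL0 : l s₀ ≠ 0 := fun h => hne (by rw [← hs₀, ← hl, h, map_zero])
  have key : ∀ s, ∃ (y : 𝔤) (c : ℂ),
      (∀ t, l t • s = lieSec (localX 𝒜) n (ρ y) t + c • t) ∧
      lieD (D.secVal s • ξ) D.vol = c • D.vol := fun s => by
    obtain ⟨y, c, h2, h3⟩ := D.exists_act_of_degree_zero ρ hTr
      (hξ.smul (D.secVal_mem_regU s)) (by simpa using h1.smul (D.secVal_hom s))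
    refine ⟨y, c, fun t => D.secVal_injective ?_, h3⟩
    rw [map_add, map_smul, map_smul, ← h2, Derivation.smul_apply, ← hl, smul_eq_mul, mul_comm,
      Algebra.smul_def]
  -- Finiteness comes from the same formula at `t = s₀`: every `s` is a multiple of `(ρ(y) + c) s₀`,
  -- so `𝔤 ⊕ ℂ` surjects onto `V^*`.
  have hfin : Module.Finite ℂ (AntiCanSec (localX 𝒜) n) := by
    let Φ : 𝔤 × ℂ →ₗ[ℂ] AntiCanSec (localX 𝒜) n :=
      (LinearMap.applyₗ s₀ ∘ₗ (lieSec (localX 𝒜) n).toLinearMap ∘ₗ ρ.toLinearMap).coprod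
        (LinearMap.toSpanSingleton ℂ _ s₀)
    refine Module.Finite.of_surjective Φ fun s => ?_
    obtain ⟨y, c, h2, -⟩ := key s
    refine ⟨(l s₀)⁻¹ • (y, c), ?_⟩
    rw [map_smul]
    change (l s₀)⁻¹ • (lieSec (localX 𝒜) n (ρ y) s₀ + c • s₀) = s
    rw [← h2, smul_smul, inv_mul_cancel₀ hL0, one_smul]
  obtain ⟨y, c, h2, h3⟩ := key s₀
  -- The divergence of `s ξ` is `ξ(s) + s div ξ`, and `div ξ` vanishes because its degree is
  -- negative.
  have hcl : c = l s₀ := by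
    have h5 := D.lieD_smul_vol ξ (D.secVal s₀)
    rw [D.lieD_vol_eq_zero hneg hξ (d := -1) (by simpa using h1) (by simp), smul_zero, add_zero,
      h3, ← hl, ← algebraMap_smul (FractionRing S) c D.vol] at h5
    exact hinj (D.smul_vol_injective h5)
  have h4 : L.smulRight s₀ = lieSec (localX 𝒜) n (ρ y) + c • 1 := LinearMap.ext h2
  have h5 := congrArg (LinearMap.trace ℂ _) h4
  have h6 : LinearMap.trace ℂ _ (lieSec (localX 𝒜) n (ρ y)) = 0 :=
    trace_eq_zero_of_semisimple ((lieSec (localX 𝒜) n).comp ρ) y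
  rw [LinearMap.trace_smulRight, map_add, map_smul, h6, LinearMap.trace_one, zero_add,
    smul_eq_mul, hcl] at h5
  have h7 : Module.finrank ℂ (AntiCanSec (localX 𝒜) n) = 1 := by
    have : (Module.finrank ℂ (AntiCanSec (localX 𝒜) n) : ℂ) = 1 :=
      mul_left_cancel₀ hL0 (h5.symm.trans (mul_one (l s₀)).symm)
    exact_mod_cast this
  obtain ⟨z, hz, hzx⟩ := exists_nonconst_ratio D.gen hK x
  obtain ⟨t, ht⟩ := D.exists_secVal_eq (algebraMap_mem_regU z) (IsHomFrac.algebraMap hz)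
  obtain ⟨a, ha⟩ := (finrank_eq_one_iff_of_nonzero' s₀ hs₀').1 h7 t
  apply hzx a
  apply IsFractionRing.injective S (FractionRing S)
  rw [← ht, ← ha, map_smul, hs₀, Algebra.smul_def, Algebra.smul_def, map_mul,
    ← IsScalarTower.algebraMap_apply]

theorem generated_of_not_const : D.Generated ρ := by
  intro r ξ hξ hr
  have hN := D.one_le
  rcases lt_or_ge r 0 with h | h
  · have h0 : ξ = 0 := by
      refine derivation_eq_zero_of_one D.gen fun x hx => ?_
      by_cases h1 : 1 + (N : ℤ) * r < 0
      · exact eq_zero_of_regU_of_neg D.gen D.ne_bot hK (hξ.apply_mem (algebraMap_mem_regU x))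
          ((hr _ _ (IsHomFrac.algebraMap hx)).cast (by simp)) h1
      -- For `r < 0`, the degree `1 + N r` of `ξ(x)` is negative except when `N = 1` and `r = -1`.
      · have h2 : (N : ℤ) = 1 ∧ (N : ℤ) * r = -1 := by
          have h3 : (N : ℤ) * r ≤ (N : ℤ) * (-1) :=
            mul_le_mul_of_nonneg_left (by omega) (by omega)
          omega
        refine D.apply_eq_zero_of_degree_neg_one ρ hTr hK (by omega) hξ ?_ hx
        exact h2.2 ▸ hr
    rw [h0]
    exact zero_mem _
  · obtain ⟨r, rfl⟩ := Int.eq_ofNat_of_zero_le h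
    exact D.mem_span_of_nonneg ρ hTr hξ hr

end ConeData

end
end CYCone

/-! ### The case where X is a point -/

set_option linter.unusedSectionVars false
set_option maxHeartbeats 1000000
namespace CYCone
noncomputable section

section Abstract

theorem exists_functional {ι V : Type*} [AddCommGroup V] [Module ℂ V] {b : ι → V}
    (hb : LinearIndependent ℂ b) (v : ι → ℂ) : ∃ l : V →ₗ[ℂ] ℂ, ∀ i, l (b i) = v i := by
  obtain ⟨l, hl⟩ := LinearMap.exists_extend ((Module.Basis.span hb).constr ℂ v)
  refine ⟨l, fun i => ?_⟩
  have h := (Module.Basis.span hb).constr_basis ℂ v i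
  rw [← hl, LinearMap.comp_apply, Submodule.subtype_apply, Module.Basis.span_apply] at h
  exact h

/-- A subspace of codimension one, described by a functional. -/
theorem mem_iff_functional_eq_zero {V : Type*} [AddCommGroup V] [Module ℂ V] {W W' : Submodule ℂ V}
    (l : V →ₗ[ℂ] ℂ) (hl : ∀ w ∈ W', l w = 0) {v₀ : V} (h₀ : l v₀ ≠ 0)
    (h : ∀ w ∈ W, ∃ c : ℂ, w - c • v₀ ∈ W') {w : V} (hw : w ∈ W) : w ∈ W' ↔ l w = 0 := by
  refine ⟨hl w, fun h1 => ?_⟩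
  obtain ⟨c, hc⟩ := h w hw
  have h2 := hl _ hc
  rw [map_sub, map_smul, h1, zero_sub, neg_eq_zero, smul_eq_mul, mul_eq_zero,
    or_iff_left h₀] at h2
  rwa [h2, zero_smul, sub_zero] at hc

theorem exists_sub_smul_mem_of_span {V ι : Type*} [AddCommGroup V] [Module ℂ V]
    {W' : Submodule ℂ V} {v₀ : V} {b : ι → V} (h : ∀ i, ∃ c : ℂ, b i - c • v₀ ∈ W') {w : V}
    (hw : w ∈ Submodule.span ℂ (Set.range b)) : ∃ c : ℂ, w - c • v₀ ∈ W' := by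
  induction hw using Submodule.span_induction with
  | mem x hx => obtain ⟨i, rfl⟩ := hx; exact h i
  | zero => exact ⟨0, by rw [zero_smul, sub_zero]; exact zero_mem _⟩
  | add x y _ _ hx hy =>
    obtain ⟨c, hc⟩ := hx
    obtain ⟨d, hd⟩ := hy
    refine ⟨c + d, ?_⟩
    rw [add_smul, add_sub_add_comm]
    exact add_mem hc hd
  | smul a x _ hx =>
    obtain ⟨c, hc⟩ := hx
    refine ⟨a * c, ?_⟩
    rw [mul_smul, ← smul_sub]
    exact W'.smul_mem a hc

end Abstract

variable {S : Type*} [CommRing S] [IsDomain S] [Algebra ℂ S] {𝒜 : ℕ → Submodule ℂ S}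
  [GradedAlgebra 𝒜]

namespace ConeData

variable {n N : ℕ} (D : ConeData 𝒜 n N)
  {𝔤 : Type*} [LieRing 𝔤] [LieAlgebra ℂ 𝔤] (ρ : 𝔤 →ₗ⁅ℂ⁆ vectorFields (localX 𝒜))
  (hK : ∀ z : functionField 𝒜, ∃ c : ℂ, algebraMap ℂ (functionField 𝒜) c = z)
include D hK

omit D in
theorem exists_const_of_degree_zero {z : FractionRing S} (h0 : IsHomFrac 𝒜 0 z) :
    ∃ c : ℂ, algebraMap ℂ (FractionRing S) c = z := by
  obtain ⟨c, hc⟩ := hK ⟨z, h0⟩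
  exact ⟨c, congrArg Subtype.val hc⟩

omit D in
theorem derivation_coe_eq_zero (ξ : Derivation ℂ (FractionRing S) (FractionRing S))
    (z : functionField 𝒜) : ξ (z : FractionRing S) = 0 := by
  obtain ⟨c, hc⟩ := exists_const_of_degree_zero hK z.2
  rw [← hc, Derivation.map_algebraMap]

/-- The function field of `X` consists of constants, so every field on `U` is vertical. -/
theorem generated_of_const : D.Generated ρ := fun r ξ hξ hr => by
  obtain ⟨G, hG, hd, rfl⟩ := exists_eq_smul_euler D.isEuler D hξ hr (derivation_coe_eq_zero hK ξ)
  exact D.smul_euler_mem_span ρ hG hd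

/-- The lift is a constant multiple of `E`; it has divergence zero, whereas `E` has divergence `N ≠
0`. -/
theorem act_eq_zero (y : 𝔤) : D.act ρ y = 0 := by
  obtain ⟨G, hG, hd, e⟩ := exists_eq_smul_euler D.isEuler D (D.isRegDer_act ρ y)
    (D.isHomDer_act ρ y) (derivation_coe_eq_zero hK _)
  obtain ⟨c, rfl⟩ := exists_const_of_degree_zero hK hd
  have h1 : lieD (D.act ρ y) D.vol = 0 := (D.isLift_lift _).lieD_vol
  rw [e, algebraMap_smul, lieD_smul_left, D.lieD_euler D.isEuler, ← algebraMap_smul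
    (FractionRing S) c, smul_smul] at h1
  have h2 := D.smul_vol_injective (h1.trans (zero_smul (FractionRing S) D.vol).symm)
  rw [e, (mul_eq_zero.1 h2).resolve_right (natCast_fractionRing_ne_zero S D.one_le), zero_smul]

theorem op_some_eq_zero (F : FractionRing S) (y : 𝔤) : D.op ρ F (some y) = 0 := by
  have h : D.gens ρ (some y) = 0 := D.act_eq_zero ρ hK y
  ext z
  rw [op, opQ_apply, h]
  change 0 + 0 * z - (0 : ℂ) • z = 0
  rw [zero_smul, zero_mul, add_zero, sub_zero]

theorem opSum_eq_map (F : FractionRing S) (W : Submodule ℂ (FractionRing S)) :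
    opSum (D.op ρ F) W = W.map (D.op ρ F none) := by
  refine le_antisymm (iSup_le fun i => ?_) (le_iSup (fun i => W.map (D.op ρ F i)) none)
  rcases i with _ | y
  · exact le_rfl
  · rw [D.op_some_eq_zero ρ hK, Submodule.map_zero]
    exact bot_le

variable {F : FractionRing S} (hFN : IsHomFrac 𝒜 N F) (hF0 : F ≠ 0)
include hFN hF0

omit D in
theorem exists_smul_zpow_of_hom {m : ℤ} {g : FractionRing S} (hg : IsHomFrac 𝒜 (N * m) g) :
    ∃ c : ℂ, g = c • F ^ m := by
  obtain ⟨c, hc⟩ := exists_const_of_degree_zero hK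
    ((hg.mul (hFN.zpow m).inv').cast (by ring))
  refine ⟨c, ?_⟩
  rw [Algebra.smul_def, hc, inv_mul_cancel_right₀ (zpow_ne_zero m hF0)]

/-- For `x` of degree one, `x ^ N` is a constant multiple of `F`, so `F⁻¹ x ^ N` is constant. -/
theorem inv_mem_regU : F⁻¹ ∈ regU 𝒜 := by
  refine mem_regU_of_pow D.gen fun x hx => ?_
  rcases eq_or_ne x 0 with rfl | hx0
  · exact ⟨1, by rw [pow_one]; exact zero_mem _⟩
  obtain ⟨c, hc⟩ := exists_smul_zpow_of_hom (N := N) (m := 1) hK hFN hF0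
    (((IsHomFrac.algebraMap hx).pow N).cast (by simp))
  refine ⟨N, mem_denIdeal.2 ?_⟩
  rw [map_pow, hc, zpow_one, mul_smul_comm, inv_mul_cancel₀ hF0]
  exact (baseRing S).smul_mem (baseRing S).one_mem c

theorem zpow_mem_regMod (hF : F ∈ regU 𝒜) (m : ℤ) : F ^ m ∈ regMod 𝒜 N := by
  refine mem_regMod_of_hom (m := m) ?_ ((hFN.zpow m).cast (mul_comm _ _))
  cases m with
  | ofNat m => exact (zpow_natCast F m).symm ▸ (regU 𝒜).pow_mem hF m
  | negSucc m =>
    rw [zpow_negSucc, ← inv_pow]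
    exact (regU 𝒜).pow_mem (D.inv_mem_regU hK hFN hF0) _

theorem regMod_eq_span (hF : F ∈ regU 𝒜) :
    regMod 𝒜 N = Submodule.span ℂ (Set.range fun m : ℤ => F ^ m) := by
  refine le_antisymm (fun g hg => ?_) (Submodule.span_le.2 ?_)
  · refine regMod_induction D.gen D.one_le (C := fun g => g ∈ Submodule.span ℂ
      (Set.range fun m : ℤ => F ^ m)) (fun m g _ hm => ?_) (zero_mem _)
      (fun a b => add_mem) hg
    obtain ⟨c, rfl⟩ := exists_smul_zpow_of_hom hK hFN hF0 hm
    exact Submodule.smul_mem _ c (Submodule.subset_span ⟨m, rfl⟩)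
  · rintro _ ⟨m, rfl⟩
    exact D.zpow_mem_regMod hK hFN hF0 hF m

omit hK in
theorem linearIndependent_zpow : LinearIndependent ℂ fun m : ℤ => F ^ m := by
  rw [linearIndependent_iff']
  intro t c hc i hi
  have hN : (0 : ℤ) < N := by have := D.one_le; omega
  have hdeg : Function.Injective fun m : ℤ => (m : ℤ) * N := fun a b h =>
    mul_right_cancel₀ hN.ne' h
  have h := family_component_mem (𝒜 := 𝒜) (W := ⊥) (fun f hf h k => by
    rw [eq_zero_of_sum_hom_eq_zero hf ((Submodule.mem_bot ℂ).1 h)]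
    exact zero_mem _) hdeg t (f := fun m => c m • F ^ m)
    (fun m => (homPart 𝒜 _).smul_mem _ (hFN.zpow m)) ((Submodule.mem_bot ℂ).2 hc) hi
  exact (smul_eq_zero.1 ((Submodule.mem_bot ℂ).1 h)).resolve_right (zpow_ne_zero i hF0)

omit hK in
theorem op_none_zpow (hF : F ∈ regU 𝒜) (m : ℤ) :
    D.op ρ F none (F ^ m) = -(((m : ℂ) + 1) • F ^ m + F ^ (m + 1)) := by
  rw [D.op_none_of_hom ρ hF hFN ((hFN.zpow m).cast (mul_comm _ _)), zpow_add_one₀ hF0,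
    mul_comm F]

/-- The functional on Laurent polynomials in `F` that computes the cokernel of `d + dF`. -/
theorem exists_functional_regMod (hF : F ∈ regU 𝒜) : ∃ l : FractionRing S →ₗ[ℂ] ℂ,
    l (F ^ (-1 : ℤ)) = 1 ∧ ∀ w ∈ regMod 𝒜 N, w ∈ opSum (D.op ρ F) (regMod 𝒜 N) ↔ l w = 0 := by
  -- The functional is formally `g ↦ Res_{F = 0} g e^F dF`: the value on `F ^ (-k - 1)` is `1 / k!`,
  -- and that on nonnegative powers is `0`. The recursion `(m + 1) v_m + v_{m+1} = 0` says that it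
  -- kills the image of the operator.
  let v : ℤ → ℂ := fun m => Int.casesOn m (fun _ => 0) (fun k => ((k.factorial : ℕ) : ℂ)⁻¹)
  obtain ⟨l, hl⟩ := exists_functional (D.linearIndependent_zpow hFN hF0) v
  have hop := D.op_none_zpow ρ hFN hF0 hF
  have hmem : ∀ m : ℤ, ((m : ℂ) + 1) • F ^ m + F ^ (m + 1) ∈
      (regMod 𝒜 N).map (D.op ρ F none) := fun m => by
    rw [← neg_neg (_ + _), ← hop, ← map_neg]
    exact ⟨_, neg_mem (D.zpow_mem_regMod hK hFN hF0 hF m), rfl⟩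
  have hv1 : v (-1) = 1 := by
    change ((Nat.factorial 0 : ℕ) : ℂ)⁻¹ = 1
    rw [Nat.factorial_zero, Nat.cast_one, inv_one]
  have hv : ∀ m : ℤ, ((m : ℂ) + 1) * v m + v (m + 1) = 0 := fun m => by
    rcases m with m | m
    · change _ * 0 + 0 = _
      rw [mul_zero, add_zero]
    · rcases m with _ | m
      · change (((-1 : ℤ) : ℂ) + 1) * _ + 0 = 0
        push_cast
        ring
      · have h : v (Int.negSucc (m + 1) + 1) = ((m.factorial : ℕ) : ℂ)⁻¹ := rfl
        have h' : v (Int.negSucc (m + 1)) = (((m + 1).factorial : ℕ) : ℂ)⁻¹ := rfl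
        have h1 : (m.factorial : ℂ) ≠ 0 := Nat.cast_ne_zero.2 m.factorial_ne_zero
        have h2 : (m : ℂ) + 1 ≠ 0 := Nat.cast_add_one_ne_zero m
        rw [h, h', Int.cast_negSucc, Nat.factorial_succ]
        push_cast
        field_simp
        ring
  refine ⟨l, by rw [hl, hv1], fun w hw => ?_⟩
  rw [D.opSum_eq_map ρ hK]
  refine mem_iff_functional_eq_zero l ?_ (v₀ := F ^ (-1 : ℤ)) (by rw [hl, hv1]; exact one_ne_zero)
    (W := regMod 𝒜 N) (fun w hw => ?_) hw
  · rintro _ ⟨w, hw, rfl⟩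
    rw [SetLike.mem_coe, D.regMod_eq_span hK hFN hF0 hF] at hw
    induction hw using Submodule.span_induction with
    | mem x hx =>
      obtain ⟨m, rfl⟩ := hx
      rw [hop, map_neg, map_add, map_smul, hl, hl, smul_eq_mul, hv, neg_zero]
    | zero => rw [map_zero, map_zero]
    | add x y _ _ hx hy => rw [map_add, map_add, hx, hy, add_zero]
    | smul c x _ hx => rw [map_smul, map_smul, hx, smul_zero]
  -- Modulo the image, `F ^ (m + 1) ≡ -(m + 1) F ^ m`. At `m = -1` this gives `1 ≡ 0`, so
  -- nonnegative powers vanish by ascending induction; the other powers reduce to `F ^ (-1)` by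
  -- descending.
  · rw [D.regMod_eq_span hK hFN hF0 hF] at hw
    refine exists_sub_smul_mem_of_span (fun m => ?_) hw
    rcases m with m | m
    · refine ⟨0, ?_⟩
      rw [zero_smul, sub_zero]
      change F ^ ((m : ℕ) : ℤ) ∈ _
      induction m with
      | zero => simpa using hmem (-1)
      | succ m ih =>
        have h := sub_mem (hmem m) (Submodule.smul_mem _ ((m : ℂ) + 1) ih)
        rw [Int.cast_natCast, add_sub_cancel_left] at h
        exact h
    · induction m with
      | zero => exact ⟨1, by rw [one_smul]; rw [show F ^ Int.negSucc 0 = F ^ (-1 : ℤ) from rfl, sub_self]; exact zero_mem _⟩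
      | succ m ih =>
        obtain ⟨c, hc⟩ := ih
        have h2 : -((m : ℂ) + 1) ≠ 0 := neg_ne_zero.2 (Nat.cast_add_one_ne_zero m)
        have e : ((Int.negSucc (m + 1) : ℤ) : ℂ) + 1 = -((m : ℂ) + 1) := by
          rw [Int.cast_negSucc]; push_cast; ring
        have h := Submodule.smul_mem _ (-((m : ℂ) + 1))⁻¹ (sub_mem (hmem (Int.negSucc (m + 1))) hc)
        refine ⟨-(-((m : ℂ) + 1))⁻¹ * c, ?_⟩
        convert h using 1
        have e' : Int.negSucc (m + 1) + 1 = Int.negSucc m := rfl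
        rw [e, e', add_sub_assoc, sub_sub_cancel, smul_add, smul_smul, inv_mul_cancel₀ h2,
          one_smul, smul_smul, neg_mul, neg_smul, sub_neg_eq_add]

omit hFN hF0 in
theorem coneFun_le_adjoin (hFN : IsHomFrac 𝒜 N F) (hF0 : F ≠ 0) :
    D.coneFun ≤ Algebra.adjoin ℂ {F} := by
  rintro _ ⟨b, rfl⟩
  obtain ⟨φ, rfl⟩ := Ideal.Quotient.mk_surjective b
  change D.polyVal φ ∈ _
  induction φ using SymmetricAlgebra.induction with
  | algebraMap r => rw [AlgHom.commutes]; exact Subalgebra.algebraMap_mem _ r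
  | ι s =>
    obtain ⟨c, hc⟩ := exists_smul_zpow_of_hom (m := 1) hK hFN hF0
      ((D.secVal_hom s).cast (mul_one _).symm)
    rw [polyVal_ι, hc, zpow_one]
    exact Subalgebra.smul_mem _ (Algebra.self_mem_adjoin_singleton ℂ F) c
  | mul a b ha hb => rw [map_mul]; exact mul_mem ha hb
  | add a b ha hb => rw [map_add]; exact add_mem ha hb

omit hFN hF0 in
theorem coneFun_eq_span {f : AntiCanSec (localX 𝒜) n} (hf : D.secVal f ≠ 0) :
    Subalgebra.toSubmodule D.coneFun =
      Submodule.span ℂ (Set.range fun m : ℕ => D.secVal f ^ m) := by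
  refine le_antisymm (fun g hg => ?_) (Submodule.span_le.2 ?_)
  · have h := D.coneFun_le_adjoin hK (D.secVal_hom f) hf hg
    rwa [← Subalgebra.mem_toSubmodule, Algebra.adjoin_eq_span,
      ← Submonoid.powers_eq_closure] at h
  · rintro _ ⟨m, rfl⟩
    exact D.coneFun.pow_mem (D.secVal_mem_coneFun f) m

omit hFN hF0 in
/-- The functional on polynomials in `f` that computes the homology of `R_f`. -/
theorem exists_functional_coneFun {f : AntiCanSec (localX 𝒜) n} (hf : D.secVal f ≠ 0) :
    ∃ l : FractionRing S →ₗ[ℂ] ℂ, l 1 = 1 ∧ ∀ w ∈ D.coneFun,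
      w ∈ opSum (D.op ρ (D.secVal f)) (Subalgebra.toSubmodule D.coneFun) ↔ l w = 0 := by
  -- Here the functional is formally the integral of `g e^F dF` from `-∞` to `0`, with value `(-1) ^
  -- m m!` on `F ^ m`. The values on negative powers play no role on polynomials in `F`.
  obtain ⟨l, hl⟩ := exists_functional (D.linearIndependent_zpow (D.secVal_hom f) hf)
    fun m => (-1) ^ m.toNat * ((m.toNat.factorial : ℕ) : ℂ)
  have hl' : ∀ m : ℕ, l (D.secVal f ^ m) = (-1) ^ m * ((m.factorial : ℕ) : ℂ) := fun m => by
    rw [← zpow_natCast, hl, Int.toNat_natCast]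
  have hop : ∀ m : ℕ, D.op ρ (D.secVal f) none (D.secVal f ^ m) =
      -(((m : ℂ) + 1) • D.secVal f ^ m + D.secVal f ^ (m + 1)) := fun m => by
    have h := D.op_none_zpow ρ (D.secVal_hom f) hf (D.secVal_mem_regU f) m
    rwa [zpow_add_one₀ hf, zpow_natCast, ← pow_succ, Int.cast_natCast] at h
  have hmem : ∀ m : ℕ, ((m : ℂ) + 1) • D.secVal f ^ m + D.secVal f ^ (m + 1) ∈
      (Subalgebra.toSubmodule D.coneFun).map (D.op ρ (D.secVal f) none) := fun m => by
    rw [← neg_neg (_ + _), ← hop, ← map_neg]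
    exact ⟨_, neg_mem (D.coneFun.pow_mem (D.secVal_mem_coneFun f) m), rfl⟩
  have h1 : l 1 = 1 := by simpa using hl' 0
  refine ⟨l, h1, fun w hw => ?_⟩
  rw [D.opSum_eq_map ρ hK]
  refine mem_iff_functional_eq_zero l ?_ (v₀ := 1) (by rw [h1]; exact one_ne_zero)
    (W := Subalgebra.toSubmodule D.coneFun) (fun w hw => ?_) hw
  · rintro _ ⟨w, hw, rfl⟩
    rw [SetLike.mem_coe, D.coneFun_eq_span hK hf] at hw
    induction hw using Submodule.span_induction with
    | mem x hx =>
      obtain ⟨m, rfl⟩ := hx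
      rw [hop, map_neg, map_add, map_smul, hl', hl', smul_eq_mul, Nat.factorial_succ, pow_succ]
      push_cast
      ring
    | zero => rw [map_zero, map_zero]
    | add x y _ _ hx hy => rw [map_add, map_add, hx, hy, add_zero]
    | smul c x _ hx => rw [map_smul, map_smul, hx, smul_zero]
  · rw [D.coneFun_eq_span hK hf] at hw
    refine exists_sub_smul_mem_of_span (fun m => ?_) hw
    induction m with
    | zero => exact ⟨1, by rw [one_smul, pow_zero, sub_self]; exact zero_mem _⟩
    | succ m ih =>
      obtain ⟨c, hc⟩ := ih
      refine ⟨-((m : ℂ) + 1) * c, ?_⟩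
      convert sub_mem (hmem m) (Submodule.smul_mem _ ((m : ℂ) + 1) hc) using 1
      rw [smul_sub, smul_smul, neg_mul, neg_smul]
      abel

omit hFN hF0 in
/-- The comparison for a point `X`, where both sides have dimension one. -/
theorem nonempty_equiv_of_const {f : AntiCanSec (localX 𝒜) n} (hf : f ≠ 0)
    (F : functionsU 𝒜 N) (hF : (F : FractionRing S) = D.secVal f) :
    Nonempty (RfH0 (localX 𝒜) n ρ f ≃ₗ[ℂ] CokerDPlusDf 𝒜 N n F) := by
  have hf0 : D.secVal f ≠ 0 := fun h => hf (D.secVal_injective (by rw [h, map_zero]))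
  obtain ⟨l, hl1, hl⟩ := D.exists_functional_coneFun ρ hK hf0
  obtain ⟨m, hm1, hm⟩ := D.exists_functional_regMod ρ hK (D.secVal_hom f) hf0
    (D.secVal_mem_regU f)
  -- Each side is identified with `ℂ` by its own functional.
  have e1 : Nonempty (RfH0 (localX 𝒜) n ρ f ≃ₗ[ℂ] (ℂ ⧸ (⊥ : Submodule ℂ ℂ))) := by
    refine nonempty_quotient_equiv (l ∘ₗ D.ringVal.toLinearMap) _ _ (fun b => ?_) (fun c => ?_)
    · rw [← D.mem_opSum_coneFun_iff ρ f b, Submodule.mem_bot]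
      exact (hl _ ⟨b, rfl⟩).symm
    · refine ⟨c • 1, ?_⟩
      rw [map_smul, Submodule.mem_bot]
      change c - c • l (D.ringVal 1) = 0
      rw [map_one, hl1, smul_eq_mul, mul_one, sub_self]
  let φ : regMod 𝒜 N →ₗ[ℂ] formsU 𝒜 N (n + 1) :=
    { toFun := fun g => ⟨(g : FractionRing S) • D.vol, D.smul_vol_mem_formsU g.2⟩
      map_add' := fun a b => Subtype.ext (add_smul _ _ _)
      map_smul' := fun c a => Subtype.ext (smul_assoc c (a : FractionRing S) D.vol) }
  let V₀ : Submodule ℂ (regMod 𝒜 N) := LinearMap.ker (m ∘ₗ (regMod 𝒜 N).subtype)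
  have e2 : Nonempty ((regMod 𝒜 N ⧸ V₀) ≃ₗ[ℂ] (ℂ ⧸ (⊥ : Submodule ℂ ℂ))) := by
    refine nonempty_quotient_equiv (m ∘ₗ (regMod 𝒜 N).subtype) _ _ (fun g => Iff.rfl)
      (fun c => ?_)
    refine ⟨c • ⟨_, D.zpow_mem_regMod hK (D.secVal_hom f) hf0 (D.secVal_mem_regU f) (-1)⟩, ?_⟩
    rw [map_smul, Submodule.mem_bot]
    change c - c • m (D.secVal f ^ (-1 : ℤ)) = 0
    rw [hm1, smul_eq_mul, mul_one, sub_self]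
  have e3 : Nonempty ((regMod 𝒜 N ⧸ V₀) ≃ₗ[ℂ] CokerDPlusDf 𝒜 N n F) := by
    refine nonempty_quotient_equiv φ _ _ (fun g => ?_) (fun ω => ?_)
    · refine (D.smul_vol_mem_range_iff ρ (D.generated_of_const ρ hK) F g.2).trans ?_
      rw [hF]
      exact hm _ g.2
    · obtain ⟨g, hg, e⟩ := D.exists_of_mem_formsU_top ω.2
      refine ⟨⟨g, hg⟩, ?_⟩
      rw [show ω = φ ⟨g, hg⟩ from Subtype.ext e, sub_self]
      exact zero_mem _
  obtain ⟨e1⟩ := e1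
  obtain ⟨e2⟩ := e2
  obtain ⟨e3⟩ := e3
  exact ⟨e1.trans (e2.symm.trans e3)⟩

end ConeData

end
end CYCone

/-! ### The main theorem -/

theorem mainTheorem7 {S : Type} [CommRing S] [IsDomain S] [Algebra ℂ S]
    (𝒜 : ℕ → Submodule ℂ S) [GradedAlgebra 𝒜] [Algebra.FiniteType ℂ S]
    (hgen : Algebra.adjoin ℂ (𝒜 1 : Set S) = ⊤) (hne : 𝒜 1 ≠ ⊥) (n : ℕ)
    (hX : AlgebraicGeometry.SmoothOfRelativeDimension n (CYCone.projToSpec 𝒜))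
    {𝔤 : Type*} [LieRing 𝔤] [LieAlgebra ℂ 𝔤] [FiniteDimensional ℂ 𝔤]
    [LieAlgebra.IsSemisimple ℂ 𝔤]
    (ρ : 𝔤 →ₗ⁅ℂ⁆ CYCone.vectorFields (CYCone.localX 𝒜))
    (N : ℕ) (hN : 1 ≤ N)
    -- (i) an isomorphism `ω_X ≅ L^{-N}`
    (α : CYCone.Can (CYCone.functionField 𝒜) n ≃ₗ[CYCone.functionField 𝒜] CYCone.twist 𝒜 (-N))
    (hα : ∀ (p : ProjectiveSpectrum 𝒜) (η : CYCone.Can (CYCone.functionField 𝒜) n),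
      η ∈ CYCone.canStalk n (CYCone.localX 𝒜 p) ↔
        (α η : FractionRing S) ∈ CYCone.twistStalk 𝒜 (-N) p)
    -- (ii) `𝔤 ⊗ O_X → T_X` is surjective
    (hT : ∀ p : ProjectiveSpectrum 𝒜, CYCone.derStalk (CYCone.localX 𝒜 p) ≤
      Submodule.span ℂ {δ | ∃ x : 𝔤, ∃ g ∈ CYCone.localX 𝒜 p,
        δ = g • (ρ x : Derivation ℂ (CYCone.functionField 𝒜) (CYCone.functionField 𝒜))})
    -- (iii) `𝔤 ⊗ Γ(X, ω_X^{-r}) → Γ(X, T_X ⊗ ω_X^{-r})` is surjective for all `r ≥ 0`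
    (hTr : ∀ r : ℕ, CYCone.twistedDerSections (CYCone.localX 𝒜) n r ≤
      Submodule.span ℂ {t | ∃ x : 𝔤, ∃ s ∈ CYCone.antiCanPowSections (CYCone.localX 𝒜) n r,
        t = (ρ x : Derivation ℂ (CYCone.functionField 𝒜) (CYCone.functionField 𝒜))
          ⊗ₜ[CYCone.functionField 𝒜] s})
    (f : CYCone.AntiCanSec (CYCone.localX 𝒜) n) (hf : f ≠ 0) :
    -- `F` is `f` regarded as a function of degree `N` on `U`
    ∃ F : CYCone.functionsU 𝒜 N,
      (∀ η, (f.eval η : FractionRing S) = F * (α η : FractionRing S)) ∧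
      Nonempty (CYCone.RfH0 (CYCone.localX 𝒜) n ρ f ≃ₗ[ℂ]
        CYCone.CokerDPlusDf 𝒜 N n F) := by
  let D : CYCone.ConeData 𝒜 n N :=
    { gen := hgen
      ne_bot := hne
      coords := CYCone.exists_local_coords hgen hX
      one_le := hN
      iso := α
      mem_iff := hα }
  refine ⟨⟨D.secVal f, D.secVal_hom f, CYCone.mem_regU.1 (D.secVal_mem_regU f)⟩,
    fun η => (D.secVal_mul_val f η).symm, ?_⟩
  -- The function field is `ℂ` exactly when `X` is a point. Only then do regular functions of
  -- negative degree survive on `U`.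
  by_cases hK : ∀ z : CYCone.functionField 𝒜, ∃ c : ℂ,
      algebraMap ℂ (CYCone.functionField 𝒜) c = z
  · exact D.nonempty_equiv_of_const ρ hK hf _ rfl
  · exact D.nonempty_equiv_of_generated ρ hf
      (fun z hz k hk h => CYCone.eq_zero_of_regU_of_neg hgen hne hK hz hk h)
      (D.generated_of_not_const ρ hTr hK) _ rfl
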